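/- Let $F=\mathbb{F}_q$ be the finite field with $q\ge 4$ elements. For $a,b\in F^\times$ put $$h(a,b)=\begin{pmatrix}-1&1/b\\-1/a&1/(ab)-1\end{pmatrix},$$ and for $a_1,\dots,a_5\in F$ let $\Phi(a_1,\dots,a_5)$ be the $5\times5$ matrix with diagonal entries $a_1,\dots,a_5$, entries $1$ immediately above the diagonal, and all other entries $0$. * $q$ even. Let $\xi\in F^\times$ be such that $h(\xi,\xi)$ has order $q-1$ or $q+1$, and let $\alpha\in F^\times\setminus\{\xi\}$ be such that each of $h(\alpha,\alpha)$ and $h(\xi,\alpha)$ has order $q-1$ or $q+1$. Put $\Phi=\Phi(\xi,\xi,\alpha,\alpha,\xi)$. * $q$ odd. Let $\xi\in F^\times\setminus\{\frac12\}$ be such that $\xi^2-\frac12$ is a nonzero square and $h(1,\xi^2)$ has order $(q-1)/2$ or $(q+1)/2$. Let $\alpha\in F^\times$ be such that $h(1,\alpha^2)$ has order $(q-1)/2$ or $(q+1)/2$, $$\alpha^2\notin\left\{\frac12,\ \frac14,\ \frac{\xi^2}{4\xi^2-1},\ \frac{2\xi^2-\frac14}{4\xi^2-1},\ \frac{\xi^2-\frac14}{4\xi^2-2},\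 \frac{\xi^2-\frac38}{2\xi^2-1}\right\},$$ and $16\alpha^2(2\xi^2-1)^2-(32\xi^4-28\xi^2+6)$ is a nonzero square. Put $\Phi=\Phi(1,\xi^2,1,\alpha^2,1)$. Let $V$ be a vector space over $F$ with basis $u_1,\dots,u_5$, and let $\varphi$ be the quadratic form on $V$, with associated bilinear form $(u,v)=\varphi(u+v)-\varphi(u)-\varphi(v)$, that is represented by $\Phi$: $\varphi(u_i)=\Phi_{ii}$ for all $i$, and $(u_i,u_j)=\Phi_{ij}$ for $i<j$. For $u\in V$ with $\varphi(u)\ne0$ let $\sigma_u(v)=v-\frac{(u,v)}{\varphi(u)}u$. Let $\Omega(V)$ be the full isometry group of $\varphi$ if $q$ is even; if $q$ is odd, let it be the group of isometries that are products of an even number of symmetries $\sigma_u$ and have trivial spinor norm, where the spinor norm of $\sigma_{w_1}\cdots\sigma_{w_r}$ is $\varphi(w_1)\cdots\varphi(w_r)$ modulo squares. Then $\Omega(V)\cong \mathrm{PSp}(4,q)$, the elements $\rho_i=-\sigma_{u_i}$ $(1\le i\le5)$ lie in $\Omega(V)$, and $(\Omega(V);\rho_1,\dots,\rho_5)$ is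 a string C-group representation: the $\rho_i$ are involutions that generate $\Omega(V)$, $\rho_i$ and $\rho_j$ commute whenever $|i-j|>1$, and $\langle\rho_i: i\in I\rangle\cap\langle\rho_j: j\in J\rangle=\langle\rho_k: k\in I\cap J\rangle$ for all $I,J\subseteq\{1,\dots,5\}$. Its Schläfli type is $[p_1,p_2,p_3,p_4]$, where $p_i$ is the order of $\rho_i\rho_{i+1}$, and each $p_i$ lies in $\{q-1,q+1\}$ if $q$ is even and in $\{(q-1)/2,(q+1)/2\}$ if $q$ is odd. -/

import Mathlib

/-! ### String C-groups -/

/-- `ρ` is a string C-group representation of `G` of rank `n`: the `ρ i` are involutions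
generating `G` and having the string property and the intersection property. -/
structure IsStringCGroup {G : Type*} [Group G] {n : ℕ} (ρ : Fin n → G) : Prop where
  generates : Subgroup.closure (Set.range ρ) = ⊤
  involution : ∀ i, orderOf (ρ i) = 2
  string : ∀ i j : Fin n, (i : ℕ) + 1 < j → Commute (ρ i) (ρ j)
  intersection : ∀ I J : Set (Fin n),
    Subgroup.closure (ρ '' I) ⊓ Subgroup.closure (ρ '' J) = Subgroup.closure (ρ '' (I ∩ J))

/-- The Schläfli type: the orders of the products of consecutive generators. -/
noncomputable def schlafliType {G : Type*} [Group G] {n : ℕ} (ρ : Fin (n + 1) → G) (i : Fin n) :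
    ℕ :=
  orderOf (ρ i.castSucc * ρ i.succ)

/-! ### Orthogonal groups -/

section Orthogonal

variable {F V : Type*} [Field F] [AddCommGroup V] [Module F V]

/-- The symmetric bilinear form `(u, v) = φ (u + v) - φ u - φ v` is `QuadraticMap.polar φ`.
The matrix `Φ` represents `φ` relative to the ordered basis `u` if it is upper triangular,
with diagonal entries `φ (u i)` and entries `(u i, u j)` above the diagonal. -/
def RepresentsForm {n : ℕ} (Φ : Matrix (Fin n) (Fin n) F) (φ : QuadraticForm F V)
    (u : Module.Basis (Fin n) F V) : Prop :=
  (∀ i, Φ i i = φ (u i)) ∧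
  (∀ i j, i < j → Φ i j = QuadraticMap.polar φ (u i) (u j)) ∧
  (∀ i j, j < i → Φ i j = 0)

/-- The isometry group of `φ`. -/
def orthGroup (φ : QuadraticForm F V) : Subgroup (V ≃ₗ[F] V) where
  carrier := {g | ∀ v, φ (g v) = φ v}
  mul_mem' := by
    intro a b ha hb v
    rw [LinearEquiv.mul_apply, ha, hb]
  one_mem' := fun _ => rfl
  inv_mem' := by
    intro a ha v
    rw [← ha (a⁻¹ v), ← LinearEquiv.mul_apply, mul_inv_cancel]
    rfl

/-- The linear map `v ↦ v - ((u, v) / φ u) • u`. -/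
noncomputable def symmetryMap (φ : QuadraticForm F V) (u : V) : V →ₗ[F] V :=
  LinearMap.id - ((φ u)⁻¹ • QuadraticMap.polarBilin φ u).smulRight u

theorem symmetryMap_apply (φ : QuadraticForm F V) (u v : V) :
    symmetryMap φ u v = v - (QuadraticMap.polar φ u v / φ u) • u := by
  simp [symmetryMap, div_eq_inv_mul]

theorem symmetryMap_involutive (φ : QuadraticForm F V) (u : V) :
    Function.Involutive (symmetryMap φ u) := by
  intro v
  by_cases hu : φ u = 0
  · simp [symmetryMap_apply, hu]
  · have h2 : symmetryMap φ u u = -u := by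
      rw [symmetryMap_apply, QuadraticMap.polar_self, nsmul_eq_mul, Nat.cast_ofNat, mul_div_assoc, div_self hu,
        mul_one, two_smul]
      abel
    conv_lhs => rw [symmetryMap_apply φ u v]
    rw [map_sub, map_smul, h2, symmetryMap_apply]
    simp

/-- The symmetry `σ_u` determined by a nonsingular vector `u` (the identity if `φ u = 0`). -/
noncomputable def symmetry (φ : QuadraticForm F V) (u : V) : V ≃ₗ[F] V :=
  LinearEquiv.ofInvolutive (symmetryMap φ u) (symmetryMap_involutive φ u)

/-- `g = σ_{u₁} ⋯ σ_{uᵣ}` with all `uᵢ` nonsingular. -/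
def IsSymmetryProduct (φ : QuadraticForm F V) (g : V ≃ₗ[F] V) (l : List V) : Prop :=
  (∀ u ∈ l, φ u ≠ 0) ∧ g = (l.map (symmetry φ)).prod

theorem IsSymmetryProduct.mul {φ : QuadraticForm F V} {g h : V ≃ₗ[F] V} {l m : List V}
    (hg : IsSymmetryProduct φ g l) (hh : IsSymmetryProduct φ h m) :
    IsSymmetryProduct φ (g * h) (l ++ m) := by
  refine ⟨fun u hu => ?_, by rw [hg.2, hh.2, List.map_append, List.prod_append]⟩
  rcases List.mem_append.1 hu with h | h
  exacts [hg.1 u h, hh.1 u h]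

theorem IsSymmetryProduct.inv {φ : QuadraticForm F V} {g : V ≃ₗ[F] V} {l : List V}
    (hg : IsSymmetryProduct φ g l) : IsSymmetryProduct φ g⁻¹ l.reverse := by
  refine ⟨fun u hu => hg.1 u (List.mem_reverse.1 hu), ?_⟩
  have hinv : ∀ u, (symmetry φ u)⁻¹ = symmetry φ u := fun u => rfl
  rw [hg.2, List.prod_inv_reverse, List.map_map, List.map_reverse]
  congr 2

/-- The kernel of `π`: the group of products of even numbers of symmetries. -/
def kerPi (φ : QuadraticForm F V) : Subgroup (V ≃ₗ[F] V) where
  carrier := {g | ∃ l : List V, IsSymmetryProduct φ g l ∧ Even l.length}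
  mul_mem' := by
    rintro a b ⟨l, hl, hl'⟩ ⟨m, hm, hm'⟩
    exact ⟨l ++ m, hl.mul hm, by rw [List.length_append]; exact hl'.add hm'⟩
  one_mem' := ⟨[], ⟨by simp, by simp⟩, by simp⟩
  inv_mem' := by
    rintro a ⟨l, hl, hl'⟩
    exact ⟨l.reverse, hl.inv, by simpa using hl'⟩

/-- The kernel of the spinor norm `θ (σ_{u₁} ⋯ σ_{uᵣ}) = φ u₁ ⋯ φ uᵣ` modulo squares. -/
def kerTheta (φ : QuadraticForm F V) : Subgroup (V ≃ₗ[F] V) where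
  carrier := {g | ∃ l : List V, IsSymmetryProduct φ g l ∧ IsSquare (l.map φ).prod}
  mul_mem' := by
    rintro a b ⟨l, hl, hl'⟩ ⟨m, hm, hm'⟩
    exact ⟨l ++ m, hl.mul hm, by rw [List.map_append, List.prod_append]; exact hl'.mul hm'⟩
  one_mem' := ⟨[], ⟨by simp, by simp⟩, by simp⟩
  inv_mem' := by
    rintro a ⟨l, hl, hl'⟩
    exact ⟨l.reverse, hl.inv, by rwa [List.map_reverse, List.prod_reverse]⟩

open Classical in
/-- The group `Ω(V)` of a quadratic space over a finite field `F`. -/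
noncomputable def Omega (φ : QuadraticForm F V) : Subgroup (V ≃ₗ[F] V) :=
  if Odd (Nat.card F) then kerPi φ ⊓ kerTheta φ
  else if Odd (Module.finrank F V) then orthGroup φ
  else kerPi φ

end Orthogonal

/-- The projective symplectic group `PSp(4, F)`. -/
abbrev PSp4 (F : Type*) [Field F] : Type _ :=
  Matrix.symplecticGroup (Fin 2) F ⧸ Subgroup.center (Matrix.symplecticGroup (Fin 2) F)

/-! ### The scalars and the forms -/

section Scalars

variable {F : Type*} [Field F]

/-- The upper bidiagonal matrix with diagonal `a` and entries `1` just above the diagonal. -/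
def formMatrix {n : ℕ} (a : Fin n → F) : Matrix (Fin n) (Fin n) F :=
  Matrix.of fun i j => if i = j then a i else if (i : ℕ) + 1 = j then 1 else 0

def PhiEven (ξ α : F) : Matrix (Fin 5) (Fin 5) F := formMatrix ![ξ, ξ, α, α, ξ]

def PhiOdd (ξ α : F) : Matrix (Fin 5) (Fin 5) F := formMatrix ![1, ξ ^ 2, 1, α ^ 2, 1]

def hMatrix (a b : F) : Matrix (Fin 2) (Fin 2) F :=
  !![-1, 1 / b; -(1 / a), 1 / (a * b) - 1]

/-- `h(a, b)` has order `q ± 1`. -/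
def HasOrderEven (a b : F) : Prop :=
  orderOf (hMatrix a b) = Nat.card F - 1 ∨ orderOf (hMatrix a b) = Nat.card F + 1

/-- `h(a, b)` has order `(q ± 1) / 2`. -/
def HasOrderOdd (a b : F) : Prop :=
  orderOf (hMatrix a b) = (Nat.card F - 1) / 2 ∨ orderOf (hMatrix a b) = (Nat.card F + 1) / 2

/-- The condition on `ξ` for `q` even. -/
def XiEven (ξ : F) : Prop := ξ ≠ 0 ∧ HasOrderEven ξ ξ

def GammaEven (ξ : F) : Set F :=
  {α | α ≠ 0 ∧ α ≠ ξ ∧ HasOrderEven α α ∧ HasOrderEven ξ α}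

def IsNonzeroSquare (a : F) : Prop := a ≠ 0 ∧ IsSquare a

/-- The condition on `ξ` for `q` odd. -/
def XiOdd (ξ : F) : Prop :=
  ξ ≠ 0 ∧ ξ ≠ 1 / 2 ∧ IsNonzeroSquare (ξ ^ 2 - 1 / 2) ∧ HasOrderOdd 1 (ξ ^ 2)

def GammaZero (ξ : F) : Set F :=
  {a | IsNonzeroSquare a ∧ HasOrderOdd 1 a} \
    {1 / 2, 1 / 4, ξ ^ 2 / (4 * ξ ^ 2 - 1), (2 * ξ ^ 2 - 1 / 4) / (4 * ξ ^ 2 - 1),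
      (ξ ^ 2 - 1 / 4) / (4 * ξ ^ 2 - 2), (ξ ^ 2 - 3 / 8) / (2 * ξ ^ 2 - 1)}

/-- A set of squares `a = α ^ 2`. -/
def GammaOdd (ξ : F) : Set F :=
  {a | a ∈ GammaZero ξ ∧
    IsNonzeroSquare (a * (16 * (2 * ξ ^ 2 - 1) ^ 2) + -(32 * ξ ^ 4 - 28 * ξ ^ 2 + 6))}

end Scalars

open QuadraticMap

namespace StringOrth
-- Quadratic forms, negatives of symmetries, and the vectors whose negative symmetries lie in a
-- group
section Basic

variable {F V : Type*} [Field F] [AddCommGroup V] [Module F V] (φ : QuadraticForm F V)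

/-! The sign in `rho φ w`, the negative of a symmetry, makes it an inner automorphism of the
Clifford algebra, where `w v w⁻¹ = ((w, v) / φ w) w - v`. In the four-dimensional spin
representation `cliff`, the matrix of `w` squares to the scalar `φ w` and is a symplectic similitude
with multiplier `φ w`. Conjugation therefore gives `spinHom`, a homomorphism from Sp(4, F) to the
orthogonal group whose kernel is the centre, and an isometry with a lift to a similitude lies in the
image exactly when the multiplier is a square. The norms of the given vectors are squares, so the
image, a copy of PSp(4, q), contains all the generators. For q even it is the whole orthogonal
group, because this group is generated by negative symmetries. For q odd it is the group of even
products with trivial spinor norm, because -1 has no lift and so both invariants can be read off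
from a lift. The last square condition on α fixes the discriminant, so that `φ` becomes x₁y₁ + x₂y₂
+ z².

Generation is proved by enlarging `reflSet φ G`, the set of vectors whose negative symmetries lie in
G; it is stable under G and under scaling. In the plane of two consecutive basis vectors, the
product of the two generators has the order of h. Order q ± 1 makes it generate the norm-one torus,
so all nonsingular vectors of the plane are reached; order (q ± 1) / 2 gives the vectors whose norms
agree up to squares (`exists_rho_eq_pow_mul`).

For q even, one symmetry outside a filled plane fills a three-dimensional space
(`mem_reflSet_of_plane_add`). The symmetries then spread over the cosets of the radical, modulo
which the space is symplectic, and a Cartan–Dieudonné argument gives all isometries.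

For q odd, the middle three vectors span a space U, identified with the traceless 2 × 2 matrices.
The group becomes a subgroup of GL₂ containing the scalars and a large torus. Since commuting is
transitive on nonscalar 2 × 2 matrices, the centralizers partition the nonscalar elements, and
counting their conjugates, as in Dickson's classification, forces unipotents
(`false_of_normalizer_le`) and then two opposite full root subgroups (`exists_two_full_roots`).
These act on U as Eichler transformations, which extend in the directions of the two outer vectors
(`HypBasis.hasEich_extend`). Opposite Eichler transformations are transitive on vectors of a given
nonzero norm, and transitivity together with one symmetry of square norm yields the whole image of
`spinHom` (`mem_genGroup_of_transitive`).

The intersection property reduces to pairs of consecutive intervals of generators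
(`intersection_of_intervals`). An element of both subgroups moves every vector, up to a common sign,
inside both spans, hence inside the span of the common vectors. The same filling arguments show that
the subgroup of the common interval contains all such elements of the big group. -/

theorem form_add (x y : V) : φ (x + y) = φ x + φ y + polar φ x y := by
  simp [polar]

theorem form_smul (a : F) (x : V) : φ (a • x) = a ^ 2 * φ x := by
  rw [QuadraticMap.map_smul, smul_eq_mul, pow_two]

theorem form_sub (x y : V) : φ (x - y) = φ x + φ y - polar φ x y := by
  rw [sub_eq_add_neg, form_add, QuadraticMap.map_neg, polar_neg_right, sub_eq_add_neg]

theorem polar_self_eq (x : V) : polar φ x x = 2 * φ x := by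
  rw [polar_self, nsmul_eq_mul, Nat.cast_ofNat]

theorem symmetry_apply (w v : V) : symmetry φ w v = v - (polar φ w v / φ w) • w :=
  symmetryMap_apply φ w v

/-- The negative of the symmetry with respect to `w`. -/
noncomputable def rho (w : V) : V ≃ₗ[F] V := LinearEquiv.neg F * symmetry φ w

theorem rho_apply_eq_neg (w v : V) : rho φ w v = -symmetry φ w v := rfl

theorem rho_apply (w v : V) : rho φ w v = (polar φ w v / φ w) • w - v := by
  rw [rho_apply_eq_neg, symmetry_apply, neg_sub]

theorem rho_apply_self {w : V} (hw : φ w ≠ 0) : rho φ w w = w := by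
  rw [rho_apply, polar_self_eq, mul_div_assoc, div_self hw, mul_one, two_smul, add_sub_cancel_right]

theorem symmetry_mul_self (w : V) : symmetry φ w * symmetry φ w = 1 := by
  ext v
  exact symmetryMap_involutive φ w v

theorem rho_mul_self (w : V) : rho φ w * rho φ w = 1 := by
  ext v
  change rho φ w (rho φ w v) = v
  rw [rho_apply_eq_neg φ w (rho φ w v), rho_apply_eq_neg φ w v, map_neg, neg_neg]
  exact symmetryMap_involutive φ w v

theorem rho_inv (w : V) : (rho φ w)⁻¹ = rho φ w :=
  inv_eq_of_mul_eq_one_left (rho_mul_self φ w)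

theorem form_symmetry (w v : V) : φ (symmetry φ w v) = φ v := by
  rw [symmetry_apply]
  by_cases hw : φ w = 0
  · simp [hw]
  · rw [form_sub, form_smul, polar_smul_right, polar_comm φ v w, smul_eq_mul]
    field_simp
    ring

theorem form_rho (w v : V) : φ (rho φ w v) = φ v := by
  rw [rho_apply_eq_neg, QuadraticMap.map_neg, form_symmetry]

theorem rho_mem_orthGroup (w : V) : rho φ w ∈ orthGroup φ := form_rho φ w

theorem symmetry_mem_orthGroup (w : V) : symmetry φ w ∈ orthGroup φ := form_symmetry φ w

variable {φ}

theorem polar_map {g : V ≃ₗ[F] V} (hg : g ∈ orthGroup φ) (x y : V) :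
    polar φ (g x) (g y) = polar φ x y := by
  simp only [polar, ← map_add, hg _]

/-- `rho φ w` is built from `φ` and `w` alone, so an isometry transports it along with `w`. This is
what makes `reflSet φ G` stable under `G`. -/
theorem conj_rho {g : V ≃ₗ[F] V} (hg : g ∈ orthGroup φ) (w : V) :
    g * rho φ w * g⁻¹ = rho φ (g w) := by
  ext v
  obtain ⟨v, rfl⟩ := g.surjective v
  have : (g * rho φ w * g⁻¹) (g v) = g (rho φ w v) := by
    simp only [LinearEquiv.mul_apply]
    congr 2
    exact g.symm_apply_apply v
  rw [this, rho_apply, rho_apply, polar_map hg, hg w, map_sub, map_smul]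

theorem rho_smul {t : F} (ht : t ≠ 0) (w : V) : rho φ (t • w) = rho φ w := by
  ext v
  rw [rho_apply, rho_apply, form_smul, polar_smul_left, smul_smul, smul_eq_mul]
  by_cases hw : φ w = 0
  · simp [hw]
  · congr 2
    field_simp

variable (φ) in
/-- The anisotropic vectors whose negative symmetries belong to `G`. -/
def reflSet (G : Subgroup (V ≃ₗ[F] V)) : Set V := {w | φ w ≠ 0 ∧ rho φ w ∈ G}

variable {G : Subgroup (V ≃ₗ[F] V)}

theorem smul_mem_reflSet {t : F} (ht : t ≠ 0) {w : V} (hw : w ∈ reflSet φ G) :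
    t • w ∈ reflSet φ G := by
  refine ⟨?_, ?_⟩
  · rw [form_smul]
    exact mul_ne_zero (pow_ne_zero 2 ht) hw.1
  · rw [rho_smul ht]
    exact hw.2

theorem smul_mem_reflSet_iff {t : F} (ht : t ≠ 0) {w : V} :
    t • w ∈ reflSet φ G ↔ w ∈ reflSet φ G := by
  refine ⟨fun h => ?_, smul_mem_reflSet ht⟩
  simpa [smul_smul, inv_mul_cancel₀ ht] using smul_mem_reflSet (inv_ne_zero ht) h

theorem map_mem_reflSet {g : V ≃ₗ[F] V} (hg : g ∈ orthGroup φ) (hG : g ∈ G) {w : V}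
    (hw : w ∈ reflSet φ G) : g w ∈ reflSet φ G := by
  refine ⟨by rw [hg w]; exact hw.1, ?_⟩
  rw [← conj_rho hg]
  exact G.mul_mem (G.mul_mem hG hw.2) (G.inv_mem hG)

theorem map_mem_reflSet_iff {g : V ≃ₗ[F] V} (hg : g ∈ orthGroup φ) (hG : g ∈ G) {w : V} :
    g w ∈ reflSet φ G ↔ w ∈ reflSet φ G := by
  refine ⟨fun h => ?_, map_mem_reflSet hg hG⟩
  have := map_mem_reflSet ((orthGroup φ).inv_mem hg) (G.inv_mem hG) h
  rwa [← LinearEquiv.mul_apply, inv_mul_cancel] at this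

theorem rho_mem_reflSet {x w : V} (hx : x ∈ reflSet φ G) (hw : w ∈ reflSet φ G) :
    rho φ x w ∈ reflSet φ G :=
  map_mem_reflSet (rho_mem_orthGroup φ x) hx.2 hw

theorem rho_mem_reflSet_iff {x w : V} (hx : x ∈ reflSet φ G) :
    rho φ x w ∈ reflSet φ G ↔ w ∈ reflSet φ G :=
  map_mem_reflSet_iff (rho_mem_orthGroup φ x) hx.2

theorem reflSet_mono {G' : Subgroup (V ≃ₗ[F] V)} (h : G ≤ G') : reflSet φ G ⊆ reflSet φ G' :=
  fun _ hw => ⟨hw.1, h hw.2⟩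

end Basic

/-! ### The intersection property, reduced to consecutive intervals -/

section CGroup

variable {G : Type*} [Group G]

theorem commute_closure_of_commute {s t : Set G} (h : ∀ x ∈ s, ∀ y ∈ t, Commute x y) {a b : G}
    (ha : a ∈ Subgroup.closure s) (hb : b ∈ Subgroup.closure t) : Commute a b := by
  have h1 : Subgroup.closure s ≤ Subgroup.centralizer (Subgroup.closure t : Set G) := by
    rw [Subgroup.closure_le]
    intro x hx
    rw [SetLike.mem_coe, Subgroup.centralizer_closure, Subgroup.mem_centralizer_iff]
    intro y hy
    exact (h x hx y hy).symm
  exact ((Subgroup.mem_centralizer_iff.1 (h1 ha)) b hb).symm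

theorem exists_mul_of_mem_closure_union {s t : Set G} (h : ∀ x ∈ s, ∀ y ∈ t, Commute x y) {g : G}
    (hg : g ∈ Subgroup.closure (s ∪ t)) :
    ∃ a ∈ Subgroup.closure s, ∃ b ∈ Subgroup.closure t, g = a * b := by
  induction hg using Subgroup.closure_induction with
  | mem x hx =>
    rcases hx with hx | hx
    · exact ⟨x, Subgroup.subset_closure hx, 1, one_mem _, by simp⟩
    · exact ⟨1, one_mem _, x, Subgroup.subset_closure hx, by simp⟩
  | one => exact ⟨1, one_mem _, 1, one_mem _, by simp⟩
  | mul x y _ _ hx hy =>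
    obtain ⟨a, ha, b, hb, rfl⟩ := hx
    obtain ⟨c, hc, d, hd, rfl⟩ := hy
    refine ⟨a * c, mul_mem ha hc, b * d, mul_mem hb hd, ?_⟩
    have := (commute_closure_of_commute h hc hb).eq
    calc a * b * (c * d) = a * (b * c) * d := by group
      _ = a * c * (b * d) := by rw [← this]; group
  | inv x _ hx =>
    obtain ⟨a, ha, b, hb, rfl⟩ := hx
    refine ⟨a⁻¹, inv_mem ha, b⁻¹, inv_mem hb, ?_⟩
    rw [(commute_closure_of_commute h ha hb).eq, mul_inv_rev]

/-- If consecutive intervals of generators intersect as they should, then a sequence of generators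
with the string property has the intersection property. -/
theorem intersection_of_intervals (ρ : ℕ → G)
    (hstr : ∀ i j, i + 1 < j → Commute (ρ i) (ρ j)) (N : ℕ)
    (hmeet : ∀ a b, a < b → b ≤ N → ∀ g ∈ Subgroup.closure (ρ '' Set.Ico a b),
      g ∈ Subgroup.closure (ρ '' Set.Ico (a + 1) (b + 1)) →
      g ∈ Subgroup.closure (ρ '' Set.Ico (a + 1) b)) :
    ∀ n a : ℕ, a + n ≤ N + 1 → ∀ I J : Set ℕ, I ⊆ Set.Ico a (a + n) → J ⊆ Set.Ico a (a + n) →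
      ∀ g ∈ Subgroup.closure (ρ '' I), g ∈ Subgroup.closure (ρ '' J) →
        g ∈ Subgroup.closure (ρ '' (I ∩ J)) := by
  intro n
  induction n with
  | zero =>
    intro a _ I J hI hJ g hg _
    have : I = ∅ := by
      rw [Set.eq_empty_iff_forall_notMem]
      intro x hx
      have := hI hx
      simp at this
    subst this
    simpa using hg
  | succ n ih =>
    intro a haN
    have mono : ∀ {I J : Set ℕ} {g : G}, I ⊆ J → g ∈ Subgroup.closure (ρ '' I) →
        g ∈ Subgroup.closure (ρ '' J) := fun h hg =>
      Subgroup.closure_mono (Set.image_mono h) hg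
    -- the two parabolic subgroups of smaller rank
    have ihl : ∀ I J : Set ℕ, I ⊆ Set.Ico a (a + n) → J ⊆ Set.Ico a (a + n) →
        ∀ g ∈ Subgroup.closure (ρ '' I), g ∈ Subgroup.closure (ρ '' J) →
        g ∈ Subgroup.closure (ρ '' (I ∩ J)) := ih a (by omega)
    have ihr : ∀ I J : Set ℕ, I ⊆ Set.Ico (a + 1) (a + n + 1) → J ⊆ Set.Ico (a + 1) (a + n + 1) →
        ∀ g ∈ Subgroup.closure (ρ '' I), g ∈ Subgroup.closure (ρ '' J) →
        g ∈ Subgroup.closure (ρ '' (I ∩ J)) := by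
      intro I J hI hJ
      refine ih (a + 1) (by omega) I J (hI.trans ?_) (hJ.trans ?_) <;>
        exact Set.Ico_subset_Ico le_rfl (by omega)
    -- One set lies in the left interval, the other in the right one: `hmeet` puts `g` into the
    -- subgroup of the common interval, and induction cuts it down by `I` on the left and by `J` on
    -- the right.
    have mixed : ∀ I J : Set ℕ, I ⊆ Set.Ico a (a + n) → J ⊆ Set.Ico (a + 1) (a + n + 1) →
        ∀ g ∈ Subgroup.closure (ρ '' I), g ∈ Subgroup.closure (ρ '' J) →
        g ∈ Subgroup.closure (ρ '' (I ∩ J)) := by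
      intro I J hI hJ g hgI hgJ
      rcases Nat.eq_zero_or_pos n with rfl | hn
      · have : J = ∅ := by
          rw [Set.eq_empty_iff_forall_notMem]
          intro x hx
          have := hJ hx
          simp at this
        subst this
        simpa using hgJ
      have hm : g ∈ Subgroup.closure (ρ '' Set.Ico (a + 1) (a + n)) :=
        hmeet a (a + n) (by omega) (by omega) g (mono hI hgI) (mono hJ hgJ)
      have h1 := ihl I (Set.Ico (a + 1) (a + n)) hI (Set.Ico_subset_Ico (by omega) le_rfl) g hgI hm
      have h2 := ihr J (Set.Ico (a + 1) (a + n)) hJ (Set.Ico_subset_Ico le_rfl (by omega)) g hgJ hm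
      have h3 := ihr (I ∩ Set.Ico (a + 1) (a + n)) (J ∩ Set.Ico (a + 1) (a + n))
        (Set.inter_subset_right.trans (Set.Ico_subset_Ico le_rfl (by omega)))
        (Set.inter_subset_left.trans hJ) g h1 h2
      exact mono (fun x hx => ⟨hx.1.1, hx.2.1⟩) h3
    -- Omitting an index splits a parabolic subgroup into commuting factors, so `g = x * y = z * w`
    -- with `x`, `y` below and above `i` and `z`, `w` below and above `j`. Then `z⁻¹ * x = w * y⁻¹`
    -- involves only indices below `j` and also only indices above `i`, and `mixed` confines it to
    -- those strictly between. This moves `x` and `w` into the subgroup of `I ∩ J`; the remaining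
    -- factor `x⁻¹ * g * w⁻¹` is treated by `mixed` once more.
    have key : ∀ i j : ℕ, ∀ I J : Set ℕ, I ⊆ Set.Ico a (a + (n + 1)) →
        J ⊆ Set.Ico a (a + (n + 1)) → i ∉ I → j ∉ J → a ≤ i → i ≤ j → j ≤ a + n →
        ∀ g ∈ Subgroup.closure (ρ '' I), g ∈ Subgroup.closure (ρ '' J) →
        g ∈ Subgroup.closure (ρ '' (I ∩ J)) := by
      intro i j I J hI hJ hiI hjJ hai hij hjn g hgI hgJ
      have split : ∀ (k : ℕ) (K : Set ℕ), k ∉ K → ∀ g ∈ Subgroup.closure (ρ '' K),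
          ∃ x ∈ Subgroup.closure (ρ '' (K ∩ Set.Iio k)),
          ∃ y ∈ Subgroup.closure (ρ '' (K ∩ Set.Ioi k)), g = x * y := by
        intro k K hk g hg
        apply exists_mul_of_mem_closure_union
        · rintro _ ⟨x, hx, rfl⟩ _ ⟨y, hy, rfl⟩
          exact hstr x y (by have := hx.2; have := hy.2; simp at *; omega)
        · rw [← Set.image_union, ← Set.inter_union_distrib_left]
          refine mono (fun x hx => ⟨hx, ?_⟩) hg
          have : x ≠ k := fun h => hk (h ▸ hx)
          simpa using this.lt_or_gt
      obtain ⟨x, hx, y, hy, hxy⟩ := split i I hiI g hgI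
      obtain ⟨z, hz, w, hw, hzw⟩ := split j J hjJ g hgJ
      have bd : ∀ k ∈ I, a ≤ k ∧ k < a + n + 1 := fun k hk => by
        have := hI hk; simp at this; omega
      have bdJ : ∀ k ∈ J, a ≤ k ∧ k < a + n + 1 := fun k hk => by
        have := hJ hk; simp at this; omega
      have he : z⁻¹ * x = w * y⁻¹ := by
        rw [inv_mul_eq_iff_eq_mul, ← mul_assoc, ← hzw, hxy, mul_inv_cancel_right]
      have hel : z⁻¹ * x ∈ Subgroup.closure (ρ '' Set.Ico a j) := by
        refine mul_mem (inv_mem (mono ?_ hz)) (mono ?_ hx)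
        · intro k hk
          exact ⟨(bdJ k hk.1).1, hk.2⟩
        · intro k hk
          exact ⟨(bd k hk.1).1, lt_of_lt_of_le hk.2 hij⟩
      have her : z⁻¹ * x ∈ Subgroup.closure (ρ '' Set.Ico (i + 1) (a + n + 1)) := by
        rw [he]
        refine mul_mem (mono ?_ hw) (inv_mem (mono ?_ hy))
        · intro k hk
          exact ⟨by have := hk.2; simp at this; omega, (bdJ k hk.1).2⟩
        · intro k hk
          exact ⟨by have := hk.2; simp at this; omega, (bd k hk.1).2⟩
      have hem := mixed _ _ (Set.Ico_subset_Ico le_rfl hjn)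
        (Set.Ico_subset_Ico (by omega) le_rfl) _ hel her
      have hxm : x ∈ Subgroup.closure (ρ '' (I ∩ (J ∩ Set.Iio j))) := by
        have hx' : x ∈ Subgroup.closure (ρ '' (J ∩ Set.Iio j ∪ Set.Ico a j ∩ Set.Ico (i + 1)
            (a + n + 1))) := by
          have : x = z * (z⁻¹ * x) := by group
          rw [this]
          exact mul_mem (mono Set.subset_union_left hz) (mono Set.subset_union_right hem)
        have := ihl (I ∩ Set.Iio i) _ (fun k hk => ⟨(bd k hk.1).1, by
          have := hk.2; simp at this; omega⟩) (fun k hk => ?_) x hx hx'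
        · refine mono ?_ this
          rintro k ⟨⟨h1, h2⟩, h3 | h3⟩
          · exact ⟨h1, h3⟩
          · have := h3.2; simp at this h2; omega
        · rcases hk with hk | hk
          · exact ⟨(bdJ k hk.1).1, by have := hk.2; simp at this; omega⟩
          · have := hk.1; simp at this ⊢; omega
      have hwm : w ∈ Subgroup.closure (ρ '' ((I ∩ Set.Ioi i) ∩ J)) := by
        have hw' : w ∈ Subgroup.closure (ρ '' (I ∩ Set.Ioi i ∪ Set.Ico a j ∩ Set.Ico (i + 1)
            (a + n + 1))) := by
          have : w = (z⁻¹ * x) * y := by rw [he]; group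
          rw [this]
          exact mul_mem (mono Set.subset_union_right hem) (mono Set.subset_union_left hy)
        have := ihr (J ∩ Set.Ioi j) _ (fun k hk => ⟨by
          have := hk.2; simp at this; omega, (bdJ k hk.1).2⟩) (fun k hk => ?_) w hw hw'
        · refine mono ?_ this
          rintro k ⟨⟨h1, h2⟩, h3 | h3⟩
          · exact ⟨h3, h1⟩
          · have := h3.1; simp at this h2; omega
        · rcases hk with hk | hk
          · exact ⟨by have := hk.2; simp at this; omega, (bd k hk.1).2⟩
          · have := hk.2; simp at this ⊢; omega
      have hc : x⁻¹ * g * w⁻¹ ∈ Subgroup.closure (ρ '' (I ∩ J)) := by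
        have hcI : x⁻¹ * g * w⁻¹ ∈ Subgroup.closure (ρ '' (I ∩ Set.Ioi i)) := by
          have : x⁻¹ * g * w⁻¹ = y * w⁻¹ := by rw [hxy]; group
          rw [this]
          exact mul_mem hy (inv_mem (mono Set.inter_subset_left hwm))
        have hcJ : x⁻¹ * g * w⁻¹ ∈ Subgroup.closure (ρ '' (J ∩ Set.Iio j)) := by
          have : x⁻¹ * g * w⁻¹ = x⁻¹ * z := by rw [hzw]; group
          rw [this]
          exact mul_mem (inv_mem (mono Set.inter_subset_right hxm)) hz
        have := mixed (J ∩ Set.Iio j) (I ∩ Set.Ioi i)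
          (fun k hk => ⟨(bdJ k hk.1).1, by have := hk.2; simp at this; omega⟩)
          (fun k hk => ⟨by have := hk.2; simp at this; omega, (bd k hk.1).2⟩) _ hcJ hcI
        exact mono (fun k hk => ⟨hk.2.1, hk.1.1⟩) this
      have : g = x * (x⁻¹ * g * w⁻¹) * w := by group
      rw [this]
      exact mul_mem (mul_mem (mono (fun k hk => ⟨hk.1, hk.2.1⟩) hxm) hc)
        (mono (fun k hk => ⟨hk.1.1, hk.2⟩) hwm)
    intro I J hI hJ g hgI hgJ
    by_cases hIe : Set.Ico a (a + (n + 1)) ⊆ I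
    · exact mono (fun k hk => ⟨hIe (hJ hk), hk⟩) hgJ
    by_cases hJe : Set.Ico a (a + (n + 1)) ⊆ J
    · exact mono (fun k hk => ⟨hk, hJe (hI hk)⟩) hgI
    obtain ⟨i, hi, hiI⟩ := Set.not_subset.1 hIe
    obtain ⟨j, hj, hjJ⟩ := Set.not_subset.1 hJe
    simp only [Set.mem_Ico] at hi hj
    rcases le_total i j with h | h
    · exact key i j I J hI hJ hiI hjJ (by omega) h (by omega) g hgI hgJ
    · rw [Set.inter_comm]
      exact key j i J I hJ hI hjJ hiI (by omega) h (by omega) g hgJ hgI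

end CGroup

/-! ### Commutative-transitive groups and their class equation -/

section CommTransitive

/-- `H` is commutative-transitive modulo the central subgroup `Z`. -/
structure CommTransitive {H : Type*} [Group H] (Z : Subgroup H) : Prop where
  central : ∀ z ∈ Z, ∀ x, Commute z x
  trans : ∀ x y w, y ∉ Z → Commute x y → Commute y w → Commute x w

variable {H : Type*} [Group H] {Z : Subgroup H}

/-- The noncentral elements commuting with a conjugate of `g`. -/
def commClass (Z : Subgroup H) (g : H) : Set H := {x | x ∉ Z ∧ ∃ h, Commute (h * x * h⁻¹) g}

theorem mem_centralizer_singleton {g x : H} :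
    x ∈ Subgroup.centralizer {g} ↔ Commute x g := by
  rw [Subgroup.mem_centralizer_singleton_iff]
  exact Iff.rfl

theorem commute_conj {x y : H} (h : H) :
    Commute (h * x * h⁻¹) (h * y * h⁻¹) ↔ Commute x y := by
  constructor
  · intro hc
    have := hc.eq
    have h2 : h * (x * y) * h⁻¹ = h * (y * x) * h⁻¹ := by
      calc h * (x * y) * h⁻¹ = h * x * h⁻¹ * (h * y * h⁻¹) := by group
        _ = h * (y * x) * h⁻¹ := by rw [this]; group
    exact mul_left_cancel (mul_right_cancel h2)
  · intro hc
    change h * x * h⁻¹ * (h * y * h⁻¹) = h * y * h⁻¹ * (h * x * h⁻¹)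
    calc h * x * h⁻¹ * (h * y * h⁻¹) = h * (x * y) * h⁻¹ := by group
      _ = h * y * h⁻¹ * (h * x * h⁻¹) := by rw [hc.eq]; group

namespace CommTransitive

theorem conj_notMem (hZ : CommTransitive Z) {x : H} (hx : x ∉ Z) (h : H) : h * x * h⁻¹ ∉ Z := by
  intro hc
  have h1 := (hZ.central _ hc h).eq
  have : x = h * x * h⁻¹ := by
    have h2 : h⁻¹ * (h * x * h⁻¹ * h) = h⁻¹ * (h * (h * x * h⁻¹)) := by rw [h1]
    simpa [mul_assoc] using h2
  exact hx (this ▸ hc)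

theorem self_mem (g : H) (hg : g ∉ Z) : g ∈ commClass Z g :=
  ⟨hg, 1, by simp⟩

/-- Commuting is an equivalence relation outside `Z`, so a common element would make a conjugate of
`g'` commute with `g`. -/
theorem disjoint_commClass (hZ : CommTransitive Z) {g g' : H} (hg' : g' ∉ Z)
    (h : g' ∉ commClass Z g) : Disjoint (commClass Z g) (commClass Z g') := by
  rw [Set.disjoint_left]
  rintro x ⟨hx, a, ha⟩ ⟨-, b, hb⟩
  refine h ⟨hg', a * b⁻¹, ?_⟩
  have h1 : Commute x (a⁻¹ * g * a) := by
    have := (commute_conj a⁻¹).2 ha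
    simpa [mul_assoc] using this
  have h2 : Commute (b⁻¹ * g' * b) x := by
    have := (commute_conj b⁻¹).2 hb.symm
    simpa [mul_assoc] using this
  have := (commute_conj a).2 (hZ.trans _ _ _ hx h2 h1)
  simpa [mul_assoc] using this

/-- The centralizers of noncentral elements are the classes of the commuting relation, with `Z`
added. To normalize one of them it is enough to carry a single noncentral member back into it. -/
theorem mem_normalizer_iff (hZ : CommTransitive Z) {g x m : H} (hg : g ∉ Z) (hx : x ∉ Z)
    (hxg : Commute x g) :
    m ∈ Subgroup.normalizer (Subgroup.centralizer {g} : Set H) ↔ Commute (m * x * m⁻¹) g := by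
  rw [Subgroup.mem_normalizer_iff]
  constructor
  · intro h
    exact mem_centralizer_singleton.1 ((h x).1 (mem_centralizer_singleton.2 hxg))
  · intro h w
    rw [mem_centralizer_singleton, mem_centralizer_singleton]
    constructor
    · intro hw
      have h1 := hZ.trans _ _ _ hg hw hxg.symm
      exact hZ.trans _ _ _ (hZ.conj_notMem hx m) ((commute_conj m).2 h1) h
    · intro hw
      have h1 := hZ.trans _ _ _ hg hw h.symm
      exact hZ.trans _ _ _ hx ((commute_conj m).1 h1) hxg

/-- Both sides count the pairs of `h` and a noncentral `x` in the centralizer. Put `y = h⁻¹ x h`;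
for a given `y`, if `a y` conjugates `y` into the centralizer, then the admissible `h` form the
coset of `a y` modulo the normalizer. -/
theorem card_commClass (hZ : CommTransitive Z) [Finite H] {g : H} (hg : g ∉ Z) :
    Nat.card (commClass Z g) * Nat.card (Subgroup.normalizer (Subgroup.centralizer {g} : Set H)) =
      Nat.card H * (Nat.card (Subgroup.centralizer {g}) - Nat.card Z) := by
  classical
  set C := Subgroup.centralizer {g} with hC
  have hZC : (Z : Set H) ⊆ C := fun z hz =>
    mem_centralizer_singleton.2 (hZ.central z hz g)
  have hdiff : Nat.card ((C : Set H) \ Z : Set H) = Nat.card C - Nat.card Z := by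
    have := Set.ncard_sdiff hZC (Set.toFinite _)
    rw [← Nat.card_coe_set_eq, ← Nat.card_coe_set_eq, ← Nat.card_coe_set_eq] at this
    exact this
  rw [← hdiff, ← Nat.card_prod, ← Nat.card_prod]
  choose a ha using fun y : commClass Z g => y.2.2
  have hback : ∀ (h : H) (x : ((C : Set H) \ Z : Set H)), h⁻¹ * x * h ∈ commClass Z g := by
    intro h x
    refine ⟨?_, h, ?_⟩
    · simpa using hZ.conj_notMem x.2.2 h⁻¹
    · simpa [mul_assoc] using mem_centralizer_singleton.1 x.2.1
  have hfwd : ∀ (y : commClass Z g)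
      (n : Subgroup.normalizer (Subgroup.centralizer {g} : Set H)),
      (n : H) * (a y * y * (a y)⁻¹) * (n : H)⁻¹ ∈ ((C : Set H) \ Z : Set H) := fun y n =>
    ⟨mem_centralizer_singleton.2 ((hZ.mem_normalizer_iff hg (hZ.conj_notMem y.2.1 _)
      (ha y)).1 n.2), hZ.conj_notMem (hZ.conj_notMem y.2.1 _) _⟩
  have hnorm : ∀ (h : H) (x : ((C : Set H) \ Z : Set H)), h * (a ⟨_, hback h x⟩)⁻¹ ∈
      Subgroup.normalizer (Subgroup.centralizer {g} : Set H) := by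
    intro h x
    refine (hZ.mem_normalizer_iff hg (hZ.conj_notMem (hback h x).1 _) (ha ⟨_, hback h x⟩)).2 ?_
    simpa [mul_assoc] using mem_centralizer_singleton.1 x.2.1
  refine Nat.card_congr ⟨fun p => ⟨p.2 * a p.1, ⟨_, hfwd p.1 p.2⟩⟩,
    fun p => ⟨⟨_, hback p.1 p.2⟩, ⟨_, hnorm p.1 p.2⟩⟩, ?_, ?_⟩
  · rintro ⟨y, n⟩
    have hy : (⟨_, hback ((n : H) * a y) ⟨_, hfwd y n⟩⟩ : commClass Z g) = y := by
      apply Subtype.ext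
      simp [mul_assoc]
    ext
    · exact congrArg Subtype.val hy
    · simp only
      rw [hy]
      simp
  · rintro ⟨h, x⟩
    ext
    · simp
    · simp only
      simp [mul_assoc]

theorem card_centralizer_eq (hZ : CommTransitive Z) {g x : H} (hg : g ∉ Z)
    (h : x ∈ commClass Z g) :
    Nat.card (Subgroup.centralizer {x}) = Nat.card (Subgroup.centralizer {g}) := by
  obtain ⟨hx, a, ha⟩ := h
  refine Nat.card_congr ⟨fun y => ⟨a * y * a⁻¹, ?_⟩, fun y => ⟨a⁻¹ * y * a, ?_⟩, ?_, ?_⟩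
  · exact mem_centralizer_singleton.2 (hZ.trans _ _ _ (hZ.conj_notMem hx a)
      ((commute_conj a).2 (mem_centralizer_singleton.1 y.2)) ha)
  · refine mem_centralizer_singleton.2 ((commute_conj a).1 ?_)
    have := hZ.trans _ _ _ hg (mem_centralizer_singleton.1 y.2) ha.symm
    simpa [mul_assoc] using this
  · intro y
    simp [mul_assoc]
  · intro y
    simp [mul_assoc]

theorem mem_commClass_symm {g x : H} (hg : g ∉ Z) (h : x ∈ commClass Z g) :
    g ∈ commClass Z x := by
  obtain ⟨-, a, ha⟩ := h
  refine ⟨hg, a⁻¹, ?_⟩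
  have := (commute_conj a⁻¹).2 ha
  simpa [mul_assoc] using this.symm

variable [Finite H]

theorem card_pos_group : (0 : ℚ) < Nat.card H := by exact_mod_cast Nat.card_pos

/-- The proportion of elements in the class of `g`. -/
noncomputable def weight (Z : Subgroup H) (g : H) : ℚ := Nat.card (commClass Z g) / Nat.card H

/-- With `r = |Z| / |C(g)|`, the weight is `1 - r` divided by the index of the centralizer in its
normalizer. All the numerical arguments below are about sums of such terms. -/
theorem weight_eq (hZ : CommTransitive Z) {g : H} (hg : g ∉ Z) :
    weight Z g = (1 - (Nat.card Z : ℚ) / Nat.card (Subgroup.centralizer {g})) *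
      (Nat.card (Subgroup.centralizer {g}) /
        Nat.card (Subgroup.normalizer (Subgroup.centralizer {g} : Set H))) := by
  have h1 := hZ.card_commClass hg
  have hle : Nat.card Z ≤ Nat.card (Subgroup.centralizer {g}) :=
    Nat.card_le_card_of_injective (Subgroup.inclusion (fun z hz =>
      mem_centralizer_singleton.2 (hZ.central z hz g))) (Subgroup.inclusion_injective _)
  have h2 : (Nat.card (commClass Z g) : ℚ) *
      Nat.card (Subgroup.normalizer (Subgroup.centralizer {g} : Set H)) =
      Nat.card H * (Nat.card (Subgroup.centralizer {g}) - Nat.card Z) := by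
    rw [← Nat.cast_sub hle]
    exact_mod_cast h1
  have hH := card_pos_group (H := H)
  have hC := card_pos_group (H := Subgroup.centralizer {g})
  have hN := card_pos_group (H := Subgroup.normalizer (Subgroup.centralizer {g} : Set H))
  rw [weight]
  field_simp
  linarith

/-- For a noncentral element, the ratio `|Z| / |C(g)|` is at most one half. -/
theorem two_mul_card_le (hZ : CommTransitive Z) {g : H} (hg : g ∉ Z) :
    2 * Nat.card Z ≤ Nat.card (Subgroup.centralizer {g}) := by
  have hle : Z ≤ Subgroup.centralizer {g} := fun z hz =>
      mem_centralizer_singleton.2 (hZ.central z hz g)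
  obtain ⟨d, hd⟩ := Subgroup.card_dvd_of_le hle
  have hlt : Nat.card Z < Nat.card (Subgroup.centralizer {g}) := by
    refine lt_of_le_of_ne (Nat.le_of_dvd Nat.card_pos (Subgroup.card_dvd_of_le hle)) fun h => hg ?_
    rw [Subgroup.eq_of_le_of_card_ge hle h.ge]
    exact mem_centralizer_singleton.2 (Commute.refl g)
  have hp : 0 < Nat.card Z := Nat.card_pos
  rw [hd] at hlt ⊢
  have : 2 ≤ d := by
    by_contra h
    interval_cases d <;> omega
  nlinarith

theorem three_mul_card_le (hZ : CommTransitive Z) {g : H} (hg : g ∉ Z)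
    (h2 : Nat.card (Subgroup.centralizer {g}) ≠ 2 * Nat.card Z) :
    3 * Nat.card Z ≤ Nat.card (Subgroup.centralizer {g}) := by
  have hle : Z ≤ Subgroup.centralizer {g} := fun z hz =>
      mem_centralizer_singleton.2 (hZ.central z hz g)
  obtain ⟨d, hd⟩ := Subgroup.card_dvd_of_le hle
  have := hZ.two_mul_card_le hg
  have hp : 0 < Nat.card Z := Nat.card_pos
  rw [hd] at this h2 ⊢
  have : 3 ≤ d := by
    by_contra h
    interval_cases d <;> omega
  nlinarith

theorem ratio_le_of_mul_le {k : ℕ} (hk : 0 < k) {K : Subgroup H}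
    (h : k * Nat.card Z ≤ Nat.card K) : (Nat.card Z : ℚ) / Nat.card K ≤ 1 / k := by
  have hK := card_pos_group (H := K)
  have hk' : (0 : ℚ) < k := by exact_mod_cast hk
  rw [div_le_div_iff₀ hK hk', one_mul, mul_comm]
  exact_mod_cast h

theorem sum_weight_le (hZ : CommTransitive Z) (s : Finset H) (hs : ∀ g ∈ s, g ∉ Z)
    (hd : ∀ g ∈ s, ∀ g' ∈ s, g ≠ g' → g' ∉ commClass Z g) :
    ∑ g ∈ s, weight Z g ≤ 1 - (Nat.card Z : ℚ) / Nat.card H := by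
  classical
  have := Fintype.ofFinite H
  have hH := card_pos_group (H := H)
  have hdisj : (s : Set H).PairwiseDisjoint fun g => (commClass Z g).toFinset := by
    intro g hg g' hg' hne
    simpa using hZ.disjoint_commClass (hs g' hg') (hd g hg g' hg' hne)
  have h1 : (s.biUnion fun g => (commClass Z g).toFinset) ⊆ (Z : Set H).toFinsetᶜ := by
    intro x hx
    simp only [Finset.mem_biUnion, Set.mem_toFinset] at hx
    obtain ⟨g, -, hx⟩ := hx
    simpa using hx.1
  have h2 := Finset.card_le_card h1
  rw [Finset.card_biUnion hdisj, Finset.card_compl] at h2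
  have hZle : Nat.card Z ≤ Nat.card H := Subgroup.card_le_card_group Z
  have h3 : ∑ g ∈ s, Nat.card (commClass Z g) ≤ Nat.card H - Nat.card Z := by
    simpa [Nat.card_eq_fintype_card] using h2
  have h4 : (∑ g ∈ s, (Nat.card (commClass Z g) : ℚ)) ≤ Nat.card H - Nat.card Z := by
    rw [← Nat.cast_sub hZle]
    exact_mod_cast h3
  simp only [weight, ← Finset.sum_div]
  rw [div_le_iff₀ hH, sub_mul, one_mul, div_mul_cancel₀ _ hH.ne']
  exact h4

theorem exists_of_sum_weight_lt (s : Finset H)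
    (h : ∑ g ∈ s, weight Z g < 1 - (Nat.card Z : ℚ) / Nat.card H) :
    ∃ x, x ∉ Z ∧ ∀ g ∈ s, x ∉ commClass Z g := by
  classical
  have := Fintype.ofFinite H
  have hH := card_pos_group (H := H)
  by_contra! hc
  have h1 : (Z : Set H).toFinsetᶜ ⊆ s.biUnion fun g => (commClass Z g).toFinset := by
    intro x hx
    simp only [Finset.mem_biUnion, Set.mem_toFinset]
    exact hc x (by simpa using hx)
  have h2 := (Finset.card_le_card h1).trans Finset.card_biUnion_le
  rw [Finset.card_compl] at h2
  have hZle : Nat.card Z ≤ Nat.card H := Subgroup.card_le_card_group Z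
  have h3 : Nat.card H - Nat.card Z ≤ ∑ g ∈ s, Nat.card (commClass Z g) := by
    simpa [Nat.card_eq_fintype_card] using h2
  have h4 : (Nat.card H - Nat.card Z : ℚ) ≤ ∑ g ∈ s, (Nat.card (commClass Z g) : ℚ) := by
    rw [← Nat.cast_sub hZle]
    exact_mod_cast h3
  simp only [weight, ← Finset.sum_div] at h
  rw [div_lt_iff₀ hH, sub_mul, one_mul, div_mul_cancel₀ _ hH.ne'] at h
  linarith

/-- A group in which every normalizer of a centralizer is at most twice the centralizer contains
no large centralizer of this kind, unless the normalizer is the whole group. -/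
theorem false_of_normalizer_le (hZ : CommTransitive Z)
    (hN : ∀ g, g ∉ Z → Nat.card (Subgroup.normalizer (Subgroup.centralizer {g} : Set H)) =
        Nat.card (Subgroup.centralizer {g}) ∨
      Nat.card (Subgroup.normalizer (Subgroup.centralizer {g} : Set H)) =
        2 * Nat.card (Subgroup.centralizer {g}))
    {g₀ : H} (hg₀ : g₀ ∉ Z) (h6 : 6 * Nat.card Z ≤ Nat.card (Subgroup.centralizer {g₀}))
    (hN₀ : Nat.card (Subgroup.normalizer (Subgroup.centralizer {g₀} : Set H)) =
        2 * Nat.card (Subgroup.centralizer {g₀}))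
    (hlt : Subgroup.normalizer (Subgroup.centralizer {g₀} : Set H) ≠ ⊤) : False := by
  classical
  have hH := card_pos_group (H := H)
  -- inverse orders
  set r : H → ℚ := fun g => (Nat.card Z : ℚ) / Nat.card (Subgroup.centralizer {g}) with hr
  have hr0 : ∀ g, 0 < r g := fun g => div_pos card_pos_group card_pos_group
  have hr2 : ∀ g, g ∉ Z → r g ≤ 1 / 2 := fun g hg =>
    ratio_le_of_mul_le (by norm_num) (hZ.two_mul_card_le hg)
  have hr3 : ∀ g, g ∉ Z → r g = 1 / 2 ∨ r g ≤ 1 / 3 := by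
    intro g hg
    by_cases h2 : Nat.card (Subgroup.centralizer {g}) = 2 * Nat.card Z
    · left
      have := card_pos_group (H := Z)
      simp only [hr, h2]
      push_cast
      field_simp
    · right
      exact ratio_le_of_mul_le (by norm_num) (hZ.three_mul_card_le hg h2)
  have hw : ∀ g, g ∉ Z → weight Z g = 1 - r g ∨ weight Z g = (1 - r g) / 2 := by
    intro g hg
    have hC := card_pos_group (H := Subgroup.centralizer {g})
    rw [hZ.weight_eq hg]
    rcases hN g hg with h | h
    · left
      rw [h, div_self hC.ne', mul_one]
    · right
      rw [h]
      push_cast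
      simp only [hr]
      field_simp
  have hr6 : r g₀ ≤ 1 / 6 := ratio_le_of_mul_le (by norm_num) h6
  have hw0 : weight Z g₀ = (1 - r g₀) / 2 := by
    have hC := card_pos_group (H := Subgroup.centralizer {g₀})
    rw [hZ.weight_eq hg₀, hN₀]
    push_cast
    simp only [hr]
    field_simp
  -- The centralizer has index 2 in its normalizer, which has index at least 2 in `H`.
  have hh : (Nat.card Z : ℚ) / Nat.card H ≤ r g₀ / 4 := by
    obtain ⟨d, hd⟩ := Subgroup.card_subgroup_dvd_card
      (Subgroup.normalizer (Subgroup.centralizer {g₀} : Set H))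
    have hd1 : d ≠ 1 := by
      rintro rfl
      rw [mul_one] at hd
      exact hlt (Subgroup.eq_top_of_card_eq _ hd.symm)
    have hd0 : d ≠ 0 := by
      rintro rfl
      rw [mul_zero] at hd
      exact Nat.card_pos.ne' hd
    have h4 : 4 * Nat.card (Subgroup.centralizer {g₀}) ≤ Nat.card H := by
      rw [hd, hN₀]
      have : 2 ≤ d := by omega
      nlinarith
    have hC := card_pos_group (H := Subgroup.centralizer {g₀})
    have h4' : (4 * Nat.card (Subgroup.centralizer {g₀}) : ℚ) ≤ Nat.card H := by exact_mod_cast h4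
    simp only [hr]
    rw [div_div]
    exact div_le_div_of_nonneg_left card_pos_group.le (by positivity) (by linarith)
  have hh0 : 0 < (Nat.card Z : ℚ) / Nat.card H := div_pos card_pos_group hH
  have pair : ∀ g, g ∉ Z → g ∉ commClass Z g₀ → ∑ x ∈ {g₀, g}, weight Z x =
      weight Z g₀ + weight Z g := by
    intro g hg hgc
    rw [Finset.sum_pair]
    rintro rfl
    exact hgc (self_mem _ hg)
  -- all classes other than that of `g₀` have index two normalizers
  have hdisj : ∀ g g', g ∉ Z → g' ∉ Z → g' ∉ commClass Z g → g ∉ commClass Z g' :=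
    fun g g' hg hg' h hc => h (mem_commClass_symm hg' hc)
  have hle2 : ∀ g, g ∉ Z → g ∉ commClass Z g₀ → weight Z g₀ + weight Z g ≤
      1 - (Nat.card Z : ℚ) / Nat.card H := by
    intro g hg hgc
    rw [← pair g hg hgc]
    refine hZ.sum_weight_le _ (by simp [hg₀, hg]) ?_
    simp only [Finset.mem_insert, Finset.mem_singleton]
    rintro x (rfl | rfl) y (rfl | rfl) hne
    · exact absurd rfl hne
    · exact hgc
    · exact hdisj _ _ hg₀ hg hgc
    · exact absurd rfl hne
  have hle3 : ∀ g g', g ∉ Z → g' ∉ Z → g ∉ commClass Z g₀ → g' ∉ commClass Z g₀ →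
      g' ∉ commClass Z g → weight Z g₀ + weight Z g + weight Z g' ≤
      1 - (Nat.card Z : ℚ) / Nat.card H := by
    intro g g' hg hg' hgc hgc' hgg
    have h1 : g₀ ≠ g := by rintro rfl; exact hgc (self_mem _ hg)
    have h2 : g₀ ≠ g' := by rintro rfl; exact hgc' (self_mem _ hg')
    have h3 : g ≠ g' := by rintro rfl; exact hgg (self_mem _ hg')
    have hs : ∑ x ∈ {g₀, g, g'}, weight Z x = weight Z g₀ + weight Z g + weight Z g' := by
      rw [Finset.sum_insert (by simp [h1, h2]), Finset.sum_pair h3, add_assoc]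
    rw [← hs]
    refine hZ.sum_weight_le _ (by simp [hg₀, hg, hg']) ?_
    simp only [Finset.mem_insert, Finset.mem_singleton]
    rintro x (rfl | rfl | rfl) y (rfl | rfl | rfl) hne
    · exact absurd rfl hne
    · exact hgc
    · exact hgc'
    · exact hdisj _ _ hg₀ hg hgc
    · exact absurd rfl hne
    · exact hgg
    · exact hdisj _ _ hg₀ hg' hgc'
    · exact hdisj _ _ hg hg' hgg
    · exact absurd rfl hne
  have hhalf : ∀ g, g ∉ Z → 1 / 4 ≤ weight Z g := by
    intro g hg
    have := hr2 g hg
    rcases hw g hg with h | h <;> linarith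
  -- Otherwise the weight of `g` is `1 - r g`. If `r g ≤ 1/3`, then adding the weight of `g₀`, at
  -- least `5/12`, exceeds 1. If `r g = 1/2`, the two classes do not fill the group but leave less
  -- than `1/4`, the least weight of a further class.
  have two : ∀ g, g ∉ Z → g ∉ commClass Z g₀ → weight Z g = (1 - r g) / 2 := by
    intro g hg hgc
    rcases hw g hg with h | h
    swap
    · exact h
    exfalso
    rcases hr3 g hg with h2 | h2
    · have hsum : ∑ x ∈ {g₀, g}, weight Z x < 1 - (Nat.card Z : ℚ) / Nat.card H := by
        rw [pair g hg hgc]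
        have := hr0 g₀
        linarith
      obtain ⟨x, hx, hxs⟩ := exists_of_sum_weight_lt _ hsum
      have := hle3 g x hg hx hgc (hxs g₀ (by simp)) (hxs g (by simp))
      have := hhalf x hx
      linarith
    · have := hle2 g hg hgc
      linarith
  -- All remaining weights are `(1 - r) / 2`, so at least three classes are needed, and three fit
  -- only if their values `r` add up to more than 1. As `r g₀ ≤ 1/6`, the other two must equal
  -- `1/2`, as in a dihedral group. But the normalizer of the centralizer of `g₀` is proper, which
  -- leaves room for a fourth class and yet not enough for its weight.
  have hsum1 : ∑ x ∈ {g₀}, weight Z x < 1 - (Nat.card Z : ℚ) / Nat.card H := by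
    rw [Finset.sum_singleton]
    have := hr0 g₀
    linarith
  obtain ⟨g₁, hg₁, hgs₁⟩ := exists_of_sum_weight_lt _ hsum1
  have hc₁ := hgs₁ g₀ (by simp)
  have hw1 := two g₁ hg₁ hc₁
  have hsum2 : ∑ x ∈ {g₀, g₁}, weight Z x < 1 - (Nat.card Z : ℚ) / Nat.card H := by
    rw [pair g₁ hg₁ hc₁]
    have := hr0 g₀
    have := hr0 g₁
    linarith
  obtain ⟨g₂, hg₂, hgs₂⟩ := exists_of_sum_weight_lt _ hsum2
  have hc₂ := hgs₂ g₀ (by simp)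
  have hc₁₂ := hgs₂ g₁ (by simp)
  have hw2 := two g₂ hg₂ hc₂
  have h3 := hle3 g₁ g₂ hg₁ hg₂ hc₁ hc₂ hc₁₂
  have h1 : g₀ ≠ g₁ := by rintro rfl; exact hc₁ (self_mem _ hg₁)
  have h2 : g₀ ≠ g₂ := by rintro rfl; exact hc₂ (self_mem _ hg₂)
  have h12 : g₁ ≠ g₂ := by rintro rfl; exact hc₁₂ (self_mem _ hg₂)
  have hs : ∑ x ∈ {g₀, g₁, g₂}, weight Z x = weight Z g₀ + weight Z g₁ + weight Z g₂ := by
    rw [Finset.sum_insert (by simp [h1, h2]), Finset.sum_pair h12, add_assoc]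
  have hr21 := hr2 g₁ hg₁
  have hr22 := hr2 g₂ hg₂
  rcases hr3 g₁ hg₁ with ha | ha
  swap
  · linarith
  rcases hr3 g₂ hg₂ with hb | hb
  swap
  · linarith
  have hsum3 : ∑ x ∈ {g₀, g₁, g₂}, weight Z x < 1 - (Nat.card Z : ℚ) / Nat.card H := by
    rw [hs]
    have := hr0 g₀
    linarith
  obtain ⟨g₃, hg₃, hgs₃⟩ := exists_of_sum_weight_lt _ hsum3
  have hd1 := hgs₃ g₀ (by simp)
  have hd2 := hgs₃ g₁ (by simp)
  have hd3 := hgs₃ g₂ (by simp)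
  have h4 : ∑ x ∈ {g₀, g₁, g₂, g₃}, weight Z x ≤ 1 - (Nat.card Z : ℚ) / Nat.card H := by
    refine hZ.sum_weight_le _ (by simp [hg₀, hg₁, hg₂, hg₃]) ?_
    simp only [Finset.mem_insert, Finset.mem_singleton]
    rintro x (rfl | rfl | rfl | rfl) y (rfl | rfl | rfl | rfl) hne <;>
    first
      | exact absurd rfl hne
      | assumption
      | (apply hdisj <;> assumption)
  have h03 : g₀ ≠ g₃ := by rintro rfl; exact hd1 (self_mem _ hg₃)
  have h13 : g₁ ≠ g₃ := by rintro rfl; exact hd2 (self_mem _ hg₃)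
  have h23 : g₂ ≠ g₃ := by rintro rfl; exact hd3 (self_mem _ hg₃)
  rw [Finset.sum_insert (by simp [h1, h2, h03]), Finset.sum_insert (by simp [h12, h13]),
    Finset.sum_pair h23] at h4
  have := hhalf g₃ hg₃
  linarith

/-- A bound for a large centralizer in the presence of an element `y` whose centralizer has
index `k` in its normalizer. -/
theorem card_centralizer_lt (hZ : CommTransitive Z) {g₀ y : H} {k : ℕ} (hg₀ : g₀ ∉ Z)
    (h6 : 6 * Nat.card Z ≤ Nat.card (Subgroup.centralizer {g₀}))
    (hN₀ : Nat.card (Subgroup.normalizer (Subgroup.centralizer {g₀} : Set H)) =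
        2 * Nat.card (Subgroup.centralizer {g₀}))
    (hy : y ∉ Z) (hy₀ : y ∉ commClass Z g₀)
    (hy3 : 3 * Nat.card Z ≤ Nat.card (Subgroup.centralizer {y}))
    (hNy : Nat.card (Subgroup.normalizer (Subgroup.centralizer {y} : Set H)) =
        k * Nat.card (Subgroup.centralizer {y}))
    (hk : k = 1 ∨ ∃ g₁, g₁ ∉ Z ∧ g₁ ∉ commClass Z y ∧
      Nat.card (Subgroup.centralizer {g₁}) = k * Nat.card Z ∧
      (Nat.card (Subgroup.normalizer (Subgroup.centralizer {g₁} : Set H)) =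
        Nat.card (Subgroup.centralizer {g₁}) ∨
      Nat.card (Subgroup.normalizer (Subgroup.centralizer {g₁} : Set H)) =
        2 * Nat.card (Subgroup.centralizer {g₁}))) :
    Nat.card (Subgroup.centralizer {g₀}) < 3 * k * Nat.card Z := by
  classical
  have hH := card_pos_group (H := H)
  have hh0 : 0 < (Nat.card Z : ℚ) / Nat.card H := div_pos card_pos_group hH
  have hzpos := card_pos_group (H := Z)
  have hcpos := card_pos_group (H := Subgroup.centralizer {g₀})
  have hypos := card_pos_group (H := Subgroup.centralizer {y})
  set r₀ : ℚ := (Nat.card Z : ℚ) / Nat.card (Subgroup.centralizer {g₀}) with hr₀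
  set ry : ℚ := (Nat.card Z : ℚ) / Nat.card (Subgroup.centralizer {y}) with hry
  have hr6 : r₀ ≤ 1 / 6 := ratio_le_of_mul_le (by norm_num) h6
  have hry3 : ry ≤ 1 / 3 := ratio_le_of_mul_le (by norm_num) hy3
  have hr₀pos : 0 < r₀ := div_pos hzpos hcpos
  have hk0 : 0 < k := by
    rcases Nat.eq_zero_or_pos k with rfl | h
    · rw [zero_mul] at hNy
      exact absurd hNy Nat.card_pos.ne'
    · exact h
  have hkQ : (0 : ℚ) < k := by exact_mod_cast hk0
  have hw0 : weight Z g₀ = (1 - r₀) / 2 := by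
    rw [hZ.weight_eq hg₀, hN₀]
    push_cast
    simp only [hr₀]
    field_simp
  have hwy : weight Z y = (1 - ry) / k := by
    rw [hZ.weight_eq hy, hNy]
    push_cast
    simp only [hry]
    field_simp
  have hne : g₀ ≠ y := by rintro rfl; exact hy₀ (self_mem _ hy)
  rcases hk with rfl | ⟨g₁, hg₁, hgy, hc₁, hN₁⟩
  · exfalso
    have := hZ.sum_weight_le {g₀, y} (by simp [hg₀, hy]) (by
      simp only [Finset.mem_insert, Finset.mem_singleton]
      rintro a (rfl | rfl) b (rfl | rfl) hne
      · exact absurd rfl hne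
      · exact hy₀
      · exact fun h => hy₀ (mem_commClass_symm hy h)
      · exact absurd rfl hne)
    rw [Finset.sum_pair hne, hw0, hwy] at this
    norm_num at this
    linarith
  -- If `g₁` belongs to the class of `g₀`, the centralizer of `g₀` has order `k |Z|`. Otherwise
  -- there are three disjoint classes, of weights `(1 - r₀) / 2`, at least `2 / (3 k)`, and at least
  -- `(1 - 1 / k) / 2`; that their sum is below 1 means `1 / k < 3 r₀`.
  by_cases h01 : g₁ ∈ commClass Z g₀
  · rw [← hZ.card_centralizer_eq hg₀ h01, hc₁]
    have : 0 < k * Nat.card Z := Nat.mul_pos hk0 Nat.card_pos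
    nlinarith
  have hne1 : g₀ ≠ g₁ := by rintro rfl; exact h01 (self_mem _ hg₁)
  have hney1 : y ≠ g₁ := by rintro rfl; exact hgy (self_mem _ hg₁)
  have hsum := hZ.sum_weight_le {g₀, y, g₁} (by simp [hg₀, hy, hg₁]) (by
    simp only [Finset.mem_insert, Finset.mem_singleton]
    rintro a (rfl | rfl | rfl) b (rfl | rfl | rfl) hne <;>
    first
      | exact absurd rfl hne
      | assumption
      | exact fun h => hy₀ (mem_commClass_symm hy h)
      | exact fun h => hgy (mem_commClass_symm hg₁ h)
      | exact fun h => h01 (mem_commClass_symm hg₁ h))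
  rw [Finset.sum_insert (by simp [hne, hne1]), Finset.sum_pair hney1, hw0, hwy] at hsum
  have hk2 : (2 : ℚ) ≤ k := by
    have := hZ.two_mul_card_le hg₁
    rw [hc₁] at this
    exact_mod_cast Nat.le_of_mul_le_mul_right this Nat.card_pos
  have hw1 : weight Z g₁ = 1 - 1 / k ∨ weight Z g₁ = (1 - 1 / k) / 2 := by
    rw [hZ.weight_eq hg₁]
    rcases hN₁ with h | h
    · left
      rw [h, hc₁]
      push_cast
      field_simp
    · right
      rw [h, hc₁]
      push_cast
      field_simp
  have hi : (1 : ℚ) / k ≤ 1 / 2 := one_div_le_one_div_of_le (by norm_num) hk2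
  have hip : (0 : ℚ) < 1 / k := by positivity
  have hyk : (2 / 3 : ℚ) * (1 / k) ≤ (1 - ry) / k := by
    rw [div_eq_mul_one_div (1 - ry)]
    exact mul_le_mul_of_nonneg_right (by linarith) hip.le
  rcases hw1 with h | h
  · exfalso
    rw [h] at hsum
    linarith
  · rw [h] at hsum
    have h1 : 1 / (k : ℚ) < 3 * r₀ := by linarith
    rw [hr₀, div_lt_iff₀ hkQ] at h1
    have h2 : (Nat.card (Subgroup.centralizer {g₀}) : ℚ) < 3 * k * Nat.card Z := by
      have h3 := mul_lt_mul_of_pos_right h1 hcpos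
      have h4 : 3 * ((Nat.card Z : ℚ) / Nat.card (Subgroup.centralizer {g₀})) * k *
          Nat.card (Subgroup.centralizer {g₀}) = 3 * k * Nat.card Z := by
        field_simp
      linarith
    exact_mod_cast h2

end CommTransitive

end CommTransitive

/-! ### 2 × 2 matrices: centralizers, axes and normalizers of tori -/

section TwoByTwo

variable {F : Type*} [Field F]

local notation "M₂" => Matrix (Fin 2) (Fin 2) F

/-- A nonscalar 2 × 2 matrix is cyclic, so only the polynomials in it commute with it. -/
theorem exists_of_commute_two {x y : M₂} (hy : ∀ s : F, y ≠ s • 1) (h : x * y = y * x) :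
    ∃ a b : F, x = a • 1 + b • y := by
  have e00 := congrFun (congrFun h 0) 0
  have e01 := congrFun (congrFun h 0) 1
  have e10 := congrFun (congrFun h 1) 0
  simp only [Matrix.mul_apply, Fin.sum_univ_two] at e00 e01 e10
  have key : ∀ b : F, x 0 1 = b * y 0 1 → x 1 0 = b * y 1 0 →
      x 1 1 - x 0 0 = b * (y 1 1 - y 0 0) → ∃ a b : F, x = a • 1 + b • y := by
    intro b h1 h2 h3
    refine ⟨x 0 0 - b * y 0 0, b, ?_⟩
    ext i j
    fin_cases i <;> fin_cases j
    · simp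
    · simpa using h1
    · simpa using h2
    · simp
      linear_combination h3
  by_cases hb : y 0 1 = 0
  · by_cases hc : y 1 0 = 0
    · have hd : y 1 1 - y 0 0 ≠ 0 := by
        intro hd
        refine hy (y 0 0) ?_
        ext i j
        fin_cases i <;> fin_cases j
        · simp
        · simpa using hb
        · simpa using hc
        · simpa using sub_eq_zero.1 hd
      have h1 : x 0 1 = 0 := by
        have : x 0 1 * (y 1 1 - y 0 0) = 0 := by rw [hb] at e01; linear_combination e01
        exact (mul_eq_zero.1 this).resolve_right hd
      have h2 : x 1 0 = 0 := by
        have : x 1 0 * (y 1 1 - y 0 0) = 0 := by rw [hc] at e10; linear_combination -e10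
        exact (mul_eq_zero.1 this).resolve_right hd
      exact key ((x 1 1 - x 0 0) / (y 1 1 - y 0 0)) (by rw [h1, hb, mul_zero])
        (by rw [h2, hc, mul_zero]) (by field_simp)
    · refine key (x 1 0 / y 1 0) ?_ (by field_simp) ?_ <;> field_simp
      · linear_combination e00
      · linear_combination e10
  · refine key (x 0 1 / y 0 1) (by field_simp) ?_ ?_ <;> field_simp
    · linear_combination -e00
    · linear_combination -e01

theorem traceless_apply {n : M₂} (hn : n.trace = 0) : n 1 1 = -n 0 0 := by
  rw [Matrix.trace_fin_two] at hn
  linear_combination hn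

theorem traceless_mul_self {n : M₂} (hn : n.trace = 0) : n * n = (-n.det) • 1 := by
  have h := traceless_apply hn
  ext i j
  fin_cases i <;> fin_cases j <;>
    simp [Matrix.mul_apply, Fin.sum_univ_two, Matrix.det_fin_two, h] <;> ring

/-- Two nilpotent `2 × 2` matrices whose product has trace zero are proportional. -/
theorem exists_smul_of_trace_mul_eq_zero {n m : M₂} (hn : n.trace = 0) (hm : m.trace = 0)
    (hn0 : n ≠ 0) (hnd : n.det = 0) (hmd : m.det = 0) (h : (n * m).trace = 0) :
    ∃ b : F, m = b • n := by
  have h1 := traceless_apply hn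
  have h2 := traceless_apply hm
  rw [Matrix.det_fin_two, h1] at hnd
  rw [Matrix.det_fin_two, h2] at hmd
  simp only [Matrix.trace_fin_two, Matrix.mul_apply, Fin.sum_univ_two, h1, h2] at h
  have e1 : n 0 0 * m 0 1 - m 0 0 * n 0 1 = 0 := by
    rw [← sq_eq_zero_iff]
    linear_combination -(m 0 1) ^ 2 * hnd - (n 0 1) ^ 2 * hmd - n 0 1 * m 0 1 * h
  have e2 : n 0 0 * m 1 0 - m 0 0 * n 1 0 = 0 := by
    rw [← sq_eq_zero_iff]
    linear_combination -(m 1 0) ^ 2 * hnd - (n 1 0) ^ 2 * hmd - n 1 0 * m 1 0 * h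
  have e3 : n 0 1 * m 1 0 - n 1 0 * m 0 1 = 0 := by
    rw [← sq_eq_zero_iff]
    linear_combination (n 0 1 * m 1 0 + n 1 0 * m 0 1 - 2 * n 0 0 * m 0 0) * h + 4 * (m 0 1 * m 1 0) * hnd -
      4 * n 0 0 ^ 2 * hmd
  have key : ∀ b : F, m 0 0 = b * n 0 0 → m 0 1 = b * n 0 1 → m 1 0 = b * n 1 0 →
      ∃ b : F, m = b • n := by
    intro b k1 k2 k3
    refine ⟨b, ?_⟩
    ext i j
    fin_cases i <;> fin_cases j
    · simpa using k1
    · simpa using k2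
    · simpa using k3
    · simp [h1, h2, k1]
  by_cases hb : n 0 1 = 0
  · by_cases hc : n 1 0 = 0
    · exfalso
      apply hn0
      have h0 : n 0 0 = 0 := by
        rw [← sq_eq_zero_iff]
        rw [hb] at hnd
        linear_combination -hnd
      ext i j
      fin_cases i <;> fin_cases j
      · simpa using h0
      · simpa using hb
      · simpa using hc
      · simp [h1, h0]
    · refine key (m 1 0 / n 1 0) ?_ ?_ (by field_simp) <;> field_simp
      · linear_combination -e2
      · linear_combination -e3
  · refine key (m 0 1 / n 0 1) ?_ (by field_simp) ?_ <;> field_simp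
    · linear_combination -e1
    · linear_combination e3

/-- The traceless part of a `2 × 2` matrix. -/
def tracelessPart (y : M₂) : M₂ := y - (y.trace / 2) • 1

theorem trace_tracelessPart (h2 : (2 : F) ≠ 0) (y : M₂) : (tracelessPart y).trace = 0 := by
  rw [tracelessPart, Matrix.trace_sub, Matrix.trace_smul, Matrix.trace_one, Fintype.card_fin,
    smul_eq_mul]
  push_cast
  field_simp
  ring

theorem eq_add_tracelessPart (y : M₂) : y = (y.trace / 2) • 1 + tracelessPart y := by
  rw [tracelessPart, add_sub_cancel]

theorem commute_tracelessPart {x y : M₂} :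
    x * tracelessPart y = tracelessPart y * x ↔ x * y = y * x := by
  simp [tracelessPart, mul_sub, sub_mul]

theorem tracelessPart_add_smul (h2 : (2 : F) ≠ 0) {n : M₂} (hn : n.trace = 0) (a b : F) :
    tracelessPart (a • 1 + b • n) = b • n := by
  rw [tracelessPart, Matrix.trace_add, Matrix.trace_smul, Matrix.trace_smul, hn, Matrix.trace_one,
    Fintype.card_fin]
  simp only [smul_eq_mul, mul_zero, add_zero]
  push_cast
  rw [mul_div_assoc, div_self h2, mul_one, add_sub_cancel_left]

/-- If `x` normalizes the line of the nilpotent matrix `n` with multiplier different from one, then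
`x` acts on the right of `n` as a scalar. -/
theorem exists_mul_eq_smul {n x : M₂} (hn0 : n ≠ 0) (hn : n.trace = 0) (hnd : n.det = 0)
    {c : F} (hc : c ≠ 0) (h : x * n = c • (n * x)) : ∃ d : F, n * x = d • n := by
  have h1 := traceless_apply hn
  have hnn : n * n = 0 := by rw [traceless_mul_self hn, hnd, neg_zero, zero_smul]
  have hz : n * x * n = 0 := by
    have : c • (n * x * n) = 0 := by
      rw [← Matrix.smul_mul, ← h, Matrix.mul_assoc, hnn, Matrix.mul_zero]
    exact (smul_eq_zero.1 this).resolve_left hc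
  have e00 := congrFun (congrFun hz 0) 0
  have e01 := congrFun (congrFun hz 0) 1
  have e10 := congrFun (congrFun hz 1) 0
  have e11 := congrFun (congrFun hz 1) 1
  simp only [Matrix.mul_apply, Fin.sum_univ_two, h1, Matrix.zero_apply] at e00 e01 e10 e11
  rw [Matrix.det_fin_two, h1] at hnd
  have key : ∀ d : F, n 0 0 * x 0 0 + n 0 1 * x 1 0 = d * n 0 0 →
      n 0 0 * x 0 1 + n 0 1 * x 1 1 = d * n 0 1 → n 1 0 * x 0 0 - n 0 0 * x 1 0 = d * n 1 0 →
      n 1 0 * x 0 1 - n 0 0 * x 1 1 = -(d * n 0 0) → ∃ d : F, n * x = d • n := by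
    intro d k1 k2 k3 k4
    refine ⟨d, ?_⟩
    ext i j
    fin_cases i <;> fin_cases j <;> simp [Matrix.mul_apply, Fin.sum_univ_two, h1]
    · exact k1
    · exact k2
    · linear_combination k3
    · linear_combination k4
  by_cases hb : n 0 1 = 0
  · have h0 : n 0 0 = 0 := by
      rw [← sq_eq_zero_iff]
      rw [hb] at hnd
      linear_combination -hnd
    have hc' : n 1 0 ≠ 0 := by
      intro hc'
      apply hn0
      ext i j
      fin_cases i <;> fin_cases j
      · simpa using h0
      · simpa using hb
      · simpa using hc'
      · simp [h1, h0]
    have h3 : x 0 1 = 0 := by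
      have : n 1 0 ^ 2 * x 0 1 = 0 := by
        rw [h0] at e10
        linear_combination e10
      exact (mul_eq_zero.1 this).resolve_left (pow_ne_zero 2 hc')
    exact key (x 0 0) (by rw [h0, hb]; ring) (by rw [h0, hb]; ring) (by rw [h0]; ring)
      (by rw [h0, h3]; ring)
  · have hd : n 1 0 = -(n 0 0 ^ 2) / n 0 1 := by
      field_simp
      linear_combination -hnd
    refine key ((n 0 0 * x 0 1 + n 0 1 * x 1 1) / n 0 1) ?_ (by field_simp) ?_ ?_
    · field_simp
      linear_combination e01
    · rw [hd]
      field_simp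
      linear_combination -(n 0 0) * e01
    · rw [hd]
      field_simp
      ring

/-- The scalar matrices in a subgroup of `GL₂`. -/
def scalarsOf (H : Subgroup (GL (Fin 2) F)) : Subgroup H where
  carrier := {x | ∃ s : F, ((x : GL (Fin 2) F) : M₂) = s • 1}
  mul_mem' := by
    rintro x y ⟨s, hs⟩ ⟨t, ht⟩
    refine ⟨s * t, ?_⟩
    rw [Subgroup.coe_mul, Units.val_mul, hs, ht]
    simp [smul_smul, mul_comm]
  one_mem' := ⟨1, by simp⟩
  inv_mem' := by
    rintro x ⟨s, hs⟩
    have hx : ((x : GL (Fin 2) F) : M₂) * (((x⁻¹ : H) : GL (Fin 2) F) : M₂) = 1 := by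
      rw [← Units.val_mul, ← Subgroup.coe_mul, mul_inv_cancel]
      rfl
    have hs0 : s ≠ 0 := by
      rintro rfl
      rw [hs, zero_smul, zero_mul] at hx
      exact zero_ne_one hx
    refine ⟨s⁻¹, ?_⟩
    rw [hs, Matrix.smul_mul, one_mul] at hx
    rw [← hx, smul_smul, inv_mul_cancel₀ hs0, one_smul]

variable {H : Subgroup (GL (Fin 2) F)}

/-- The underlying matrix. -/
def toMat (x : H) : M₂ := ((x : GL (Fin 2) F) : M₂)

theorem toMat_mul (x y : H) : toMat (x * y) = toMat x * toMat y := rfl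

theorem toMat_one : toMat (1 : H) = 1 := rfl

theorem toMat_injective : Function.Injective (toMat : H → M₂) := fun _ _ h =>
  Subtype.ext (Units.ext h)

theorem toMat_mul_inv (x : H) : toMat x * toMat x⁻¹ = 1 := by
  rw [← toMat_mul, mul_inv_cancel, toMat_one]

theorem toMat_inv_mul (x : H) : toMat x⁻¹ * toMat x = 1 := by
  rw [← toMat_mul, inv_mul_cancel, toMat_one]

theorem mul_toMat_ne_zero {n : M₂} (hn : n ≠ 0) (x : H) : n * toMat x ≠ 0 := by
  intro h
  apply hn
  rw [← mul_one n, ← toMat_mul_inv x, ← Matrix.mul_assoc, h, Matrix.zero_mul]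

theorem commute_iff_toMat {x y : H} : Commute x y ↔ toMat x * toMat y = toMat y * toMat x :=
  ⟨fun h => congrArg toMat h.eq, fun h => toMat_injective h⟩

theorem mem_scalarsOf {x : H} : x ∈ scalarsOf H ↔ ∃ s : F, toMat x = s • 1 := Iff.rfl

theorem mem_scalarsOf_iff (h2 : (2 : F) ≠ 0) {x : H} :
    x ∈ scalarsOf H ↔ tracelessPart (toMat x) = 0 := by
  rw [mem_scalarsOf]
  constructor
  · rintro ⟨s, hs⟩
    have := tracelessPart_add_smul h2 (n := (0 : M₂)) (by simp) s 0
    rw [hs]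
    simpa using this
  · intro h
    exact ⟨_, by rw [eq_add_tracelessPart (toMat x), h, add_zero]⟩

-- The centralizer of a nonscalar matrix `y` lies in the commutative algebra `F[y]`, so commuting
-- passes through `y`.
variable (H) in
theorem commTransitive_scalarsOf : CommTransitive (scalarsOf H) where
  central := by
    rintro z ⟨s, hs⟩ x
    rw [commute_iff_toMat]
    change toMat z = _ at hs
    rw [hs]
    simp
  trans := by
    intro x y w hy hxy hyw
    rw [commute_iff_toMat] at *
    have hy' : ∀ s : F, toMat y ≠ s • 1 := fun s hs => hy ⟨s, hs⟩
    obtain ⟨a, b, h1⟩ := exists_of_commute_two hy' hxy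
    obtain ⟨c, d, h2⟩ := exists_of_commute_two hy' hyw.symm
    rw [h1, h2]
    simp only [mul_add, add_mul, Matrix.smul_mul, Matrix.mul_smul, one_mul, mul_one, smul_smul]
    rw [mul_comm c a, mul_comm d a, mul_comm c b, mul_comm d b]
    abel

theorem card_scalarsOf [Finite F] (hs : ∀ s : Fˣ, Units.map (algebraMap F M₂).toMonoidHom s ∈ H) :
    Nat.card (scalarsOf H) = Nat.card F - 1 := by
  rw [← Nat.card_units]
  refine (Nat.card_congr (Equiv.ofBijective (fun s : Fˣ => (⟨⟨_, hs s⟩, (s : F), ?_⟩ : scalarsOf H))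
    ⟨?_, ?_⟩)).symm
  · change algebraMap F M₂ s = _
    rw [Algebra.algebraMap_eq_smul_one]
  · intro s t hst
    have h1 : (algebraMap F M₂ s) = algebraMap F M₂ t :=
      congrArg (fun z : scalarsOf H => toMat (z : H)) hst
    exact Units.ext ((algebraMap F M₂).injective h1)
  · rintro ⟨x, s, hsx⟩
    have hs0 : s ≠ 0 := by
      rintro rfl
      have := toMat_mul_inv x
      change toMat x = _ at hsx
      rw [hsx, zero_smul, zero_mul] at this
      exact zero_ne_one this
    refine ⟨Units.mk0 s hs0, Subtype.ext (toMat_injective ?_)⟩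
    change algebraMap F M₂ s = toMat x
    rw [Algebra.algebraMap_eq_smul_one]
    exact hsx.symm

/-- The centralizer of `g` is determined by the line of its traceless part `n`, the axis.
Conjugation by a normalizing element sends `n` to some `a + b n` and preserves the trace; since 2 is
invertible, `a = 0`. -/
theorem mem_normalizer_centralizer (h2 : (2 : F) ≠ 0) {g : H} (hg : g ∉ scalarsOf H) {x : H} :
    x ∈ Subgroup.normalizer (Subgroup.centralizer {g} : Set H) ↔
      ∃ b : F, toMat x * tracelessPart (toMat g) = b • (tracelessPart (toMat g) * toMat x) := by
  have hn := trace_tracelessPart h2 (toMat g)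
  have hn0 : tracelessPart (toMat g) ≠ 0 := fun h => hg ((mem_scalarsOf_iff h2).2 h)
  set n := tracelessPart (toMat g) with hndef
  rw [(commTransitive_scalarsOf H).mem_normalizer_iff hg hg (Commute.refl g), commute_iff_toMat,
    ← commute_tracelessPart, ← hndef, toMat_mul, toMat_mul]
  set X := toMat x
  set Y := toMat x⁻¹
  have hXY : X * Y = 1 := toMat_mul_inv x
  have hYX : Y * X = 1 := toMat_inv_mul x
  have hgx : toMat g = ((toMat g).trace / 2) • 1 + n := eq_add_tracelessPart _
  have hconj : X * toMat g * Y = ((toMat g).trace / 2) • 1 + X * n * Y := by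
    conv_lhs => rw [hgx]
    simp only [mul_add, add_mul, Matrix.mul_smul, Matrix.smul_mul, mul_one, hXY]
  have hcomm : X * toMat g * Y * n = n * (X * toMat g * Y) ↔ X * n * Y * n = n * (X * n * Y) := by
    rw [hconj]
    simp [mul_add, add_mul]
  rw [hcomm]
  constructor
  · intro h
    have hns : ∀ s : F, n ≠ s • 1 := by
      intro s hs
      apply hn0
      have : n.trace = s * 2 := by
        rw [hs, Matrix.trace_smul, Matrix.trace_one, Fintype.card_fin, smul_eq_mul, Nat.cast_ofNat]
      rw [hn] at this
      rw [hs, (mul_eq_zero.1 this.symm).resolve_right h2, zero_smul]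
    obtain ⟨a, b, hab⟩ := exists_of_commute_two hns h
    have htr : (X * n * Y).trace = 0 := by
      rw [Matrix.mul_assoc, Matrix.trace_mul_comm, Matrix.mul_assoc, hYX, mul_one, hn]
    rw [hab, Matrix.trace_add, Matrix.trace_smul, Matrix.trace_smul, hn, Matrix.trace_one,
      Fintype.card_fin, smul_zero, add_zero, smul_eq_mul, Nat.cast_ofNat] at htr
    have ha := (mul_eq_zero.1 htr).resolve_right h2
    rw [ha, zero_smul, zero_add] at hab
    refine ⟨b, ?_⟩
    have : X * n = X * n * Y * X := by rw [Matrix.mul_assoc _ Y X, hYX, mul_one]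
    rw [this, hab, Matrix.smul_mul]
  · rintro ⟨b, hb⟩
    rw [hb, Matrix.smul_mul, Matrix.mul_assoc n X Y, hXY, mul_one, Matrix.smul_mul, Matrix.mul_smul]

/-- The character by which the normalizer of a torus acts on its axis. -/
theorem exists_axisChar (h2 : (2 : F) ≠ 0) [Finite F] {g : H} (hg : g ∉ scalarsOf H) :
    ∃ f : Subgroup.normalizer (Subgroup.centralizer {g} : Set H) →* Fˣ,
      (∀ x : Subgroup.normalizer (Subgroup.centralizer {g} : Set H),
        toMat (x : H) * tracelessPart (toMat g) =
        (f x : F) • (tracelessPart (toMat g) * toMat (x : H))) ∧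
      Nat.card (Subgroup.normalizer (Subgroup.centralizer {g} : Set H)) =
        Nat.card f.range * Nat.card (Subgroup.centralizer {g}) := by
  have hn0 : tracelessPart (toMat g) ≠ 0 := fun h => hg ((mem_scalarsOf_iff h2).2 h)
  set n := tracelessPart (toMat g) with hndef
  choose b hb using fun x : Subgroup.normalizer (Subgroup.centralizer {g} : Set H) =>
    (mem_normalizer_centralizer h2 hg).1 x.2
  simp only [← hndef] at hb
  have huniq : ∀ (x : H) (s t : F), s • (n * toMat x) = t • (n * toMat x) → s = t := by
    intro x s t h
    rw [← sub_eq_zero, ← sub_smul] at h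
    exact sub_eq_zero.1 ((smul_eq_zero.1 h).resolve_right (mul_toMat_ne_zero hn0 x))
  let f₀ : Subgroup.normalizer (Subgroup.centralizer {g} : Set H) →* F :=
    { toFun := b
      map_one' := by
        apply huniq 1
        have := hb 1
        rw [Subgroup.coe_one] at this
        rw [← this, toMat_one, one_mul, mul_one, one_smul]
      map_mul' := by
        intro x y
        apply huniq (x * y)
        rw [← Subgroup.coe_mul, ← hb, Subgroup.coe_mul, toMat_mul, Matrix.mul_assoc, hb y,
          Matrix.mul_smul, ← Matrix.mul_assoc, hb x, Matrix.smul_mul, smul_smul, Matrix.mul_assoc,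
          mul_comm] }
  refine ⟨f₀.toHomUnits, fun x => hb x, ?_⟩
  have hker : f₀.toHomUnits.ker = (Subgroup.centralizer {g}).subgroupOf
      (Subgroup.normalizer (Subgroup.centralizer {g} : Set H)) := by
    ext x
    rw [MonoidHom.mem_ker, Subgroup.mem_subgroupOf, mem_centralizer_singleton, commute_iff_toMat,
      ← commute_tracelessPart, ← hndef, hb x, Units.ext_iff]
    change b x = 1 ↔ _
    constructor
    · intro h
      rw [h, one_smul]
    · intro h
      apply huniq x
      rw [h, one_smul]
  have hle : Subgroup.centralizer {g} ≤
      Subgroup.normalizer (Subgroup.centralizer {g} : Set H) := Subgroup.le_normalizer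
  rw [← Nat.card_congr (Subgroup.subgroupOfEquivOfLe hle).toEquiv, ← hker, ← Subgroup.index_ker,
    mul_comm, Subgroup.card_mul_index]

/-- The square of the axis is the nonzero scalar `-det`, which conjugation fixes, so the character
on the axis takes only the values 1 and -1. -/
theorem card_normalizer_of_det_ne_zero (h2 : (2 : F) ≠ 0) [Finite F] {g : H}
    (hg : g ∉ scalarsOf H) (hd : (tracelessPart (toMat g)).det ≠ 0) :
    Nat.card (Subgroup.normalizer (Subgroup.centralizer {g} : Set H)) =
        Nat.card (Subgroup.centralizer {g}) ∨
      Nat.card (Subgroup.normalizer (Subgroup.centralizer {g} : Set H)) =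
        2 * Nat.card (Subgroup.centralizer {g}) := by
  obtain ⟨f, hf, hcard⟩ := exists_axisChar h2 hg
  have hn := trace_tracelessPart h2 (toMat g)
  set n := tracelessPart (toMat g)
  have hsq : ∀ x, f x = 1 ∨ f x = -1 := by
    intro x
    have h1 : toMat (x : H) * (n * n) = (f x * f x : F) • (n * n * toMat (x : H)) := by
      rw [← Matrix.mul_assoc, hf x, Matrix.smul_mul, Matrix.mul_assoc, hf x, Matrix.mul_smul,
        smul_smul, Matrix.mul_assoc]
    rw [traceless_mul_self hn, Matrix.mul_smul, mul_one, Matrix.smul_mul, one_mul,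
      ← sub_eq_zero, smul_smul, ← sub_smul] at h1
    have h3 : toMat (x : H) ≠ 0 := by
      have := mul_toMat_ne_zero (one_ne_zero (α := M₂)) (x : H)
      rwa [one_mul] at this
    have h4 := (smul_eq_zero.1 h1).resolve_right h3
    have h5 : (f x : F) * f x = 1 := by
      have : n.det * ((f x : F) * f x - 1) = 0 := by linear_combination h4
      linear_combination (mul_eq_zero.1 this).resolve_left hd
    rcases mul_self_eq_one_iff.1 h5 with h | h
    · left; exact Units.ext h
    · right; exact Units.ext h
  have hle : (f.range : Set Fˣ) ⊆ {1, -1} := by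
    rintro _ ⟨x, rfl⟩
    simpa using hsq x
  have h3 : Nat.card f.range ≤ 2 := by
    have h := Set.ncard_le_ncard hle (Set.toFinite _)
    exact h.trans (Set.ncard_insert_le _ _ |>.trans (by simp))
  have h4 : 0 < Nat.card f.range := Nat.card_pos
  have : Nat.card f.range = 1 ∨ Nat.card f.range = 2 := by omega
  rcases this with h | h
  · left; rw [hcard, h, one_mul]
  · right; rw [hcard, h]

end TwoByTwo

/-! ### Large subrings of a finite field, and normalizers of unipotent elements -/

section Unipotents

variable {F : Type*} [Field F]

local notation "M₂" => Matrix (Fin 2) (Fin 2) F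

/-- A proper subring `R` of a finite field is a subfield over which the field has dimension at least
2, so `|R|² ≤ q`. Together with `k < |R|` and `q ≤ 6 k` this leaves `q ≤ 18` and `|R| ≤ 4`, and no
odd `q ≥ 11` in that range has a suitable divisor `|R|`. -/
theorem subring_eq_top_of_card [Finite F] (h2 : (2 : F) ≠ 0) (hq : 11 ≤ Nat.card F) (R : Subring F)
    {k : ℕ} (hk : k + 1 ≤ Nat.card R) (hqk : Nat.card F - 1 < 6 * k) : R = ⊤ := by
  classical
  by_contra hR
  have := Fintype.ofFinite F
  have hinv : ∀ r ∈ R, r⁻¹ ∈ R := by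
    intro r hr
    by_cases hr0 : r = 0
    · rw [hr0, inv_zero]
      exact R.zero_mem
    · have h1 := FiniteField.pow_card_sub_one_eq_one r hr0
      have h3 : r⁻¹ = r ^ (Fintype.card F - 2) := by
        rw [inv_eq_iff_eq_inv, eq_comm, inv_eq_of_mul_eq_one_left]
        rw [← pow_succ', ← h1]
        congr 1
        rw [Nat.card_eq_fintype_card] at hq
        omega
      rw [h3]
      exact R.pow_mem hr _
  obtain ⟨y, hy⟩ : ∃ y, y ∉ R := by
    by_contra! h
    exact hR (eq_top_iff.2 fun x _ => h x)
  have hinj : Function.Injective fun p : R × R => (p.1 : F) + p.2 * y := by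
    rintro ⟨r, s⟩ ⟨r', s'⟩ h
    simp only at h
    by_cases hs : (s : F) = s'
    · rw [hs] at h
      exact Prod.ext (Subtype.ext (add_right_cancel h)) (Subtype.ext hs)
    · exfalso
      apply hy
      have hs' : (s : F) - s' ≠ 0 := sub_ne_zero.2 hs
      have : y = (r' - r : F) * (s - s' : F)⁻¹ := by
        rw [eq_mul_inv_iff_mul_eq₀ hs']
        linear_combination h
      rw [this]
      exact R.mul_mem (R.sub_mem r'.2 r.2) (hinv _ (R.sub_mem s.2 s'.2))
  have hsq : Nat.card R * Nat.card R ≤ Nat.card F := by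
    rw [← Nat.card_prod]
    exact Nat.card_le_card_of_injective _ hinj
  have hodd : Nat.card F % 2 = 1 := by
    rw [Nat.card_eq_fintype_card]
    exact FiniteField.odd_card_of_char_ne_two fun h => h2 (by
      have := ringChar.Nat.cast_ringChar (R := F)
      rw [h] at this
      exact_mod_cast this)
  have hdvd : Nat.card R ∣ Nat.card F := by
    have := AddSubgroup.card_addSubgroup_dvd_card R.toAddSubgroup
    exact this
  have hk3 : k ≤ 3 := by
    by_contra h
    have h3 := Nat.mul_le_mul hk hk
    have h4 : (k + 1) * (k + 1) ≤ 6 * k := by omega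
    nlinarith
  have hR4 : Nat.card R ≤ 4 := by
    by_contra h
    have : 5 * 5 ≤ Nat.card R * Nat.card R := Nat.mul_le_mul (by omega) (by omega)
    omega
  generalize Nat.card R = r at *
  generalize Nat.card F = q at *
  have hq18 : q ≤ 18 := by omega
  interval_cases q <;> interval_cases r <;> omega

variable {H : Subgroup (GL (Fin 2) F)}

theorem det_tracelessPart (h2 : (2 : F) ≠ 0) (y : M₂) :
    (tracelessPart y).det = y.det - (y.trace / 2) ^ 2 := by
  simp [tracelessPart, Matrix.det_fin_two, Matrix.trace_fin_two]
  field_simp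
  ring

theorem det_tracelessPart_conj (h2 : (2 : F) ≠ 0) (h x : H) :
    (tracelessPart (toMat (h * x * h⁻¹))).det = (tracelessPart (toMat x)).det := by
  have h1 : toMat (h * x * h⁻¹) = toMat h * (toMat x * toMat h⁻¹) := by
    rw [toMat_mul, toMat_mul, Matrix.mul_assoc]
  have h3 : (toMat h).det * (toMat h⁻¹).det = 1 := by
    rw [← Matrix.det_mul, toMat_mul_inv, Matrix.det_one]
  rw [det_tracelessPart h2, det_tracelessPart h2, h1, Matrix.trace_mul_comm, Matrix.mul_assoc,
    toMat_inv_mul, mul_one, Matrix.det_mul, Matrix.det_mul]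
  linear_combination (toMat x).det * h3

/-- An element commuting with `y` has a multiple of the traceless part of `y` as its own traceless
part. Hence the classes of semisimple elements and of scalar multiples of unipotents are disjoint.
-/
theorem det_tracelessPart_of_mem_commClass (h2 : (2 : F) ≠ 0) {x y : H} (hy : y ∉ scalarsOf H)
    (hd : (tracelessPart (toMat y)).det = 0) (hx : x ∈ commClass (scalarsOf H) y) :
    (tracelessPart (toMat x)).det = 0 := by
  obtain ⟨-, a, ha⟩ := hx
  rw [← det_tracelessPart_conj h2 a x]
  obtain ⟨s, t, hst⟩ := exists_of_commute_two (y := toMat y) (fun s hs => hy ⟨s, hs⟩)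
    (commute_iff_toMat.1 ha)
  have : toMat (a * x * a⁻¹) =
      (s + t * ((toMat y).trace / 2)) • 1 + t • tracelessPart (toMat y) := by
    rw [hst]
    conv_lhs => rw [eq_add_tracelessPart (toMat y)]
    rw [smul_add, smul_smul, add_smul, add_assoc]
  rw [this, tracelessPart_add_smul h2 (trace_tracelessPart h2 _), Matrix.det_smul, hd, mul_zero]

/-- If the normalizer of the centralizer of a unipotent element acts on its axis with a nontrivial
cyclic group of multipliers, a generator of that group comes from a split torus. -/
theorem card_centralizer_of_nilpotent (h2 : (2 : F) ≠ 0) [Finite F] {y : H} (hy : y ∉ scalarsOf H)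
    (hd : (tracelessPart (toMat y)).det = 0)
    (f : Subgroup.normalizer (Subgroup.centralizer {y} : Set H) →* Fˣ)
    (hf : ∀ x : Subgroup.normalizer (Subgroup.centralizer {y} : Set H),
      toMat (x : H) * tracelessPart (toMat y) =
        (f x : F) • (tracelessPart (toMat y) * toMat (x : H)))
    (h : Subgroup.normalizer (Subgroup.centralizer {y} : Set H)) (hf1 : f h ≠ 1)
    (hgen : ∀ x, f x ∈ Subgroup.zpowers (f h)) :
    (h : H) ∉ scalarsOf H ∧ (tracelessPart (toMat (h : H))).det ≠ 0 ∧
      Nat.card (Subgroup.centralizer {(h : H)}) = Nat.card f.range * Nat.card (scalarsOf H) := by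
  have hn := trace_tracelessPart h2 (toMat y)
  have hn0 : tracelessPart (toMat y) ≠ 0 := fun h => hy ((mem_scalarsOf_iff h2).2 h)
  set n := tracelessPart (toMat y) with hndef
  set γ : F := ((f h : Fˣ) : F) with hγ
  have hγ1 : γ ≠ 1 := fun h' => hf1 (Units.ext h')
  have hγ0 : γ ≠ 0 := (f h).ne_zero
  -- Multiplication of `n` by `h` on the right and on the left gives the multiples `d` and `γ d`,
  -- the two eigenvalues of `h`. They differ because `γ ≠ 1`, so `h` is nonscalar and semisimple,
  -- and its centralizer, consisting of the `a + b h`, also preserves the axis.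
  obtain ⟨d, hnd⟩ := exists_mul_eq_smul hn0 hn hd hγ0 (hf h)
  have hdn : toMat (h : H) * n = (γ * d) • n := by rw [hf h, hnd, smul_smul]
  have hd0 : d ≠ 0 := by
    rintro rfl
    rw [zero_smul] at hnd
    exact mul_toMat_ne_zero hn0 _ hnd
  have hhZ : (h : H) ∉ scalarsOf H := by
    rintro ⟨s, hs⟩
    change toMat (h : H) = _ at hs
    rw [hs, Matrix.mul_smul, mul_one] at hnd
    rw [hs, Matrix.smul_mul, one_mul] at hdn
    have h3 : d • n = (γ * d) • n := by rw [← hnd, ← hdn]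
    rw [← sub_eq_zero, ← sub_smul] at h3
    have h4 := (smul_eq_zero.1 h3).resolve_right hn0
    apply hγ1
    have : d * (γ - 1) = 0 := by linear_combination -h4
    linear_combination (mul_eq_zero.1 this).resolve_left hd0
  refine ⟨hhZ, ?_, ?_⟩
  · intro hm
    have hmt := trace_tracelessPart h2 (toMat (h : H))
    have hms := eq_add_tracelessPart (toMat (h : H))
    set m := tracelessPart (toMat (h : H))
    set s := (toMat (h : H)).trace / 2
    have hmm : m * m = 0 := by rw [traceless_mul_self hmt, hm, neg_zero, zero_smul]
    have e1 : n * m = (d - s) • n := by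
      rw [hms, mul_add, Matrix.mul_smul, mul_one] at hnd
      rw [sub_smul, ← hnd, add_sub_cancel_left]
    have e2 : m * n = (γ * d - s) • n := by
      rw [hms, add_mul, Matrix.smul_mul, one_mul] at hdn
      rw [sub_smul, ← hdn, add_sub_cancel_left]
    have e3 : ((d - s) * (d - s)) • n = 0 := by
      have : n * m * m = 0 := by rw [Matrix.mul_assoc, hmm, Matrix.mul_zero]
      rwa [e1, Matrix.smul_mul, e1, smul_smul] at this
    have e4 : ((γ * d - s) * (γ * d - s)) • n = 0 := by
      have : m * (m * n) = 0 := by rw [← Matrix.mul_assoc, hmm, Matrix.zero_mul]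
      rwa [e2, Matrix.mul_smul, e2, smul_smul] at this
    have e5 := mul_self_eq_zero.1 ((smul_eq_zero.1 e3).resolve_right hn0)
    have e6 := mul_self_eq_zero.1 ((smul_eq_zero.1 e4).resolve_right hn0)
    apply hγ1
    have : d * (γ - 1) = 0 := by linear_combination e6 - e5
    linear_combination (mul_eq_zero.1 this).resolve_left hd0
  · have hform : ∀ x : H, Commute x h → ∃ a b : F, toMat x = a • 1 + b • toMat (h : H) ∧
        toMat x * n = (a + b * (γ * d)) • n ∧ n * toMat x = (a + b * d) • n := by
      intro x hx
      obtain ⟨a, b, hab⟩ := exists_of_commute_two (y := toMat (h : H)) (fun s hs => hhZ ⟨s, hs⟩)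
        (commute_iff_toMat.1 hx)
      refine ⟨a, b, hab, ?_, ?_⟩
      · rw [hab, add_mul, Matrix.smul_mul, one_mul, Matrix.smul_mul, hdn, smul_smul, add_smul]
      · rw [hab, mul_add, Matrix.mul_smul, mul_one, Matrix.mul_smul, hnd, smul_smul, add_smul]
    have hle : Subgroup.centralizer {(h : H)} ≤
        Subgroup.normalizer (Subgroup.centralizer {y} : Set H) := by
      intro x hx
      obtain ⟨a, b, -, h3, h4⟩ := hform x (mem_centralizer_singleton.1 hx)
      have h5 : a + b * d ≠ 0 := by
        intro h5
        rw [h5, zero_smul] at h4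
        exact mul_toMat_ne_zero hn0 x h4
      refine (mem_normalizer_centralizer h2 hy).2 ⟨(a + b * (γ * d)) / (a + b * d), ?_⟩
      rw [← hndef, h3, h4, smul_smul, div_mul_cancel₀ _ h5]
    -- An element `a + b h` acts trivially on the axis only if `b = 0`, so the kernel consists of
    -- the scalars. The range is not diminished, because `h` itself attains a generator.
    set f' := f.comp (Subgroup.inclusion hle) with hf'
    have hker : f'.ker = (scalarsOf H).subgroupOf (Subgroup.centralizer {(h : H)}) := by
      ext x
      rw [MonoidHom.mem_ker, Subgroup.mem_subgroupOf]
      have h6 := hf (Subgroup.inclusion hle x)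
      rw [Subgroup.coe_inclusion] at h6
      constructor
      · intro h1
        obtain ⟨a, b, hab, h3, h4⟩ := hform x (mem_centralizer_singleton.1 x.2)
        have h1' : f (Subgroup.inclusion hle x) = 1 := h1
        rw [h1', Units.val_one, one_smul, h3, h4, ← sub_eq_zero, ← sub_smul] at h6
        have h7 := (smul_eq_zero.1 h6).resolve_right hn0
        have h8 : b * (d * (γ - 1)) = 0 := by linear_combination h7
        have h9 := (mul_eq_zero.1 h8).resolve_right (mul_ne_zero hd0 (sub_ne_zero.2 hγ1))
        exact ⟨a, by change toMat (x : H) = _; rw [hab, h9, zero_smul, add_zero]⟩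
      · rintro ⟨s, hs⟩
        change toMat (x : H) = _ at hs
        rw [hs, Matrix.smul_mul, one_mul, Matrix.mul_smul, mul_one, smul_smul, ← sub_eq_zero,
          ← sub_smul] at h6
        have h7 := (smul_eq_zero.1 h6).resolve_right hn0
        have hs0 : s ≠ 0 := by
          rintro rfl
          have := mul_toMat_ne_zero hn0 (x : H)
          rw [hs, zero_smul, mul_zero] at this
          exact this rfl
        have h8 : s * ((f (Subgroup.inclusion hle x) : F) - 1) = 0 := by linear_combination -h7
        exact Units.ext (by
          have := (mul_eq_zero.1 h8).resolve_left hs0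
          change (f (Subgroup.inclusion hle x) : F) = 1
          linear_combination this)
    have hrange : f'.range = f.range := by
      apply le_antisymm
      · rintro _ ⟨x, rfl⟩
        exact ⟨_, rfl⟩
      · rintro _ ⟨x, rfl⟩
        have hh : f h ∈ f'.range :=
          ⟨⟨h, mem_centralizer_singleton.2 (Commute.refl _)⟩, rfl⟩
        exact (Subgroup.zpowers_le.2 hh) (hgen x)
    have hleZ : scalarsOf H ≤ Subgroup.centralizer {(h : H)} := fun z hz =>
      mem_centralizer_singleton.2 ((commTransitive_scalarsOf H).central z hz _)
    rw [← Nat.card_congr (Subgroup.subgroupOfEquivOfLe hleZ).toEquiv, ← hker, ← hrange,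
      ← Subgroup.index_ker, mul_comm, Subgroup.card_mul_index]

end Unipotents

/-! ### A large torus and one unipotent element yield full root subgroups -/

section Unipotents

variable {F : Type*} [Field F]

local notation "M₂" => Matrix (Fin 2) (Fin 2) F

variable {H : Subgroup (GL (Fin 2) F)}

/-- A subgroup of `GL₂` containing the scalars and having a large torus that is inverted in, but
not normalized by, the group contains two opposite full root subgroups as soon as it
contains a noncentral element with nilpotent traceless part. -/
theorem exists_full_root_of_nilpotent [Finite F] (h2 : (2 : F) ≠ 0) (hq : 11 ≤ Nat.card F)
    (hs : ∀ s : Fˣ, Units.map (algebraMap F M₂).toMonoidHom s ∈ H) {g₀ y : H}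
    (hg₀ : g₀ ∉ scalarsOf H) (hd₀ : (tracelessPart (toMat g₀)).det ≠ 0)
    (h6 : 6 * Nat.card (scalarsOf H) ≤ Nat.card (Subgroup.centralizer {g₀}))
    (hsq : (Nat.card F - 1) * (Nat.card F - 1) ≤ 2 * Nat.card (Subgroup.centralizer {g₀}))
    (hN₀ : Nat.card (Subgroup.normalizer (Subgroup.centralizer {g₀} : Set H)) =
        2 * Nat.card (Subgroup.centralizer {g₀}))
    (hy : y ∉ scalarsOf H) (hd : (tracelessPart (toMat y)).det = 0) (t : F) :
    ∃ x : H, toMat x = 1 + t • tracelessPart (toMat y) := by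
  classical
  have hZ := commTransitive_scalarsOf H
  have hn := trace_tracelessPart h2 (toMat y)
  have hn0 : tracelessPart (toMat y) ≠ 0 := fun h => hy ((mem_scalarsOf_iff h2).2 h)
  obtain ⟨f, hf, hcard⟩ := exists_axisChar h2 hy
  have hys := eq_add_tracelessPart (toMat y)
  set n := tracelessPart (toMat y) with hndef
  set s := (toMat y).trace / 2 with hsdef
  have hnn : n * n = 0 := by rw [traceless_mul_self hn, hd, neg_zero, zero_smul]
  have hs0 : s ≠ 0 := by
    intro h0
    rw [h0, zero_smul, zero_add] at hys
    have := mul_toMat_ne_zero hn0 y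
    rw [hys, hnn] at this
    exact this rfl
  -- If the scalars had index 2 in the centralizer, `y * y` would be scalar; but its traceless part
  -- is `(2 s) n`.
  have h3 : 3 * Nat.card (scalarsOf H) ≤ Nat.card (Subgroup.centralizer {y}) := by
    refine hZ.three_mul_card_le hy fun h => ?_
    have hle : scalarsOf H ≤ Subgroup.centralizer {y} := fun z hz =>
      mem_centralizer_singleton.2 (hZ.central z hz y)
    have hidx : ((scalarsOf H).subgroupOf (Subgroup.centralizer {y})).index = 2 := by
      have h1 := Subgroup.card_mul_index ((scalarsOf H).subgroupOf (Subgroup.centralizer {y}))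
      rw [Nat.card_congr (Subgroup.subgroupOfEquivOfLe hle).toEquiv, h, mul_comm 2] at h1
      exact Nat.eq_of_mul_eq_mul_left Nat.card_pos h1
    have hyy := Subgroup.mul_self_mem_of_index_two hidx
      ⟨y, mem_centralizer_singleton.2 (Commute.refl y)⟩
    rw [Subgroup.mem_subgroupOf] at hyy
    have hyy' := (mem_scalarsOf_iff h2).1 hyy
    have hmul : toMat (y * y) = (s * s) • 1 + (2 * s) • n := by
      rw [toMat_mul, hys]
      simp only [mul_add, add_mul, Matrix.smul_mul, Matrix.mul_smul, one_mul, mul_one, smul_smul,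
        hnn, add_zero, two_mul, add_smul]
      abel
    change tracelessPart (toMat (y * y)) = 0 at hyy'
    rw [hmul, tracelessPart_add_smul h2 hn] at hyy'
    exact (mul_ne_zero h2 hs0) ((smul_eq_zero.1 hyy').resolve_right hn0)
  have hy₀ : y ∉ commClass (scalarsOf H) g₀ := fun h =>
    hd₀ (det_tracelessPart_of_mem_commClass h2 hy hd (CommTransitive.mem_commClass_symm hg₀ h))
  have hlt := hZ.card_centralizer_lt hg₀ h6 hN₀ hy hy₀ h3 hcard (by
    obtain ⟨⟨_, h, rfl⟩, hgen⟩ := IsCyclic.exists_generator (α := f.range)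
    by_cases h1 : f h = 1
    · left
      rw [Nat.card_eq_one_iff_unique]
      refine ⟨⟨fun a b => ?_⟩, ⟨1⟩⟩
      have h4 : ∀ a : f.range, a = 1 := by
        intro a
        obtain ⟨k, hk⟩ := Subgroup.mem_zpowers_iff.1 (hgen a)
        rw [← hk]
        have : (⟨f h, ⟨h, rfl⟩⟩ : f.range) = 1 := Subtype.ext h1
        rw [this, one_zpow]
      rw [h4 a, h4 b]
    · right
      obtain ⟨k1, k2, k3⟩ := card_centralizer_of_nilpotent h2 hy hd f hf h h1 (fun x => by
        obtain ⟨k, hk⟩ := Subgroup.mem_zpowers_iff.1 (hgen ⟨f x, ⟨x, rfl⟩⟩)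
        refine Subgroup.mem_zpowers_iff.2 ⟨k, ?_⟩
        have := congrArg Subtype.val hk
        simpa using this)
      exact ⟨h, k1, fun hc => k2 (det_tracelessPart_of_mem_commClass h2 hy hd hc), k3,
        card_normalizer_of_det_ne_zero h2 k1 k2⟩)
  have hz := card_scalarsOf hs
  -- Compares `(q - 1)² ≤ 2 |C(g₀)|` with `|C(g₀)| < 3 k (q - 1)`, where `k` is the number of
  -- multipliers on the axis of `y`.
  have hk6 : Nat.card F - 1 < 6 * Nat.card f.range := by
    rw [hz] at hlt
    have : (Nat.card F - 1) * (Nat.card F - 1) < (6 * Nat.card f.range) * (Nat.card F - 1) := by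
      nlinarith
    exact lt_of_mul_lt_mul_right this (Nat.zero_le _)
  -- `A` parametrizes the root subgroup of `n` inside `H`, and `R` is its ring of multipliers. The
  -- normalizer scales the parameter by the values of `f`, so `R` contains these and 0, hence more
  -- than `k` elements, and is all of `F`. As `A` contains `s⁻¹`, coming from `y` divided by its
  -- eigenvalue, it is also all of `F`.
  let A : AddSubgroup F :=
    { carrier := {t | ∃ x : H, toMat x = 1 + t • n}
      add_mem' := by
        rintro a b ⟨x, hx⟩ ⟨x', hx'⟩
        refine ⟨x * x', ?_⟩
        rw [toMat_mul, hx, hx']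
        simp only [mul_add, add_mul, Matrix.smul_mul, Matrix.mul_smul, one_mul, mul_one, hnn,
          smul_zero, add_zero, add_smul]
        abel
      zero_mem' := ⟨1, by rw [toMat_one, zero_smul, add_zero]⟩
      neg_mem' := by
        rintro a ⟨x, hx⟩
        refine ⟨x⁻¹, ?_⟩
        have h1 := toMat_inv_mul x
        rw [hx] at h1
        have h4 : (1 + a • n) * (1 + (-a) • n) = 1 := by
          simp only [mul_add, add_mul, Matrix.smul_mul, Matrix.mul_smul, one_mul, mul_one, hnn,
            smul_zero, add_zero]
          rw [neg_smul]
          abel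
        calc toMat x⁻¹ = toMat x⁻¹ * ((1 + a • n) * (1 + (-a) • n)) := by rw [h4, mul_one]
          _ = 1 + (-a) • n := by rw [← Matrix.mul_assoc, h1, one_mul] }
  let R : Subring F :=
    { carrier := {r | ∀ t ∈ A, r * t ∈ A}
      mul_mem' := by
        intro a b ha hb t ht
        rw [mul_assoc]
        exact ha _ (hb _ ht)
      one_mem' := by
        intro t ht
        rwa [one_mul]
      add_mem' := by
        intro a b ha hb t ht
        rw [add_mul]
        exact A.add_mem (ha t ht) (hb t ht)
      zero_mem' := by
        intro t _
        rw [zero_mul]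
        exact A.zero_mem
      neg_mem' := by
        intro a ha t ht
        rw [neg_mul]
        exact A.neg_mem (ha t ht) }
  have hfR : ∀ x, ((f x : Fˣ) : F) ∈ R := by
    rintro x a ⟨w, hw⟩
    refine ⟨x * w * (x : H)⁻¹, ?_⟩
    rw [toMat_mul, toMat_mul, hw, mul_add, Matrix.mul_smul, hf x, add_mul, mul_one, toMat_mul_inv,
      Matrix.smul_mul, Matrix.smul_mul, Matrix.mul_assoc, toMat_mul_inv, mul_one, smul_smul,
      mul_comm]
  have hR : R = ⊤ := by
    refine subring_eq_top_of_card h2 hq R ?_ hk6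
    rw [← Finite.card_option]
    refine Nat.card_le_card_of_injective (fun o : Option f.range => o.elim (⟨0, R.zero_mem⟩ : R)
      (fun u => ⟨((u : Fˣ) : F), ?_⟩)) ?_
    · obtain ⟨_, x, rfl⟩ := u
      exact hfR x
    · rintro (_ | u) (_ | v) huv
      · rfl
      · exact absurd (congrArg Subtype.val huv).symm (v : Fˣ).ne_zero
      · exact absurd (congrArg Subtype.val huv) (u : Fˣ).ne_zero
      · have h1 : ((u : Fˣ) : F) = ((v : Fˣ) : F) := congrArg Subtype.val huv
        rw [Subtype.ext (Units.ext h1)]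
  have hsA : s⁻¹ ∈ A := by
    refine ⟨⟨_, hs (Units.mk0 s⁻¹ (inv_ne_zero hs0))⟩ * y, ?_⟩
    rw [toMat_mul, hys]
    change algebraMap F M₂ s⁻¹ * _ = _
    rw [Algebra.algebraMap_eq_smul_one, Matrix.smul_mul, one_mul, smul_add, smul_smul,
      inv_mul_cancel₀ hs0, one_smul]
  have htR : t * s ∈ R := by
    rw [hR]
    trivial
  have := htR _ hsA
  rwa [mul_assoc, mul_inv_cancel₀ hs0, mul_one] at this

/-- `n₀` is the axis of a large torus, inverted by `j` and not normalized by all of `H`. The class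
equation forbids that every nonscalar element be semisimple, so some `y` has a nilpotent traceless
part and supplies one full root subgroup. The other is a conjugate of it by an element moving the
axis of `y`; two nonproportional nilpotents have a product of nonzero trace. -/
theorem exists_two_full_roots [Finite F] (h2 : (2 : F) ≠ 0) (hq : 11 ≤ Nat.card F)
    (hs : ∀ s : Fˣ, Units.map (algebraMap F M₂).toMonoidHom s ∈ H) {n₀ : M₂}
    (ht₀ : n₀.trace = 0) (hd₀ : n₀.det ≠ 0)
    (h6 : 6 * (Nat.card F - 1) ≤ Nat.card {x : H // toMat x * n₀ = n₀ * toMat x})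
    (hsq : (Nat.card F - 1) * (Nat.card F - 1) ≤
      2 * Nat.card {x : H // toMat x * n₀ = n₀ * toMat x})
    {j : H} (hj : toMat j * n₀ = -(n₀ * toMat j))
    (hnn : ∃ x : H, ¬ ∃ b : F, toMat x * n₀ = b • (n₀ * toMat x)) :
    ∃ n m : M₂, n.trace = 0 ∧ n.det = 0 ∧ m.trace = 0 ∧ m.det = 0 ∧ (n * m).trace ≠ 0 ∧
      (∀ t : F, ∃ x : H, toMat x = 1 + t • n) ∧ ∀ t : F, ∃ x : H, toMat x = 1 + t • m := by
  classical
  have hZ := commTransitive_scalarsOf H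
  have hz := card_scalarsOf hs
  have hn₀ : ∀ s : F, n₀ ≠ s • 1 := by
    rintro s rfl
    rw [Matrix.trace_smul, Matrix.trace_one, Fintype.card_fin, smul_eq_mul, Nat.cast_ofNat] at ht₀
    rw [(mul_eq_zero.1 ht₀).resolve_right h2, zero_smul] at hd₀
    simp at hd₀
  have hn₀0 : n₀ ≠ 0 := fun h => hn₀ 0 (by rw [h, zero_smul])
  obtain ⟨g₀, hcomm, hg₀⟩ : ∃ g₀ : H, toMat g₀ * n₀ = n₀ * toMat g₀ ∧ g₀ ∉ scalarsOf H := by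
    by_contra! h
    have := Nat.card_le_card_of_injective
      (fun x : {x : H // toMat x * n₀ = n₀ * toMat x} => (⟨x, h x x.2⟩ : scalarsOf H))
      (fun a b hab => Subtype.ext (congrArg (fun z : scalarsOf H => (z : H)) hab))
    omega
  obtain ⟨a₀, b₀, hab₀⟩ := exists_of_commute_two hn₀ hcomm
  have htf : tracelessPart (toMat g₀) = b₀ • n₀ := by rw [hab₀, tracelessPart_add_smul h2 ht₀]
  have hb₀ : b₀ ≠ 0 := by
    rintro rfl
    rw [zero_smul] at htf
    exact hg₀ ((mem_scalarsOf_iff h2).2 htf)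
  have hdg : (tracelessPart (toMat g₀)).det ≠ 0 := by
    rw [htf, Matrix.det_smul]
    exact mul_ne_zero (pow_ne_zero _ hb₀) hd₀
  have hC : ∀ x : H, Commute x g₀ ↔ toMat x * n₀ = n₀ * toMat x := by
    intro x
    rw [commute_iff_toMat, ← commute_tracelessPart, htf, Matrix.mul_smul, Matrix.smul_mul]
    exact ⟨fun h => smul_right_injective _ hb₀ h, fun h => by rw [h]⟩
  have hcard : Nat.card {x : H // toMat x * n₀ = n₀ * toMat x} =
      Nat.card (Subgroup.centralizer {g₀}) := by
    refine Nat.card_congr (Equiv.subtypeEquivRight fun x => ?_)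
    rw [mem_centralizer_singleton, hC]
  rw [hcard] at h6 hsq
  rw [← hz] at h6
  have hN : ∀ x : H, x ∈ Subgroup.normalizer (Subgroup.centralizer {g₀} : Set H) ↔
      ∃ b : F, toMat x * n₀ = b • (n₀ * toMat x) := by
    intro x
    rw [mem_normalizer_centralizer h2 hg₀, htf]
    refine exists_congr fun b => ?_
    rw [Matrix.mul_smul, Matrix.smul_mul, smul_comm b b₀]
    exact ⟨fun h => smul_right_injective _ hb₀ h, fun h => by rw [h]⟩
  have hN₀ : Nat.card (Subgroup.normalizer (Subgroup.centralizer {g₀} : Set H)) =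
      2 * Nat.card (Subgroup.centralizer {g₀}) := by
    refine (card_normalizer_of_det_ne_zero h2 hg₀ hdg).resolve_left fun h => ?_
    have heq := Subgroup.eq_of_le_of_card_ge (Subgroup.le_normalizer
      (H := Subgroup.centralizer {g₀})) h.le
    have hjN : j ∈ Subgroup.normalizer (Subgroup.centralizer {g₀} : Set H) :=
      (hN j).2 ⟨-1, by rw [hj, neg_one_smul]⟩
    rw [← heq, mem_centralizer_singleton, hC, hj] at hjN
    have h4 : (2 : F) • (n₀ * toMat j) = 0 := by
      rw [two_smul]
      nth_rewrite 1 [← hjN]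
      exact neg_add_cancel _
    exact mul_toMat_ne_zero hn₀0 j ((smul_eq_zero.1 h4).resolve_left h2)
  have hNtop : Subgroup.normalizer (Subgroup.centralizer {g₀} : Set H) ≠ ⊤ := by
    intro h
    obtain ⟨x, hx⟩ := hnn
    exact hx ((hN x).1 (h ▸ Subgroup.mem_top x))
  obtain ⟨y, hy, hd⟩ : ∃ y : H, y ∉ scalarsOf H ∧ (tracelessPart (toMat y)).det = 0 := by
    by_contra! h
    exact hZ.false_of_normalizer_le (fun g hg => card_normalizer_of_det_ne_zero h2 hg (h g hg))
      hg₀ h6 hN₀ hNtop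
  have hroot := exists_full_root_of_nilpotent h2 hq hs hg₀ hdg h6 hsq hN₀ hy hd
  have hn := trace_tracelessPart h2 (toMat y)
  have hn0 : tracelessPart (toMat y) ≠ 0 := fun h => hy ((mem_scalarsOf_iff h2).2 h)
  have hnd := hd
  have hy₀ : ¬ Commute y g₀ := fun h => hdg (det_tracelessPart_of_mem_commClass h2 hy hd
    ⟨hg₀, 1, by simpa using h.symm⟩)
  have hyC : ∀ x : H, toMat x * tracelessPart (toMat y) = tracelessPart (toMat y) * toMat x →
      Commute x y := fun x hx => commute_iff_toMat.2 (commute_tracelessPart.1 hx)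
  set n := tracelessPart (toMat y) with hndef
  -- some element moves the axis of `y`
  obtain ⟨x, hx⟩ : ∃ x : H, ¬ ∃ b : F, toMat x * n = b • (n * toMat x) := by
    by_contra! hall
    -- If all of `H` preserved the axis of `y`, every commutator would centralize `y`. Choose `w = a
    -- + b n₀` in the torus, nonscalar and of nonzero trace; this is possible because otherwise the
    -- nonscalar elements of the torus would lie in one coset of the scalars. The commutator of `j`
    -- and `w` then commutes with both `g₀` and `y`, hence is scalar, although conjugation by `j`
    -- turns `w` into `a - b n₀`.
    obtain ⟨w, hwC, hwZ, hwt⟩ : ∃ w : H, Commute w g₀ ∧ w ∉ scalarsOf H ∧ (toMat w).trace ≠ 0 := by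
      by_contra! hw
      have hmem : ∀ w : H, Commute w g₀ → w ∉ scalarsOf H → g₀⁻¹ * w ∈ scalarsOf H := by
        intro w hwC hwZ
        obtain ⟨a, b, hab⟩ := exists_of_commute_two hn₀ ((hC w).1 hwC)
        have ht := hw w hwC hwZ
        have ht₀' := hw g₀ (Commute.refl _) hg₀
        rw [hab, Matrix.trace_add, Matrix.trace_smul, Matrix.trace_smul, ht₀, Matrix.trace_one,
          Fintype.card_fin, smul_zero, add_zero, smul_eq_mul, Nat.cast_ofNat] at ht
        rw [hab₀, Matrix.trace_add, Matrix.trace_smul, Matrix.trace_smul, ht₀, Matrix.trace_one,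
          Fintype.card_fin, smul_zero, add_zero, smul_eq_mul, Nat.cast_ofNat] at ht₀'
        have ha := (mul_eq_zero.1 ht).resolve_right h2
        have ha₀ := (mul_eq_zero.1 ht₀').resolve_right h2
        refine ⟨b / b₀, ?_⟩
        change toMat (g₀⁻¹ * w) = _
        have : toMat w = (b / b₀) • toMat g₀ := by
          rw [hab, hab₀, ha, ha₀, zero_smul, zero_add, zero_add, smul_smul,
            div_mul_cancel₀ _ hb₀]
        rw [toMat_mul, this, Matrix.mul_smul, toMat_inv_mul]
      have hle : Nat.card (Subgroup.centralizer {g₀}) ≤ Nat.card (scalarsOf H × Bool) := by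
        refine Nat.card_le_card_of_injective (fun w : Subgroup.centralizer {g₀} =>
          if hwZ : (w : H) ∈ scalarsOf H then ((⟨w, hwZ⟩ : scalarsOf H), true)
          else ((⟨_, hmem w (mem_centralizer_singleton.1 w.2) hwZ⟩ : scalarsOf H), false)) ?_
        intro v w hvw
        by_cases hv : (v : H) ∈ scalarsOf H <;> by_cases hw' : (w : H) ∈ scalarsOf H
        · simp only [hv, hw', dif_pos] at hvw
          exact Subtype.ext (congrArg (fun z : scalarsOf H × Bool => (z.1 : H)) hvw)
        · simp [hv, hw'] at hvw
        · simp [hv, hw'] at hvw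
        · simp only [hv, hw', dif_neg, not_false_eq_true] at hvw
          exact Subtype.ext (mul_left_cancel
            (congrArg (fun z : scalarsOf H × Bool => (z.1 : H)) hvw))
      rw [Nat.card_prod, Nat.card_eq_fintype_card (α := Bool), Fintype.card_bool] at hle
      have : 0 < Nat.card (scalarsOf H) := Nat.card_pos
      omega
    obtain ⟨a, b, hab⟩ := exists_of_commute_two hn₀ ((hC w).1 hwC)
    have ha : a ≠ 0 := by
      rintro rfl
      rw [hab, zero_smul, zero_add, Matrix.trace_smul, ht₀, smul_zero] at hwt
      exact hwt rfl
    have hb : b ≠ 0 := by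
      rintro rfl
      rw [zero_smul, add_zero] at hab
      exact hwZ ⟨a, hab⟩
    -- the commutator of `j` and `w` is scalar
    have hjw : toMat (j * w * j⁻¹) = a • 1 + (-b) • n₀ := by
      rw [toMat_mul, toMat_mul, hab, mul_add, Matrix.mul_smul, mul_one, Matrix.mul_smul, hj,
        add_mul, Matrix.smul_mul, toMat_mul_inv, smul_neg, Matrix.neg_mul, Matrix.smul_mul,
        Matrix.mul_assoc, toMat_mul_inv, mul_one, neg_smul]
    have hjwC : Commute (j * w * j⁻¹) g₀ := by
      rw [hC, hjw]
      simp [add_mul, mul_add]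
    have huC : Commute (j * w * j⁻¹ * w⁻¹) g₀ := hjwC.mul_left hwC.inv_left
    have hnorm : ∀ x x' : H, Commute (x * x' * x⁻¹ * x'⁻¹) y := by
      intro x x'
      obtain ⟨b, hb⟩ := hall x
      obtain ⟨c, hc⟩ := hall x'
      apply hyC
      have hinv : ∀ (x : H) (b : F), toMat x * n = b • (n * toMat x) →
          n * toMat x⁻¹ = b • (toMat x⁻¹ * n) := by
        intro x b hb
        calc n * toMat x⁻¹ = toMat x⁻¹ * (toMat x * n) * toMat x⁻¹ := by
              rw [← Matrix.mul_assoc, toMat_inv_mul, one_mul]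
          _ = b • (toMat x⁻¹ * n) := by
              rw [hb, Matrix.mul_smul, Matrix.smul_mul, Matrix.mul_assoc, Matrix.mul_assoc,
                toMat_mul_inv, mul_one]
      have h1 := hinv x b hb
      have h3 := hinv x' c hc
      rw [toMat_mul, toMat_mul, toMat_mul]
      set X := toMat x
      set X' := toMat x'
      set Y := toMat x⁻¹
      set Y' := toMat x'⁻¹
      have hb0 : b ≠ 0 := by
        rintro rfl
        rw [zero_smul] at h1
        exact mul_toMat_ne_zero hn0 _ h1
      have hc0 : c ≠ 0 := by
        rintro rfl
        rw [zero_smul] at h3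
        exact mul_toMat_ne_zero hn0 _ h3
      have e1 : Y * n = b⁻¹ • (n * Y) := by rw [h1, smul_smul, inv_mul_cancel₀ hb0, one_smul]
      have e2 : Y' * n = c⁻¹ • (n * Y') := by rw [h3, smul_smul, inv_mul_cancel₀ hc0, one_smul]
      calc X * X' * Y * Y' * n = X * (X' * (Y * (Y' * n))) := by simp only [Matrix.mul_assoc]
        _ = c⁻¹ • X * (X' * (Y * n)) * Y' := by
            rw [e2]; simp only [Matrix.mul_smul, Matrix.smul_mul, Matrix.mul_assoc]
        _ = (c⁻¹ * b⁻¹) • (X * (X' * n)) * Y * Y' := by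
            rw [e1]; simp only [Matrix.mul_smul, Matrix.smul_mul, Matrix.mul_assoc, smul_smul]
            rw [mul_comm]
        _ = (c⁻¹ * b⁻¹ * c) • (X * n) * X' * Y * Y' := by
            rw [hc]; simp only [Matrix.mul_smul, Matrix.smul_mul, Matrix.mul_assoc, smul_smul]
        _ = n * (X * X' * Y * Y') := by
            rw [hb]
            simp only [Matrix.smul_mul, Matrix.mul_assoc, smul_smul]
            rw [show c⁻¹ * b⁻¹ * c * b = 1 by field_simp, one_smul]
    have huZ : j * w * j⁻¹ * w⁻¹ ∈ scalarsOf H := by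
      by_contra hu
      exact hy₀ (hZ.trans _ _ _ hu (hnorm j w).symm huC)
    obtain ⟨s, hs'⟩ := huZ
    change toMat (j * w * j⁻¹ * w⁻¹) = _ at hs'
    have h5 : a • 1 + (-b) • n₀ = s • (a • 1 + b • n₀) := by
      rw [← hjw, ← hab]
      have : j * w * j⁻¹ = (j * w * j⁻¹ * w⁻¹) * w := by group
      rw [this, toMat_mul, hs', Matrix.smul_mul, one_mul]
    have h6 := congrArg Matrix.trace h5
    simp only [Matrix.trace_add, Matrix.trace_smul, ht₀, Matrix.trace_one, Fintype.card_fin,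
      smul_eq_mul, mul_zero, add_zero, Nat.cast_ofNat] at h6
    have hs1 : s = 1 := by
      have : (a * 2) * (s - 1) = 0 := by linear_combination -h6
      linear_combination (mul_eq_zero.1 this).resolve_left (mul_ne_zero ha h2)
    rw [hs1, one_smul, add_right_inj, neg_smul] at h5
    have h7 : (2 * b) • n₀ = 0 := by
      rw [two_mul, add_smul]
      nth_rewrite 1 [← h5]
      exact neg_add_cancel _
    exact hn₀0 ((smul_eq_zero.1 h7).resolve_left (mul_ne_zero h2 hb))
  refine ⟨n, toMat x * n * toMat x⁻¹, hn, hnd, ?_, ?_, ?_, hroot, ?_⟩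
  · rw [Matrix.mul_assoc, Matrix.trace_mul_comm, Matrix.mul_assoc, toMat_inv_mul, mul_one, hn]
  · rw [Matrix.det_mul, Matrix.det_mul, hnd, mul_zero, zero_mul]
  · intro h0
    obtain ⟨b, hb⟩ := exists_smul_of_trace_mul_eq_zero hn
      (by rw [Matrix.mul_assoc, Matrix.trace_mul_comm, Matrix.mul_assoc, toMat_inv_mul, mul_one, hn])
      hn0 hnd (by rw [Matrix.det_mul, Matrix.det_mul, hnd, mul_zero, zero_mul]) h0
    refine hx ⟨b, ?_⟩
    rw [← Matrix.smul_mul, ← hb, Matrix.mul_assoc, toMat_inv_mul, mul_one]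
  · intro t
    obtain ⟨v, hv⟩ := hroot t
    refine ⟨x * v * x⁻¹, ?_⟩
    rw [toMat_mul, toMat_mul, hv, mul_add, add_mul, mul_one, toMat_mul_inv, Matrix.mul_smul,
      Matrix.smul_mul]

end Unipotents

/-! ### The polynomial X² - τX + 1 and its torus -/

section QuadPoly

open Polynomial

variable {F : Type*} [Field F]

/-- The characteristic polynomial of a `2 × 2` matrix of determinant `1` and trace `τ`. -/
noncomputable def quadPoly (τ : F) : F[X] := X ^ 2 - C τ * X + 1

theorem quadPoly_monic (τ : F) : (quadPoly τ).Monic := by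
  rw [quadPoly]
  monicity!

theorem quadPoly_degree (τ : F) : (quadPoly τ).natDegree = 2 := by
  rw [quadPoly]
  compute_degree!

/-- Reduction modulo `quadPoly τ`. -/
theorem exists_mod_quadPoly (τ : F) (p : F[X]) :
    ∃ (r s : F) (m : F[X]), p = (C r + C s * X) + quadPoly τ * m := by
  have hd : (p %ₘ quadPoly τ).natDegree < 2 := by
    have := natDegree_modByMonic_lt p (quadPoly_monic τ) (by
      intro h
      have := quadPoly_degree τ
      rw [h, natDegree_one] at this
      omega)
    rwa [quadPoly_degree] at this
  obtain ⟨s, r, h⟩ := exists_eq_X_add_C_of_natDegree_le_one (Nat.lt_succ_iff.1 hd)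
  refine ⟨r, s, p /ₘ quadPoly τ, ?_⟩
  rw [add_comm (C r), ← h, modByMonic_add_div]

theorem quadPoly_dvd_iff {A : Type*} [Ring A] [Algebra F A] {τ : F} {x : A}
    (hx : aeval x (quadPoly τ) = 0)
    (hind : ∀ r s : F, algebraMap F A r + algebraMap F A s * x = 0 → r = 0 ∧ s = 0) (p : F[X]) :
    quadPoly τ ∣ p ↔ aeval x p = 0 := by
  constructor
  · rintro ⟨m, rfl⟩
    rw [map_mul, hx, zero_mul]
  · intro h
    obtain ⟨r, s, m, rfl⟩ := exists_mod_quadPoly τ p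
    rw [map_add, map_mul, hx, zero_mul, add_zero] at h
    simp only [map_add, aeval_C, map_mul, aeval_X] at h
    obtain ⟨rfl, rfl⟩ := hind r s h
    simp

theorem quadPoly_dvd_iff_roots {K : Type*} [Field K] [Algebra F K] {τ : F} {l : K}
    (hl : l * l = algebraMap F K τ * l - 1) (hτ : τ ^ 2 ≠ 4) (p : F[X]) :
    quadPoly τ ∣ p ↔ aeval l p = 0 ∧ aeval l⁻¹ p = 0 := by
  have hl0 : l ≠ 0 := by
    rintro rfl
    simp at hl
  have hinv : l⁻¹ = algebraMap F K τ - l :=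
    inv_eq_of_mul_eq_one_right (by linear_combination -hl)
  have hne : l⁻¹ ≠ l := by
    intro h
    apply hτ
    apply (algebraMap F K).injective
    rw [hinv] at h
    have h1 : l * l = 1 := by linear_combination -hl - l * h
    rw [map_pow, show (4 : F) = ((4 : ℕ) : F) by norm_num, map_natCast]
    push_cast
    linear_combination (algebraMap F K τ + 2 * l) * h + 4 * h1
  have hx : ∀ x : K, x = l ∨ x = l⁻¹ → aeval x (quadPoly τ) = 0 := by
    rintro x (rfl | rfl) <;> simp only [quadPoly, map_add, map_sub, map_mul, map_pow, aeval_X,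
      aeval_C, map_one]
    · linear_combination hl
    · rw [hinv]
      linear_combination hl
  constructor
  · rintro ⟨m, rfl⟩
    rw [map_mul, map_mul, hx l (Or.inl rfl), hx _ (Or.inr rfl), zero_mul, zero_mul]
    exact ⟨rfl, rfl⟩
  · rintro ⟨h1, h2⟩
    obtain ⟨r, s, m, rfl⟩ := exists_mod_quadPoly τ p
    rw [map_add, map_mul, hx l (Or.inl rfl), zero_mul, add_zero] at h1
    rw [map_add, map_mul, hx _ (Or.inr rfl), zero_mul, add_zero] at h2
    simp only [map_add, aeval_C, map_mul, aeval_X] at h1 h2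
    have h3 : algebraMap F K s * (l⁻¹ - l) = 0 := by linear_combination h2 - h1
    have hs : s = 0 := by
      apply (algebraMap F K).injective
      rw [map_zero]
      exact (mul_eq_zero.1 h3).resolve_right (sub_ne_zero.2 hne)
    subst hs
    have hr : r = 0 := by
      apply (algebraMap F K).injective
      rw [map_zero]
      simpa using h1
    subst hr
    simp

/-- In the torus `F[h]`, the square of an element of norm one is a power of an element `h` of
order `(q ± 1) / 2` or `q ± 1`. -/
theorem exists_pow_of_norm_one [Finite F] {τ : F} (hτ : τ ^ 2 ≠ 4) {c : ℕ} (hc0 : 0 < c)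
    (hc : ∀ n, quadPoly τ ∣ X ^ n - 1 ↔ c ∣ n)
    (hcq : (c ∣ Nat.card F - 1 ∧ Nat.card F - 1 ∣ 2 * c) ∨
      (c ∣ Nat.card F + 1 ∧ Nat.card F + 1 ∣ 2 * c)) {a b : F}
    (hN : a ^ 2 + a * b * τ + b ^ 2 = 1) :
    ∃ k : ℕ, quadPoly τ ∣ (C a + C b * X) ^ 2 - X ^ k := by
  let K := AlgebraicClosure F
  obtain ⟨l, hl⟩ : ∃ l : K, l * l = algebraMap F K τ * l - 1 := by
    obtain ⟨l, hl⟩ := IsAlgClosed.exists_aeval_eq_zero K (quadPoly τ) (by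
      rw [degree_eq_natDegree (quadPoly_monic τ).ne_zero, quadPoly_degree]
      norm_num)
    refine ⟨l, ?_⟩
    simp only [quadPoly, map_add, map_sub, map_mul, map_pow, aeval_X, aeval_C, map_one] at hl
    linear_combination hl
  have hl0 : l ≠ 0 := by
    rintro rfl
    simp at hl
  have hinv : l⁻¹ = algebraMap F K τ - l :=
    inv_eq_of_mul_eq_one_right (by linear_combination -hl)
  have hdvd := fun p => quadPoly_dvd_iff_roots hl hτ (p := p)
  have hprim : IsPrimitiveRoot l c := by
    constructor
    · have := ((hdvd _).1 ((hc c).2 dvd_rfl)).1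
      simpa [sub_eq_zero] using this
    · intro n hn
      refine (hc n).1 ((hdvd _).2 ⟨by simp [hn], by simp [hn]⟩)
  have hNK : (algebraMap F K a + algebraMap F K b * l) *
      (algebraMap F K a + algebraMap F K b * l⁻¹) = 1 := by
    have := congrArg (algebraMap F K) hN
    simp only [map_add, map_mul, map_pow, map_one] at this
    rw [hinv]
    linear_combination this - algebraMap F K b ^ 2 * hl
  set z := algebraMap F K a + algebraMap F K b * l with hz
  have hz0 : z ≠ 0 := left_ne_zero_of_mul_eq_one hNK
  have hfrob : ∀ x : F, algebraMap F K x ^ Nat.card F = algebraMap F K x := by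
    intro x
    have := Fintype.ofFinite F
    rw [← map_pow, Nat.card_eq_fintype_card, FiniteField.pow_card]
  have hzq : z ^ Nat.card F = algebraMap F K a + algebraMap F K b * l ^ Nat.card F := by
    have := Fintype.ofFinite F
    obtain ⟨p, hp⟩ := CharP.exists F
    have := hp
    obtain ⟨n, hprime, hcard⟩ := FiniteField.card F p
    have : Fact p.Prime := ⟨hprime⟩
    have : CharP K p := charP_of_injective_algebraMap (algebraMap F K).injective p
    have h1 := hfrob a
    have h2 := hfrob b
    rw [Nat.card_eq_fintype_card, hcard] at h1 h2 ⊢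
    rw [hz, add_pow_char_pow, mul_pow, h1, h2]
  -- In the first case Frobenius fixes `l` and therefore `z`. In the second it inverts `l` and sends
  -- `z` to its conjugate, which is `z⁻¹` because the norm is one. So `z` to the power `q - 1`,
  -- respectively `q + 1`, is 1, and that exponent divides `2 c`. Hence `z²` is a power of the
  -- primitive root `l`.
  have hzc : z ^ (2 * c) = 1 := by
    rcases hcq with ⟨h1, h2⟩ | ⟨h1, h2⟩
    · have hlq : l ^ (Nat.card F - 1) = 1 := (hprim.pow_eq_one_iff_dvd _).2 h1
      have hcard : 0 < Nat.card F := Nat.card_pos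
      have hlq' : l ^ Nat.card F = l := by
        rw [show Nat.card F = Nat.card F - 1 + 1 by omega, pow_succ, hlq, one_mul]
      rw [hlq', ← hz] at hzq
      obtain ⟨m, hm⟩ := h2
      have : z ^ (Nat.card F - 1) = 1 := by
        apply mul_right_cancel₀ hz0
        rw [one_mul, ← pow_succ, show Nat.card F - 1 + 1 = Nat.card F by omega, hzq]
      rw [hm, pow_mul, this, one_pow]
    · have hlq : l ^ (Nat.card F + 1) = 1 := (hprim.pow_eq_one_iff_dvd _).2 h1
      have hlq' : l ^ Nat.card F = l⁻¹ := by
        exact eq_inv_of_mul_eq_one_left (by rw [← pow_succ, hlq])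
      rw [hlq'] at hzq
      obtain ⟨m, hm⟩ := h2
      have : z ^ (Nat.card F + 1) = 1 := by
        rw [pow_succ, hzq, mul_comm, hNK]
      rw [hm, pow_mul, this, one_pow]
  have : NeZero c := ⟨hc0.ne'⟩
  obtain ⟨k, -, hk⟩ := hprim.eq_pow_of_pow_eq_one (ξ := z ^ 2) (by rw [← pow_mul, hzc])
  refine ⟨k, (hdvd _).2 ⟨?_, ?_⟩⟩
  · simp only [map_sub, map_pow, map_add, map_mul, aeval_C, aeval_X]
    rw [← hz, hk, sub_self]
  · simp only [map_sub, map_pow, map_add, map_mul, aeval_C, aeval_X]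
    rw [eq_inv_of_mul_eq_one_right hNK, inv_pow, inv_pow, hk, sub_self]

theorem orderOf_eq_of_dvd {M : Type*} [Monoid M] {x : M} {τ : F} {c : ℕ}
    (hc : ∀ n, quadPoly τ ∣ X ^ n - 1 ↔ c ∣ n) (hx : ∀ n, x ^ n = 1 ↔ quadPoly τ ∣ X ^ n - 1) :
    orderOf x = c :=
  Nat.dvd_antisymm (orderOf_dvd_of_pow_eq_one ((hx c).2 ((hc c).2 dvd_rfl)))
    ((hc _).1 ((hx _).1 (pow_orderOf_eq_one x)))

/-- `h(a, b)` has determinant 1 and trace `1 / (a b) - 2` and is not scalar, so this is its minimal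
polynomial, even when the eigenvalues coincide. -/
theorem quadPoly_dvd_pow_sub_one_iff {a b : F} (ha : a ≠ 0) (hb : b ≠ 0) (n : ℕ) :
    quadPoly (1 / (a * b) - 2) ∣ X ^ n - 1 ↔ orderOf (hMatrix a b) ∣ n := by
  rw [quadPoly_dvd_iff (x := hMatrix a b), orderOf_dvd_iff_pow_eq_one]
  · simp [sub_eq_zero]
  · simp only [quadPoly, map_add, map_sub, map_mul, aeval_X, aeval_C, map_one,
      Algebra.algebraMap_eq_smul_one, hMatrix, pow_two]
    ext i j
    fin_cases i <;> fin_cases j <;> simp [Matrix.mul_apply, Fin.sum_univ_two] <;> field_simp <;>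
      ring
  · intro r s h
    have h1 := congrFun (congrFun h 0) 1
    have h2 := congrFun (congrFun h 0) 0
    simp [Algebra.algebraMap_eq_smul_one, hMatrix, hb] at h1 h2
    subst h1
    simpa using h2

end QuadPoly

/-! ### The product of two negative symmetries on a nondegenerate plane -/

section Plane

open Polynomial

variable {F V : Type*} [Field F] [AddCommGroup V] [Module F V]

theorem toLinearMap_pow_apply (g : V ≃ₗ[F] V) (n : ℕ) (x : V) :
    ((g : V →ₗ[F] V) ^ n) x = (g ^ n) x := by
  induction n with
  | zero => rfl
  | succ n ih => rw [pow_succ', pow_succ', Module.End.mul_apply, ih]; rfl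

variable {φ : QuadraticForm F V} {u v : V}

theorem rho_mul_rho_apply_left (hu : φ u ≠ 0) (huv : polar φ u v = 1) :
    (rho φ u * rho φ v) u = (1 / (φ u * φ v) - 1) • u - (1 / φ v) • v := by
  rw [LinearEquiv.mul_apply, rho_apply φ v, polar_comm, huv, map_sub, map_smul, rho_apply_self φ hu,
    rho_apply, huv]
  simp only [smul_sub, smul_smul, sub_smul, one_smul]
  rw [one_div_mul_one_div, mul_comm (φ v)]
  abel

theorem rho_mul_rho_apply_right (hv : φ v ≠ 0) (huv : polar φ u v = 1) :
    (rho φ u * rho φ v) v = (1 / φ u) • u - v := by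
  rw [LinearEquiv.mul_apply, rho_apply_self φ hv, rho_apply, huv]

theorem rho_mul_rho_apply_orthogonal {y : V} (h1 : polar φ u y = 0) (h2 : polar φ v y = 0) :
    (rho φ u * rho φ v) y = y := by
  rw [LinearEquiv.mul_apply, rho_apply φ v, h2, zero_div, zero_smul, zero_sub, map_neg, rho_apply,
    h1, zero_div, zero_smul, zero_sub, neg_neg]

theorem rho_mul_rho_apply_apply (hu : φ u ≠ 0) (hv : φ v ≠ 0) (huv : polar φ u v = 1) (a b : F) :
    (rho φ u * rho φ v) ((rho φ u * rho φ v) (a • u + b • v)) =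
      (1 / (φ u * φ v) - 2) • (rho φ u * rho φ v) (a • u + b • v) - (a • u + b • v) := by
  simp only [map_add, map_sub, map_smul, rho_mul_rho_apply_left hu huv,
    rho_mul_rho_apply_right hv huv]
  match_scalars <;> field_simp <;> ring

theorem exists_sub_orthogonal (hdet : 4 * (φ u * φ v) ≠ 1) (huv : polar φ u v = 1) (y : V) :
    ∃ a b : F, polar φ u (y - (a • u + b • v)) = 0 ∧ polar φ v (y - (a • u + b • v)) = 0 := by
  have hd : 4 * (φ u * φ v) - 1 ≠ 0 := sub_ne_zero.2 hdet
  have hi := inv_mul_cancel₀ hd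
  set D := 4 * (φ u * φ v) - 1 with hD
  refine ⟨D⁻¹ * (2 * φ v * polar φ u y - polar φ v y),
    D⁻¹ * (2 * φ u * polar φ v y - polar φ u y), ?_, ?_⟩
  · rw [polar_sub_right, polar_add_right, polar_smul_right, polar_smul_right, polar_self_eq, huv]
    simp only [smul_eq_mul]
    linear_combination (-polar φ u y) * hi + D⁻¹ * polar φ u y * hD
  · rw [polar_sub_right, polar_add_right, polar_smul_right, polar_smul_right, polar_self_eq,
      polar_comm φ v u, huv]
    simp only [smul_eq_mul]
    linear_combination (-polar φ v y) * hi + D⁻¹ * polar φ v y * hD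

theorem aeval_rho_mul_rho (hu : φ u ≠ 0) (hv : φ v ≠ 0) (huv : polar φ u v = 1) {p : F[X]}
    (hp : quadPoly (1 / (φ u * φ v) - 2) ∣ p) (a b : F) :
    aeval ((rho φ u * rho φ v : V ≃ₗ[F] V) : V →ₗ[F] V) p (a • u + b • v) = 0 := by
  obtain ⟨m, rfl⟩ := hp
  have h := rho_mul_rho_apply_apply hu hv huv a b
  rw [mul_comm, map_mul, Module.End.mul_apply]
  generalize 1 / (φ u * φ v) - 2 = τ at h ⊢
  generalize a • u + b • v = x at h ⊢
  have h0 : aeval ((rho φ u * rho φ v : V ≃ₗ[F] V) : V →ₗ[F] V) (quadPoly τ) x = 0 := by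
    simp only [quadPoly, map_add, map_sub, map_mul, aeval_X, aeval_C, map_one,
      LinearMap.add_apply, LinearMap.sub_apply, Module.End.mul_apply, Module.algebraMap_end_apply,
      Module.End.one_apply, pow_two, LinearEquiv.coe_coe]
    rw [h]
    abel
  rw [h0, map_zero]

theorem ind_of_det (hdet : 4 * (φ u * φ v) ≠ 1) (huv : polar φ u v = 1) {a b : F}
    (h : a • u + b • v = 0) : a = 0 ∧ b = 0 := by
  have hd : 4 * (φ u * φ v) - 1 ≠ 0 := sub_ne_zero.2 hdet
  have h1 : polar φ u (a • u + b • v) = 0 := by rw [h, polar_zero_right]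
  have h2 : polar φ v (a • u + b • v) = 0 := by rw [h, polar_zero_right]
  rw [polar_add_right, polar_smul_right, polar_smul_right, polar_self_eq] at h1 h2
  rw [polar_comm φ v u] at h2
  rw [huv, smul_eq_mul, smul_eq_mul] at h1 h2
  constructor
  · exact (mul_eq_zero.1 (show (4 * (φ u * φ v) - 1) * a = 0 by
      linear_combination 2 * φ v * h1 - h2)).resolve_left hd
  · exact (mul_eq_zero.1 (show (4 * (φ u * φ v) - 1) * b = 0 by
      linear_combination 2 * φ u * h2 - h1)).resolve_left hd

theorem pow_apply_orthogonal {y : V} (h1 : polar φ u y = 0) (h2 : polar φ v y = 0) (n : ℕ) :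
    ((rho φ u * rho φ v) ^ n) y = y := by
  induction n with
  | zero => rfl
  | succ n ih => rw [pow_succ, LinearEquiv.mul_apply, rho_mul_rho_apply_orthogonal h1 h2, ih]

/-- On the plane the product has minimal polynomial `quadPoly`; on the orthogonal complement the two
signs cancel and it is the identity. For a nondegenerate plane these two pieces make up the whole
space. -/
theorem rho_mul_rho_pow_eq_one_iff (hu : φ u ≠ 0) (hv : φ v ≠ 0) (huv : polar φ u v = 1)
    (hdet : 4 * (φ u * φ v) ≠ 1) (n : ℕ) :
    (rho φ u * rho φ v) ^ n = 1 ↔ quadPoly (1 / (φ u * φ v) - 2) ∣ X ^ n - 1 := by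
  constructor
  · intro h
    obtain ⟨r, s, m, hm⟩ := exists_mod_quadPoly (1 / (φ u * φ v) - 2) (X ^ n - 1)
    have h1 : aeval ((rho φ u * rho φ v : V ≃ₗ[F] V) : V →ₗ[F] V) (X ^ n - 1 : F[X]) u = 0 := by
      simp only [map_sub, map_pow, aeval_X, map_one, LinearMap.sub_apply, toLinearMap_pow_apply, h]
      exact sub_self _
    rw [hm, map_add, LinearMap.add_apply] at h1
    have h2 := aeval_rho_mul_rho hu hv huv (dvd_mul_right (quadPoly (1 / (φ u * φ v) - 2)) m) 1 0
    rw [one_smul, zero_smul, add_zero] at h2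
    rw [h2, add_zero] at h1
    simp only [map_add, map_mul, aeval_C, aeval_X, LinearMap.add_apply, Module.End.mul_apply,
      Module.algebraMap_end_apply, LinearEquiv.coe_coe, rho_mul_rho_apply_left hu huv] at h1
    have h3 : (r + s * (1 / (φ u * φ v) - 1)) • u + (-(s * (1 / φ v))) • v = 0 := by
      rw [← h1]
      module
    obtain ⟨h4, h5⟩ := ind_of_det hdet huv h3
    have hs : s = 0 := by
      have := neg_eq_zero.1 h5
      exact (mul_eq_zero.1 this).resolve_right (one_div_ne_zero hv)
    subst hs
    rw [zero_mul, add_zero] at h4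
    subst h4
    exact ⟨m, by rw [hm]; simp⟩
  · intro h
    ext y
    obtain ⟨a, b, h1, h2⟩ := exists_sub_orthogonal hdet huv y
    have h3 := aeval_rho_mul_rho hu hv huv h a b
    simp only [map_sub, map_pow, aeval_X, map_one, LinearMap.sub_apply, toLinearMap_pow_apply] at h3
    have h4 := pow_apply_orthogonal h1 h2 n
    rw [map_sub, sub_eq_zero.1 h3] at h4
    exact sub_left_injective h4

theorem orderOf_rho_mul_rho (hu : φ u ≠ 0) (hv : φ v ≠ 0) (huv : polar φ u v = 1)
    (hdet : 4 * (φ u * φ v) ≠ 1) :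
    orderOf (rho φ u * rho φ v) = orderOf (hMatrix (φ u) (φ v)) :=
  orderOf_eq_of_dvd (quadPoly_dvd_pow_sub_one_iff hu hv) (rho_mul_rho_pow_eq_one_iff hu hv huv hdet)

/-- If `4 a b = 1` the trace is 2 and `(X - 1)²` divides `X ^ n - 1`; the derivative at 1 then shows
that `n` vanishes in `F`. So an order prime to the characteristic makes the plane nondegenerate. -/
theorem mul_ne_one_of_orderOf {a b : F} (ha : a ≠ 0) (hb : b ≠ 0)
    (hn : (orderOf (hMatrix a b) : F) ≠ 0) : 4 * (a * b) ≠ 1 := by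
  intro h
  have hab : a * b ≠ 0 := mul_ne_zero ha hb
  have hτ : 1 / (a * b) - 2 = 2 := by
    rw [sub_eq_iff_eq_add, div_eq_iff hab]
    linear_combination -h
  obtain ⟨m, hm⟩ := (quadPoly_dvd_pow_sub_one_iff ha hb _).2 (dvd_refl (orderOf (hMatrix a b)))
  rw [hτ] at hm
  have := congrArg (fun p => eval 1 (derivative p)) hm
  simp [quadPoly, derivative_X_pow] at this
  apply hn
  rw [this]
  norm_num

theorem polar_rho_mul_rho (hu : φ u ≠ 0) (hv : φ v ≠ 0) (huv : polar φ u v = 1) (a b : F) :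
    polar φ (a • u + b • v) ((rho φ u * rho φ v) (a • u + b • v)) =
      (1 / (φ u * φ v) - 2) * φ (a • u + b • v) := by
  have hvu : polar φ v u = 1 := by rw [polar_comm, huv]
  rw [map_add, map_smul, map_smul, rho_mul_rho_apply_left hu huv, rho_mul_rho_apply_right hv huv]
  simp only [form_add, form_smul, polar_add_left, polar_smul_left, polar_add_right,
    polar_sub_right, polar_smul_right, polar_self_eq, huv, hvu, smul_eq_mul]
  field_simp
  ring

/-- If the torus generated by `rho u * rho v` is large, it contains the products of symmetries
with respect to vectors of the plane whose norms agree up to squares. -/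
theorem exists_rho_eq_pow_mul [Finite F] (hu0 : φ u ≠ 0) (hv0 : φ v ≠ 0) (huv : polar φ u v = 1)
    (hdet : 4 * (φ u * φ v) ≠ 1) {c : ℕ} (hc : orderOf (hMatrix (φ u) (φ v)) = c)
    (hc0 : 0 < c) (hcq : (c ∣ Nat.card F - 1 ∧ Nat.card F - 1 ∣ 2 * c) ∨
      (c ∣ Nat.card F + 1 ∧ Nat.card F + 1 ∣ 2 * c)) {a b d l s : F} {x y : V} (hs : s ≠ 0)
    (hxp : x = a • u + b • v) (hyp : y = d • u + l • v) (hy0 : φ y ≠ 0) (hx : φ x = s ^ 2 * φ y) :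
    ∃ k : ℕ, rho φ x = (rho φ u * rho φ v) ^ k * rho φ y := by
  have hab : φ u * φ v ≠ 0 := mul_ne_zero hu0 hv0
  set τ := 1 / (φ u * φ v) - 2 with hτdef
  have hτ : τ ^ 2 ≠ 4 := by
    intro h
    rw [hτdef, one_div] at h
    have h1 : (φ u * φ v)⁻¹ * ((φ u * φ v)⁻¹ - 4) = 0 := by linear_combination h
    have h2 := sub_eq_zero.1 ((mul_eq_zero.1 h1).resolve_left (inv_ne_zero hab))
    rw [← h2, inv_mul_cancel₀ hab] at hdet
    exact hdet rfl
  obtain ⟨h, hh⟩ : ∃ h, h = rho φ u * rho φ v := ⟨_, rfl⟩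
  have hho : h ∈ orthGroup φ := by
    rw [hh]
    exact (orthGroup φ).mul_mem (rho_mem_orthGroup φ u) (rho_mem_orthGroup φ v)
  have hhy : h y = (d * (τ + 1) + l / φ u) • u - (d / φ v + l) • v := by
    rw [hyp, map_add, map_smul, map_smul, hh, rho_mul_rho_apply_left hu0 huv,
      rho_mul_rho_apply_right hv0 huv, hτdef]
    match_scalars <;> field_simp <;> ring
  have hpol : polar φ y (h y) = τ * φ y := by
    rw [hyp, hh, polar_rho_mul_rho hu0 hv0 huv]
  have hφy : φ y = d ^ 2 * φ u + d * l + l ^ 2 * φ v := by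
    rw [hyp, form_add, form_smul, form_smul, polar_smul_left, polar_smul_right, huv]
    simp only [smul_eq_mul]
    ring
  -- the vectors `y` and `h y` span the plane
  have hdec : ∀ p r : F, ∃ p' r' : F, p • u + r • v = p' • y + r' • h y := by
    intro p r
    obtain ⟨i, hi⟩ : ∃ i : F, i * (d ^ 2 * φ u + d * l + l ^ 2 * φ v) = 1 :=
      ⟨(φ y)⁻¹, by rw [← hφy, inv_mul_cancel₀ hy0]⟩
    have hτ1 : φ u * φ v * (τ + 1) = 1 - φ u * φ v := by
      rw [hτdef]
      field_simp
      ring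
    refine ⟨φ u * φ v * i * (p * (d / φ v + l) + r * (d * (τ + 1) + l / φ u)),
      φ u * φ v * i * (p * l - r * d), ?_⟩
    have e1 : φ u * (l / φ u) = l := mul_div_cancel₀ _ hu0
    have e2 : φ v * (d / φ v) = d := mul_div_cancel₀ _ hv0
    rw [hhy, hyp]
    generalize l / φ u = A at e1 ⊢
    generalize d / φ v = B at e2 ⊢
    match_scalars
    · linear_combination -p * hi - i * p * φ u * d * e2 - i * p * l * φ v * e1 -
        i * p * l * d * hτ1
    · linear_combination -r * hi - i * r * d * φ u * e2 - i * r * l * φ v * e1 -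
        i * r * l * d * hτ1
  -- Up to the factor `s`, the vector `x` is `z y` with `z = a' + b' h`, and the equality of norms
  -- says that `z` has norm one. As `rho φ y` inverts the torus, conjugating it by `z` gives `z² *
  -- rho φ y`, and `z²` is a power of `h` by `exists_pow_of_norm_one`.
  obtain ⟨a', b', hx'⟩ : ∃ a' b' : F, x = s • (a' • y + b' • h y) := by
    obtain ⟨p, r, hpr⟩ := hdec a b
    refine ⟨p / s, r / s, ?_⟩
    rw [hxp, hpr, smul_add, smul_smul, smul_smul, mul_div_cancel₀ _ hs, mul_div_cancel₀ _ hs]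
  have hform : φ (a' • y + b' • h y) = (a' ^ 2 + a' * b' * τ + b' ^ 2) * φ y := by
    rw [form_add, form_smul, form_smul, polar_smul_left, polar_smul_right, hpol, hho y]
    simp only [smul_eq_mul]
    ring
  have hN : a' ^ 2 + a' * b' * τ + b' ^ 2 = 1 := by
    rw [hx', form_smul, hform] at hx
    have := mul_left_cancel₀ (pow_ne_zero 2 hs) hx
    exact mul_right_cancel₀ hy0 (by rw [this, one_mul])
  obtain ⟨k, hk⟩ := exists_pow_of_norm_one hτ hc0
    (fun n => by rw [hτdef, quadPoly_dvd_pow_sub_one_iff hu0 hv0, hc]) hcq hN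
  refine ⟨k, ?_⟩
  rw [hx', rho_smul hs, ← hh]
  have h2 : ∀ r t : F, h (h (r • u + t • v)) = τ • h (r • u + t • v) - (r • u + t • v) := by
    intro r t
    have := rho_mul_rho_apply_apply hu0 hv0 huv r t
    rwa [← hh, ← hτdef] at this
  have h2y : h (h y) = τ • h y - y := by rw [hyp, h2]
  have hkP : ∀ r t : F, (h ^ k) (r • u + t • v) =
      a' ^ 2 • (r • u + t • v) + (2 * a' * b') • h (r • u + t • v) +
        b' ^ 2 • h (h (r • u + t • v)) := by
    intro r t
    have h1 := aeval_rho_mul_rho hu0 hv0 huv hk r t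
    generalize r • u + t • v = x at h1 ⊢
    rw [← hh, map_sub, LinearMap.sub_apply, sub_eq_zero, map_pow (aeval _) X, aeval_X,
      toLinearMap_pow_apply] at h1
    rw [← h1, show (C a' + C b' * X : F[X]) ^ 2 =
      C (a' ^ 2) + C (2 * a' * b') * X + C (b' ^ 2) * X * X by
        simp only [map_mul, map_pow, map_ofNat]; ring]
    simp only [map_add, map_mul, aeval_C, aeval_X, LinearMap.add_apply, Module.End.mul_apply,
      Module.algebraMap_end_apply, LinearEquiv.coe_coe]
    simp only [smul_smul, mul_assoc]
  have hky : (h ^ k) y = a' ^ 2 • y + (2 * a' * b') • h y + b' ^ 2 • h (h y) := by rw [hyp, hkP]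
  have hkhy : (h ^ k) (h y) = a' ^ 2 • h y + (2 * a' * b') • h (h y) + b' ^ 2 • h (h (h y)) := by
    rw [← LinearEquiv.mul_apply, ← pow_succ, pow_succ', LinearEquiv.mul_apply, hky]
    simp only [map_add, map_smul]
  have hform' : φ (a' • y + b' • h y) = φ y := by rw [hform, hN, one_mul]
  have hval : ∀ z, rho φ (a' • y + b' • h y) z =
      ((a' * polar φ y z + b' * polar φ (h y) z) / φ y) • (a' • y + b' • h y) - z := by
    intro z
    rw [rho_apply, hform', polar_add_left, polar_smul_left, polar_smul_left, smul_eq_mul,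
      smul_eq_mul]
  have hself : polar φ (h y) (h y) = 2 * φ y := by rw [polar_self_eq, hho y]
  have hby : rho φ (a' • y + b' • h y) y = (h ^ k * rho φ y) y := by
    rw [hval, LinearEquiv.mul_apply, rho_apply_self φ hy0, hky, h2y, polar_comm φ (h y), hpol,
      polar_self_eq]
    match_scalars
    · field_simp
      linear_combination hN
    · field_simp
  have hbhy : rho φ (a' • y + b' • h y) (h y) = (h ^ k * rho φ y) (h y) := by
    have h5 : rho φ y (h y) = τ • y - h y := by
      rw [rho_apply, hpol, mul_div_assoc, div_self hy0, mul_one]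
    rw [hval, LinearEquiv.mul_apply, h5, map_sub, map_smul, hkhy, hky, h2y, map_sub, map_smul, h2y,
      hpol, hself]
    match_scalars
    · field_simp
      ring
    · field_simp
      linear_combination hN
  ext z
  obtain ⟨r, t, hz1, hz2⟩ := exists_sub_orthogonal hdet huv z
  have hsplit : ∀ g : V ≃ₗ[F] V, g z = g (r • u + t • v) + g (z - (r • u + t • v)) := by
    intro g
    rw [← map_add, add_sub_cancel]
  rw [hsplit, hsplit (h ^ k * rho φ y)]
  congr 1
  · obtain ⟨r', t', hrt⟩ := hdec r t
    rw [hrt, map_add, map_add, map_smul, map_smul, map_smul, map_smul, hby, hbhy]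
  · have h8 : polar φ y (z - (r • u + t • v)) = 0 := by
      rw [hyp, polar_add_left, polar_smul_left, polar_smul_left, hz1, hz2, smul_zero, smul_zero,
        add_zero]
    have h9 : polar φ (h y) (z - (r • u + t • v)) = 0 := by
      rw [hhy, polar_sub_left, polar_smul_left, polar_smul_left, hz1, hz2, smul_zero, smul_zero,
        sub_zero]
    rw [hval, LinearEquiv.mul_apply, rho_apply, h8, h9]
    simp only [mul_zero, add_zero, zero_div, zero_smul, zero_sub, map_neg]
    rw [hh, pow_apply_orthogonal hz1 hz2]

theorem mem_reflSet_of_plane [Finite F] {G : Subgroup (V ≃ₗ[F] V)} (hu : u ∈ reflSet φ G)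
    (hv : v ∈ reflSet φ G) (huv : polar φ u v = 1) (hdet : 4 * (φ u * φ v) ≠ 1) {c : ℕ}
    (hc : orderOf (hMatrix (φ u) (φ v)) = c)
    (hc0 : 0 < c) (hcq : (c ∣ Nat.card F - 1 ∧ Nat.card F - 1 ∣ 2 * c) ∨
      (c ∣ Nat.card F + 1 ∧ Nat.card F + 1 ∣ 2 * c)) {a b s : F} (hs : s ≠ 0)
    (hx : φ (a • u + b • v) = s ^ 2 * φ u) : a • u + b • v ∈ reflSet φ G := by
  obtain ⟨k, hk⟩ := exists_rho_eq_pow_mul hu.1 hv.1 huv hdet hc hc0 hcq (d := 1) (l := 0) hs rfl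
    (by rw [one_smul, zero_smul, add_zero]) hu.1 hx
  refine ⟨?_, ?_⟩
  · rw [hx]
    exact mul_ne_zero (pow_ne_zero 2 hs) hu.1
  · rw [hk]
    exact G.mul_mem (G.pow_mem (G.mul_mem hu.2 hv.2) k) hu.2

end Plane

/-! ### Singular vectors and the normal form x₁y₁ + x₂y₂ + cz² -/

section Standard

variable {F V : Type*} [Field F] [AddCommGroup V] [Module F V] {φ : QuadraticForm F V}

theorem exists_ne_zero_of_lt_finrank [FiniteDimensional F V] {n : ℕ} (l : Fin n → V →ₗ[F] F)
    (h : n < Module.finrank F V) : ∃ v : V, v ≠ 0 ∧ ∀ i, l i v = 0 := by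
  have := LinearMap.ker_ne_bot_of_finrank_lt (f := LinearMap.pi l) (by simpa using h)
  obtain ⟨v, hv, hv0⟩ := (Submodule.ne_bot_iff _).1 this
  exact ⟨v, hv0, fun i => congrFun (LinearMap.mem_ker.1 hv) i⟩

/-- In characteristic 2, orthogonal vectors `x`, `y` of norms `a²`, `b²` give the singular vector `b
x + a y`. In odd characteristic, three mutually orthogonal anisotropic vectors define a conic, which
has a point over a finite field. -/
theorem exists_singular [Finite F] [FiniteDimensional F V] (φ : QuadraticForm F V)
    (h3 : 3 ≤ Module.finrank F V) : ∃ e : V, e ≠ 0 ∧ φ e = 0 := by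
  by_contra! han
  obtain ⟨x, hx0, -⟩ := exists_ne_zero_of_lt_finrank (V := V) (F := F) (n := 0) Fin.elim0 (by omega)
  by_cases h2 : (2 : F) = 0
  · obtain ⟨l, hl⟩ : ∃ l : Module.Dual F V, l x ≠ 0 := by
      by_contra! h
      exact hx0 ((Module.forall_dual_apply_eq_zero_iff F x).1 h)
    obtain ⟨y, hy0, hy⟩ := exists_ne_zero_of_lt_finrank (n := 2) ![polarBilin φ x, l] (by omega)
    have hxy : polar φ x y = 0 := hy 0
    have hly : l y = 0 := hy 1
    have : CharP F 2 := CharTwo.of_one_ne_zero_of_two_eq_zero one_ne_zero h2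
    have hsq : ∀ t : F, ∃ s, t = s ^ 2 := fun t => by
      obtain ⟨s, hs⟩ := FiniteField.isSquare_of_char_two (ringChar.eq_iff.2 this) t
      exact ⟨s, by rw [hs, pow_two]⟩
    obtain ⟨a, ha⟩ := hsq (φ x)
    obtain ⟨b, hb⟩ := hsq (φ y)
    have hb0 : b ≠ 0 := by
      rintro rfl
      exact han y hy0 (by rw [hb]; simp)
    refine han (b • x + a • y) (fun h0 => ?_) ?_
    · have := congrArg l h0
      rw [map_add, map_smul, map_smul, hly, smul_zero, add_zero, map_zero, smul_eq_mul] at this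
      exact (mul_ne_zero hb0 hl) this
    · rw [form_add, form_smul, form_smul, polar_smul_left, polar_smul_right, hxy, ha, hb,
        smul_zero, smul_zero]
      linear_combination (a ^ 2 * b ^ 2) * h2
  · obtain ⟨y, hy0, hy⟩ := exists_ne_zero_of_lt_finrank (n := 1) ![polarBilin φ x] (by omega)
    have hxy : polar φ x y = 0 := hy 0
    obtain ⟨z, hz0, hz⟩ := exists_ne_zero_of_lt_finrank (n := 2) ![polarBilin φ x, polarBilin φ y]
      (by omega)
    have hxz : polar φ x z = 0 := hz 0
    have hyz : polar φ y z = 0 := hz 1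
    obtain ⟨s, t, hst⟩ : ∃ s t : F, φ x * s ^ 2 + φ y * t ^ 2 + φ z = 0 := by
      have := Fintype.ofFinite F
      have hodd : ringChar F ≠ 2 := fun h => h2 (by
        have := ringChar.of_eq h
        exact CharTwo.two_eq_zero)
      obtain ⟨s, t, h⟩ := FiniteField.exists_root_sum_quadratic
        (f := Polynomial.C (φ x) * Polynomial.X ^ 2)
        (g := Polynomial.C (φ y) * Polynomial.X ^ 2 + Polynomial.C (φ z))
        (by rw [Polynomial.degree_C_mul_X_pow 2 (han x hx0)]; rfl)
        (by
          have h1 : (Polynomial.C (φ y) * Polynomial.X ^ 2).degree = 2 := by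
            rw [Polynomial.degree_C_mul_X_pow 2 (han y hy0)]; rfl
          rw [Polynomial.degree_add_eq_left_of_degree_lt, h1]
          rw [h1]
          exact lt_of_le_of_lt Polynomial.degree_C_le (by norm_num))
        (by
          rw [← Nat.card_eq_fintype_card]
          exact Nat.odd_iff.1 (by
            rw [Nat.card_eq_fintype_card]
            exact Nat.odd_iff.2 (FiniteField.odd_card_of_char_ne_two hodd)))
      refine ⟨s, t, ?_⟩
      simp at h
      linear_combination h
    refine han (s • x + t • y + z) (fun h0 => ?_) ?_
    · have : polar φ z (s • x + t • y + z) = 0 := by rw [h0, polar_zero_right]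
      rw [polar_add_right, polar_add_right, polar_smul_right, polar_smul_right, polar_comm φ z x,
        polar_comm φ z y, hxz, hyz, polar_self_eq, smul_zero, smul_zero, zero_add, zero_add] at this
      exact mul_ne_zero h2 (han z hz0) this
    · rw [form_add, form_add, form_smul, form_smul, polar_add_left, polar_smul_left,
        polar_smul_left, polar_smul_left, polar_smul_right, hxy, hxz, hyz]
      simp only [smul_zero, add_zero]
      linear_combination hst

/-- A quadratic form is regular if its radical contains no nonzero singular vector. -/
def Regular (φ : QuadraticForm F V) : Prop :=
  ∀ y, (∀ v, polar φ y v = 0) → φ y = 0 → y = 0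

/-- A hyperbolic pair. -/
structure IsHyp (φ : QuadraticForm F V) (e f : V) : Prop where
  left : φ e = 0
  right : φ f = 0
  polar : polar φ e f = 1

theorem IsHyp.symm {e f : V} (h : IsHyp φ e f) : IsHyp φ f e :=
  ⟨h.right, h.left, by rw [polar_comm]; exact h.polar⟩

theorem isHyp_of_polar_ne_zero {e v : V} (he : φ e = 0) (hv : polar φ e v ≠ 0) :
    IsHyp φ e ((polar φ e v)⁻¹ • v - ((polar φ e v)⁻¹ ^ 2 * φ v) • e) := by
  refine ⟨he, ?_, ?_⟩
  · rw [form_sub, form_smul, form_smul, he, polar_smul_left, polar_smul_right, polar_comm φ v e]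
    simp only [smul_eq_mul]
    field_simp
    ring
  · rw [polar_sub_right, polar_smul_right, polar_smul_right, polar_self_eq, he, mul_zero, smul_zero,
      sub_zero, smul_eq_mul, inv_mul_cancel₀ hv]

/-- The basis `b` puts `φ` in the form `x₁ y₁ + x₂ y₂ + c z²`. -/
def IsStd (φ : QuadraticForm F V) (b : Module.Basis (Fin 5) F V) (c : F) : Prop :=
  ∀ v, φ v = b.repr v 0 * b.repr v 1 + b.repr v 2 * b.repr v 3 + c * b.repr v 4 ^ 2

theorem basis_sum_five (b : Module.Basis (Fin 5) F V) (v : V) :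
    b.repr v 0 • b 0 + b.repr v 1 • b 1 + b.repr v 2 • b 2 + b.repr v 3 • b 3 + b.repr v 4 • b 4
      = v := by
  conv_rhs => rw [← b.sum_repr v, Fin.sum_univ_five]

variable [Finite F] [FiniteDimensional F V]

theorem exists_isHyp (hreg : Regular φ) (h3 : 3 ≤ Module.finrank F V) : ∃ e f, IsHyp φ e f := by
  obtain ⟨e, he0, he⟩ := exists_singular φ h3
  obtain ⟨v, hv⟩ : ∃ v, polar φ e v ≠ 0 := by
    by_contra! h
    exact he0 (hreg e h he)
  exact ⟨e, _, isHyp_of_polar_ne_zero he hv⟩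

/-- The orthogonal complement of the given pair has dimension at least 3, so it contains a singular
vector. A partner for it is found in the whole space, by regularity, and then projected to the
complement. -/
theorem exists_isHyp_orthogonal (hreg : Regular φ) (h5 : 5 ≤ Module.finrank F V) {e f : V}
    (hef : IsHyp φ e f) : ∃ e' f', IsHyp φ e' f' ∧ polar φ e e' = 0 ∧ polar φ e f' = 0 ∧
      polar φ f e' = 0 ∧ polar φ f f' = 0 := by
  let W : Submodule F V := LinearMap.ker ((polarBilin φ e).prod (polarBilin φ f))
  have hW : ∀ x, x ∈ W ↔ polar φ e x = 0 ∧ polar φ f x = 0 := by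
    intro x
    simp [W]
  have hfin : 3 ≤ Module.finrank F W := by
    have h1 := LinearMap.finrank_range_add_finrank_ker ((polarBilin φ e).prod (polarBilin φ f))
    have h2 := Submodule.finrank_le (LinearMap.range ((polarBilin φ e).prod (polarBilin φ f)))
    rw [Module.finrank_prod, Module.finrank_self] at h2
    change _ + Module.finrank F W = _ at h1
    omega
  obtain ⟨⟨e', heW⟩, he0, he'⟩ := exists_singular (φ.comp W.subtype) hfin
  have he0 : e' ≠ 0 := fun h => he0 (Subtype.ext h)
  have he' : φ e' = 0 := he'
  obtain ⟨h1, h2⟩ := (hW e').1 heW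
  obtain ⟨v, hv⟩ : ∃ v, polar φ e' v ≠ 0 := by
    by_contra! h
    exact he0 (hreg e' h he')
  set v' := v - polar φ f v • e - polar φ e v • f with hv'
  have hev : polar φ e v' = 0 := by
    rw [hv', polar_sub_right, polar_sub_right, polar_smul_right, polar_smul_right, polar_self_eq,
      hef.left, hef.polar]
    simp
  have hfv : polar φ f v' = 0 := by
    rw [hv', polar_sub_right, polar_sub_right, polar_smul_right, polar_smul_right, polar_self_eq,
      hef.right, hef.symm.polar]
    simp
  have hvv : polar φ e' v' = polar φ e' v := by
    rw [hv', polar_sub_right, polar_sub_right, polar_smul_right, polar_smul_right,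
      polar_comm φ e' e, polar_comm φ e' f, h1, h2]
    simp
  rw [← hvv] at hv
  refine ⟨e', _, isHyp_of_polar_ne_zero he' hv, h1, ?_, h2, ?_⟩
  · rw [polar_sub_right, polar_smul_right, polar_smul_right, hev, h1, smul_zero, smul_zero, sub_zero]
  · rw [polar_sub_right, polar_smul_right, polar_smul_right, hfv, h2, smul_zero, smul_zero, sub_zero]

theorem exists_isStd (hreg : Regular φ) (h5 : Module.finrank F V = 5) :
    ∃ (b : Module.Basis (Fin 5) F V) (c : F), c ≠ 0 ∧ IsStd φ b c := by
  obtain ⟨e, f, hef⟩ := exists_isHyp hreg (by omega)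
  obtain ⟨e', f', hef', h1, h2, h3, h4⟩ := exists_isHyp_orthogonal hreg h5.ge hef
  obtain ⟨r, hr0, hr⟩ := exists_ne_zero_of_lt_finrank (n := 4)
    ![polarBilin φ e, polarBilin φ f, polarBilin φ e', polarBilin φ f'] (by omega)
  have r1 : polar φ e r = 0 := hr 0
  have r2 : polar φ f r = 0 := hr 1
  have r3 : polar φ e' r = 0 := hr 2
  have r4 : polar φ f' r = 0 := hr 3
  have hform : ∀ x₁ y₁ x₂ y₂ z : F, φ (x₁ • e + y₁ • f + x₂ • e' + y₂ • f' + z • r) =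
      x₁ * y₁ + x₂ * y₂ + φ r * z ^ 2 := by
    intro x₁ y₁ x₂ y₂ z
    simp only [form_add, form_smul, polar_add_left, polar_smul_left, polar_smul_right, smul_eq_mul,
      hef.left, hef.right, hef.polar, hef'.left, hef'.right, hef'.polar, h1, h2, h3, h4, r1, r2, r3,
      r4]
    ring
  have hpol : ∀ x₁ y₁ x₂ y₂ z : F, ∀ w, polar φ w (x₁ • e + y₁ • f + x₂ • e' + y₂ • f' + z • r) =
      x₁ * polar φ w e + y₁ * polar φ w f + x₂ * polar φ w e' + y₂ * polar φ w f' +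
        z * polar φ w r := by
    intro x₁ y₁ x₂ y₂ z w
    simp only [polar_add_right, polar_smul_right, smul_eq_mul]
  have hli : LinearIndependent F ![e, f, e', f', r] := by
    rw [Fintype.linearIndependent_iff]
    intro g hg
    rw [Fin.sum_univ_five] at hg
    change g 0 • e + g 1 • f + g 2 • e' + g 3 • f' + g 4 • r = 0 at hg
    have hp := fun w => hpol (g 0) (g 1) (g 2) (g 3) (g 4) w
    simp only [hg, polar_zero_right] at hp
    have g1 := hp e
    have g0 := hp f
    have g3 := hp e'
    have g2 := hp f'
    simp only [polar_self_eq, hef.left, hef.right, hef.polar, hef.symm.polar, hef'.left, hef'.right,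
      hef'.polar, hef'.symm.polar, h1, h2, h3, h4, r1, r2, r3, r4, polar_comm φ e' e,
      polar_comm φ e' f, polar_comm φ f' e, polar_comm φ f' f, mul_zero, mul_one, zero_add,
      add_zero] at g0 g1 g2 g3
    rw [← g0, ← g1, ← g2, ← g3, zero_smul, zero_smul, zero_smul, zero_smul, zero_add, zero_add,
      zero_add, zero_add] at hg
    have g4 := (smul_eq_zero.1 hg).resolve_right hr0
    intro i
    fin_cases i
    exacts [g0.symm, g1.symm, g2.symm, g3.symm, g4]
  let b := basisOfLinearIndependentOfCardEqFinrank hli (by rw [h5]; rfl)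
  have hb : ⇑b = ![e, f, e', f', r] := coe_basisOfLinearIndependentOfCardEqFinrank _ _
  have hsum : ∀ v, b.repr v 0 • e + b.repr v 1 • f + b.repr v 2 • e' + b.repr v 3 • f' +
      b.repr v 4 • r = v := by
    intro v
    have := basis_sum_five b v
    rw [hb] at this
    exact this
  refine ⟨b, φ r, fun hr' => hr0 (hreg r (fun v => ?_) hr'), fun v => ?_⟩
  · rw [← hsum v, hpol, polar_comm φ r e, polar_comm φ r f, polar_comm φ r e', polar_comm φ r f',
      polar_self_eq, r1, r2, r3, r4, hr']
    simp
  · conv_lhs => rw [← hsum v]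
    exact hform _ _ _ _ _

end Standard

/-! ### The spin representation and the homomorphism from the symplectic group -/

section Clifford

open Matrix

variable {F V : Type*} [Field F] [AddCommGroup V] [Module F V]

/-- `4 × 4` matrices in `2 × 2` blocks. -/
abbrev M₄ (F : Type*) := Matrix (Fin 2 ⊕ Fin 2) (Fin 2 ⊕ Fin 2) F

theorem fromBlocks_sub_fromBlocks (A B C D A' B' C' D' : Matrix (Fin 2) (Fin 2) F) :
    fromBlocks A B C D - fromBlocks A' B' C' D' =
      fromBlocks (A - A') (B - B') (C - C') (D - D') := by
  ext (i | i) (j | j) <;> simp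

/-- The spin representation of the Clifford algebra of the form `x₁ y₁ + x₂ y₂ + z²`. -/
noncomputable def cliff (b : Module.Basis (Fin 5) F V) : V →ₗ[F] M₄ F where
  toFun v := fromBlocks
    !![b.repr v 4, b.repr v 0; b.repr v 1, -b.repr v 4] !![0, b.repr v 2; -b.repr v 2, 0]
    !![0, -b.repr v 3; b.repr v 3, 0] !![b.repr v 4, b.repr v 1; b.repr v 0, -b.repr v 4]
  map_add' v w := by
    rw [fromBlocks_add]
    congr 1 <;> (ext i j; fin_cases i <;> fin_cases j <;> simp [add_comm])
  map_smul' t v := by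
    rw [RingHom.id_apply, fromBlocks_smul]
    congr 1 <;> (ext i j; fin_cases i <;> fin_cases j <;> simp)

variable {φ : QuadraticForm F V} {b : Module.Basis (Fin 5) F V}

theorem cliff_apply (v : V) : cliff b v = fromBlocks
    !![b.repr v 4, b.repr v 0; b.repr v 1, -b.repr v 4] !![0, b.repr v 2; -b.repr v 2, 0]
    !![0, -b.repr v 3; b.repr v 3, 0] !![b.repr v 4, b.repr v 1; b.repr v 0, -b.repr v 4] := rfl

theorem cliff_injective : Function.Injective (cliff b) := by
  intro v w h
  apply b.repr.injective
  ext i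
  have h' := fun i j => congrFun (congrFun h i) j
  simp only [cliff_apply] at h'
  fin_cases i
  · simpa using h' (Sum.inl 0) (Sum.inl 1)
  · simpa using h' (Sum.inl 1) (Sum.inl 0)
  · simpa using h' (Sum.inl 0) (Sum.inr 1)
  · simpa using h' (Sum.inr 1) (Sum.inl 0)
  · simpa using h' (Sum.inl 0) (Sum.inl 0)

theorem cliff_mul_self (hb : IsStd φ b 1) (v : V) : cliff b v * cliff b v = φ v • 1 := by
  rw [cliff_apply, fromBlocks_multiply, hb v, ← fromBlocks_one, fromBlocks_smul]
  congr 1 <;> (ext i j; fin_cases i <;> fin_cases j <;> simp <;> ring)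

theorem cliff_anticomm (hb : IsStd φ b 1) (w v : V) :
    cliff b w * cliff b v + cliff b v * cliff b w = polar φ w v • 1 := by
  have h1 := cliff_mul_self hb (w + v)
  rw [map_add, mul_add, add_mul, add_mul, cliff_mul_self hb, cliff_mul_self hb, form_add, add_smul,
    add_smul] at h1
  have h2 : φ w • (1 : M₄ F) + φ v • 1 + (cliff b w * cliff b v + cliff b v * cliff b w) =
      φ w • 1 + φ v • 1 + polar φ w v • 1 := by
    rw [← h1]
    abel
  exact add_left_cancel h2

theorem cliff_transpose_mul_J (v : V) :
    (cliff b v)ᵀ * J (Fin 2) F = J (Fin 2) F * cliff b v := by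
  rw [cliff_apply, J, fromBlocks_transpose, fromBlocks_multiply, fromBlocks_multiply]
  congr 1 <;> (ext i j; fin_cases i <;> fin_cases j <;> simp)

/-- `J * cliff b v` runs through a hyperplane of the alternating matrices, the five-dimensional
constituent of the exterior square. Alternating matrices are written as `L - Lᵀ`, which is correct
also in characteristic 2, and the hyperplane is given by a trace. Together with `exists_cliff_eq`
this characterizes the range of `cliff` in a way that symplectic conjugation visibly respects. -/
theorem exists_alternating_cliff (v : V) :
    ∃ L : M₄ F, J (Fin 2) F * cliff b v = L - Lᵀ ∧ (L * J (Fin 2) F).trace = 0 := by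
  refine ⟨fromBlocks !![0, b.repr v 3; 0, 0]
    !![-b.repr v 4, -b.repr v 1; -b.repr v 0, b.repr v 4] 0 !![0, b.repr v 2; 0, 0], ?_, ?_⟩
  · rw [cliff_apply, J, fromBlocks_transpose, fromBlocks_multiply, fromBlocks_sub_fromBlocks]
    congr 1 <;> (ext i j; fin_cases i <;> fin_cases j <;> simp)
  · rw [J, fromBlocks_multiply]
    simp [Matrix.trace, Fin.sum_univ_two]

theorem exists_cliff_eq {Y L : M₄ F} (h : J (Fin 2) F * Y = L - Lᵀ)
    (hL : (L * J (Fin 2) F).trace = 0) : ∃ v, cliff b v = Y := by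
  have hY : Y = -(J (Fin 2) F * (L - Lᵀ)) := by
    rw [← h, ← mul_assoc, J_squared, neg_mul, one_mul, neg_neg]
  rw [← fromBlocks_toBlocks L] at hY hL
  generalize L.toBlocks₁₁ = A at hY hL
  generalize L.toBlocks₁₂ = B at hY hL
  generalize L.toBlocks₂₁ = C at hY hL
  generalize L.toBlocks₂₂ = D at hY hL
  rw [J, fromBlocks_multiply] at hL
  simp [Matrix.trace, Fin.sum_univ_two] at hL
  rw [J, fromBlocks_transpose, fromBlocks_sub_fromBlocks, fromBlocks_multiply, fromBlocks_neg] at hY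
  refine ⟨b.equivFun.symm ![C 0 1 - B 1 0, C 1 0 - B 0 1, D 0 1 - D 1 0, A 0 1 - A 1 0,
    C 0 0 - B 0 0], ?_⟩
  have hr : ∀ (x : Fin 5 → F) i, b.repr (b.equivFun.symm x) i = x i := by
    intro x i
    rw [← Module.Basis.equivFun_apply, LinearEquiv.apply_symm_apply]
  rw [hY, cliff_apply]
  simp only [hr]
  congr 1 <;> (ext i j; fin_cases i <;> fin_cases j <;> simp)
  all_goals linear_combination hL

/-- Schur's lemma for the spin representation; the four singular basis vectors already suffice. -/
theorem exists_scalar_of_commute {N : M₄ F} (h : ∀ v, N * cliff b v = cliff b v * N) :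
    ∃ c : F, N = c • 1 := by
  have h' := fun v i j => congrFun (congrFun (h v) i) j
  have h0 := h' (b 0)
  have h1 := h' (b 1)
  have h2 := h' (b 2)
  have h3 := h' (b 3)
  simp only [cliff_apply, Matrix.mul_apply, Fintype.sum_sum_type, Fin.sum_univ_two,
    Sum.forall, Fin.forall_fin_two, Module.Basis.repr_self] at h0 h1 h2 h3
  simp at h0 h1 h2 h3
  refine ⟨N (Sum.inl 0) (Sum.inl 0), ?_⟩
  ext (i | i) (j | j) <;> fin_cases i <;> fin_cases j <;> simp <;> grind

/-- `M` is a symplectic similitude with multiplier `μ` that induces `g` by conjugation on the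
spin representation. -/
structure IsLift (b : Module.Basis (Fin 5) F V) (g : V ≃ₗ[F] V) (M : M₄ F) (μ : F) : Prop where
  ne_zero : μ ≠ 0
  simil : Mᵀ * J (Fin 2) F * M = μ • J (Fin 2) F
  intertwine : ∀ v, cliff b (g v) * M = M * cliff b v

theorem IsLift.exists_inv {g : V ≃ₗ[F] V} {M : M₄ F} {μ : F} (h : IsLift b g M μ) :
    ∃ N : M₄ F, N * M = 1 ∧ M * N = 1 := by
  have h1 : (-(μ⁻¹ • (J (Fin 2) F * Mᵀ * J (Fin 2) F))) * M = 1 := by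
    rw [neg_mul, Matrix.smul_mul, mul_assoc, mul_assoc, ← mul_assoc Mᵀ, h.simil, Matrix.mul_smul,
      J_squared, smul_smul, inv_mul_cancel₀ h.ne_zero, one_smul, neg_neg]
  exact ⟨_, h1, mul_eq_one_comm.1 h1⟩

theorem IsLift.one : IsLift b 1 1 1 :=
  ⟨one_ne_zero, by simp, fun v => by simp⟩

theorem IsLift.mul {g g' : V ≃ₗ[F] V} {M M' : M₄ F} {μ μ' : F} (h : IsLift b g M μ)
    (h' : IsLift b g' M' μ') : IsLift b (g * g') (M * M') (μ * μ') := by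
  refine ⟨mul_ne_zero h.ne_zero h'.ne_zero, ?_, fun v => ?_⟩
  · calc (M * M')ᵀ * J (Fin 2) F * (M * M') = M'ᵀ * (Mᵀ * J (Fin 2) F * M) * M' := by
          rw [transpose_mul]; simp only [mul_assoc]
      _ = (μ * μ') • J (Fin 2) F := by
          rw [h.simil, Matrix.mul_smul, Matrix.smul_mul, h'.simil, smul_smul]
  · rw [LinearEquiv.mul_apply, ← mul_assoc, h.intertwine, mul_assoc, h'.intertwine, mul_assoc]

theorem IsLift.smul {g : V ≃ₗ[F] V} {M : M₄ F} {μ c : F} (h : IsLift b g M μ) (hc : c ≠ 0) :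
    IsLift b g (c • M) (c ^ 2 * μ) := by
  refine ⟨mul_ne_zero (pow_ne_zero 2 hc) h.ne_zero, ?_, fun v => ?_⟩
  · rw [transpose_smul, Matrix.smul_mul, Matrix.smul_mul, Matrix.mul_smul, h.simil, smul_smul,
      smul_smul, pow_two, mul_assoc]
  · rw [Matrix.mul_smul, h.intertwine, Matrix.smul_mul]

theorem J_ne_zero : J (Fin 2) F ≠ 0 := by
  intro h
  have := J_squared (Fin 2) F
  rw [h, zero_mul] at this
  have := congrFun (congrFun this (Sum.inl 0)) (Sum.inl 0)
  simp at this

/-- By Schur's lemma two lifts of `g` differ by a scalar `c`, which changes the multiplier by `c²`.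
The multiplier modulo squares thus plays the role of the spinor norm. -/
theorem IsLift.exists_sq {g : V ≃ₗ[F] V} {M M' : M₄ F} {μ μ' : F} (h : IsLift b g M μ)
    (h' : IsLift b g M' μ') : ∃ c : F, M' = c • M ∧ μ' = c ^ 2 * μ := by
  obtain ⟨N, hN, hN'⟩ := h.exists_inv
  obtain ⟨c, hc⟩ := exists_scalar_of_commute (b := b) (N := N * M') (fun v => by
    rw [mul_assoc, ← h'.intertwine, ← mul_assoc, ← mul_assoc]
    congr 1
    calc N * cliff b (g v) = N * (cliff b (g v) * M) * N := by
          rw [mul_assoc, mul_assoc, hN', mul_one]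
      _ = cliff b v * N := by
          rw [h.intertwine, ← mul_assoc, hN, one_mul])
  have hM : M' = c • M := by
    rw [← one_mul M', ← hN', mul_assoc, hc, Matrix.mul_smul, mul_one]
  refine ⟨c, hM, ?_⟩
  have h1 := h'.simil
  rw [hM, transpose_smul, Matrix.smul_mul, Matrix.smul_mul, Matrix.mul_smul, h.simil, smul_smul,
    smul_smul] at h1
  have h2 := smul_left_injective F (J_ne_zero (F := F)) h1
  rw [← h2, pow_two, mul_assoc]

theorem isLift_rho (hb : IsStd φ b 1) {w : V} (hw : φ w ≠ 0) :
    IsLift b (rho φ w) (cliff b w) (φ w) := by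
  refine ⟨hw, ?_, fun v => ?_⟩
  · rw [cliff_transpose_mul_J, mul_assoc, cliff_mul_self hb, Matrix.mul_smul, mul_one]
  · rw [rho_apply, map_sub, map_smul, sub_mul, Matrix.smul_mul, cliff_mul_self hb, smul_smul,
      div_mul_cancel₀ _ hw, ← cliff_anticomm hb, add_sub_cancel_right]

/-- A lift of -1 would anticommute with every `cliff b v` and therefore commute with products of two
of them. In this odd dimension `cliff b (b 4)` is a product of two commutators, so the lift would
both commute and anticommute with it. -/
theorem not_isLift_neg (h2 : (2 : F) ≠ 0) (M : M₄ F) (μ : F) :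
    ¬ IsLift b (LinearEquiv.neg F) M μ := by
  intro h
  have h' : ∀ v, cliff b v * M = -(M * cliff b v) := by
    intro v
    rw [← h.intertwine, LinearEquiv.neg_apply, map_neg, neg_mul, neg_neg]
  have hr : (cliff b (b 0) * cliff b (b 1) - cliff b (b 1) * cliff b (b 0)) *
      (cliff b (b 2) * cliff b (b 3) - cliff b (b 3) * cliff b (b 2)) = cliff b (b 4) := by
    simp only [cliff_apply, Module.Basis.repr_self, fromBlocks_multiply, fromBlocks_sub_fromBlocks]
    congr 1 <;> (ext i j; fin_cases i <;> fin_cases j <;> simp)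
  have h3 : cliff b (b 4) * M = M * cliff b (b 4) := by
    rw [← hr]
    have e : ∀ x y, cliff b x * cliff b y * M = M * (cliff b x * cliff b y) := by
      intro x y
      rw [mul_assoc, h', mul_neg, ← mul_assoc, h', neg_mul, neg_neg, mul_assoc]
    have e2 : ∀ x y, (cliff b x * cliff b y - cliff b y * cliff b x) * M =
        M * (cliff b x * cliff b y - cliff b y * cliff b x) := by
      intro x y
      rw [sub_mul, mul_sub, e, e]
    rw [mul_assoc, e2, ← mul_assoc, e2, mul_assoc]
  have h4 : (2 : F) • (M * cliff b (b 4)) = 0 := by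
    rw [two_smul]
    nth_rewrite 1 [← h3]
    rw [h', neg_add_cancel]
  obtain ⟨N, hN, hN'⟩ := h.exists_inv
  have h5 : cliff b (b 4) = 0 := by
    rw [← one_mul (cliff b (b 4)), ← hN, mul_assoc, (smul_eq_zero.1 h4).resolve_left h2, mul_zero]
  have := congrFun (congrFun h5 (Sum.inl 0)) (Sum.inl 0)
  simp [cliff_apply] at this

/-- With `P = M⁻¹`, conjugation turns `J * cliff b v` into its congruence transform by `P`.
Congruence preserves the shape `L - Lᵀ`, and the trace of `L * J` is unchanged because `P * J * Pᵀ =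
J`. -/
theorem exists_isLift_of_mem [FiniteDimensional F V] (b : Module.Basis (Fin 5) F V)
    (M : symplecticGroup (Fin 2) F) : ∃ g : V ≃ₗ[F] V, IsLift b g M 1 := by
  have hJM : (M : M₄ F)ᵀ * J (Fin 2) F * M = J (Fin 2) F := SymplecticGroup.mem_iff'.1 M.2
  have hinv : (M : M₄ F) * (M⁻¹ : symplecticGroup (Fin 2) F) = 1 := by
    rw [← Submonoid.coe_mul, mul_inv_cancel, Submonoid.coe_one]
  have hinv' : ((M⁻¹ : symplecticGroup (Fin 2) F) : M₄ F) * M = 1 := by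
    rw [← Submonoid.coe_mul, inv_mul_cancel, Submonoid.coe_one]
  set P : M₄ F := ((M⁻¹ : symplecticGroup (Fin 2) F) : M₄ F) with hP
  have hPJ : P * J (Fin 2) F * Pᵀ = J (Fin 2) F :=
    SymplecticGroup.mem_iff.1 (M⁻¹ : symplecticGroup (Fin 2) F).2
  have hJ : J (Fin 2) F * M = Pᵀ * J (Fin 2) F := by
    have : Pᵀ * (M : M₄ F)ᵀ = 1 := by rw [← transpose_mul, hinv, transpose_one]
    conv_rhs => rw [← hJM]
    rw [← mul_assoc, ← mul_assoc, this, one_mul]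
  have hex : ∀ v, ∃ w, cliff b w = M * cliff b v * P := by
    intro v
    obtain ⟨L, hL, hL'⟩ := exists_alternating_cliff (b := b) v
    refine exists_cliff_eq (L := Pᵀ * L * P) ?_ ?_
    · rw [← mul_assoc, ← mul_assoc, hJ, mul_assoc Pᵀ, hL]
      simp only [transpose_mul, transpose_transpose, mul_sub, sub_mul, mul_assoc]
    · rw [mul_assoc, mul_assoc, trace_mul_comm, mul_assoc, mul_assoc, ← mul_assoc P, hPJ, hL']
  choose f hf using hex
  let f' : V →ₗ[F] V :=
    { toFun := f
      map_add' := fun v w => cliff_injective (b := b) (by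
        rw [map_add, hf, hf, hf, map_add, mul_add, add_mul])
      map_smul' := fun t v => cliff_injective (b := b) (by
        rw [RingHom.id_apply, map_smul, hf, hf, map_smul, Matrix.mul_smul, Matrix.smul_mul]) }
  have hinj : Function.Injective f' := by
    intro v w h
    apply cliff_injective (b := b)
    have h1 : cliff b (f v) = cliff b (f w) := congrArg (cliff b) h
    rw [hf, hf] at h1
    calc cliff b v = P * (M * cliff b v * P) * M := by
          rw [mul_assoc P, mul_assoc _ P, hinv', mul_one, ← mul_assoc, hinv', one_mul]
      _ = cliff b w := by
          rw [h1, mul_assoc P, mul_assoc _ P, hinv', mul_one, ← mul_assoc, hinv', one_mul]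
  refine ⟨LinearEquiv.ofInjectiveEndo f' hinj, one_ne_zero, by rw [hJM, one_smul], fun v => ?_⟩
  change cliff b (f v) * M = _
  rw [hf, mul_assoc, hinv', mul_one]

theorem IsLift.ext_left {g g' : V ≃ₗ[F] V} {M : M₄ F} {μ μ' : F} (h : IsLift b g M μ)
    (h' : IsLift b g' M μ') : g = g' := by
  obtain ⟨N, hN, hN'⟩ := h.exists_inv
  ext v
  apply cliff_injective (b := b)
  rw [← mul_one (cliff b (g v)), ← mul_one (cliff b (g' v)), ← hN', ← mul_assoc, ← mul_assoc,
    h.intertwine, h'.intertwine]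

theorem IsLift.mem_orthGroup (hb : IsStd φ b 1) {g : V ≃ₗ[F] V} {M : M₄ F} {μ : F}
    (h : IsLift b g M μ) : g ∈ orthGroup φ := by
  intro v
  obtain ⟨N, hN, hN'⟩ := h.exists_inv
  have h1 : cliff b (g v) * cliff b (g v) = cliff b v * cliff b v := by
    calc cliff b (g v) * cliff b (g v) = cliff b (g v) * (cliff b (g v) * M) * N := by
          rw [mul_assoc, mul_assoc, hN', mul_one]
      _ = (cliff b (g v) * M) * (cliff b v * N) := by
          rw [mul_assoc (cliff b (g v)) M, ← mul_assoc M, ← h.intertwine]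
          simp only [mul_assoc]
      _ = M * (φ v • 1) * N := by
          rw [← mul_assoc, mul_assoc _ M, mul_assoc, mul_assoc, ← mul_assoc (cliff b (g v)),
            h.intertwine, ← cliff_mul_self hb]
          simp only [mul_assoc]
      _ = cliff b v * cliff b v := by
          rw [Matrix.mul_smul, mul_one, Matrix.smul_mul, hN', cliff_mul_self hb]
  rw [cliff_mul_self hb, cliff_mul_self hb] at h1
  have := congrFun (congrFun h1 (Sum.inl 0)) (Sum.inl 0)
  simpa using this

/-- The homomorphism from the symplectic group to the orthogonal group. -/
noncomputable def spinHom [FiniteDimensional F V] (b : Module.Basis (Fin 5) F V) :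
    symplecticGroup (Fin 2) F →* (V ≃ₗ[F] V) where
  toFun M := (exists_isLift_of_mem b M).choose
  map_one' := (exists_isLift_of_mem b 1).choose_spec.ext_left IsLift.one
  map_mul' M M' := (exists_isLift_of_mem b (M * M')).choose_spec.ext_left
    ((exists_isLift_of_mem b M).choose_spec.mul (exists_isLift_of_mem b M').choose_spec)

variable [FiniteDimensional F V]

theorem isLift_spinHom (b : Module.Basis (Fin 5) F V) (M : symplecticGroup (Fin 2) F) :
    IsLift b (spinHom b M) M 1 := (exists_isLift_of_mem b M).choose_spec

theorem mem_range_spinHom_of_isLift {g : V ≃ₗ[F] V} {M : M₄ F} {μ : F}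
    (h : IsLift b g M μ) (hμ : IsSquare μ) : g ∈ (spinHom b).range := by
  obtain ⟨c, rfl⟩ := hμ
  have hc : c ≠ 0 := left_ne_zero_of_mul h.ne_zero
  have h1 := h.smul (inv_ne_zero hc)
  rw [← pow_two, inv_pow, inv_mul_cancel₀ (pow_ne_zero 2 hc)] at h1
  refine ⟨⟨c⁻¹ • M, SymplecticGroup.mem_iff'.2 (by rw [h1.simil, one_smul])⟩, ?_⟩
  exact (isLift_spinHom b _).ext_left h1

theorem isSquare_of_mem_range {g : V ≃ₗ[F] V} (hg : g ∈ (spinHom b).range)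
    {M : M₄ F} {μ : F} (h : IsLift b g M μ) : IsSquare μ := by
  obtain ⟨N, rfl⟩ := hg
  obtain ⟨c, -, hc⟩ := (isLift_spinHom b N).exists_sq h
  exact ⟨c, by rw [hc, mul_one, pow_two]⟩

theorem range_spinHom_le (hb : IsStd φ b 1) : (spinHom b).range ≤ orthGroup φ := by
  rintro _ ⟨M, rfl⟩
  exact (isLift_spinHom b M).mem_orthGroup hb

/-- A matrix acting trivially commutes with all `cliff b v` and is scalar. Conversely, `cliff b v`
is itself symplectic when `φ v = 1`, so a central matrix commutes with it, and the vectors `b 4` and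
`b i + b 4` of norm one span the space. -/
theorem ker_spinHom (hb : IsStd φ b 1) :
    (spinHom b).ker = Subgroup.center (symplecticGroup (Fin 2) F) := by
  ext M
  rw [MonoidHom.mem_ker, Subgroup.mem_center_iff]
  constructor
  · intro h N
    have h1 := isLift_spinHom b M
    rw [h] at h1
    obtain ⟨c, hc⟩ := exists_scalar_of_commute (b := b) (fun v => (h1.intertwine v).symm)
    apply Subtype.ext
    rw [Submonoid.coe_mul, Submonoid.coe_mul, hc, Matrix.mul_smul, mul_one, Matrix.smul_mul,
      one_mul]
  · intro h
    have h1 : ∀ v, φ v = 1 → cliff b v * (M : M₄ F) = M * cliff b v := by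
      intro v hv
      have h2 := h ⟨cliff b v, SymplecticGroup.mem_iff'.2 (by
        rw [cliff_transpose_mul_J, mul_assoc, cliff_mul_self hb, hv, one_smul, mul_one])⟩
      exact congrArg Subtype.val h2
    have h4 : cliff b (b 4) * (M : M₄ F) = M * cliff b (b 4) := h1 _ (by
      rw [hb]
      simp)
    have h5 : ∀ i, cliff b (b i) * (M : M₄ F) = M * cliff b (b i) := by
      intro i
      by_cases hi : i = 4
      · rw [hi, h4]
      have h3 := h1 (b i + b 4) (by
        rw [hb]
        fin_cases i <;> simp at hi ⊢)
      rw [map_add, add_mul, mul_add, h4] at h3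
      exact add_right_cancel h3
    have h6 : ∀ v, cliff b v * (M : M₄ F) = M * cliff b v := by
      intro v
      rw [← basis_sum_five b v]
      simp only [map_add, map_smul, add_mul, mul_add, Matrix.smul_mul, Matrix.mul_smul, h5]
    refine (isLift_spinHom b M).ext_left (μ' := 1) ⟨one_ne_zero, (isLift_spinHom b M).simil, h6⟩

end Clifford

/-! ### Characteristic 2: from a plane to a three-dimensional space -/

section EvenPlane

variable {F V : Type*} [Field F] [AddCommGroup V] [Module F V] {φ : QuadraticForm F V}
  {G : Subgroup (V ≃ₗ[F] V)}

theorem rho_apply_two (h2 : (2 : F) = 0) (w v : V) :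
    rho φ w v = v + (polar φ w v / φ w) • w := by
  rw [rho_apply, sub_eq_add_neg, add_comm]
  congr 1
  rw [← neg_one_smul F, show (-1 : F) = 1 by linear_combination -h2, one_smul]

theorem polar_self_two (h2 : (2 : F) = 0) (x : V) : polar φ x x = 0 := by
  rw [polar_self_eq, h2, zero_mul]

theorem exists_sq_two [Finite F] (h2 : (2 : F) = 0) (t : F) : ∃ s, s ^ 2 = t := by
  have : CharP F 2 := CharTwo.of_one_ne_zero_of_two_eq_zero one_ne_zero h2
  obtain ⟨s, hs⟩ := FiniteField.isSquare_of_char_two (ringChar.eq_iff.2 this) t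
  exact ⟨s, by rw [hs, pow_two]⟩

theorem eq_of_sq_two (h2 : (2 : F) = 0) {s t : F} (h : s ^ 2 = t ^ 2) : s = t := by
  have : (s - t) ^ 2 = 0 := by linear_combination h - (s * t - t ^ 2) * h2
  exact sub_eq_zero.1 (pow_eq_zero_iff two_ne_zero |>.1 this)

/-- In the group generated by the symmetries in `k • e + r` with `e` singular. -/
theorem rho_mul_rho_mul_rho_two (h2 : (2 : F) = 0) {e r : V} (he : φ e = 0)
    (her : polar φ e r = 0) (k l : F) :
    rho φ (k • e + r) * rho φ (l • e + r) * rho φ ((k + l) • e + r) = rho φ r := by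
  have hre : polar φ r e = 0 := by rw [polar_comm, her]
  have hf : ∀ k : F, φ (k • e + r) = φ r := by
    intro k
    rw [form_add, form_smul, he, polar_smul_left, her]
    simp
  ext v
  simp only [LinearEquiv.mul_apply, rho_apply_two h2, hf, polar_add_left, polar_smul_left,
    polar_add_right, polar_smul_right, her, hre, polar_self_two h2, smul_eq_mul]
  match_scalars
  · rfl
  · linear_combination ((k ^ 2 + l ^ 2 + k * l) * polar φ e v + (k + l) * polar φ r v) / φ r * h2
  · linear_combination ((k + l) * polar φ e v + polar φ r v) / φ r * h2

/-- The given symmetry applied to a suitable vector of the hyperbolic plane yields a vector `e + μ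
r`, and the symmetries of the plane rescale `μ` to any nonzero value. A vector with nonzero
components along `f` and `r` is moved into the plane by the symmetry in one of these. -/
theorem mem_reflSet_of_isHyp [Finite F] (hq : 4 ≤ Nat.card F) (h2 : (2 : F) = 0) {e f r : V}
    (hef : IsHyp φ e f) (her : polar φ e r = 0) (hfr : polar φ f r = 0) (hr : φ r ≠ 0)
    (hP : ∀ a b : F, a * b ≠ 0 → a • e + b • f ∈ reflSet φ G) {a₀ b₀ : F} (h₀ : a₀ * b₀ ≠ 0)
    (hw₀ : a₀ • e + b₀ • f + r ∈ reflSet φ G) (a b c : F)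
    (hw : φ (a • e + b • f + c • r) ≠ 0) : a • e + b • f + c • r ∈ reflSet φ G := by
  have hre : polar φ r e = 0 := by rw [polar_comm, her]
  have hrf : polar φ r f = 0 := by rw [polar_comm, hfr]
  have hfe := hef.symm.polar
  have hform : ∀ a b c : F, φ (a • e + b • f + c • r) = a * b + c ^ 2 * φ r := by
    intro a b c
    rw [form_add, form_add, form_smul, form_smul, form_smul, hef.left, hef.right]
    simp only [polar_add_left, polar_smul_left, polar_smul_right, her, hfr, hef.polar, smul_eq_mul]
    ring
  have hpol : ∀ a b c a' b' c' : F, polar φ (a • e + b • f + c • r) (a' • e + b' • f + c' • r) =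
      a * b' + b * a' := by
    intro a b c a' b' c'
    simp only [polar_add_left, polar_smul_left, polar_add_right, polar_smul_right, her, hfr,
      hef.polar, hfe, hre, hrf, polar_self_two h2, smul_eq_mul]
    ring
  have hrho : ∀ a b c a' b' c' : F, rho φ (a • e + b • f + c • r) (a' • e + b' • f + c' • r) =
      (a' + (a * b' + b * a') / (a * b + c ^ 2 * φ r) * a) • e +
      (b' + (a * b' + b * a') / (a * b + c ^ 2 * φ r) * b) • f +
      (c' + (a * b' + b * a') / (a * b + c ^ 2 * φ r) * c) • r := by
    intro a b c a' b' c'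
    rw [rho_apply_two h2, hform, hpol]
    module
  have hP' : ∀ a b : F, a * b ≠ 0 → a • e + b • f + (0 : F) • r ∈ reflSet φ G := by
    intro a b h
    rw [zero_smul, add_zero]
    exact hP a b h
  have ha₀ : a₀ ≠ 0 := left_ne_zero_of_mul h₀
  have hb₀ : b₀ ≠ 0 := right_ne_zero_of_mul h₀
  rw [show a₀ • e + b₀ • f + r = a₀ • e + b₀ • f + (1 : F) • r by rw [one_smul]] at hw₀
  obtain ⟨μ, hμ, hμS⟩ : ∃ μ : F, μ ≠ 0 ∧ (1 : F) • e + (0 : F) • f + μ • r ∈ reflSet φ G := by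
    have hD := hw₀.1
    rw [hform, one_pow, one_mul] at hD
    refine ⟨b₀ / (a₀ * b₀ + φ r), div_ne_zero hb₀ hD, ?_⟩
    -- The coordinates of the plane vector are chosen so that the `f`-coordinate of its image
    -- vanishes and the `e`-coordinate is 1.
    have hz := rho_mem_reflSet hw₀ (hP' (φ r / (a₀ * b₀ + φ r)) (b₀ / (a₀ * b₀ + φ r) * b₀)
      (mul_ne_zero (div_ne_zero hr hD) (mul_ne_zero (div_ne_zero hb₀ hD) hb₀)))
    rw [hrho] at hz
    convert hz using 3
    · congr 1
      field_simp
      grind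
    · congr 1
      field_simp
      grind
    · field_simp
      ring
  have hall : ∀ ν : F, ν ≠ 0 → (1 : F) • e + (0 : F) • f + ν • r ∈ reflSet φ G := by
    intro ν hν
    have h1 := rho_mem_reflSet (hP' 1 1 (by simp)) hμS
    have h3 := rho_mem_reflSet (hP' 1 (ν / μ) (by simp [hμ, hν])) h1
    rw [hrho, hrho] at h3
    have h4 := smul_mem_reflSet (t := ν / μ) (div_ne_zero hν hμ) h3
    convert h4 using 1
    match_scalars
    · field_simp
      grind
    · field_simp
      grind
    · field_simp
      ring
  by_cases hb : b = 0
  · subst hb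
    rw [hform, mul_zero, zero_add] at hw
    have hc : c ≠ 0 := by
      rintro rfl
      simp at hw
    by_cases ha : a = 0
    · subst ha
      -- The symmetry in `r` is the product of those in `e + r`, `k e + r` and `(1 + k) e + r`; all
      -- three have nonzero coefficient of `e` once `k` is neither 0 nor 1.
      obtain ⟨k, hk0, hk1⟩ : ∃ k : F, k ≠ 0 ∧ k ≠ 1 := by
        by_contra! h
        have : Nat.card F ≤ Nat.card Bool := by
          refine Nat.card_le_card_of_injective (fun x : F => open Classical in decide (x = 0)) ?_
          intro x y hxy
          by_cases hx : x = 0 <;> by_cases hy : y = 0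
          · rw [hx, hy]
          · simp [hx, hy] at hxy
          · simp [hx, hy] at hxy
          · rw [h x hx, h y hy]
        rw [Nat.card_eq_fintype_card (α := Bool), Fintype.card_bool] at this
        omega
      have hk : ∀ k : F, k ≠ 0 → rho φ (k • e + r) ∈ G := by
        intro k hk
        have h1 := smul_mem_reflSet hk (hall k⁻¹ (inv_ne_zero hk))
        rw [smul_add, smul_add, smul_smul, smul_smul, smul_smul, mul_one, mul_zero, zero_smul,
          add_zero, mul_inv_cancel₀ hk, one_smul] at h1
        exact h1.2
      have h5 := rho_mul_rho_mul_rho_two h2 hef.left her 1 k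
      have hrG : r ∈ reflSet φ G := by
        refine ⟨hr, ?_⟩
        rw [← h5]
        refine G.mul_mem (G.mul_mem (hk 1 one_ne_zero) (hk k hk0)) (hk _ fun h => hk1 ?_)
        linear_combination h - h2
      rw [zero_smul, zero_smul, add_zero, zero_add]
      exact smul_mem_reflSet hc hrG
    · have := smul_mem_reflSet ha (hall (c / a) (div_ne_zero hc ha))
      convert this using 1
      match_scalars
      · ring
      · ring
      · field_simp
  · by_cases hc : c = 0
    · subst hc
      rw [hform] at hw
      exact hP' a b (by simpa using hw)
    · rw [← rho_mem_reflSet_iff (hall (b / (c * φ r)) (div_ne_zero hb (mul_ne_zero hc hr))), hrho]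
      have hw' : φ (rho φ ((1 : F) • e + (0 : F) • f + (b / (c * φ r)) • r)
          (a • e + b • f + c • r)) ≠ 0 := by rwa [form_rho]
      rw [hrho] at hw'
      have h0 : c + (1 * b + 0 * a) / (1 * 0 + (b / (c * φ r)) ^ 2 * φ r) * (b / (c * φ r)) = 0 := by
        field_simp
        grind
      rw [h0] at hw' ⊢
      rw [hform] at hw'
      refine hP' _ _ fun h => hw' ?_
      rw [h, zero_pow two_ne_zero, zero_mul, add_zero]

/-- In an anisotropic plane the symmetry in `x - y` exchanges vectors `x`, `y` of equal norm. So, up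
to scaling, membership of `x + t r` depends only on `c = φ x / φ (x + t r)`. The good values `c`
contain 1 and are closed under sums of three, because `c (1 + c)` is additive in characteristic 2;
thus they form a coset `1 + A` of an additive group, and `A` turns out to have more than half of the
elements of `F`. -/
theorem mem_reflSet_of_anisotropic [Finite F] (h2 : (2 : F) = 0) {u v r : V}
    (huv : polar φ u v = 1) (hur : polar φ u r = 0) (hvr : polar φ v r = 0) (hr : φ r ≠ 0)
    (han : ∀ a b : F, φ (a • u + b • v) = 0 → a • u + b • v = 0)
    (hP : ∀ a b : F, φ (a • u + b • v) ≠ 0 → a • u + b • v ∈ reflSet φ G) {a₀ b₀ : F}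
    (h₀ : φ (a₀ • u + b₀ • v) ≠ 0) (hw₀ : a₀ • u + b₀ • v + r ∈ reflSet φ G) (a b c : F)
    (hw : φ (a • u + b • v + c • r) ≠ 0) : a • u + b • v + c • r ∈ reflSet φ G := by
  let P : Submodule F V := Submodule.span F {u, v}
  have hmem : ∀ {x}, x ∈ P ↔ ∃ a b : F, a • u + b • v = x := Submodule.mem_span_pair
  have hru : polar φ r u = 0 := by rw [polar_comm, hur]
  have hrv : polar φ r v = 0 := by rw [polar_comm, hvr]
  have hPr : ∀ x ∈ P, polar φ x r = 0 := by
    intro x hx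
    obtain ⟨a, b, rfl⟩ := hmem.1 hx
    rw [polar_add_left, polar_smul_left, polar_smul_left, hur, hvr, smul_zero, smul_zero, add_zero]
  have hPan : ∀ x ∈ P, φ x = 0 → x = 0 := by
    intro x hx
    obtain ⟨a, b, rfl⟩ := hmem.1 hx
    exact han a b
  have hPS : ∀ x ∈ P, φ x ≠ 0 → x ∈ reflSet φ G := by
    intro x hx
    obtain ⟨a, b, rfl⟩ := hmem.1 hx
    exact hP a b
  have huP : u ∈ P := Submodule.subset_span (by simp)
  have hvP : v ∈ P := Submodule.subset_span (by simp)
  have hform : ∀ x ∈ P, ∀ c : F, φ (x + c • r) = φ x + c ^ 2 * φ r := by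
    intro x hx c
    rw [form_add, form_smul, polar_smul_right, hPr x hx, smul_zero, add_zero]
  have hu : φ u ≠ 0 := fun h => by
    rw [hPan u huP h, polar_zero_left] at huv
    exact zero_ne_one huv
  -- transitivity on the vectors of given norm
  have htrans : ∀ x ∈ P, ∀ y ∈ P, φ x = φ y → ∀ c : F, x + c • r ∈ reflSet φ G →
      y + c • r ∈ reflSet φ G := by
    intro x hx y hy hxy c hc
    by_cases h : x = y
    · rwa [← h]
    · have hz : φ (x - y) ≠ 0 := fun h0 =>
        h (sub_eq_zero.1 (hPan _ (P.sub_mem hx hy) h0))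
      have hzS := hPS _ (P.sub_mem hx hy) hz
      have h1 := rho_mem_reflSet hzS hc
      have hzr : polar φ (x - y) r = 0 := hPr _ (P.sub_mem hx hy)
      have hzx : polar φ (x - y) x = φ (x - y) := by
        rw [form_sub, polar_sub_left, polar_self_two h2, polar_comm φ y x, hxy]
        linear_combination -φ y * h2
      rw [rho_apply_two h2, polar_add_right, polar_smul_right, hzr, smul_zero, add_zero, hzx,
        div_self hz, one_smul] at h1
      convert h1 using 1
      have : (2 : F) • x = (2 : F) • y := by rw [h2, zero_smul, zero_smul]
      rw [two_smul, two_smul] at this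
      have h3 : x + c • r + (x - y) = (x + x) - y + c • r := by abel
      rw [h3, this, add_sub_cancel_right]
  let T : F → Prop := fun c => ∀ s t : F, s ^ 2 * φ u = c → t ^ 2 * φ r = 1 + c →
    s • u + t • r ∈ reflSet φ G
  have hT : ∀ x ∈ P, ∀ t : F, x + t • r ∈ reflSet φ G → T (φ x / φ (x + t • r)) := by
    intro x hx t hxt s' t' hs' ht'
    obtain ⟨k, hk⟩ := exists_sq_two h2 (φ (x + t • r))⁻¹
    have hD := hxt.1
    have hk0 : k ≠ 0 := by
      rintro rfl
      exact inv_ne_zero hD (by rw [← hk]; simp)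
    have h1 := smul_mem_reflSet hk0 hxt
    rw [smul_add, smul_smul] at h1
    have htk : k * t = t' := by
      apply eq_of_sq_two h2
      apply mul_right_cancel₀ hr
      rw [ht', mul_pow, hk]
      have := hform x hx t
      field_simp
      linear_combination -this - φ x * h2
    rw [htk] at h1
    refine htrans _ (P.smul_mem k hx) _ (P.smul_mem s' huP) ?_ t' h1
    rw [form_smul, form_smul, hs', hk, inv_mul_eq_div]
  have hTconv : ∀ x ∈ P, ∀ t : F, φ (x + t • r) ≠ 0 → T (φ x / φ (x + t • r)) →
      x + t • r ∈ reflSet φ G := by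
    intro x hx t hD hc
    obtain ⟨k, hk⟩ := exists_sq_two h2 (φ (x + t • r))⁻¹
    have hk0 : k ≠ 0 := by
      rintro rfl
      exact inv_ne_zero hD (by rw [← hk]; simp)
    obtain ⟨s, hs⟩ := exists_sq_two h2 (φ x / φ (x + t • r) / φ u)
    have hs' : s ^ 2 * φ u = φ x / φ (x + t • r) := by rw [hs, div_mul_cancel₀ _ hu]
    have h1 := hc s (k * t) hs' (by
      rw [mul_pow, hk]
      have := hform x hx t
      field_simp
      linear_combination -this - φ x * h2)
    have h3 := htrans _ (P.smul_mem s huP) _ (P.smul_mem k hx) (by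
      rw [form_smul, form_smul, hs', hk, inv_mul_eq_div]) _ h1
    rw [← smul_smul, ← smul_add, smul_mem_reflSet_iff hk0] at h3
    exact h3
  have hone : T 1 := by
    have h1 := hT u huP 0
    rw [zero_smul, add_zero, div_self hu] at h1
    exact h1 (hPS u huP hu)
  have hadd : ∀ c₁ c₂ c₃, T c₁ → T c₂ → T c₃ → T (c₁ + c₂ + c₃) := by
    intro c₁ c₂ c₃ k₁ k₂ k₃ s t hs ht
    have hex : ∀ c, ∃ s t : F, s ^ 2 * φ u = c ∧ t ^ 2 * φ r = 1 + c := by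
      intro c
      obtain ⟨s, hs⟩ := exists_sq_two h2 (c / φ u)
      obtain ⟨t, ht⟩ := exists_sq_two h2 ((1 + c) / φ r)
      exact ⟨s, t, by rw [hs, div_mul_cancel₀ _ hu], by rw [ht, div_mul_cancel₀ _ hr]⟩
    have hf : ∀ c s t : F, s ^ 2 * φ u = c → t ^ 2 * φ r = 1 + c → φ (s • u + t • r) = 1 := by
      intro c s t hs ht
      rw [hform _ (P.smul_mem s huP), form_smul, hs, ht]
      linear_combination c * h2
    obtain ⟨s₁, t₁, hs₁, ht₁⟩ := hex c₁
    obtain ⟨s₂, t₂, hs₂, ht₂⟩ := hex c₂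
    obtain ⟨s₃, t₃, hs₃, ht₃⟩ := hex c₃
    have hss : s ^ 2 = s₁ ^ 2 + s₂ ^ 2 + s₃ ^ 2 := by
      apply mul_right_cancel₀ hu
      rw [hs, ← hs₁, ← hs₂, ← hs₃]
      ring
    have htt : t ^ 2 = t₁ ^ 2 + t₂ ^ 2 + t₃ ^ 2 := by
      apply mul_right_cancel₀ hr
      rw [ht]
      linear_combination -ht₁ - ht₂ - ht₃ - h2
    have hst : s * t = s₁ * t₁ + s₂ * t₂ + s₃ * t₃ := by
      apply eq_of_sq_two h2
      apply mul_right_cancel₀ (mul_ne_zero hu hr)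
      have e : (s₁ * t₁ + s₂ * t₂ + s₃ * t₃) ^ 2 =
          s₁ ^ 2 * t₁ ^ 2 + s₂ ^ 2 * t₂ ^ 2 + s₃ ^ 2 * t₃ ^ 2 := by
        linear_combination (s₁ * t₁ * s₂ * t₂ + s₁ * t₁ * s₃ * t₃ + s₂ * t₂ * s₃ * t₃) * h2
      rw [e]
      calc (s * t) ^ 2 * (φ u * φ r) = (s ^ 2 * φ u) * (t ^ 2 * φ r) := by ring
        _ = (s₁ ^ 2 * φ u) * (t₁ ^ 2 * φ r) + (s₂ ^ 2 * φ u) * (t₂ ^ 2 * φ r) +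
              (s₃ ^ 2 * φ u) * (t₃ ^ 2 * φ r) := by
            rw [hs, ht, hs₁, ht₁, hs₂, ht₂, hs₃, ht₃]
            linear_combination (c₁ * c₂ + c₁ * c₃ + c₂ * c₃) * h2
        _ = _ := by ring
    refine ⟨by rw [hf _ s t hs ht]; exact one_ne_zero, ?_⟩
    -- The vectors have norm one and lie in the plane of `u` and `r`, on which the polar form
    -- vanishes. Such symmetries `v ↦ v + (w, v) w` are multiplied by adding the rank-one parts, and
    -- `hss`, `hst`, `htt` say that the sum of three is again of rank one.
    have hprod : rho φ (s • u + t • r) = rho φ (s₁ • u + t₁ • r) * rho φ (s₂ • u + t₂ • r) *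
        rho φ (s₃ • u + t₃ • r) := by
      ext x
      simp only [LinearEquiv.mul_apply, rho_apply_two h2, hf _ _ _ hs ht, hf _ _ _ hs₁ ht₁,
        hf _ _ _ hs₂ ht₂, hf _ _ _ hs₃ ht₃, polar_add_left, polar_smul_left, polar_add_right,
        polar_smul_right, hur, hru, polar_self_two h2, smul_eq_mul, div_one, mul_zero, add_zero]
      match_scalars
      · rfl
      · linear_combination polar φ u x * hss + polar φ r x * hst
      · linear_combination polar φ u x * hst + polar φ r x * htt
    rw [hprod]
    exact G.mul_mem (G.mul_mem (k₁ s₁ t₁ hs₁ ht₁).2 (k₂ s₂ t₂ hs₂ ht₂).2) (k₃ s₃ t₃ hs₃ ht₃).2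
  let A : AddSubgroup F :=
    { carrier := {c | T (1 + c)}
      add_mem' := by
        intro x y hx hy
        have := hadd _ _ _ hone hx hy
        rw [show (1 : F) + (1 + x) + (1 + y) = 1 + (x + y) by linear_combination h2] at this
        exact this
      zero_mem' := by
        change T (1 + 0)
        rwa [add_zero]
      neg_mem' := by
        intro x hx
        change T (1 + -x)
        rwa [show (1 : F) + -x = 1 + x by linear_combination -x * h2] }
  have hA : A = ⊤ := by
    set x₀ := a₀ • u + b₀ • v with hx₀
    have hx₀P : x₀ ∈ P := hmem.2 ⟨_, _, rfl⟩
    obtain ⟨y₀, hy₀P, hxy₀⟩ : ∃ y ∈ P, polar φ x₀ y = 1 := by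
      by_cases hb : b₀ = 0
      · have ha : a₀ ≠ 0 := by
          rintro rfl
          rw [hx₀, hb, zero_smul, zero_smul, zero_add, QuadraticMap.map_zero] at h₀
          exact h₀ rfl
        refine ⟨a₀⁻¹ • v, P.smul_mem _ hvP, ?_⟩
        rw [hx₀, polar_smul_right, polar_add_left, polar_smul_left, huv, hb, zero_smul,
          polar_zero_left, add_zero, smul_eq_mul, smul_eq_mul, mul_one, inv_mul_cancel₀ ha]
      · refine ⟨b₀⁻¹ • u, P.smul_mem _ huP, ?_⟩
        rw [hx₀, polar_smul_right, polar_add_left, polar_smul_left, polar_self_two h2,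
          polar_smul_left, polar_comm φ v u, huv, smul_eq_mul, smul_eq_mul, smul_eq_mul, mul_zero,
          zero_add, mul_one, inv_mul_cancel₀ hb]
    clear_value x₀
    have hD : φ (x₀ + r) ≠ 0 := hw₀.1
    set ν := φ r / φ (x₀ + r) ^ 2 with hν
    have hν0 : ν ≠ 0 := div_ne_zero hr (pow_ne_zero 2 hD)
    have hxt : ∀ t : F, φ (t • x₀ + y₀) = t ^ 2 * φ x₀ + t + φ y₀ := by
      intro t
      rw [form_add, form_smul, polar_smul_left, hxy₀, smul_eq_mul]
      ring
    have hxt0 : ∀ t : F, t ^ 2 * φ x₀ + t + φ y₀ ≠ 0 := by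
      intro t h0
      rw [← hxt] at h0
      have h1 := hPan _ (P.add_mem (P.smul_mem t hx₀P) hy₀P) h0
      have h3 : polar φ x₀ (t • x₀ + y₀) = 1 := by
        rw [polar_add_right, polar_smul_right, polar_self_two h2, hxy₀, smul_zero, zero_add]
      rw [h1, polar_zero_right] at h3
      exact zero_ne_one h3
    -- The symmetry in `x₀ + r` gives the plane vector `t x₀ + y₀` a component along `r`; as `t`
    -- varies, so does its norm, and each norm contributes an element of `A`.
    have hval : ∀ t : F, ν / (t ^ 2 * φ x₀ + t + φ y₀) ∈ A := by
      intro t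
      have hxP : t • x₀ + y₀ ∈ P := P.add_mem (P.smul_mem t hx₀P) hy₀P
      have h1 := rho_mem_reflSet hw₀ (hPS _ hxP (by rw [hxt]; exact hxt0 t))
      have h3 : polar φ (x₀ + r) (t • x₀ + y₀) = 1 := by
        rw [polar_add_left, polar_comm φ r, hPr _ hxP, polar_add_right, polar_smul_right,
          polar_self_two h2, hxy₀, smul_zero, zero_add, add_zero]
      have hn : φ (rho φ (x₀ + r) (t • x₀ + y₀)) = t ^ 2 * φ x₀ + t + φ y₀ := by
        rw [form_rho, hxt]
      rw [rho_apply_two h2, h3, smul_add, ← add_assoc] at h1 hn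
      have hxP' : t • x₀ + y₀ + (1 / φ (x₀ + r)) • x₀ ∈ P := P.add_mem hxP (P.smul_mem _ hx₀P)
      have h4 := hT _ hxP' _ h1
      rw [hn] at h4
      change T (1 + _)
      convert h4 using 1
      have h5 := hform _ hxP' (1 / φ (x₀ + r))
      rw [hn] at h5
      rw [eq_div_iff (hxt0 t), add_mul, one_mul, div_mul_cancel₀ _ (hxt0 t), h5, hν]
      field_simp
      linear_combination φ r * h2
    rw [← AddSubgroup.card_eq_iff_eq_top]
    by_contra hne
    have := Fintype.ofFinite F
    have hdvd := AddSubgroup.card_addSubgroup_dvd_card A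
    have hle : 2 * Nat.card A ≤ Nat.card F := by
      obtain ⟨m, hm⟩ := hdvd
      have hpos : 0 < Nat.card F := Nat.card_pos
      rcases m with _ | _ | m
      · omega
      · exact absurd (by rw [hm]; ring) hne
      · rw [hm]
        nlinarith
    classical
    -- Each value is attained for at most two `t`, so there are at least `q / 2` of them. None is 0,
    -- and adding 0 gives more than `q / 2` elements of `A`.
    let img : Finset F := Finset.univ.image fun t : F => ν / (t ^ 2 * φ x₀ + t + φ y₀)
    have himg : Fintype.card F ≤ 2 * img.card := by
      refine Finset.card_le_mul_card_image (s := Finset.univ)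
        (f := fun t : F => ν / (t ^ 2 * φ x₀ + t + φ y₀)) 2 fun y hy => ?_
      obtain ⟨t₀, -, rfl⟩ := Finset.mem_image.1 hy
      refine (Finset.card_le_card (t := {t₀, t₀ + 1 / φ x₀}) fun t ht => ?_).trans
        Finset.card_le_two
      have h1 := (Finset.mem_filter.1 ht).2
      rw [div_eq_div_iff (hxt0 t) (hxt0 t₀)] at h1
      have h3 := mul_left_cancel₀ hν0 h1
      have h4 : (t - t₀) * ((t + t₀) * φ x₀ + 1) = 0 := by linear_combination -h3
      rw [Finset.mem_insert, Finset.mem_singleton]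
      rcases mul_eq_zero.1 h4 with h5 | h5
      · exact Or.inl (sub_eq_zero.1 h5)
      · right
        field_simp
        linear_combination h5 - (t₀ * φ x₀ + 1) * h2
    have h0 : (0 : F) ∉ img := by
      intro h
      obtain ⟨t, -, ht⟩ := Finset.mem_image.1 h
      exact div_ne_zero hν0 (hxt0 t) ht
    have hsub : (insert 0 img).card ≤ Nat.card A := by
      have hcard : Nat.card A = (Finset.univ.filter (· ∈ A)).card := by
        rw [Nat.card_eq_fintype_card, Fintype.card_subtype]
      rw [hcard]
      exact Finset.card_le_card (by
        intro x hx
        rw [Finset.mem_filter]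
        refine ⟨Finset.mem_univ _, ?_⟩
        rcases Finset.mem_insert.1 hx with rfl | hx
        · exact A.zero_mem
        · obtain ⟨t, -, rfl⟩ := Finset.mem_image.1 hx
          exact hval t)
    rw [Finset.card_insert_of_notMem h0] at hsub
    rw [Nat.card_eq_fintype_card (α := F)] at hle
    omega
  have hTall : ∀ c, T c := by
    intro c
    have : c - 1 ∈ A := by rw [hA]; trivial
    change T (1 + (c - 1)) at this
    rwa [add_sub_cancel] at this
  exact hTconv _ (hmem.2 ⟨_, _, rfl⟩) c hw (hTall _)

/-- In even characteristic, if all symmetries of a nondegenerate plane lie in `G`, as well as one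
symmetry in the three-space spanned by it and an orthogonal vector, then so do all of them. -/
theorem mem_reflSet_of_plane_add [Finite F] (hq : 4 ≤ Nat.card F) (h2 : (2 : F) = 0) {u v r : V}
    (huv : polar φ u v = 1) (hur : polar φ u r = 0) (hvr : polar φ v r = 0) (hr : φ r ≠ 0)
    (hP : ∀ a b : F, φ (a • u + b • v) ≠ 0 → a • u + b • v ∈ reflSet φ G) {a₀ b₀ : F}
    (h₀ : φ (a₀ • u + b₀ • v) ≠ 0) (hw₀ : a₀ • u + b₀ • v + r ∈ reflSet φ G) (a b c : F)
    (hw : φ (a • u + b • v + c • r) ≠ 0) : a • u + b • v + c • r ∈ reflSet φ G := by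
  by_cases han : ∀ a b : F, φ (a • u + b • v) = 0 → a • u + b • v = 0
  · exact mem_reflSet_of_anisotropic h2 huv hur hvr hr han hP h₀ hw₀ a b c hw
  push Not at han
  obtain ⟨x, y, he, he0⟩ := han
  have hvu : polar φ v u = 1 := by rw [polar_comm, huv]
  -- the hyperbolic pair
  obtain ⟨f, x', y', hf, hef⟩ : ∃ (f : V) (x' y' : F), f = x' • u + y' • v ∧
      IsHyp φ (x • u + y • v) f := by
    have hex : ∃ s t : F, polar φ (x • u + y • v) (s • u + t • v) ≠ 0 := by
      by_contra! h
      have h1 := h 1 0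
      have h3 := h 0 1
      simp only [polar_add_left, polar_smul_left, polar_add_right, polar_smul_right, huv, hvu,
        polar_self_two h2, smul_eq_mul] at h1 h3
      apply he0
      rw [show x = 0 by linear_combination h3, show y = 0 by linear_combination h1]
      simp
    obtain ⟨s, t, hst⟩ := hex
    have := isHyp_of_polar_ne_zero he hst
    set k := (polar φ (x • u + y • v) (s • u + t • v))⁻¹
    set l := k ^ 2 * φ (s • u + t • v)
    exact ⟨_, k * s - l * x, k * t - l * y, by module, this⟩
  have hdec : ∀ a b : F, ∃ a' b' : F, a • u + b • v = a' • (x • u + y • v) + b' • f := by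
    intro a b
    have hp := hef.polar
    rw [hf] at hp
    simp only [polar_add_left, polar_smul_left, polar_add_right, polar_smul_right, huv, hvu,
      polar_self_two h2, smul_eq_mul] at hp
    refine ⟨a * y' + b * x', a * y + b * x, ?_⟩
    rw [hf]
    match_scalars
    · linear_combination -a * hp - a * x' * y * h2 - b * x * x' * h2 + a * (x' * y) * h2
    · linear_combination -b * hp - a * y * y' * h2
  have hform : ∀ a b : F, φ (a • (x • u + y • v) + b • f) = a * b := by
    intro a b
    rw [form_add, form_smul, form_smul, he, hef.right, polar_smul_left, polar_smul_right, hef.polar]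
    simp
  obtain ⟨p, q, hpq⟩ := hdec a b
  obtain ⟨p₀, q₀, hpq₀⟩ := hdec a₀ b₀
  rw [hpq] at hw ⊢
  rw [hpq₀] at hw₀ h₀
  rw [hform] at h₀
  refine mem_reflSet_of_isHyp hq h2 hef ?_ ?_ hr ?_ h₀ hw₀ p q c hw
  · rw [polar_add_left, polar_smul_left, polar_smul_left, hur, hvr, smul_zero, smul_zero, add_zero]
  · rw [hf, polar_add_left, polar_smul_left, polar_smul_left, hur, hvr, smul_zero, smul_zero,
      add_zero]
  · intro s t hst
    have e : s • (x • u + y • v) + t • f = (s * x + t * x') • u + (s * y + t * y') • v := by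
      rw [hf]
      module
    rw [← hform, e] at hst
    rw [e]
    exact hP _ _ hst

end EvenPlane

/-! ### Characteristic 2: generating the orthogonal group modulo and above the radical -/

section EvenGeneration

variable {F V : Type*} [Field F] [AddCommGroup V] [Module F V] {φ : QuadraticForm F V}
  {G : Subgroup (V ≃ₗ[F] V)} {R : V}

/-- All nonsingular vectors of the coset `u + F R` give elements of `G`. -/
def CosetFull (φ : QuadraticForm F V) (G : Subgroup (V ≃ₗ[F] V)) (R u : V) : Prop :=
  ∀ t : F, φ (u + t • R) ≠ 0 → u + t • R ∈ reflSet φ G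

theorem CosetFull.smul {u : V} (hu : CosetFull φ G R u) {c : F} (hc : c ≠ 0) :
    CosetFull φ G R (c • u) := by
  intro t ht
  have e : c • u + t • R = c • (u + (t / c) • R) := by
    rw [smul_add, smul_smul, mul_div_cancel₀ _ hc]
  rw [e] at ht ⊢
  refine smul_mem_reflSet hc (hu _ fun h => ht ?_)
  rw [form_smul, h, mul_zero]

/-- Modulo the radical the form is symplectic and symmetries become transvections. As every element
of `F` is a square, `m` can be chosen to give `b + m R` any prescribed norm; with the norm `(a, b) /
t` its symmetry sends `a` to `a + t b` modulo `R`. -/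
theorem CosetFull.add_smul [Finite F] (hR : ∀ v, polar φ R v = 0) (h2 : (2 : F) = 0)
    (hφR : φ R ≠ 0) {a b : V} (ha : CosetFull φ G R a) (hb : CosetFull φ G R b)
    (hab : polar φ a b ≠ 0) (t : F) : CosetFull φ G R (a + t • b) := by
  by_cases ht : t = 0
  · rwa [ht, zero_smul, add_zero]
  intro l hl
  have hR' : ∀ v, polar φ v R = 0 := fun v => by rw [polar_comm, hR]
  obtain ⟨m, hm⟩ := exists_sq_two h2 ((polar φ a b / t - φ b) / φ R)
  have hbm : φ (b + m • R) = polar φ a b / t := by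
    rw [form_add, form_smul, polar_smul_right, hR', smul_zero, add_zero, hm, div_mul_cancel₀ _ hφR]
    ring
  have hbS := hb m (by rw [hbm]; exact div_ne_zero hab ht)
  have e : rho φ (b + m • R) (a + (l + t * m) • R) = a + t • b + l • R := by
    rw [rho_apply_two h2, hbm, polar_add_left, polar_smul_left, hR, polar_add_right,
      polar_smul_right, hR', polar_comm φ b a, smul_zero, smul_zero, add_zero, add_zero,
      div_div_cancel₀ hab]
    match_scalars
    · ring
    · linear_combination t * m * h2
    · ring
  rw [← e] at hl ⊢
  rw [form_rho] at hl
  exact rho_mem_reflSet hbS (ha _ hl)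

/-- The symmetry in `v` sends `u` to `u + k v` with `k ≠ 0`, so that coset is full; adding `u` again
leaves `k v`. Thus a single symmetry not orthogonal to a full coset fills its own coset. -/
theorem CosetFull.of_mem_reflSet [Finite F] (hR : ∀ v, polar φ R v = 0) (h2 : (2 : F) = 0)
    (hφR : φ R ≠ 0) {u v : V} (hu : CosetFull φ G R u)
    (hv : v ∈ reflSet φ G) (huv : polar φ u v ≠ 0) : CosetFull φ G R v := by
  have hv0 := hv.1
  have hR' : ∀ v, polar φ v R = 0 := fun v => by rw [polar_comm, hR]
  have hu' : CosetFull φ G R (u + (polar φ u v / φ v) • v) := by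
    intro t ht
    have e : rho φ v (u + t • R) = u + (polar φ u v / φ v) • v + t • R := by
      rw [rho_apply_two h2, polar_add_right, polar_smul_right, hR', smul_zero, add_zero,
        polar_comm φ v u]
      abel
    rw [← e] at ht ⊢
    rw [form_rho] at ht
    exact rho_mem_reflSet hv (hu t ht)
  have h1 := hu.add_smul hR h2 hφR hu' (by
    rw [polar_add_right, polar_self_two h2, polar_smul_right, zero_add, smul_eq_mul]
    exact mul_ne_zero (div_ne_zero huv hv0) huv) 1
  rw [one_smul, ← add_assoc, ← two_smul F u, h2, zero_smul, zero_add] at h1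
  have h3 := h1.smul (inv_ne_zero (div_ne_zero huv hv0))
  rwa [smul_smul, inv_mul_cancel₀ (div_ne_zero huv hv0), one_smul] at h3

/-- The four vectors form a path in the symplectic quotient. If both middle coordinates are nonzero,
the vector is a sum of two nonorthogonal vectors from the planes at the two ends. Every other vector
is brought to this shape by adding multiples of path vectors not orthogonal to it. -/
theorem cosetFull_of_path [Finite F] (hR : ∀ v, polar φ R v = 0) (hq : 4 ≤ Nat.card F)
    (h2 : (2 : F) = 0) (hφR : φ R ≠ 0) {u₁ u₂ u₃ u₄ : V} (h12 : polar φ u₁ u₂ = 1) (h13 : polar φ u₁ u₃ = 0)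
    (h14 : polar φ u₁ u₄ = 0) (h23 : polar φ u₂ u₃ = 1) (h24 : polar φ u₂ u₄ = 0)
    (h34 : polar φ u₃ u₄ = 1) (d₀ : CosetFull φ G R 0) (d₁ : CosetFull φ G R u₁)
    (d₂ : CosetFull φ G R u₂) (d₃ : CosetFull φ G R u₃) (d₄ : CosetFull φ G R u₄)
    (a₁ a₂ a₃ a₄ : F) : CosetFull φ G R (a₁ • u₁ + a₂ • u₂ + a₃ • u₃ + a₄ • u₄) := by
  have h21 : polar φ u₂ u₁ = 1 := by rw [polar_comm, h12]
  have h31 : polar φ u₃ u₁ = 0 := by rw [polar_comm, h13]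
  have h41 : polar φ u₄ u₁ = 0 := by rw [polar_comm, h14]
  have h32 : polar φ u₃ u₂ = 1 := by rw [polar_comm, h23]
  have h42 : polar φ u₄ u₂ = 0 := by rw [polar_comm, h24]
  have h43 : polar φ u₄ u₃ = 1 := by rw [polar_comm, h34]
  have hplane : ∀ {x y : V}, polar φ x y = 1 → CosetFull φ G R x → CosetFull φ G R y →
      ∀ a b : F, CosetFull φ G R (a • x + b • y) := by
    intro x y hxy hx hy a b
    by_cases ha : a = 0
    · by_cases hb : b = 0
      · simpa [ha, hb] using d₀
      · simpa [ha] using hy.smul hb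
    · refine (hx.smul ha).add_smul hR h2 hφR hy ?_ b
      rw [polar_smul_left, hxy]
      simpa using ha
  have hp : ∀ a₁ a₂ a₃ a₄ b₁ b₂ b₃ b₄ : F, polar φ (a₁ • u₁ + a₂ • u₂ + a₃ • u₃ + a₄ • u₄)
      (b₁ • u₁ + b₂ • u₂ + b₃ • u₃ + b₄ • u₄) =
      a₁ * b₂ + a₂ * b₁ + a₂ * b₃ + a₃ * b₂ + a₃ * b₄ + a₄ * b₃ := by
    intro a₁ a₂ a₃ a₄ b₁ b₂ b₃ b₄
    simp only [polar_add_left, polar_smul_left, polar_add_right, polar_smul_right, h12, h13, h14,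
      h23, h24, h34, h21, h31, h41, h32, h42, h43, polar_self_two h2, smul_eq_mul]
    ring
  have hgood : ∀ a₁ a₂ a₃ a₄ : F, a₂ ≠ 0 → a₃ ≠ 0 →
      CosetFull φ G R (a₁ • u₁ + a₂ • u₂ + a₃ • u₃ + a₄ • u₄) := by
    intro a₁ a₂ a₃ a₄ k2 k3
    have h1 := (hplane h12 d₁ d₂ a₁ a₂).add_smul hR h2 hφR (hplane h34 d₃ d₄ a₃ a₄) (by
      have := hp a₁ a₂ 0 0 0 0 a₃ a₄
      simp only [zero_smul, add_zero, zero_add] at this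
      rw [this]
      simp [k2, k3]) 1
    rwa [one_smul, ← add_assoc] at h1
  -- adding a multiple of a generator
  have hadd : ∀ (w y : V) (t : F), CosetFull φ G R y → polar φ w y ≠ 0 →
      CosetFull φ G R (w + t • y) → CosetFull φ G R w := by
    intro w y t hy hwy h
    have h1 := h.add_smul hR h2 hφR hy (by
      rwa [polar_add_left, polar_smul_left, polar_self_two h2, smul_zero, add_zero]) t
    rwa [add_assoc, ← _root_.add_smul, ← two_mul, h2, zero_mul, zero_smul, add_zero] at h1
  have hpu : ∀ a₁ a₂ a₃ a₄ : F,
      polar φ (a₁ • u₁ + a₂ • u₂ + a₃ • u₃ + a₄ • u₄) u₁ = a₂ ∧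
      polar φ (a₁ • u₁ + a₂ • u₂ + a₃ • u₃ + a₄ • u₄) u₂ = a₁ + a₃ ∧
      polar φ (a₁ • u₁ + a₂ • u₂ + a₃ • u₃ + a₄ • u₄) u₃ = a₂ + a₄ ∧
      polar φ (a₁ • u₁ + a₂ • u₂ + a₃ • u₃ + a₄ • u₄) u₄ = a₃ := by
    intro a₁ a₂ a₃ a₄
    simp only [polar_add_left, polar_smul_left, h12, h13, h14,
      h23, h24, h34, h21, h31, h41, h32, h42, h43, polar_self_two h2, smul_eq_mul]
    refine ⟨?_, ?_, ?_, ?_⟩ <;> ring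
  have hm₁ : ∀ a₁ a₂ a₃ a₄ t : F, a₂ ≠ 0 →
      CosetFull φ G R ((a₁ + t) • u₁ + a₂ • u₂ + a₃ • u₃ + a₄ • u₄) →
      CosetFull φ G R (a₁ • u₁ + a₂ • u₂ + a₃ • u₃ + a₄ • u₄) := by
    intro a₁ a₂ a₃ a₄ t h k
    refine hadd _ u₁ t d₁ (by rwa [(hpu a₁ a₂ a₃ a₄).1]) ?_
    convert k using 1
    module
  have hm₂ : ∀ a₁ a₂ a₃ a₄ t : F, a₁ + a₃ ≠ 0 →
      CosetFull φ G R (a₁ • u₁ + (a₂ + t) • u₂ + a₃ • u₃ + a₄ • u₄) →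
      CosetFull φ G R (a₁ • u₁ + a₂ • u₂ + a₃ • u₃ + a₄ • u₄) := by
    intro a₁ a₂ a₃ a₄ t h k
    refine hadd _ u₂ t d₂ (by rwa [(hpu a₁ a₂ a₃ a₄).2.1]) ?_
    convert k using 1
    module
  have hm₃ : ∀ a₁ a₂ a₃ a₄ t : F, a₂ + a₄ ≠ 0 →
      CosetFull φ G R (a₁ • u₁ + a₂ • u₂ + (a₃ + t) • u₃ + a₄ • u₄) →
      CosetFull φ G R (a₁ • u₁ + a₂ • u₂ + a₃ • u₃ + a₄ • u₄) := by
    intro a₁ a₂ a₃ a₄ t h k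
    refine hadd _ u₃ t d₃ (by rwa [(hpu a₁ a₂ a₃ a₄).2.2.1]) ?_
    convert k using 1
    module
  have hm₄ : ∀ a₁ a₂ a₃ a₄ t : F, a₃ ≠ 0 →
      CosetFull φ G R (a₁ • u₁ + a₂ • u₂ + a₃ • u₃ + (a₄ + t) • u₄) →
      CosetFull φ G R (a₁ • u₁ + a₂ • u₂ + a₃ • u₃ + a₄ • u₄) := by
    intro a₁ a₂ a₃ a₄ t h k
    refine hadd _ u₄ t d₄ (by rwa [(hpu a₁ a₂ a₃ a₄).2.2.2]) ?_
    convert k using 1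
    module
  have hone : ∀ x : F, ∃ t, x + t = 1 := fun x => ⟨1 - x, by ring⟩
  have hz : ∀ x : F, ∃ t, x + t = 0 := fun x => ⟨-x, by ring⟩
  have c₂ : ∀ a₁ a₃ a₄ : F, a₃ ≠ 0 →
      CosetFull φ G R (a₁ • u₁ + (0 : F) • u₂ + a₃ • u₃ + a₄ • u₄) := by
    have c₂' : ∀ a₁ a₃ a₄ : F, a₃ ≠ 0 → a₁ + a₃ ≠ 0 →
        CosetFull φ G R (a₁ • u₁ + (0 : F) • u₂ + a₃ • u₃ + a₄ • u₄) := by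
      intro a₁ a₃ a₄ h h'
      refine hm₂ _ _ _ _ 1 h' (hgood _ _ _ _ (by simp) h)
    intro a₁ a₃ a₄ h
    by_cases h' : a₁ + a₃ = 0
    · obtain ⟨t, ht⟩ := hone a₄
      refine hm₄ _ _ _ _ t h ?_
      rw [ht]
      obtain ⟨k, hk0, hk1⟩ : ∃ k : F, k ≠ 0 ∧ k ≠ a₃ := by
        classical
        have := Fintype.ofFinite F
        have hlt : ({0, a₃} : Finset F).card < (Finset.univ : Finset F).card := by
          refine lt_of_le_of_lt Finset.card_le_two ?_
          rw [Finset.card_univ, ← Nat.card_eq_fintype_card]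
          omega
        obtain ⟨k, -, hk⟩ := Finset.exists_mem_notMem_of_card_lt_card hlt
        simp only [Finset.mem_insert, Finset.mem_singleton, not_or] at hk
        exact ⟨k, hk⟩
      refine hm₃ _ _ _ _ (k - a₃) (by simp) ?_
      rw [add_sub_cancel]
      refine c₂' _ _ _ hk0 fun h0 => hk1 ?_
      linear_combination h0 - h'
    · exact c₂' _ _ _ h h'
  have c₃ : ∀ a₁ a₂ a₄ : F, a₂ ≠ 0 →
      CosetFull φ G R (a₁ • u₁ + a₂ • u₂ + (0 : F) • u₃ + a₄ • u₄) := by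
    intro a₁ a₂ a₄ h
    by_cases h' : a₂ + a₄ = 0
    · obtain ⟨t, ht⟩ := hone a₁
      refine hm₁ _ _ _ _ t h ?_
      rw [ht]
      refine hm₂ _ _ _ _ (-a₂) (by simp) ?_
      rw [add_neg_cancel]
      refine hm₃ _ _ _ _ 1 (by
        rw [zero_add]
        rintro rfl
        rw [add_zero] at h'
        exact h h') ?_
      exact c₂ _ _ _ (by simp)
    · exact hm₃ _ _ _ _ 1 h' (hgood _ _ _ _ h (by simp))
  by_cases k2 : a₂ = 0
  · subst k2
    by_cases k3 : a₃ = 0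
    · subst k3
      by_cases k1 : a₁ = 0
      · subst k1
        by_cases k4 : a₄ = 0
        · subst k4
          simpa using d₀
        · exact hm₃ _ _ _ _ 1 (by simpa using k4) (c₂ _ _ _ (by simp))
      · exact hm₂ _ _ _ _ 1 (by simpa using k1) (c₃ _ _ _ (by simp))
    · exact c₂ _ _ _ k3
  · by_cases k3 : a₃ = 0
    · subst k3
      exact c₃ _ _ _ k2
    · exact hgood _ _ _ _ k2 k3

/-- The fixed space of `g`. -/
def fixedSpace (g : V ≃ₗ[F] V) : Submodule F V := LinearMap.ker ((g : V →ₗ[F] V) - LinearMap.id)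

theorem mem_fixedSpace {g : V ≃ₗ[F] V} {v : V} : v ∈ fixedSpace g ↔ g v = v := by
  rw [fixedSpace, LinearMap.mem_ker, LinearMap.sub_apply, sub_eq_zero]
  rfl

theorem polar_sub_of_mem_fixedSpace {g : V ≃ₗ[F] V} (hg : g ∈ orthGroup φ) {x : V}
    (hx : x ∈ fixedSpace g) (v : V) : polar φ (g v - v) x = 0 := by
  rw [polar_sub_left, sub_eq_zero]
  conv_lhs => rw [← mem_fixedSpace.1 hx]
  exact polar_map hg v x

theorem rho_sub_apply (h2 : (2 : F) = 0) {g : V ≃ₗ[F] V} (hg : g ∈ orthGroup φ) {v : V}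
    (hw : φ (g v - v) ≠ 0) : rho φ (g v - v) (g v) = v := by
  have h1 : polar φ (g v - v) (g v) = φ (g v - v) := by
    rw [form_sub, polar_sub_left, polar_self_eq, hg v, polar_comm φ v]
    ring
  rw [rho_apply, h1, div_self hw, one_smul, sub_sub, add_comm, ← sub_sub, sub_self, zero_sub,
    ← neg_one_smul F v, show (-1 : F) = 1 by linear_combination -h2, one_smul]

theorem rho_apply_of_orthogonal_two (h2 : (2 : F) = 0) {w x : V} (h : polar φ w x = 0) :
    rho φ w x = x := by
  rw [rho_apply_two h2, h, zero_div, zero_smul, add_zero]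

/-- Induction on the codimension of the fixed space, as for Cartan–Dieudonné. If some `g v - v` is
nonsingular, its symmetry sends `g v` back to `v` and fixes whatever `g` fixes. Only isometries with
all `g v - v` singular are left to `hts`. -/
theorem mem_of_sub_mem_of_step [FiniteDimensional F V] (h2 : (2 : F) = 0) {U : Submodule F V}
    (hU : ∀ x ∈ U, φ x ≠ 0 → x ∈ reflSet φ G)
    (hts : ∀ g ∈ orthGroup φ, (∀ v, g v - v ∈ U) → (∀ v, φ (g v - v) = 0) → g ≠ 1 →
      ∃ k ∈ G, k ∈ orthGroup φ ∧ (∀ v, k v - v ∈ U) ∧ fixedSpace g < fixedSpace (k * g))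
    {g : V ≃ₗ[F] V} (hg : g ∈ orthGroup φ) (hgU : ∀ v, g v - v ∈ U) : g ∈ G := by
  induction hn : Module.finrank F V - Module.finrank F (fixedSpace g) using
    Nat.strong_induction_on generalizing g with
  | _ n ih =>
    by_cases h1 : g = 1
    · rw [h1]
      exact G.one_mem
    obtain ⟨k, hkG, hkO, hkU, hlt⟩ : ∃ k ∈ G, k ∈ orthGroup φ ∧ (∀ v, k v - v ∈ U) ∧
        fixedSpace g < fixedSpace (k * g) := by
      by_cases hs : ∀ v, φ (g v - v) = 0
      · exact hts g hg hgU hs h1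
      push Not at hs
      obtain ⟨v, hv⟩ := hs
      refine ⟨rho φ (g v - v), (hU _ (hgU v) hv).2, rho_mem_orthGroup φ _, fun x => ?_, ?_⟩
      · rw [rho_apply_two h2, add_sub_cancel_left]
        exact U.smul_mem _ (hgU v)
      · refine lt_of_le_of_ne (fun x hx => ?_) fun heq => hv ?_
        · rw [mem_fixedSpace, LinearEquiv.mul_apply, mem_fixedSpace.1 hx]
          exact rho_apply_of_orthogonal_two h2 (polar_sub_of_mem_fixedSpace hg hx v)
        · have : v ∈ fixedSpace g := by
            rw [heq, mem_fixedSpace, LinearEquiv.mul_apply]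
            exact rho_sub_apply h2 hg hv
          rw [mem_fixedSpace.1 this, sub_self, QuadraticMap.map_zero]
    have hlt' := Submodule.finrank_lt_finrank_of_lt hlt
    have hle := Submodule.finrank_le (fixedSpace (k * g))
    have hkg := ih _ (by omega) ((orthGroup φ).mul_mem hkO hg) (fun v => by
      have e : (k * g) v - v = (k (g v) - g v) + (g v - v) := by
        rw [LinearEquiv.mul_apply]
        abel
      rw [e]
      exact U.add_mem (hkU _) (hgU v)) rfl
    have := G.mul_mem (G.inv_mem hkG) hkg
    rwa [inv_mul_cancel_left] at this

/-- Isometries moving vectors only inside a subspace without two independent orthogonal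
singular vectors. -/
theorem mem_of_sub_mem [FiniteDimensional F V] (h2 : (2 : F) = 0) (hreg : Regular φ)
    {U : Submodule F V} (hU : ∀ x ∈ U, φ x ≠ 0 → x ∈ reflSet φ G)
    (hsing : ∀ d ∈ U, ∀ e ∈ U, φ d = 0 → φ e = 0 → polar φ d e = 0 → e ≠ 0 → ∃ c : F, d = c • e)
    {g : V ≃ₗ[F] V} (hg : g ∈ orthGroup φ) (hgU : ∀ v, g v - v ∈ U) : g ∈ G := by
  refine mem_of_sub_mem_of_step h2 hU ?_ hg hgU
  intro g hg hgU hs h1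
  exfalso
  apply h1
  by_contra hne
  obtain ⟨v, hv⟩ : ∃ v, g v ≠ v := by
    by_contra! h
    exact hne (LinearEquiv.ext h)
  set e := g v - v with he
  have he0 : e ≠ 0 := sub_ne_zero.2 hv
  have horth : ∀ x, polar φ (g x - x) e = 0 := by
    intro x
    have h3 := hs (x + v)
    rw [show g (x + v) - (x + v) = (g x - x) + e by rw [map_add, he]; abel, form_add, hs x, hs v]
      at h3
    simpa using h3
  -- All displacements `g x - x` are singular and mutually orthogonal, so by `hsing` they are
  -- multiples of `e`. But `x + c e` has the norm of `x` only if `c (e, x) = 0`. So `g` fixes every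
  -- vector not orthogonal to `e`, and these span the space.
  have hl : ∀ x, polar φ e x ≠ 0 → g x = x := by
    intro x hx
    obtain ⟨c, hc⟩ := hsing _ (hgU x) _ (hgU v) (hs x) (hs v) (horth x) he0
    have h3 := hg x
    rw [show g x = x + c • e by rw [← hc]; abel, form_add, form_smul, hs v, polar_smul_right,
      polar_comm φ x e, smul_eq_mul] at h3
    have h4 : c = 0 := by
      have : c * polar φ e x = 0 := by linear_combination h3
      exact (mul_eq_zero.1 this).resolve_right hx
    rw [h4, zero_smul, sub_eq_zero] at hc
    exact hc
  obtain ⟨y, hy⟩ : ∃ y, polar φ e y ≠ 0 := by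
    by_contra! h
    exact he0 (hreg e h (hs v))
  by_cases hev : polar φ e v = 0
  · have h3 := hl (v + y) (by rwa [polar_add_right, hev, zero_add])
    rw [map_add, hl y hy] at h3
    exact hv (add_right_cancel h3)
  · exact hv (hl v hev)

/-- If every displacement of `g` is singular, first compose with the symmetry in `e + R`, where `e`
is one of them: this keeps all fixed vectors, as they are orthogonal to `e`, and creates a
nonsingular displacement. A second symmetry then gains a fixed vector. -/
theorem mem_of_mem_orthGroup [FiniteDimensional F V] (hR : ∀ v, polar φ R v = 0) (h2 : (2 : F) = 0)
    (hreg : Regular φ) (hφR : φ R ≠ 0) (hU : ∀ x, φ x ≠ 0 → x ∈ reflSet φ G) {g : V ≃ₗ[F] V}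
    (hg : g ∈ orthGroup φ) : g ∈ G := by
  refine mem_of_sub_mem_of_step (U := ⊤) h2 (fun x _ => hU x) ?_ hg (fun _ => trivial)
  intro g hg _ hs h1
  have hR' : ∀ v, polar φ v R = 0 := fun v => by rw [polar_comm, hR]
  obtain ⟨v, hv⟩ : ∃ v, g v ≠ v := by
    by_contra! h
    exact h1 (LinearEquiv.ext h)
  set e := g v - v with he
  have he0 : e ≠ 0 := sub_ne_zero.2 hv
  have horth : ∀ x, polar φ (g x - x) e = 0 := by
    intro x
    have h3 := hs (x + v)
    rw [show g (x + v) - (x + v) = (g x - x) + e by rw [map_add, he]; abel, form_add, hs x, hs v]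
      at h3
    simpa using h3
  have heF : ∀ x ∈ fixedSpace g, polar φ e x = 0 := fun x hx =>
    polar_sub_of_mem_fixedSpace hg hx v
  obtain ⟨y, hy⟩ : ∃ y, polar φ e y ≠ 0 := by
    by_contra! h
    exact he0 (hreg e h (hs v))
  have hφe : φ (e + R) = φ R := by rw [form_add, hs v, hR', add_zero, zero_add]
  set g' := rho φ (e + R) * g with hg'
  have hgO' : g' ∈ orthGroup φ := (orthGroup φ).mul_mem (rho_mem_orthGroup φ _) hg
  have hfix : fixedSpace g ≤ fixedSpace g' := by
    intro x hx
    rw [mem_fixedSpace, hg', LinearEquiv.mul_apply, mem_fixedSpace.1 hx]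
    refine rho_apply_of_orthogonal_two h2 ?_
    rw [polar_add_left, heF x hx, hR, add_zero]
  have hdiff : g' y - y = (g y - y) + (polar φ e y / φ R) • (e + R) := by
    have h3 : polar φ e (g y) = polar φ e y := by
      have := horth y
      rw [polar_comm, polar_sub_right, sub_eq_zero] at this
      exact this
    rw [hg', LinearEquiv.mul_apply, rho_apply_two h2, hφe, polar_add_left, hR, add_zero, h3]
    abel
  have hw : φ (g' y - y) ≠ 0 := by
    rw [hdiff, form_add, hs y, polar_smul_right, polar_add_right, horth y, hR', form_smul, hφe,
      add_zero, smul_zero, add_zero, zero_add]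
    exact mul_ne_zero (pow_ne_zero 2 (div_ne_zero hy hφR)) hφR
  refine ⟨rho φ (g' y - y) * rho φ (e + R), G.mul_mem (hU _ hw).2 (hU _ ?_).2,
    (orthGroup φ).mul_mem (rho_mem_orthGroup φ _) (rho_mem_orthGroup φ _), fun _ => trivial, ?_⟩
  · rwa [hφe]
  rw [mul_assoc, ← hg']
  refine lt_of_le_of_ne (fun x hx => ?_) fun heq => hy (heF y ?_)
  · rw [mem_fixedSpace, LinearEquiv.mul_apply, mem_fixedSpace.1 (hfix hx)]
    exact rho_apply_of_orthogonal_two h2 (polar_sub_of_mem_fixedSpace hgO' (hfix hx) y)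
  · rw [heq, mem_fixedSpace, LinearEquiv.mul_apply]
    exact rho_sub_apply h2 hgO' hw

end EvenGeneration

/-! ### From generators of the orthogonal group to string C-groups -/

section Framework

variable {F V : Type*} [Field F] [AddCommGroup V] [Module F V] {φ : QuadraticForm F V}

/-- The group generated by the `rho (u i)` with `i ∈ I`. -/
def genGroup (φ : QuadraticForm F V) {n : ℕ} (u : Fin n → V) (I : Set (Fin n)) :
    Subgroup (V ≃ₗ[F] V) :=
  Subgroup.closure ((fun i => rho φ (u i)) '' I)

theorem rho_mem_genGroup {n : ℕ} (u : Fin n → V) {I : Set (Fin n)} {i : Fin n} (hi : i ∈ I) :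
    rho φ (u i) ∈ genGroup φ u I :=
  Subgroup.subset_closure ⟨i, hi, rfl⟩

theorem genGroup_mono {n : ℕ} (u : Fin n → V) {I J : Set (Fin n)} (h : I ⊆ J) :
    genGroup φ u I ≤ genGroup φ u J :=
  Subgroup.closure_mono (Set.image_mono h)

theorem genGroup_le_orthGroup {n : ℕ} (u : Fin n → V) (I : Set (Fin n)) :
    genGroup φ u I ≤ orthGroup φ := by
  rw [genGroup, Subgroup.closure_le]
  rintro _ ⟨i, -, rfl⟩
  exact rho_mem_orthGroup φ _

/-- The common part of two consecutive intervals of generators is an interval inside the three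
middle indices, so only seven sets have to be examined. -/
theorem forall_interval {P : Set (Fin 5) → Prop} (h0 : P ∅) (h1 : P {1}) (h2 : P {2}) (h3 : P {3})
    (h12 : P {1, 2}) (h23 : P {2, 3}) (h123 : P {1, 2, 3}) (a b : ℕ) (hab : a < b) (hb : b ≤ 4) :
    P {i | a + 1 ≤ (i : ℕ) ∧ (i : ℕ) < b} := by
  have key : ∀ S : Set (Fin 5), P S → (∀ i : Fin 5, i ∈ S ↔ a + 1 ≤ (i : ℕ) ∧ (i : ℕ) < b) →
      P {i | a + 1 ≤ (i : ℕ) ∧ (i : ℕ) < b} := by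
    intro S hS h
    have : S = {i : Fin 5 | a + 1 ≤ (i : ℕ) ∧ (i : ℕ) < b} := Set.ext h
    rwa [← this]
  have he : ∀ i : Fin 5, (i = 1 ↔ (i : ℕ) = 1) ∧ (i = 2 ↔ (i : ℕ) = 2) ∧ (i = 3 ↔ (i : ℕ) = 3) := by
    decide
  by_cases c0 : b = a + 1
  · refine key _ h0 fun i => ?_
    simp only [Set.mem_empty_iff_false, false_iff]
    omega
  by_cases c1 : b = a + 2
  · rcases (show a = 0 ∨ a = 1 ∨ a = 2 by omega) with rfl | rfl | rfl
    · refine key _ h1 fun i => ?_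
      rw [Set.mem_singleton_iff, (he i).1]
      omega
    · refine key _ h2 fun i => ?_
      rw [Set.mem_singleton_iff, (he i).2.1]
      omega
    · refine key _ h3 fun i => ?_
      rw [Set.mem_singleton_iff, (he i).2.2]
      omega
  by_cases c2 : b = a + 3
  · rcases (show a = 0 ∨ a = 1 by omega) with rfl | rfl
    · refine key _ h12 fun i => ?_
      rw [Set.mem_insert_iff, Set.mem_singleton_iff, (he i).1, (he i).2.1]
      omega
    · refine key _ h23 fun i => ?_
      rw [Set.mem_insert_iff, Set.mem_singleton_iff, (he i).2.1, (he i).2.2]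
      omega
  · refine key _ h123 fun i => ?_
    rw [Set.mem_insert_iff, Set.mem_insert_iff, Set.mem_singleton_iff, (he i).1, (he i).2.1,
      (he i).2.2]
    omega

theorem commute_rho {x y : V} (h : polar φ x y = 0) : Commute (rho φ x) (rho φ y) := by
  have hyx : polar φ y x = 0 := by rw [polar_comm, h]
  ext v
  simp only [LinearEquiv.mul_apply, rho_apply, polar_sub_right, polar_smul_right, h, hyx, smul_zero,
    zero_sub, neg_div, neg_smul]
  abel

theorem orderOf_rho {n : ℕ} (u : Module.Basis (Fin n) F V) {i j : Fin n} (hij : i ≠ j)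
    (hi : φ (u i) ≠ 0) (h : polar φ (u i) (u j) ≠ 0) : orderOf (rho φ (u i)) = 2 := by
  refine orderOf_eq_prime (by rw [pow_two, rho_mul_self]) fun h1 => ?_
  have h2 : rho φ (u i) (u j) = u j := by rw [h1]; rfl
  rw [rho_apply] at h2
  have h3 := congrArg (fun x => u.repr x i) h2
  simp [hij.symm] at h3
  exact h3.elim h hi

/-- The string C-group property for the group generated by the `rho (u i)`, reduced to
the intersections of consecutive intervals. -/
theorem isStringCGroup_of_intervals (u : Module.Basis (Fin 5) F V) (Ω : Subgroup (V ≃ₗ[F] V))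
    (hΩ : genGroup φ u Set.univ = Ω) (hne : ∀ i, φ (u i) ≠ 0)
    (h1 : ∀ i j : Fin 5, (i : ℕ) + 1 = j → polar φ (u i) (u j) = 1)
    (h0 : ∀ i j : Fin 5, (i : ℕ) + 1 < j → polar φ (u i) (u j) = 0)
    (hmeet : ∀ a b : ℕ, a < b → b ≤ 4 → ∀ g,
      g ∈ genGroup φ u {i | a ≤ (i : ℕ) ∧ (i : ℕ) < b} →
      g ∈ genGroup φ u {i | a + 1 ≤ (i : ℕ) ∧ (i : ℕ) < b + 1} →
      g ∈ genGroup φ u {i | a + 1 ≤ (i : ℕ) ∧ (i : ℕ) < b})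
    (ρ : Fin 5 → Ω) (hρ : ∀ i, (ρ i : V ≃ₗ[F] V) = rho φ (u i)) : IsStringCGroup ρ := by
  have hmem : ∀ (I : Set (Fin 5)) (x : Ω),
      x ∈ Subgroup.closure (ρ '' I) ↔ (x : V ≃ₗ[F] V) ∈ genGroup φ u I := by
    intro I x
    have : (Subgroup.closure (ρ '' I)).map Ω.subtype = genGroup φ u I := by
      rw [MonoidHom.map_closure, genGroup, Set.image_image]
      congr 1
      exact Set.image_congr fun i _ => hρ i
    rw [← this]
    exact (Subgroup.mem_map_iff_mem Ω.subtype_injective).symm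
  refine ⟨?_, ?_, ?_, ?_⟩
  · rw [eq_top_iff]
    intro x _
    rw [← Set.image_univ, hmem, hΩ]
    exact x.2
  · intro i
    rw [← Subgroup.orderOf_coe, hρ]
    by_cases hi : (i : ℕ) + 1 < 5
    · refine orderOf_rho u (j := ⟨i + 1, hi⟩) (fun h => ?_) (hne i) ?_
      · have := congrArg Fin.val h
        simp at this
      · rw [h1 i ⟨i + 1, hi⟩ rfl]
        exact one_ne_zero
    · have hi' : (i : ℕ) - 1 < 5 := by omega
      refine orderOf_rho u (j := ⟨i - 1, hi'⟩) (fun h => ?_) (hne i) ?_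
      · have := congrArg Fin.val h
        simp only at this
        omega
      · rw [polar_comm, h1 ⟨i - 1, hi'⟩ i (by simp only; omega)]
        exact one_ne_zero
  · intro i j hij
    apply Subtype.ext
    rw [Subgroup.coe_mul, Subgroup.coe_mul, hρ, hρ]
    exact commute_rho (h0 i j hij)
  · intro I J
    refine le_antisymm ?_ (le_inf (Subgroup.closure_mono (Set.image_mono Set.inter_subset_left))
      (Subgroup.closure_mono (Set.image_mono Set.inter_subset_right)))
    rintro x ⟨hI, hJ⟩
    replace hI := (hmem I x).1 hI
    replace hJ := (hmem J x).1 hJ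
    rw [hmem]
    -- `intersection_of_intervals` is indexed by the natural numbers; beyond the last generator the
    -- sequence is continued by 1, which commutes with everything.
    let r : ℕ → V ≃ₗ[F] V := fun n => if h : n < 5 then rho φ (u ⟨n, h⟩) else 1
    have hr : ∀ S : Set (Fin 5), r '' (Fin.val '' S) = (fun i => rho φ (u i)) '' S := by
      intro S
      rw [Set.image_image]
      exact Set.image_congr fun i _ => by simp [r]
    have hIco : ∀ a b, b ≤ 5 → Fin.val '' {i : Fin 5 | a ≤ (i : ℕ) ∧ (i : ℕ) < b} = Set.Ico a b := by
      intro a b hb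
      ext n
      constructor
      · rintro ⟨i, hi, rfl⟩
        exact hi
      · intro hn
        exact ⟨⟨n, lt_of_lt_of_le hn.2 hb⟩, hn, rfl⟩
    have := intersection_of_intervals r (fun i j hij => by
        by_cases hj : j < 5
        · have hi : i < 5 := by omega
          simp only [r, dif_pos hi, dif_pos hj]
          exact commute_rho (h0 ⟨i, hi⟩ ⟨j, hj⟩ hij)
        · simp only [r, dif_neg hj]
          exact Commute.one_right _) 4 (fun a b hab hb g hg hg' => by
        rw [← hIco _ _ (by omega), hr] at hg hg' ⊢
        exact hmeet a b hab hb g hg hg') 5 0 (by norm_num) (Fin.val '' I) (Fin.val '' J)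
      (by rintro _ ⟨i, -, rfl⟩; exact ⟨Nat.zero_le _, by simp⟩)
      (by rintro _ ⟨i, -, rfl⟩; exact ⟨Nat.zero_le _, by simp⟩) x
      (by rw [hr]; exact hI) (by rw [hr]; exact hJ)
    rw [← Set.image_inter Fin.val_injective, hr] at this
    exact this

theorem exists_isStd_one [Finite F] [FiniteDimensional F V] {b : Module.Basis (Fin 5) F V} {c s : F}
    (hb : IsStd φ b c) (hs : s ≠ 0) (hc : c = s ^ 2) :
    ∃ b' : Module.Basis (Fin 5) F V, IsStd φ b' 1 := by
  refine ⟨b.unitsSMul (fun i => if i = 4 then (Units.mk0 s hs)⁻¹ else 1), fun v => ?_⟩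
  rw [hb v, hc]
  simp [Module.Basis.repr_unitsSMul, Units.smul_def]
  ring

end Framework

/-! ### Even q: generation and intersections -/

section EvenMain

variable {F V : Type*} [Field F] [AddCommGroup V] [Module F V] {φ : QuadraticForm F V}

/-- The order depends only on the trace, which is symmetric in `a` and `b`. -/
theorem orderOf_hMatrix_comm {a b : F} (ha : a ≠ 0) (hb : b ≠ 0) :
    orderOf (hMatrix a b) = orderOf (hMatrix b a) :=
  orderOf_eq_of_dvd (τ := 1 / (b * a) - 2) (quadPoly_dvd_pow_sub_one_iff hb ha) fun n => by
    rw [mul_comm b a, quadPoly_dvd_pow_sub_one_iff ha hb, orderOf_dvd_iff_pow_eq_one]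

theorem HasOrderEven.symm {a b : F} (ha : a ≠ 0) (hb : b ≠ 0) (h : HasOrderEven a b) :
    HasOrderEven b a := by
  rwa [HasOrderEven, orderOf_hMatrix_comm hb ha]

theorem sub_mem_span_of_mem_genGroup (h2 : (2 : F) = 0) {n : ℕ} (u : Fin n → V) {I : Set (Fin n)}
    {g : V ≃ₗ[F] V} (hg : g ∈ genGroup φ u I) (v : V) : g v - v ∈ Submodule.span F (u '' I) := by
  induction hg using Subgroup.closure_induction generalizing v with
  | mem x hx =>
    obtain ⟨i, hi, rfl⟩ := hx
    rw [rho_apply_two h2, add_sub_cancel_left]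
    exact Submodule.smul_mem _ _ (Submodule.subset_span ⟨i, hi, rfl⟩)
  | one => simp
  | mul x y _ _ hx hy =>
    rw [LinearEquiv.mul_apply, ← sub_add_sub_cancel]
    exact Submodule.add_mem _ (hx _) (hy _)
  | inv x _ hx =>
    have := hx (x⁻¹ v)
    rw [← LinearEquiv.mul_apply, mul_inv_cancel, ← Submodule.neg_mem_iff, neg_sub] at this
    exact this

theorem mem_span_inter {n : ℕ} (u : Module.Basis (Fin n) F V) {I J : Set (Fin n)} {x : V}
    (hI : x ∈ Submodule.span F (u '' I)) (hJ : x ∈ Submodule.span F (u '' J)) :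
    x ∈ Submodule.span F (u '' (I ∩ J)) := by
  rw [Module.Basis.mem_span_image] at hI hJ ⊢
  exact Set.subset_inter hI hJ

variable [Finite F]

theorem mem_reflSet_of_plane_even (h2 : (2 : F) = 0) (hq : 4 ≤ Nat.card F)
    {G : Subgroup (V ≃ₗ[F] V)} {u v : V} (hu : u ∈ reflSet φ G)
    (hv : v ∈ reflSet φ G) (huv : polar φ u v = 1) (hord : HasOrderEven (φ u) (φ v)) (a b : F)
    (hx : φ (a • u + b • v) ≠ 0) : a • u + b • v ∈ reflSet φ G := by
  obtain ⟨s, hs⟩ := exists_sq_two h2 (φ (a • u + b • v) / φ u)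
  have hu0 := hu.1
  refine mem_reflSet_of_plane hu hv huv ?_ rfl (s := s) ?_ ?_ ?_ ?_
  · rw [show (4 : F) = 2 * 2 by norm_num, h2]
    simp
  · rcases hord with h | h <;> rw [h] <;> omega
  · rcases hord with h | h <;> rw [h]
    · exact Or.inl ⟨dvd_rfl, dvd_mul_left _ _⟩
    · exact Or.inr ⟨dvd_rfl, dvd_mul_left _ _⟩
  · rintro rfl
    rw [zero_pow two_ne_zero] at hs
    exact div_ne_zero hx hu0 hs.symm
  · rw [hs, div_mul_cancel₀ _ hu0]

/-- Because `α ≠ ξ`, the vectors `u 1 + u 3` and `u 2 + u 4`, the radicals of the spaces of `u 1, u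
2, u 3` and of `u 2, u 3, u 4`, are nonsingular, so each of these spaces is filled from a plane and
one further generator. The radical of the whole space is spanned by `R = u 0 + u 2 + u 4`, of norm
`α`. Since `u 0 + R = u 2 + u 4` lies in the second space, the plane of `u 0` and `u 1` acquires a
symmetry outside it, which fills its sum with `R`; from there the cosets of `R` are filled along the
path. For the intersections, `mem_of_sub_mem` identifies each small subgroup by the displacements of
its elements. -/
theorem genGroup_eq_orthGroup_and_intersection (h2 : (2 : F) = 0) (hq : 4 ≤ Nat.card F) {ξ α : F}
    (hξ : XiEven ξ) (hα : α ∈ GammaEven ξ) (u : Module.Basis (Fin 5) F V)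
    (hd : φ (u 0) = ξ ∧ φ (u 1) = ξ ∧ φ (u 2) = α ∧ φ (u 3) = α ∧ φ (u 4) = ξ)
    (h1 : ∀ i j : Fin 5, (i : ℕ) + 1 = j → polar φ (u i) (u j) = 1)
    (h0 : ∀ i j : Fin 5, (i : ℕ) + 1 < j → polar φ (u i) (u j) = 0) :
    Regular φ ∧ genGroup φ u Set.univ = orthGroup φ ∧
    ∀ a b : ℕ, a < b → b ≤ 4 → ∀ g,
      g ∈ genGroup φ u {i | a ≤ (i : ℕ) ∧ (i : ℕ) < b} →
      g ∈ genGroup φ u {i | a + 1 ≤ (i : ℕ) ∧ (i : ℕ) < b + 1} →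
      g ∈ genGroup φ u {i | a + 1 ≤ (i : ℕ) ∧ (i : ℕ) < b} := by
  obtain ⟨hξ0, hξξ⟩ := hξ
  obtain ⟨hα0, hαξ, hαα, hξα⟩ := hα
  obtain ⟨d0, d1, d2, d3, d4⟩ := hd
  have hfd : FiniteDimensional F V := Module.Basis.finiteDimensional_of_finite u
  have hsum : α + ξ ≠ 0 := fun h => hαξ (by linear_combination h - ξ * h2)
  have p01 := h1 0 1 rfl
  have p12 := h1 1 2 rfl
  have p23 := h1 2 3 rfl
  have p34 := h1 3 4 rfl
  have p02 := h0 0 2 (by decide)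
  have p03 := h0 0 3 (by decide)
  have p04 := h0 0 4 (by decide)
  have p13 := h0 1 3 (by decide)
  have p14 := h0 1 4 (by decide)
  have p24 := h0 2 4 (by decide)
  have p10 : polar φ (u 1) (u 0) = 1 := by rw [polar_comm, p01]
  have p21 : polar φ (u 2) (u 1) = 1 := by rw [polar_comm, p12]
  have p32 : polar φ (u 3) (u 2) = 1 := by rw [polar_comm, p23]
  have p43 : polar φ (u 4) (u 3) = 1 := by rw [polar_comm, p34]
  have p20 : polar φ (u 2) (u 0) = 0 := by rw [polar_comm, p02]
  have p30 : polar φ (u 3) (u 0) = 0 := by rw [polar_comm, p03]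
  have p40 : polar φ (u 4) (u 0) = 0 := by rw [polar_comm, p04]
  have p31 : polar φ (u 3) (u 1) = 0 := by rw [polar_comm, p13]
  have p41 : polar φ (u 4) (u 1) = 0 := by rw [polar_comm, p14]
  have p42 : polar φ (u 4) (u 2) = 0 := by rw [polar_comm, p24]
  have hself := polar_self_two (φ := φ) h2
  have hne : ∀ i, φ (u i) ≠ 0 := by
    intro i
    fin_cases i
    exacts [d0 ▸ hξ0, d1 ▸ hξ0, d2 ▸ hα0, d3 ▸ hα0, d4 ▸ hξ0]
  have hS : ∀ (I : Set (Fin 5)) i, i ∈ I → u i ∈ reflSet φ (genGroup φ u I) := fun I i hi =>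
    ⟨hne i, rho_mem_genGroup u hi⟩
  -- the planes
  have hP01 : ∀ a b : F, φ (a • u 0 + b • u 1) ≠ 0 →
      a • u 0 + b • u 1 ∈ reflSet φ (genGroup φ u Set.univ) := fun a b =>
    mem_reflSet_of_plane_even h2 hq (hS _ 0 (Set.mem_univ _)) (hS _ 1 (Set.mem_univ _)) p01
      (by rw [d0, d1]; exact hξξ) a b
  have hP12 : ∀ a b : F, φ (a • u 1 + b • u 2) ≠ 0 →
      a • u 1 + b • u 2 ∈ reflSet φ (genGroup φ u {1, 2}) := fun a b =>
    mem_reflSet_of_plane_even h2 hq (hS _ 1 (by simp)) (hS _ 2 (by simp)) p12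
      (by rw [d1, d2]; exact hξα) a b
  have hP23 : ∀ a b : F, φ (a • u 2 + b • u 3) ≠ 0 →
      a • u 2 + b • u 3 ∈ reflSet φ (genGroup φ u {2, 3}) := fun a b =>
    mem_reflSet_of_plane_even h2 hq (hS _ 2 (by simp)) (hS _ 3 (by simp)) p23
      (by rw [d2, d3]; exact hαα) a b
  -- the three-dimensional spaces
  have hU123 : ∀ a b c : F, φ (a • u 1 + b • u 2 + c • u 3) ≠ 0 →
      a • u 1 + b • u 2 + c • u 3 ∈ reflSet φ (genGroup φ u {1, 2, 3}) := by
    intro a b c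
    have hr : φ (u 1 + u 3) ≠ 0 := by
      rw [form_add, d1, d3, p13, add_zero, add_comm]
      exact hsum
    have := mem_reflSet_of_plane_add (G := genGroup φ u {1, 2, 3}) hq h2 (r := u 1 + u 3) p12
      (by rw [polar_add_right, hself, p13, add_zero])
      (by rw [polar_add_right, p21, p23]; linear_combination h2) hr
      (fun a b h => reflSet_mono (genGroup_mono u (by
        rintro x (rfl | rfl) <;> simp)) (hP12 a b h)) (a₀ := 1) (b₀ := 0)
      (by rw [one_smul, zero_smul, add_zero]; exact hne 1)
      (by
        rw [one_smul, zero_smul, add_zero, ← add_assoc, ← two_smul F (u 1), h2, zero_smul, zero_add]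
        exact hS _ 3 (by simp)) (a - c) b c
    rwa [show (a - c) • u 1 + b • u 2 + c • (u 1 + u 3) = a • u 1 + b • u 2 + c • u 3 by module]
      at this
  have hU234 : ∀ a b c : F, φ (a • u 2 + b • u 3 + c • u 4) ≠ 0 →
      a • u 2 + b • u 3 + c • u 4 ∈ reflSet φ (genGroup φ u Set.univ) := by
    intro a b c
    have hr : φ (u 2 + u 4) ≠ 0 := by
      rw [form_add, d2, d4, p24, add_zero]
      exact hsum
    have := mem_reflSet_of_plane_add (G := genGroup φ u Set.univ) hq h2 (r := u 2 + u 4) p23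
      (by rw [polar_add_right, hself, p24, add_zero])
      (by rw [polar_add_right, p32, p34]; linear_combination h2) hr
      (fun a b h => reflSet_mono (genGroup_mono u (Set.subset_univ _)) (hP23 a b h))
      (a₀ := 1) (b₀ := 0)
      (by rw [one_smul, zero_smul, add_zero]; exact hne 2)
      (by
        rw [one_smul, zero_smul, add_zero, ← add_assoc, ← two_smul F (u 2), h2, zero_smul, zero_add]
        exact hS _ 4 trivial) (a - c) b c
    rwa [show (a - c) • u 2 + b • u 3 + c • (u 2 + u 4) = a • u 2 + b • u 3 + c • u 4 by module]
      at this
  -- the radical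
  obtain ⟨R, hRdef⟩ : ∃ R, R = u 0 + u 2 + u 4 := ⟨_, rfl⟩
  have hcoord : ∀ x : V, ∃ a : Fin 5 → F,
      x = a 0 • u 0 + a 1 • u 1 + a 2 • u 2 + a 3 • u 3 + a 4 • u 4 := fun x =>
    ⟨u.repr x, (basis_sum_five u x).symm⟩
  have hR : ∀ v, polar φ R v = 0 := by
    intro v
    obtain ⟨a, rfl⟩ := hcoord v
    rw [hRdef]
    simp only [polar_add_left, polar_add_right, polar_smul_right, hself, p01, p23, p02,
      p03, p04, p24, p21, p43, p20, p40, p41, p42, smul_eq_mul]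
    linear_combination (a 1 + a 3) * h2
  have hφR : φ R ≠ 0 := by
    rw [hRdef, form_add, form_add, polar_add_left, d0, d2, d4, p02, p04, p24]
    intro h
    exact hα0 (by linear_combination h - ξ * h2)
  have hreg : Regular φ := by
    intro y hy hy0
    obtain ⟨a, rfl⟩ := hcoord y
    have e : ∀ i, polar φ (a 0 • u 0 + a 1 • u 1 + a 2 • u 2 + a 3 • u 3 + a 4 • u 4) (u i) = 0 :=
      fun i => hy _
    have e0 := e 0
    have e1 := e 1
    have e3 := e 3
    have e4 := e 4
    simp only [polar_add_left, polar_smul_left, hself, p01, p23, p34,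
      p03, p04, p13, p14, p24, p10, p21, p43, p20, p30, p40, p31, p41, smul_eq_mul,
      mul_one, mul_zero, add_zero, zero_add] at e0 e1 e3 e4
    have f2 : a 2 = a 0 := by linear_combination e1 - a 0 * h2
    have f4 : a 4 = a 0 := by linear_combination e3 - e1 - a 0 * h2 + a 0 * h2
    rw [e0, e4, f2, f4, zero_smul, zero_smul, add_zero, add_zero, ← smul_add, ← smul_add,
      ← hRdef] at hy0 ⊢
    rw [form_smul] at hy0
    rw [pow_eq_zero_iff two_ne_zero |>.1 ((mul_eq_zero.1 hy0).resolve_right hφR), zero_smul]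
  have hP01R : ∀ a b c : F, φ (a • u 0 + b • u 1 + c • R) ≠ 0 →
      a • u 0 + b • u 1 + c • R ∈ reflSet φ (genGroup φ u Set.univ) := by
    refine mem_reflSet_of_plane_add hq h2 p01 (by rw [polar_comm, hR]) (by rw [polar_comm, hR]) hφR
      hP01 (a₀ := 1) (b₀ := 0) (by rw [one_smul, zero_smul, add_zero]; exact hne 0) ?_
    have e : (1 : F) • u 0 + (0 : F) • u 1 + R = (1 : F) • u 2 + (0 : F) • u 3 + (1 : F) • u 4 := by
      rw [hRdef]
      match_scalars
      · linear_combination h2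
      · ring
      · ring
      · ring
      · ring
    rw [e]
    apply hU234
    rw [one_smul, zero_smul, add_zero, one_smul, form_add, d2, d4, p24, add_zero]
    exact hsum
  have hfull : ∀ x, φ x ≠ 0 → x ∈ reflSet φ (genGroup φ u Set.univ) := by
    have c0 : CosetFull φ (genGroup φ u Set.univ) R 0 := by
      intro t
      have := hP01R 0 0 t
      rwa [zero_smul, zero_smul, add_zero] at this
    have c1 : CosetFull φ (genGroup φ u Set.univ) R (u 0) := by
      intro t
      have := hP01R 1 0 t
      rwa [one_smul, zero_smul, add_zero] at this
    have c2 : CosetFull φ (genGroup φ u Set.univ) R (u 1) := by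
      intro t
      have := hP01R 0 1 t
      rwa [one_smul, zero_smul, zero_add] at this
    have c3 := c2.of_mem_reflSet hR h2 hφR (hS _ 2 trivial) (by rw [p12]; exact one_ne_zero)
    have c4 := c3.of_mem_reflSet hR h2 hφR (hS _ 3 trivial) (by rw [p23]; exact one_ne_zero)
    intro x
    obtain ⟨a, rfl⟩ := hcoord x
    have := cosetFull_of_path hR hq h2 hφR p01 p02 p03 p12 p13 p23 c0 c1 c2 c3 c4
      (a 0 - a 4) (a 1) (a 2 - a 4) (a 3) (a 4)
    rwa [show (a 0 - a 4) • u 0 + a 1 • u 1 + (a 2 - a 4) • u 2 + a 3 • u 3 + a 4 • R =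
      a 0 • u 0 + a 1 • u 1 + a 2 • u 2 + a 3 • u 3 + a 4 • u 4 by rw [hRdef]; module] at this
  refine ⟨hreg, le_antisymm (genGroup_le_orthGroup u _) fun g hg =>
    mem_of_mem_orthGroup hR h2 hreg hφR hfull hg, ?_⟩
  -- intersections
  have hK : ∀ a b : ℕ, a < b → b ≤ 4 → ∀ g ∈ orthGroup φ,
      (∀ v, g v - v ∈ Submodule.span F (u '' {i | a + 1 ≤ (i : ℕ) ∧ (i : ℕ) < b})) →
      g ∈ genGroup φ u {i | a + 1 ≤ (i : ℕ) ∧ (i : ℕ) < b} := by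
    have hline : ∀ i : Fin 5, ∀ g ∈ orthGroup φ, (∀ v, g v - v ∈ Submodule.span F (u '' {i})) →
        g ∈ genGroup φ u {i} := by
      intro i g hg hgU
      refine mem_of_sub_mem h2 hreg ?_ ?_ hg hgU
      · intro x hx hx0
        rw [Set.image_singleton, Submodule.mem_span_singleton] at hx
        obtain ⟨c, rfl⟩ := hx
        refine smul_mem_reflSet (fun h => hx0 ?_) (hS _ i rfl)
        rw [h, zero_smul, QuadraticMap.map_zero]
      · intro d _ e he _ he0 _ hne0
        rw [Set.image_singleton, Submodule.mem_span_singleton] at he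
        obtain ⟨c, rfl⟩ := he
        rw [form_smul] at he0
        exact absurd (by rw [pow_eq_zero_iff two_ne_zero |>.1
          ((mul_eq_zero.1 he0).resolve_right (hne i)), zero_smul]) hne0
    have hplane : ∀ i j : Fin 5, polar φ (u i) (u j) = 1 →
        (∀ a b : F, φ (a • u i + b • u j) ≠ 0 →
          a • u i + b • u j ∈ reflSet φ (genGroup φ u {i, j})) →
        ∀ g ∈ orthGroup φ, (∀ v, g v - v ∈ Submodule.span F (u '' {i, j})) →
        g ∈ genGroup φ u {i, j} := by
      intro i j hij hP g hg hgU
      have hji : polar φ (u j) (u i) = 1 := by rw [polar_comm, hij]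
      refine mem_of_sub_mem h2 hreg ?_ ?_ hg hgU
      · intro x hx
        rw [Set.image_pair, Submodule.mem_span_pair] at hx
        obtain ⟨a, b, rfl⟩ := hx
        exact hP a b
      · intro d hd e he _ _ hde hne0
        rw [Set.image_pair, Submodule.mem_span_pair] at hd he
        obtain ⟨a, b, rfl⟩ := hd
        obtain ⟨x, y, rfl⟩ := he
        simp only [polar_add_left, polar_smul_left, polar_add_right, polar_smul_right, hij, hji,
          hself, smul_eq_mul, mul_one, mul_zero, add_zero, zero_add] at hde
        by_cases hx : x = 0
        · have hy : y ≠ 0 := by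
            rintro rfl
            exact hne0 (by rw [hx, zero_smul, zero_smul, add_zero])
          refine ⟨b / y, ?_⟩
          have ha : a = 0 := by
            rw [hx] at hde
            exact (mul_eq_zero.1 (by linear_combination hde : a * y = 0)).resolve_right hy
          rw [hx, ha, zero_smul, zero_add, zero_add, smul_smul, div_mul_cancel₀ _ hy]
        · refine ⟨a / x, ?_⟩
          match_scalars
          · field_simp
          · field_simp
            linear_combination hde - a * y * h2
    refine forall_interval (P := fun K => ∀ g ∈ orthGroup φ,
      (∀ v, g v - v ∈ Submodule.span F (u '' K)) → g ∈ genGroup φ u K) ?_ (hline 1) (hline 2)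
      (hline 3) (hplane 1 2 p12 hP12) (hplane 2 3 p23 hP23) ?_
    · intro g _ hgU
      have : g = 1 := by
        ext v
        have := hgU v
        rw [Set.image_empty, Submodule.span_empty, Submodule.mem_bot, sub_eq_zero] at this
        exact this
      rw [this]
      exact Subgroup.one_mem _
    · intro g hg hgU
      have hspan : ∀ x, x ∈ Submodule.span F (u '' {1, 2, 3}) ↔
          ∃ a b c : F, x = a • u 1 + b • u 2 + c • u 3 := by
        intro x
        rw [Set.image_insert_eq, Set.image_pair, Submodule.mem_span_insert]
        simp only [Submodule.mem_span_pair]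
        constructor
        · rintro ⟨a, _, ⟨b, c, rfl⟩, rfl⟩
          exact ⟨a, b, c, by rw [add_assoc]⟩
        · rintro ⟨a, b, c, rfl⟩
          exact ⟨a, _, ⟨b, c, rfl⟩, by rw [add_assoc]⟩
      refine mem_of_sub_mem h2 hreg ?_ ?_ hg hgU
      · intro x hx
        obtain ⟨a, b, c, rfl⟩ := (hspan x).1 hx
        exact hU123 a b c
      · intro d hd e he hd0 he0 hde hne0
        obtain ⟨a, b, c, rfl⟩ := (hspan d).1 hd
        obtain ⟨x, y, z, rfl⟩ := (hspan e).1 he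
        simp only [polar_add_left, polar_smul_left, polar_add_right, polar_smul_right, p12, p13,
          p23, p21, p31, p32, hself, smul_eq_mul, mul_one, mul_zero, add_zero, zero_add] at hde
        have hform : ∀ a b c : F, φ (a • u 1 + b • u 2 + c • u 3) =
            a ^ 2 * ξ + b ^ 2 * α + c ^ 2 * α + a * b + b * c := by
          intro a b c
          simp only [form_add, form_smul, polar_add_left, polar_smul_left, polar_smul_right, p12,
            p13, p23, d1, d2, d3, smul_eq_mul]
          ring
        rw [hform] at hd0 he0
        -- coordinates with respect to `u 1`, `u 2` and the radical `u 1 + u 3`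
        have key : ∀ k : F, a + c = k * (x + z) → b = k * y →
            ∃ k : F, a • u 1 + b • u 2 + c • u 3 = k • (x • u 1 + y • u 2 + z • u 3) := by
          intro k hk1 hk2
          -- Subtracting `k` times the second vector leaves `c - k z` times the radical vector `u 1
          -- + u 3`, whose norm is `α + ξ`. Both given vectors are singular, so this remainder is
          -- singular and must vanish.
          have hc : (c - k * z) ^ 2 * (α + ξ) = 0 := by
            have ha : a = k * (x + z) - c := by linear_combination hk1
            rw [ha, hk2] at hd0
            linear_combination hd0 - k ^ 2 * he0 +
              (ξ * (c - k * z) * (c - k * z - c + k * x + k * z) - α * k * z * (c - k * z) ) * h2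
          have hc' := sub_eq_zero.1
            (pow_eq_zero_iff two_ne_zero |>.1 ((mul_eq_zero.1 hc).resolve_right hsum))
          refine ⟨k, ?_⟩
          rw [hk2, hc', show a = k * x by linear_combination hk1 - hc']
          module
        by_cases hy : y = 0
        · by_cases hxz : x + z = 0
          · exfalso
            apply hne0
            have hz : x = z := by linear_combination hxz - z * h2
            rw [hy, hz] at he0
            have : z ^ 2 * (α + ξ) = 0 := by linear_combination he0
            have hz0 := pow_eq_zero_iff two_ne_zero |>.1 ((mul_eq_zero.1 this).resolve_right hsum)
            rw [hy, hz, hz0]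
            simp
          · refine key ((a + c) / (x + z)) (by rw [div_mul_cancel₀ _ hxz]) ?_
            rw [hy, mul_zero]
            rw [hy] at hde
            exact (mul_eq_zero.1 (by linear_combination hde : b * (x + z) = 0)).resolve_right hxz
        · refine key (b / y) ?_ (by rw [div_mul_cancel₀ _ hy])
          field_simp
          linear_combination hde - b * (x + z) * h2
  intro a b hab hb g hg hg'
  refine hK a b hab hb g (genGroup_le_orthGroup u _ hg) fun v => ?_
  have := mem_span_inter u (sub_mem_span_of_mem_genGroup h2 u hg v)
    (sub_mem_span_of_mem_genGroup h2 u hg' v)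
  refine Submodule.span_mono (Set.image_mono ?_) this
  rintro i ⟨hi, hi'⟩
  exact ⟨hi'.1, hi.2⟩

end EvenMain

/-! ### Quadratic equations over finite fields -/

section FieldLemmas

theorem exists_notMem_of_card_lt {F : Type*} [Finite F] {s : Finset F} (h : s.card < Nat.card F) : ∃ t, t ∉ s := by
  by_contra! hs
  have := Fintype.ofFinite F
  rw [Finset.eq_univ_iff_forall.2 hs, Finset.card_univ, Nat.card_eq_fintype_card] at h
  exact lt_irrefl _ h

variable {F : Type*} [Field F]

theorem exists_forall_sq_eq (a : F) : ∃ r : F, ∀ t, t ^ 2 = a → t = r ∨ t = -r := by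
  by_cases h : ∃ r : F, r ^ 2 = a
  · obtain ⟨r, rfl⟩ := h
    exact ⟨r, fun t => sq_eq_sq_iff_eq_or_eq_neg.1⟩
  · exact ⟨0, fun t ht => absurd ⟨t, ht⟩ h⟩

variable [Finite F]

theorem exists_quadratic_sum (h2 : (2 : F) ≠ 0) {a b : F} (ha : a ≠ 0) (hb : b ≠ 0) (d c : F) :
    ∃ x y : F, a * x ^ 2 + b * y ^ 2 + d * y = c := by
  open Polynomial in
  have := Fintype.ofFinite F
  have hF : ringChar F ≠ 2 := fun h => h2 (by
    have := CharP.cast_eq_zero F (ringChar F)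
    rwa [h, Nat.cast_ofNat] at this)
  obtain ⟨x, y, hxy⟩ := FiniteField.exists_root_sum_quadratic
    (f := C a * X ^ 2 + C 0 * X + C 0) (g := C b * X ^ 2 + C d * X + C (-c))
    (degree_quadratic ha) (degree_quadratic hb) (FiniteField.odd_card_of_char_ne_two hF)
  refine ⟨x, y, ?_⟩
  simp at hxy
  linear_combination hxy

/-- Ratios of values of the form `1 - D * k ^ 2` exhaust the nonzero elements. -/
theorem exists_ratio_eq (h2 : (2 : F) ≠ 0) (hq : 7 ≤ Nat.card F) {D l : F} (hD : D ≠ 0)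
    (hl : l ≠ 0) : ∃ k m : F, 1 - D * m ^ 2 ≠ 0 ∧ l * (1 - D * m ^ 2) = 1 - D * k ^ 2 := by
  by_cases hsq : IsSquare D
  · obtain ⟨d, rfl⟩ := hsq
    have hd : d ≠ 0 := left_ne_zero_of_mul hD
    classical
    -- With `M = d m` and `K = d k` the equation is the conic `l (1 - M²) = 1 - K²` through the
    -- point `(1, 1)`; the parameter is `t = (M - 1) / (K - 1)`. The five excluded values of `t` are
    -- those at which the denominator or `1 - M²` vanishes.
    obtain ⟨r, hr⟩ := exists_forall_sq_eq l⁻¹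
    obtain ⟨t, ht⟩ := exists_notMem_of_card_lt (s := {0, 1, l⁻¹, r, -r})
      (lt_of_le_of_lt Finset.card_le_five (by omega))
    simp only [Finset.mem_insert, Finset.mem_singleton, not_or] at ht
    obtain ⟨t0, t1, tl, tr, tr'⟩ := ht
    have hQ : 1 - l * t ^ 2 ≠ 0 := fun h => by
      rcases hr t (eq_inv_of_mul_eq_one_right (by linear_combination -h)) with h | h
      exacts [tr h, tr' h]
    have hlt : 1 - l * t ≠ 0 := fun h => tl (eq_inv_of_mul_eq_one_right (by linear_combination -h))
    have ht1 : 1 - t ≠ 0 := sub_ne_zero.2 (Ne.symm t1)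
    obtain ⟨Q, hQd⟩ : ∃ Q, Q = 1 - l * t ^ 2 := ⟨_, rfl⟩
    rw [← hQd] at hQ
    have e1 : 1 - d * d * ((1 - 2 * t + l * t ^ 2) / (d * Q)) ^ 2 =
        (2 * 2 * t * (1 - l * t) * (1 - t)) / Q ^ 2 := by
      field_simp
      rw [hQd]
      ring
    refine ⟨(2 * l * t - l * t ^ 2 - 1) / (d * Q), (1 - 2 * t + l * t ^ 2) / (d * Q), ?_, ?_⟩
    · rw [e1]
      exact div_ne_zero (mul_ne_zero (mul_ne_zero (mul_ne_zero (mul_ne_zero h2 h2) t0) hlt) ht1)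
        (pow_ne_zero 2 hQ)
    · rw [e1]
      field_simp
      rw [hQd]
      ring
  · obtain ⟨k, m, h⟩ := exists_quadratic_sum h2 hD (neg_ne_zero.2 (mul_ne_zero hl hD)) 0 (1 - l)
    refine ⟨k, m, fun h0 => hsq ⟨m⁻¹, ?_⟩, by linear_combination h⟩
    have hm : m ≠ 0 := by
      rintro rfl
      simp at h0
    field_simp
    linear_combination -h0

/-- A solution of `a t² + b y² = 1` with both coordinates nonzero serves at once. If a coordinate
vanishes, then `a` or `b` is a square, the equation becomes a difference of two squares, and the
factor `s` can be chosen freely outside five values. -/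
theorem exists_sq_eq_add_sq (h2 : (2 : F) ≠ 0) (hq : 7 ≤ Nat.card F) {a b : F} (ha : a ≠ 0)
    (hb : b ≠ 0) : ∃ m t y : F, m ≠ 0 ∧ t ≠ 0 ∧ y ≠ 0 ∧ m ^ 2 = a * t ^ 2 + b * y ^ 2 := by
  have key : ∀ a y₀ : F, a ≠ 0 → y₀ ≠ 0 →
      ∃ m y : F, m ≠ 0 ∧ y ≠ 0 ∧ m ^ 2 = a + (y₀ * y) ^ 2 := by
    intro a y₀ ha hy₀
    classical
    obtain ⟨r, hr⟩ := exists_forall_sq_eq a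
    obtain ⟨r', hr'⟩ := exists_forall_sq_eq (-a)
    obtain ⟨s, hs⟩ := exists_notMem_of_card_lt (s := {0, r, -r, r', -r'})
      (lt_of_le_of_lt Finset.card_le_five (by omega))
    simp only [Finset.mem_insert, Finset.mem_singleton, not_or] at hs
    obtain ⟨s0, s1, s2, s3, s4⟩ := hs
    refine ⟨(a + s ^ 2) / (2 * s), (a - s ^ 2) / (2 * s * y₀), div_ne_zero (fun h => ?_)
      (mul_ne_zero h2 s0), div_ne_zero (fun h => ?_) (mul_ne_zero (mul_ne_zero h2 s0) hy₀), ?_⟩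
    · rcases hr' s (by linear_combination h) with h | h
      exacts [s3 h, s4 h]
    · rcases hr s (by linear_combination -h) with h | h
      exacts [s1 h, s2 h]
    · field_simp
      ring
  obtain ⟨t, y, h⟩ := exists_quadratic_sum h2 ha hb 0 1
  by_cases ht : t = 0
  · have hy : y ≠ 0 := by
      rintro rfl
      simp [ht] at h
    obtain ⟨m, z, hm, hz, hmz⟩ := key a y⁻¹ ha (inv_ne_zero hy)
    refine ⟨m, 1, z, hm, one_ne_zero, hz, ?_⟩
    rw [hmz]
    rw [ht] at h
    have : b = y⁻¹ ^ 2 := by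
      field_simp
      linear_combination h
    rw [this]
    ring
  by_cases hy : y = 0
  · obtain ⟨m, z, hm, hz, hmz⟩ := key b t⁻¹ hb (inv_ne_zero ht)
    refine ⟨m, z, 1, hm, hz, one_ne_zero, ?_⟩
    rw [hmz]
    rw [hy] at h
    have : a = t⁻¹ ^ 2 := by
      field_simp
      linear_combination h
    rw [this]
    ring
  · exact ⟨1, t, y, one_ne_zero, ht, hy, by linear_combination -h⟩

theorem exists_sq_mul_of_not_isSquare {a b : F} (ha : ¬ IsSquare a) (hb : ¬ IsSquare b) :
    ∃ s : F, s ≠ 0 ∧ a = s ^ 2 * b := by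
  have hF := Fintype.ofFinite F
  classical
  have h2 : ringChar F ≠ 2 := fun h => ha (FiniteField.isSquare_of_char_two h a)
  have hb0 : b ≠ 0 := fun h => hb (h ▸ IsSquare.zero)
  have ha0 : a ≠ 0 := fun h => ha (h ▸ IsSquare.zero)
  obtain ⟨s, hs⟩ : IsSquare (a / b) := by
    rw [← quadraticChar_one_iff_isSquare (div_ne_zero ha0 hb0), div_eq_mul_inv, map_mul,
      (quadraticChar_neg_one_iff_not_isSquare).2 ha, (quadraticChar_neg_one_iff_not_isSquare).2
      (show ¬ IsSquare b⁻¹ by rwa [isSquare_inv])]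
    norm_num
  refine ⟨s, ?_, ?_⟩
  · rintro rfl
    exact div_ne_zero ha0 hb0 (by rw [hs, mul_zero])
  · rw [pow_two, ← hs, div_mul_cancel₀ _ hb0]

end FieldLemmas

/-! ### Eichler transformations and transitivity -/

section Eichler

variable {F V : Type*} [Field F] [AddCommGroup V] [Module F V] {φ : QuadraticForm F V}

/-- The group `G` contains the Eichler transformation determined by `e` and `x`. -/
def HasEich (φ : QuadraticForm F V) (G : Subgroup (V ≃ₗ[F] V)) (e x : V) : Prop :=
  ∃ g ∈ G, ∀ v, g v = v + polar φ e v • x - polar φ x v • e - (φ x * polar φ e v) • e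

variable {G : Subgroup (V ≃ₗ[F] V)} {e f : V}

theorem HasEich.mono {G' : Subgroup (V ≃ₗ[F] V)} (h : G ≤ G') {x : V} (hx : HasEich φ G e x) :
    HasEich φ G' e x := by
  obtain ⟨g, hg, hgv⟩ := hx
  exact ⟨g, h hg, hgv⟩

theorem HasEich.add (he : φ e = 0) {x y : V} (hex : polar φ e x = 0) (hey : polar φ e y = 0)
    (hx : HasEich φ G e x) (hy : HasEich φ G e y) : HasEich φ G e (x + y) := by
  obtain ⟨g, hg, hgv⟩ := hx
  obtain ⟨k, hk, hkv⟩ := hy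
  refine ⟨g * k, G.mul_mem hg hk, fun v => ?_⟩
  rw [LinearEquiv.mul_apply, hgv, hkv]
  simp only [polar_add_left, polar_add_right, polar_sub_right, polar_smul_right, polar_self_eq, he,
    hey, polar_comm φ x e, hex, form_add, smul_eq_mul]
  module

/-- The group generated by opposite Eichler transformations is transitive on vectors of
a given nonzero norm. -/
theorem exists_map_eq_of_hasEich [Finite F] (h2 : (2 : F) ≠ 0) (hq : 7 ≤ Nat.card F)
    (hG : G ≤ orthGroup φ) (hef : IsHyp φ e f) (W : Submodule F V)
    (hWe : ∀ w ∈ W, polar φ e w = 0) (hWf : ∀ w ∈ W, polar φ f w = 0)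
    (hE : ∀ w ∈ W, HasEich φ G e w) (hF : ∀ w ∈ W, HasEich φ G f w) {w₀ : V} (hw₀ : w₀ ∈ W)
    (hφw₀ : φ w₀ ≠ 0) {a b a' b' : F} {x x' : V} (hx : x ∈ W) (hx' : x' ∈ W)
    (h0 : φ (a • e + b • f + x) ≠ 0) (heq : φ (a • e + b • f + x) = φ (a' • e + b' • f + x')) :
    ∃ g ∈ G, g (a • e + b • f + x) = a' • e + b' • f + x' := by
  obtain ⟨c, hc⟩ : ∃ c, c = φ (a • e + b • f + x) := ⟨_, rfl⟩
  rw [← hc] at h0 heq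
  have hfe : polar φ f e = 1 := hef.symm.polar
  have hform : ∀ (a b : F), ∀ y ∈ W, φ (a • e + b • f + y) = a * b + φ y := by
    intro a b y hy
    simp only [form_add, form_smul, polar_add_left, polar_smul_left, polar_smul_right, hef.left,
      hef.right, hef.polar, hWe y hy, hWf y hy, smul_eq_mul]
    ring
  let conn : V → V → Prop := fun z z' => ∃ g ∈ G, g z = z'
  have htrans : ∀ {z z' z''}, conn z z' → conn z' z'' → conn z z'' := by
    rintro _ _ _ ⟨g, hg, rfl⟩ ⟨k, hk, rfl⟩
    exact ⟨k * g, G.mul_mem hk hg, rfl⟩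
  have hsymm : ∀ {z z'}, conn z z' → conn z' z := by
    rintro z _ ⟨g, hg, rfl⟩
    exact ⟨g⁻¹, G.inv_mem hg, by rw [← LinearEquiv.mul_apply, inv_mul_cancel]; rfl⟩
  have stepE : ∀ (a b : F), ∀ y ∈ W, ∀ x ∈ W, conn (a • e + b • f + y)
      ((a - polar φ x y - φ x * b) • e + b • f + (y + b • x)) := by
    intro a b y hy x hx
    obtain ⟨g, hg, hgv⟩ := hE x hx
    refine ⟨g, hg, ?_⟩
    rw [hgv]
    simp only [polar_add_right, polar_smul_right, polar_self_eq, hef.left, hef.polar,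
      polar_comm φ x e, polar_comm φ x f, hWe _ hx, hWf _ hx, hWe _ hy, smul_eq_mul]
    module
  have stepF : ∀ (a b : F), ∀ y ∈ W, ∀ x ∈ W, conn (a • e + b • f + y)
      (a • e + (b - polar φ x y - φ x * a) • f + (y + a • x)) := by
    intro a b y hy x hx
    obtain ⟨g, hg, hgv⟩ := hF x hx
    refine ⟨g, hg, ?_⟩
    rw [hgv]
    simp only [polar_add_right, polar_smul_right, polar_self_eq, hef.right, hfe,
      polar_comm φ x e, polar_comm φ x f, hWe _ hx, hWf _ hx, hWf _ hy, smul_eq_mul]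
    module
  -- Normal form: when the `f`-coordinate `b` is nonzero, a transformation along `e` clears the
  -- component in `W`, and the norm `c` then determines the `e`-coordinate. If `b = 0`, a
  -- transformation along `f` first makes it nonzero (`hnorm'`).
  have hnorm : ∀ (a b : F), ∀ y ∈ W, b ≠ 0 → φ (a • e + b • f + y) = c →
      conn (a • e + b • f + y) ((c / b) • e + b • f + (0 : V)) := by
    intro a b y hy hb h
    have := stepE a b y hy ((-b⁻¹) • y) (W.smul_mem _ hy)
    rw [hform _ _ _ hy] at h
    rw [smul_smul, polar_smul_left, form_smul, polar_self_eq, smul_eq_mul, mul_neg,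
      mul_inv_cancel₀ hb, neg_one_smul, add_neg_cancel] at this
    convert this using 4
    rw [← h]
    field_simp
    ring
  have hnorm' : ∀ (a b : F), ∀ y ∈ W, φ (a • e + b • f + y) = c →
      ∃ b', b' ≠ 0 ∧ conn (a • e + b • f + y) ((c / b') • e + b' • f + (0 : V)) := by
    intro a b y hy h
    by_cases hb : b = 0
    · have hy' : φ y = c := by rw [← h, hform _ _ _ hy, hb, mul_zero, zero_add]
      obtain ⟨t, ht⟩ : ∃ t : F, b - polar φ (t • y) y - φ (t • y) * a ≠ 0 := by
        by_contra! hall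
        have h1 := hall 1
        have h3 := hall (-1)
        simp only [polar_smul_left, form_smul, polar_self_eq, hy', hb, smul_eq_mul] at h1 h3
        have : 2 * 2 * c = 0 := by linear_combination h3 - h1
        exact mul_ne_zero (mul_ne_zero h2 h2) h0 this
      have h1 := stepF a b y hy (t • y) (W.smul_mem _ hy)
      refine ⟨_, ht, htrans h1 (hnorm _ _ _ (W.add_mem hy (W.smul_mem _ (W.smul_mem _ hy))) ht ?_)⟩
      obtain ⟨g, hg, hgz⟩ := h1
      rw [← hgz, hG hg, h]
    · exact ⟨b, hb, hnorm a b y hy hb h⟩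
  -- Moving out along `f` in the direction `w₀` and normalizing again multiplies `b` by `1 - c φ(w₀)
  -- k²`. By `exists_ratio_eq`, quotients of such factors exhaust the nonzero elements, so all
  -- normal forms of norm `c` are connected.
  have hscale : ∀ b k : F, b ≠ 0 → 1 - c * φ w₀ * k ^ 2 ≠ 0 →
      conn ((c / b) • e + b • f + (0 : V))
        ((c / (b * (1 - c * φ w₀ * k ^ 2))) • e + (b * (1 - c * φ w₀ * k ^ 2)) • f + (0 : V)) := by
    intro b k hb hk
    have h1 := stepF (c / b) b 0 W.zero_mem ((b * k) • w₀) (W.smul_mem _ hw₀)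
    have h3 : b - polar φ ((b * k) • w₀) 0 - φ ((b * k) • w₀) * (c / b) =
        b * (1 - c * φ w₀ * k ^ 2) := by
      rw [polar_zero_right, form_smul]
      field_simp
      ring
    rw [h3] at h1
    refine htrans h1 (hnorm _ _ _ (W.add_mem W.zero_mem (W.smul_mem _ (W.smul_mem _ hw₀)))
      (mul_ne_zero hb hk) ?_)
    obtain ⟨g, hg, hgz⟩ := h1
    rw [← hgz, hG hg, hform _ _ _ W.zero_mem, QuadraticMap.map_zero, add_zero, div_mul_cancel₀ _ hb]
  obtain ⟨b₁, hb₁, h1⟩ := hnorm' a b x hx hc.symm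
  obtain ⟨b₂, hb₂, h3⟩ := hnorm' a' b' x' hx' heq.symm
  obtain ⟨k, m, hm, hkm⟩ := exists_ratio_eq h2 hq (mul_ne_zero h0 hφw₀) (div_ne_zero hb₂ hb₁)
  have h4 := hscale b₂ m hb₂ hm
  have h5 := hscale b₁ k hb₁ (by rw [← hkm]; exact mul_ne_zero (div_ne_zero hb₂ hb₁) hm)
  have h6 : b₁ * (1 - c * φ w₀ * k ^ 2) = b₂ * (1 - c * φ w₀ * m ^ 2) := by
    rw [← hkm]
    field_simp
  rw [h6] at h5
  exact htrans h1 (htrans h5 (htrans (hsymm h4) (hsymm h3)))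

end Eichler

/-! ### Cartan–Dieudonné relative to a nondegenerate subspace -/

section CartanDieudonne

variable {F V : Type*} [Field F] [AddCommGroup V] [Module F V] {φ : QuadraticForm F V}

/-- The restriction of the polar form of `φ` to `U` is nondegenerate. -/
def Nondeg (φ : QuadraticForm F V) (U : Submodule F V) : Prop :=
  ∀ x ∈ U, (∀ y ∈ U, polar φ x y = 0) → x = 0

theorem symmetry_sub_mem {U : Submodule F V} {x : V} (hx : x ∈ U) (v : V) :
    symmetry φ x v - v ∈ U := by
  rw [symmetry_apply, sub_sub_cancel_left]
  exact U.neg_mem (U.smul_mem _ hx)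

/-- Symmetries in vectors of `U` make `h` fix an anisotropic `x` in `U`; its displacements then lie
in the part of `U` orthogonal to `x`, which is nondegenerate of smaller dimension. If `h x - x` is
singular, then `h x + x` has norm `4 φ x`, and the symmetries in `h x + x` and in `x` are used
instead. -/
theorem exists_symmetry_list [FiniteDimensional F V] (h2 : (2 : F) ≠ 0) {U : Submodule F V}
    (hU : Nondeg φ U) {h : V ≃ₗ[F] V} (hh : h ∈ orthGroup φ) (hhU : ∀ v, h v - v ∈ U) :
    ∃ l : List V, (∀ x ∈ l, x ∈ U ∧ φ x ≠ 0) ∧ h = (l.map (symmetry φ)).prod := by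
  induction hn : Module.finrank F U using Nat.strong_induction_on generalizing U h with
  | _ n ih =>
  by_cases hex : ∀ x ∈ U, φ x = 0
  · refine ⟨[], by simp, ?_⟩
    ext v
    have hz : ∀ x ∈ U, x = 0 := fun x hx => hU x hx fun y hy => by
      rw [polar, hex _ (U.add_mem hx hy), hex x hx, hex y hy, sub_zero, sub_zero]
    exact sub_eq_zero.1 (hz _ (hhU v))
  push Not at hex
  obtain ⟨x, hxU, hx0⟩ := hex
  -- the case of an isometry fixing `x`
  have key : ∀ k ∈ orthGroup φ, (∀ v, k v - v ∈ U) → k x = x →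
      ∃ l : List V, (∀ x ∈ l, x ∈ U ∧ φ x ≠ 0) ∧ k = (l.map (symmetry φ)).prod := by
    intro k hk hkU hkx
    have hmem : ∀ y, y ∈ U ⊓ LinearMap.ker (polarBilin φ x) ↔ y ∈ U ∧ polar φ x y = 0 := by
      intro y
      simp
    obtain ⟨l, hl, hkl⟩ := ih _ (by
        rw [← hn]
        refine Submodule.finrank_lt_finrank_of_lt (lt_of_le_of_ne inf_le_left fun h => ?_)
        rw [← h] at hxU
        have := ((hmem x).1 hxU).2
        rw [polar_self_eq] at this
        exact mul_ne_zero h2 hx0 this)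
      (U := U ⊓ LinearMap.ker (polarBilin φ x)) (h := k) (by
        intro y hy hyz
        rw [hmem] at hy
        refine hU y hy.1 fun z hz => ?_
        have := hyz (z - (polar φ x z / (2 * φ x)) • x) ((hmem _).2
          ⟨U.sub_mem hz (U.smul_mem _ hxU), by
            rw [polar_sub_right, polar_smul_right, polar_self_eq, smul_eq_mul,
              div_mul_cancel₀ _ (mul_ne_zero h2 hx0), sub_self]⟩)
        rwa [polar_sub_right, polar_smul_right, polar_comm φ y x, hy.2, smul_zero, sub_zero] at this)
      hk (fun v => (hmem _).2 ⟨hkU v, by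
        rw [polar_sub_right]
        conv_lhs => rw [← hkx]
        rw [polar_map hk, hkx, sub_self]⟩) rfl
    exact ⟨l, fun y hy => ⟨((hmem y).1 (hl y hy).1).1, (hl y hy).2⟩, hkl⟩
  have hstep : ∀ y ∈ U, ∀ k : V ≃ₗ[F] V, (∀ v, k v - v ∈ U) →
      ∀ v, (symmetry φ y * k) v - v ∈ U := by
    intro y hy k hk v
    rw [LinearEquiv.mul_apply, ← sub_add_sub_cancel]
    exact U.add_mem (symmetry_sub_mem hy _) (hk v)
  have hcons : ∀ y ∈ U, φ y ≠ 0 → ∀ k : V ≃ₗ[F] V,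
      (∃ l : List V, (∀ x ∈ l, x ∈ U ∧ φ x ≠ 0) ∧ symmetry φ y * k = (l.map (symmetry φ)).prod) →
      ∃ l : List V, (∀ x ∈ l, x ∈ U ∧ φ x ≠ 0) ∧ k = (l.map (symmetry φ)).prod := by
    rintro y hy hy0 k ⟨l, hl, hkl⟩
    refine ⟨y :: l, ?_, ?_⟩
    · rintro z hz
      rcases List.mem_cons.1 hz with rfl | hz
      exacts [⟨hy, hy0⟩, hl z hz]
    · rw [List.map_cons, List.prod_cons, ← hkl, ← mul_assoc, symmetry_mul_self, one_mul]
  have hpx : polar φ x (h x) + φ (h x - x) = 2 * φ x := by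
    rw [form_sub, hh x, polar_comm φ (h x) x]
    ring
  by_cases hm : φ (h x - x) = 0
  · have hpl : φ (h x + x) = 2 * 2 * φ x := by
      rw [form_add, hh x, polar_comm φ (h x) x]
      linear_combination hpx - hm
    have hp0 : φ (h x + x) ≠ 0 := by
      rw [hpl]
      exact mul_ne_zero (mul_ne_zero h2 h2) hx0
    have hpU : h x + x ∈ U := by
      have : h x + x = (h x - x) + (2 : F) • x := by rw [two_smul]; abel
      rw [this]
      exact U.add_mem (hhU x) (U.smul_mem _ hxU)
    refine hcons _ hpU hp0 h (hcons _ hxU hx0 _ (key _ ?_ (hstep _ hxU _ (hstep _ hpU _ hhU)) ?_))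
    · exact (orthGroup φ).mul_mem (symmetry_mem_orthGroup φ _)
        ((orthGroup φ).mul_mem (symmetry_mem_orthGroup φ _) hh)
    · have h3 : symmetry φ (h x + x) (h x) = -x := by
        have : polar φ (h x + x) (h x) = φ (h x + x) := by
          rw [polar_add_left, polar_self_eq, hh x, hpl]
          linear_combination hpx - hm
        rw [symmetry_apply, this, div_self hp0, one_smul]
        abel
      rw [LinearEquiv.mul_apply, LinearEquiv.mul_apply, h3, symmetry_apply, polar_neg_right,
        polar_self_eq, neg_div, mul_div_assoc, div_self hx0]
      module
  · refine hcons _ (hhU x) hm h (key _ ((orthGroup φ).mul_mem (symmetry_mem_orthGroup φ _) hh)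
      (hstep _ (hhU x) _ hhU) ?_)
    have : polar φ (h x - x) (h x) = φ (h x - x) := by
      rw [polar_sub_left, polar_self_eq, hh x]
      linear_combination -hpx
    rw [LinearEquiv.mul_apply, symmetry_apply, this, div_self hm, one_smul, sub_sub_cancel]

theorem prod_symmetry_eq (l : List V) : (l.map (symmetry φ)).prod =
    LinearEquiv.neg F ^ l.length * (l.map (rho φ)).prod := by
  have hN : LinearEquiv.neg F * LinearEquiv.neg F = (1 : V ≃ₗ[F] V) := by
    ext v
    simp
  have hc : ∀ g : V ≃ₗ[F] V, Commute (LinearEquiv.neg F) g := fun g => by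
    ext v
    simp
  induction l with
  | nil => simp
  | cons x l ih =>
    rw [List.map_cons, List.prod_cons, ih, List.map_cons, List.prod_cons, List.length_cons,
      show symmetry φ x = LinearEquiv.neg F * rho φ x by rw [rho, ← mul_assoc, hN, one_mul], pow_succ,
      mul_assoc, mul_assoc, ← mul_assoc (rho φ x), ((hc (rho φ x)).pow_left _).symm.eq,
      ← mul_assoc, ← mul_assoc, ← mul_assoc, ((hc _).pow_right _).eq]
    simp only [mul_assoc]

end CartanDieudonne

/-! ### Lifts and factorizations of elements of trivial spinor norm -/

section Lifts

variable {F V : Type*} [Field F] [AddCommGroup V] [Module F V] {φ : QuadraticForm F V}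
  {b : Module.Basis (Fin 5) F V}

open Matrix in
theorem IsLift.inv {g : V ≃ₗ[F] V} {M : M₄ F} {μ : F} (h : IsLift b g M μ) :
    ∃ N : M₄ F, IsLift b g⁻¹ N μ⁻¹ := by
  obtain ⟨N, hN, hN'⟩ := h.exists_inv
  refine ⟨N, inv_ne_zero h.ne_zero, ?_, fun v => ?_⟩
  · have h1 : Nᵀ * (Mᵀ * J (Fin 2) F * M) * N = J (Fin 2) F := by
      calc Nᵀ * (Mᵀ * J (Fin 2) F * M) * N = (M * N)ᵀ * J (Fin 2) F * (M * N) := by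
            rw [transpose_mul]; simp only [mul_assoc]
        _ = J (Fin 2) F := by rw [hN']; simp
    rw [h.simil, Matrix.mul_smul, Matrix.smul_mul] at h1
    rw [← h1, smul_smul, inv_mul_cancel₀ h.ne_zero, one_smul]
    rw [h1]
  · have h1 := h.intertwine (g⁻¹ v)
    rw [← LinearEquiv.mul_apply, mul_inv_cancel, LinearEquiv.coe_one, id_eq] at h1
    calc cliff b (g⁻¹ v) * N = N * (M * cliff b (g⁻¹ v)) * N := by rw [← mul_assoc, hN, one_mul]
      _ = N * cliff b v := by rw [← h1, mul_assoc, mul_assoc, hN', mul_one]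

/-- If both had lifts, so would their quotient -1. This fixes every sign ambiguity in products of
symmetries. -/
theorem IsLift.ne_neg_mul (h2 : (2 : F) ≠ 0) {g g' : V ≃ₗ[F] V} {M M' : M₄ F} {μ μ' : F}
    (h : IsLift b g M μ) (h' : IsLift b g' M' μ') : g ≠ LinearEquiv.neg F * g' := by
  intro hgg
  obtain ⟨N, hN⟩ := h'.inv
  have := h.mul hN
  rw [hgg, mul_assoc, mul_inv_cancel, mul_one] at this
  exact not_isLift_neg h2 _ _ this

theorem exists_isLift_prod (hb : IsStd φ b 1) (l : List V) (hl : ∀ x ∈ l, φ x ≠ 0) :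
    ∃ M, IsLift b (l.map (rho φ)).prod M (l.map φ).prod := by
  induction l with
  | nil => exact ⟨1, IsLift.one⟩
  | cons x l ih =>
    obtain ⟨M, hM⟩ := ih fun y hy => hl y (List.mem_cons_of_mem _ hy)
    exact ⟨_, (isLift_rho hb (hl x List.mem_cons_self)).mul hM⟩

theorem neg_pow_eq (n : ℕ) : (LinearEquiv.neg F : V ≃ₗ[F] V) ^ n = 1 ∧ Even n ∨
    (LinearEquiv.neg F : V ≃ₗ[F] V) ^ n = LinearEquiv.neg F ∧ ¬ Even n := by
  have hN : LinearEquiv.neg F * LinearEquiv.neg F = (1 : V ≃ₗ[F] V) := by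
    ext v
    simp
  rcases Nat.even_or_odd n with h | h
  · obtain ⟨k, rfl⟩ := h
    exact Or.inl ⟨by rw [← two_mul, pow_mul, pow_two, hN, one_pow], ⟨k, rfl⟩⟩
  · obtain ⟨k, rfl⟩ := h
    exact Or.inr ⟨by rw [pow_succ, pow_mul, pow_two, hN, one_pow, one_mul], by simp⟩

theorem rho_mem_of_mem {U : Submodule F V} {x y : V} (hx : x ∈ U) (hy : y ∈ U) : rho φ x y ∈ U := by
  rw [rho_apply]
  exact U.sub_mem (U.smul_mem _ hx) hy

variable [FiniteDimensional F V] [Finite F]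

/-- An element of trivial spinor norm, acting up to sign trivially modulo a nondegenerate
subspace `U`, lies in a group containing the relevant products of symmetries. -/
theorem mem_of_mem_range_spinHom (h2 : (2 : F) ≠ 0) (hb : IsStd φ b 1) {G : Subgroup (V ≃ₗ[F] V)}
    {U : Submodule F V} (hU : Nondeg φ U)
    (hsq : ∀ x ∈ U, φ x ≠ 0 → IsSquare (φ x) → rho φ x ∈ G)
    (hnon : ∀ x ∈ U, ∀ y ∈ U, ¬ IsSquare (φ x) → ¬ IsSquare (φ y) → rho φ x * rho φ y ∈ G)
    {g : V ≃ₗ[F] V} (hg : g ∈ (spinHom b).range) {ε : F} (hε : ε = 1 ∨ ε = -1)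
    (hgU : ∀ v, g v - ε • v ∈ U) : g ∈ G := by
  have hgo := range_spinHom_le hb hg
  obtain ⟨N, rfl⟩ := hg
  have hlg := isLift_spinHom b N
  -- `g` is a product of negative symmetries up to sign, and the sign is trivial because both `g`
  -- and the product have lifts.
  obtain ⟨l, hl, hP⟩ : ∃ l : List V, (∀ x ∈ l, x ∈ U ∧ φ x ≠ 0) ∧
      spinHom b N = (l.map (rho φ)).prod := by
    obtain ⟨l, hl, n, hln⟩ : ∃ l : List V, (∀ x ∈ l, x ∈ U ∧ φ x ≠ 0) ∧
        ∃ n, spinHom b N = LinearEquiv.neg F ^ n * (l.map (rho φ)).prod := by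
      rcases hε with rfl | rfl
      · obtain ⟨l, hl, h⟩ := exists_symmetry_list h2 hU hgo (fun v => by simpa using hgU v)
        exact ⟨l, hl, _, by rw [h, prod_symmetry_eq]⟩
      · obtain ⟨l, hl, h⟩ := exists_symmetry_list h2 hU (h := LinearEquiv.neg F * spinHom b N)
          (fun v => by rw [LinearEquiv.mul_apply, LinearEquiv.neg_apply, QuadraticMap.map_neg, hgo v])
          (fun v => by
            rw [LinearEquiv.mul_apply, LinearEquiv.neg_apply, ← U.neg_mem_iff]
            simpa [add_comm] using hgU v)
        refine ⟨l, hl, l.length + 1, ?_⟩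
        rw [pow_succ', mul_assoc, ← prod_symmetry_eq, ← h]
        ext v
        simp
    refine ⟨l, hl, ?_⟩
    obtain ⟨M, hM⟩ := exists_isLift_prod hb l fun x hx => (hl x hx).2
    rcases neg_pow_eq (F := F) (V := V) n with ⟨h, -⟩ | ⟨h, -⟩
    · rw [hln, h, one_mul]
    · rw [h] at hln
      exact absurd hln (hlg.ne_neg_mul h2 hM)
  have hsquare : IsSquare (l.map φ).prod := by
    obtain ⟨M, hM⟩ := exists_isLift_prod hb l fun x hx => (hl x hx).2
    rw [← hP] at hM
    exact isSquare_of_mem_range ⟨N, rfl⟩ hM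
  rw [hP]
  -- Factors of nonsquare norm are even in number and are collected in pairs. An open factor `x` is
  -- carried to the right, past factors of square norm by conjugating them, until it meets the next
  -- nonsquare one, where `hnon` applies.
  have key : ∀ l : List V, (∀ x ∈ l, x ∈ U ∧ φ x ≠ 0) →
      (IsSquare (l.map φ).prod → (l.map (rho φ)).prod ∈ G) ∧
      (¬ IsSquare (l.map φ).prod → ∀ x ∈ U, ¬ IsSquare (φ x) →
        rho φ x * (l.map (rho φ)).prod ∈ G) := by
    intro l
    induction l with
    | nil => exact fun _ => ⟨fun _ => by simp, fun h => (h (by simp)).elim⟩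
    | cons y l ih =>
      intro hl
      obtain ⟨hy, hy0⟩ := hl y List.mem_cons_self
      obtain ⟨ih1, ih2⟩ := ih fun x hx => hl x (List.mem_cons_of_mem _ hx)
      have hl0 : (l.map φ).prod ≠ 0 := List.prod_ne_zero fun h0 => by
        obtain ⟨x, hx, hx0⟩ := List.mem_map.1 h0
        exact (hl x (List.mem_cons_of_mem _ hx)).2 hx0
      simp only [List.map_cons, List.prod_cons]
      by_cases hys : IsSquare (φ y)
      · refine ⟨fun h => G.mul_mem (hsq y hy hy0 hys) (ih1 ?_), fun h x hx hxs => ?_⟩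
        · have := (hys.inv).mul h
          rwa [← mul_assoc, inv_mul_cancel₀ hy0, one_mul] at this
        · have h1 := hsq (rho φ x y) (rho_mem_of_mem hx hy) (by rwa [form_rho]) (by rwa [form_rho])
          have h3 := G.mul_mem h1 (ih2 (fun h' => h (hys.mul h')) x hx hxs)
          rwa [← conj_rho (rho_mem_orthGroup φ x), ← mul_assoc, inv_mul_cancel_right, mul_assoc] at h3
      · refine ⟨fun h => ih2 (fun h' => hys ?_) y hy hys, fun h x hx hxs => ?_⟩
        · have := h.mul h'.inv
          rwa [mul_assoc, mul_inv_cancel₀ hl0, mul_one] at this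
        · rw [← mul_assoc]
          refine G.mul_mem (hnon x hx y hy hxs hys) (ih1 ?_)
          by_contra h'
          obtain ⟨s, -, hs⟩ := exists_sq_mul_of_not_isSquare hys h'
          exact h ⟨s * (l.map φ).prod, by rw [hs]; ring⟩
  exact (key l hl).1 hsquare

end Lifts

/-! ### Hyperbolic bases of three-dimensional subspaces -/

section HyperbolicBasis

variable {F V : Type*} [Field F] [AddCommGroup V] [Module F V] {φ : QuadraticForm F V}
  {U : Submodule F V}

/-- `U` is spanned by a hyperbolic pair `e`, `f` and a nonsingular vector `w` orthogonal to it. -/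
structure HypBasis (φ : QuadraticForm F V) (U : Submodule F V) (e f w : V) : Prop where
  hyp : IsHyp φ e f
  left_mem : e ∈ U
  right_mem : f ∈ U
  mem : w ∈ U
  left : polar φ e w = 0
  right : polar φ f w = 0
  ne_zero : φ w ≠ 0
  eq : ∀ z ∈ U, z = polar φ f z • e + polar φ e z • f + (polar φ w z / (2 * φ w)) • w

theorem HypBasis.symm {e f w : V} (H : HypBasis φ U e f w) : HypBasis φ U f e (-w) where
  hyp := H.hyp.symm
  left_mem := H.right_mem
  right_mem := H.left_mem
  mem := U.neg_mem H.mem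
  left := by rw [polar_neg_right, H.right, neg_zero]
  right := by rw [polar_neg_right, H.left, neg_zero]
  ne_zero := by rw [QuadraticMap.map_neg]; exact H.ne_zero
  eq z hz := by
    conv_lhs => rw [H.eq z hz]
    rw [polar_neg_left, QuadraticMap.map_neg]
    module

variable [FiniteDimensional F V]

theorem hypBasis_of_finrank (h2 : (2 : F) ≠ 0) (h3 : Module.finrank F U = 3) {e f w : V}
    (hef : IsHyp φ e f) (he : e ∈ U) (hf : f ∈ U) (hw : w ∈ U) (hew : polar φ e w = 0)
    (hfw : polar φ f w = 0) (hw0 : φ w ≠ 0) : HypBasis φ U e f w := by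
  refine ⟨hef, he, hf, hw, hew, hfw, hw0, fun z hz => ?_⟩
  let l : U →ₗ[F] Fin 3 → F :=
    LinearMap.pi ![polarBilin φ f ∘ₗ U.subtype, polarBilin φ e ∘ₗ U.subtype,
      polarBilin φ w ∘ₗ U.subtype]
  have hl : ∀ (x : U), l x = ![polar φ f x, polar φ e x, polar φ w x] := by
    intro x
    ext i
    fin_cases i <;> simp [l]
  have hval : ∀ a b c : F, polar φ f (a • e + b • f + c • w) = a ∧
      polar φ e (a • e + b • f + c • w) = b ∧
      polar φ w (a • e + b • f + c • w) = c * (2 * φ w) := by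
    intro a b c
    refine ⟨?_, ?_, ?_⟩ <;>
    simp [polar_add_right, polar_smul_right, hef.left, hef.right, hef.polar,
      hef.symm.polar, hew, hfw, polar_comm φ w e, polar_comm φ w f]
  have hmem : ∀ a b c : F, a • e + b • f + c • w ∈ U := fun a b c =>
    U.add_mem (U.add_mem (U.smul_mem _ he) (U.smul_mem _ hf)) (U.smul_mem _ hw)
  have hsurj : Function.Surjective l := by
    intro y
    refine ⟨⟨_, hmem (y 0) (y 1) (y 2 / (2 * φ w))⟩, ?_⟩
    rw [hl]
    obtain ⟨h0, h1, h3⟩ := hval (y 0) (y 1) (y 2 / (2 * φ w))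
    simp only [h0, h1, h3, div_mul_cancel₀ _ (mul_ne_zero h2 hw0)]
    ext i
    fin_cases i <;> rfl
  have hinj := (LinearMap.injective_iff_surjective_of_finrank_eq_finrank (f := l)
    (by rw [h3, Module.finrank_fin_fun])).2 hsurj
  have := hinj (a₁ := ⟨z, hz⟩)
    (a₂ := ⟨_, hmem (polar φ f z) (polar φ e z) (polar φ w z / (2 * φ w))⟩) (by
    rw [hl, hl]
    obtain ⟨h0, h1, h3⟩ := hval (polar φ f z) (polar φ e z) (polar φ w z / (2 * φ w))
    simp only [h0, h1, h3, div_mul_cancel₀ _ (mul_ne_zero h2 hw0)])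
  exact congrArg Subtype.val this

theorem exists_hypBasis [Finite F] (h2 : (2 : F) ≠ 0) (hU : Nondeg φ U)
    (h3 : Module.finrank F U = 3) : ∃ e f w, HypBasis φ U e f w := by
  obtain ⟨e, he0, he⟩ := exists_singular (φ.comp U.subtype) h3.ge
  rw [QuadraticMap.comp_apply, Submodule.subtype_apply] at he
  obtain ⟨v, hv, hev⟩ : ∃ v ∈ U, polar φ e v ≠ 0 := by
    by_contra! h
    exact he0 (Subtype.ext (hU e e.2 h))
  have hef := isHyp_of_polar_ne_zero he hev
  have hf : (polar φ e v)⁻¹ • v - ((polar φ e v)⁻¹ ^ 2 * φ v) • (e : V) ∈ U :=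
    U.sub_mem (U.smul_mem _ hv) (U.smul_mem _ e.2)
  generalize (polar φ e v)⁻¹ • v - ((polar φ e v)⁻¹ ^ 2 * φ v) • (e : V) = f at hef hf
  obtain ⟨w, hw0, hw⟩ := exists_ne_zero_of_lt_finrank (V := U) (n := 2)
    ![polarBilin φ e ∘ₗ U.subtype, polarBilin φ f ∘ₗ U.subtype] (by rw [h3]; norm_num)
  have hew : polar φ e w = 0 := hw 0
  have hfw : polar φ f w = 0 := hw 1
  by_cases hφw : φ w = 0
  · exfalso
    obtain ⟨z, hz, hwz⟩ : ∃ z ∈ U, polar φ w z ≠ 0 := by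
      by_contra! h
      exact hw0 (Subtype.ext (hU w w.2 h))
    -- otherwise `w` and a vector hyperbolic to it give a four-dimensional space
    let l : (Fin 4 → F) →ₗ[F] U := Fintype.linearCombination F ![e, ⟨f, hf⟩, w, ⟨z, hz⟩]
    obtain ⟨c, hc, hc0⟩ := (Submodule.ne_bot_iff _).1
      (LinearMap.ker_ne_bot_of_finrank_lt (f := l) (by rw [h3, Module.finrank_fin_fun]; norm_num))
    have hc' : c 0 • (e : V) + c 1 • f + c 2 • (w : V) + c 3 • z = 0 := by
      have := congrArg Subtype.val (LinearMap.mem_ker.1 hc)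
      simpa [l, Fintype.linearCombination_apply, Fin.sum_univ_four] using this
    have hwe : polar φ w e = 0 := by rw [polar_comm, hew]
    have hwf : polar φ w f = 0 := by rw [polar_comm, hfw]
    have c3 : c 3 = 0 := by
      have := congrArg (polar φ w) hc'
      simp only [polar_add_right, polar_smul_right, polar_self_eq, hφw, hwe, hwf, polar_zero_right,
        smul_eq_mul, mul_zero, zero_add] at this
      exact (mul_eq_zero.1 this).resolve_right hwz
    have c0 : c 0 = 0 := by
      have := congrArg (polar φ f) hc'
      simpa [polar_add_right, polar_smul_right, polar_self_eq, hef.right, hef.symm.polar, hfw, c3]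
        using this
    have c1 : c 1 = 0 := by
      have := congrArg (polar φ e) hc'
      simpa [polar_add_right, polar_smul_right, polar_self_eq, he, hef.polar, hew, c3] using this
    have c2 : c 2 = 0 := by
      rw [c0, c1, c3] at hc'
      simpa [hw0] using hc'
    exact hc0 (by ext i; fin_cases i <;> assumption)
  · exact ⟨e, f, w, hypBasis_of_finrank h2 h3 hef e.2 hf w.2 hew hfw hφw⟩

end HyperbolicBasis

/-! ### Three-dimensional spaces as traceless 2 × 2 matrices -/

section QuaternionModel

open Matrix

variable {F V : Type*} [Field F] [AddCommGroup V] [Module F V] {φ : QuadraticForm F V}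
  {U : Submodule F V} {e f w : V}

/-- The projection to a three-dimensional subspace, identified with the traceless matrices. -/
noncomputable def slMap (φ : QuadraticForm F V) (e f w : V) : V →ₗ[F] Matrix (Fin 2) (Fin 2) F where
  toFun v := !![polar φ w v / (2 * φ w), polar φ f v / φ w; polar φ e v, -(polar φ w v / (2 * φ w))]
  map_add' x y := by
    ext i j
    fin_cases i <;> fin_cases j <;> simp [polar_add_right] <;> ring
  map_smul' t x := by
    ext i j
    fin_cases i <;> fin_cases j <;> simp [polar_smul_right] <;> ring

theorem slMap_apply (v : V) : slMap φ e f w v =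
    !![polar φ w v / (2 * φ w), polar φ f v / φ w; polar φ e v, -(polar φ w v / (2 * φ w))] := rfl

theorem trace_slMap (v : V) : (slMap φ e f w v).trace = 0 := by
  simp [slMap_apply, trace_fin_two]

theorem HypBasis.polar_eq (H : HypBasis φ U e f w) {z : V} (hz : z ∈ U) (v : V) :
    polar φ z v = polar φ f z * polar φ e v + polar φ e z * polar φ f v +
      polar φ w z / (2 * φ w) * polar φ w v := by
  conv_lhs => rw [H.eq z hz]
  simp only [polar_add_left, polar_smul_left, smul_eq_mul]

theorem HypBasis.slMap_anticomm (h2 : (2 : F) ≠ 0) (H : HypBasis φ U e f w) {z : V} (hz : z ∈ U)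
    (v : V) : slMap φ e f w z * slMap φ e f w v + slMap φ e f w v * slMap φ e f w z =
      (polar φ z v / φ w) • 1 := by
  have hw := H.ne_zero
  rw [H.polar_eq hz]
  ext i j
  fin_cases i <;> fin_cases j <;> simp [slMap_apply] <;>
    field_simp <;> ring

theorem HypBasis.slMap_mul_self (h2 : (2 : F) ≠ 0) (H : HypBasis φ U e f w) {z : V} (hz : z ∈ U) :
    slMap φ e f w z * slMap φ e f w z = (φ z / φ w) • 1 := by
  have h := H.slMap_anticomm h2 hz z
  rw [polar_self_eq, ← two_smul F, mul_div_assoc, mul_smul] at h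
  exact smul_right_injective _ h2 h

theorem HypBasis.eq_zero_of_slMap (h2 : (2 : F) ≠ 0) (H : HypBasis φ U e f w) {z : V} (hz : z ∈ U)
    (h : slMap φ e f w z = 0) : z = 0 := by
  have hw := H.ne_zero
  have h' := fun i j => congrFun (congrFun h i) j
  have h0 := h' 0 0
  have h1 := h' 0 1
  have h3 := h' 1 0
  simp [slMap_apply, h2, hw] at h0 h1 h3
  rw [H.eq z hz, h0, h1, h3]
  simp

theorem HypBasis.exists_slMap_eq (h2 : (2 : F) ≠ 0) (H : HypBasis φ U e f w)
    {n : Matrix (Fin 2) (Fin 2) F} (hn : n.trace = 0) : ∃ z ∈ U, slMap φ e f w z = n := by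
  have hw := H.ne_zero
  refine ⟨(φ w * n 0 1) • e + n 1 0 • f + n 0 0 • w, U.add_mem (U.add_mem (U.smul_mem _ H.left_mem)
    (U.smul_mem _ H.right_mem)) (U.smul_mem _ H.mem), ?_⟩
  have h11 := traceless_apply hn
  ext i j
  fin_cases i <;> fin_cases j <;> simp [slMap_apply, polar_add_right, polar_smul_right,
    H.hyp.left, H.hyp.right, H.hyp.polar, H.hyp.symm.polar, H.left, H.right,
    polar_comm φ w e, polar_comm φ w f, h11] <;> field_simp

theorem HypBasis.slMap_rho (h2 : (2 : F) ≠ 0) (H : HypBasis φ U e f w) {z : V} (hz : z ∈ U)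
    (hz0 : φ z ≠ 0) (v : V) : slMap φ e f w z * slMap φ e f w v =
      slMap φ e f w (rho φ z v) * slMap φ e f w z := by
  rw [rho_apply, map_sub, map_smul, sub_mul, smul_mul_assoc, H.slMap_mul_self h2 hz, smul_smul,
    div_mul_div_cancel₀ hz0, ← H.slMap_anticomm h2 hz, add_sub_cancel_right]

theorem HypBasis.slMap_eq_zero (H : HypBasis φ U e f w) {v : V} (hv : ∀ z ∈ U, polar φ z v = 0) :
    slMap φ e f w v = 0 := by
  rw [slMap_apply, hv e H.left_mem, hv f H.right_mem, hv w H.mem]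
  ext i j
  fin_cases i <;> fin_cases j <;> simp

/-- The matrices inducing on the traceless matrices the action of an element of `G`. -/
def slGroup (φ : QuadraticForm F V) (e f w : V) (G : Subgroup (V ≃ₗ[F] V)) :
    Subgroup (GL (Fin 2) F) where
  carrier := {M | ∃ g ∈ G, ∀ v, (M : Matrix (Fin 2) (Fin 2) F) * slMap φ e f w v =
    slMap φ e f w (g v) * M}
  mul_mem' := by
    rintro M N ⟨g, hg, hgM⟩ ⟨k, hk, hkN⟩
    refine ⟨g * k, G.mul_mem hg hk, fun v => ?_⟩
    rw [Units.val_mul, mul_assoc, hkN, ← mul_assoc, hgM, mul_assoc, LinearEquiv.mul_apply]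
  one_mem' := ⟨1, G.one_mem, fun v => by simp⟩
  inv_mem' := by
    rintro M ⟨g, hg, hgM⟩
    refine ⟨g⁻¹, G.inv_mem hg, fun v => ?_⟩
    have h := hgM (g⁻¹ v)
    rw [← LinearEquiv.mul_apply, mul_inv_cancel, LinearEquiv.coe_one, id_eq] at h
    rw [Units.inv_mul_eq_iff_eq_mul, ← mul_assoc, h, mul_assoc, Units.mul_inv, mul_one]

/-- A unipotent matrix in `slGroup` induces an Eichler transformation. -/
theorem HypBasis.hasEich (h2 : (2 : F) ≠ 0) (H : HypBasis φ U e f w) {e₁ f₁ w₁ : V}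
    (H₁ : HypBasis φ U e₁ f₁ w₁) (hw₁ : slMap φ e f w w₁ =
      slMap φ e f w e₁ * slMap φ e f w f₁ - slMap φ e f w f₁ * slMap φ e f w e₁)
    {G : Subgroup (V ≃ₗ[F] V)}
    (hGU : ∀ g ∈ G, ∃ ε : F, (ε = 1 ∨ ε = -1) ∧ ∀ v, g v - ε • v ∈ U)
    (hx : ∀ t : F, ∃ x : slGroup φ e f w G, toMat x = 1 + t • slMap φ e f w e₁) (t : F) :
    HasEich φ G e₁ (t • w₁) := by
  have hw := H.ne_zero
  set Y := slMap φ e f w with hY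
  have hnn : Y e₁ * Y e₁ = 0 := by
    rw [H.slMap_mul_self h2 H₁.left_mem, H₁.hyp.left, zero_div, zero_smul]
  have hmm : Y f₁ * Y f₁ = 0 := by
    rw [H.slMap_mul_self h2 H₁.right_mem, H₁.hyp.right, zero_div, zero_smul]
  have hnm : Y e₁ * Y f₁ = (φ w)⁻¹ • 1 - Y f₁ * Y e₁ := by
    rw [eq_sub_iff_add_eq, H.slMap_anticomm h2 H₁.left_mem, H₁.hyp.polar, one_div]
  have hnmn : Y e₁ * Y f₁ * Y e₁ = (φ w)⁻¹ • Y e₁ := by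
    rw [hnm, sub_mul, mul_assoc, hnn, mul_zero, sub_zero, smul_mul_assoc, one_mul]
  have hφw₁ : φ w₁ = (φ w)⁻¹ := by
    have h1 := H.slMap_mul_self h2 H₁.mem
    rw [← hY, hw₁] at h1
    have h3 : (Y e₁ * Y f₁ - Y f₁ * Y e₁) * (Y e₁ * Y f₁ - Y f₁ * Y e₁) =
        (φ w)⁻¹ • (Y e₁ * Y f₁ + Y f₁ * Y e₁) := by
      rw [mul_sub, sub_mul, sub_mul, mul_assoc (Y f₁) (Y e₁) (Y e₁ * Y f₁),
        ← mul_assoc (Y e₁) (Y e₁), hnn, mul_assoc (Y e₁) (Y f₁) (Y f₁ * Y e₁),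
        ← mul_assoc (Y f₁) (Y f₁), hmm, ← mul_assoc (Y e₁ * Y f₁), hnmn,
        mul_assoc (Y f₁), ← mul_assoc (Y e₁) (Y f₁) (Y e₁), hnmn]
      simp
    rw [h3, H.slMap_anticomm h2 H₁.left_mem, H₁.hyp.polar, smul_smul] at h1
    have h4 := congrFun (congrFun h1 0) 0
    simp at h4
    field_simp at h4 ⊢
    exact h4.symm
  have hYv : ∀ v, Y v = polar φ f₁ v • Y e₁ + polar φ e₁ v • Y f₁ +
      (polar φ w₁ v / (2 * φ w₁)) • Y w₁ := by
    intro v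
    rw [← map_smul, ← map_smul, ← map_smul, ← map_add, ← map_add, ← sub_eq_zero, ← map_sub]
    have hw1 := H₁.ne_zero
    refine H.slMap_eq_zero fun z hz => ?_
    rw [H₁.polar_eq hz]
    simp only [polar_sub_right, polar_add_right, polar_smul_right, polar_self_eq, H₁.hyp.left,
      H₁.hyp.right, H₁.hyp.polar, H₁.hyp.symm.polar, H₁.left, H₁.right, polar_comm φ w₁ e₁,
      polar_comm φ w₁ f₁, smul_eq_mul]
    field_simp
    ring
  -- Conjugation by `1 + t Y(e₁)` adds `t` times this commutator and subtracts `t² Y(e₁) Y(v)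
  -- Y(e₁)`. Expressed by the hyperbolic basis, these are the linear and the quadratic term of the
  -- Eichler transformation along `e₁` in the direction `w₁`.
  have hcomm : ∀ v, Y e₁ * Y v - Y v * Y e₁ = polar φ e₁ v • Y w₁ - polar φ w₁ v • Y e₁ := by
    intro v
    have h3 : Y e₁ * Y w₁ - Y w₁ * Y e₁ = -(2 * (φ w)⁻¹) • Y e₁ := by
      rw [hw₁, mul_sub, sub_mul, ← mul_assoc, hnn, ← mul_assoc, hnmn, mul_assoc (Y f₁), hnn,
        zero_mul, mul_zero]
      module
    have h4 : Y e₁ * Y v - Y v * Y e₁ = polar φ e₁ v • (Y e₁ * Y f₁ - Y f₁ * Y e₁) +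
        (polar φ w₁ v / (2 * φ w₁)) • (Y e₁ * Y w₁ - Y w₁ * Y e₁) := by
      rw [hYv v]
      simp only [mul_add, add_mul, mul_smul_comm, smul_mul_assoc]
      module
    have h5 : polar φ w₁ v / (2 * (φ w)⁻¹) * -(2 * (φ w)⁻¹) = -polar φ w₁ v := by
      field_simp
    rw [h4, h3, ← hw₁, hφw₁, smul_smul, h5, neg_smul, sub_eq_add_neg]
  have hnyn : ∀ v, Y e₁ * Y v * Y e₁ = (polar φ e₁ v * (φ w)⁻¹) • Y e₁ := by
    intro v
    have := H.slMap_anticomm h2 H₁.left_mem v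
    rw [← eq_sub_iff_add_eq] at this
    rw [← hY] at this
    rw [this, sub_mul, mul_assoc, hnn, mul_zero, sub_zero, smul_mul_assoc, one_mul, div_eq_mul_inv]
  -- The element with parameter `t / 2` is squared: its isometry is known only to act as 1 or -1
  -- modulo `U`, and squaring removes the sign.
  obtain ⟨x, hxt⟩ := hx (t / 2)
  obtain ⟨g, hg, hgx⟩ := x.2
  change ∀ v, toMat x * Y v = Y (g v) * toMat x at hgx
  have hxx : toMat x * toMat x = 1 + t • Y e₁ := by
    rw [hxt, mul_add, add_mul, add_mul, smul_mul_smul_comm, hnn]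
    simp only [one_mul, mul_one, smul_zero, add_zero]
    match_scalars <;> field_simp
    norm_num
  refine ⟨g * g, G.mul_mem hg hg, fun v => ?_⟩
  obtain ⟨ε, hε, hgε⟩ := hGU g hg
  have hmem : (g * g) v - v ∈ U := by
    have h1 := U.add_mem (hgε (g v)) (U.smul_mem ε (hgε v))
    rw [smul_sub, smul_smul, sub_add_sub_cancel] at h1
    rcases hε with rfl | rfl <;> simpa using h1
  have hgg : (1 + t • Y e₁) * Y v = Y ((g * g) v) * (1 + t • Y e₁) := by
    rw [← hxx, mul_assoc, hgx, ← mul_assoc, hgx, mul_assoc, LinearEquiv.mul_apply]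
  have hinv : (1 + t • Y e₁) * (1 - t • Y e₁) = 1 := by
    rw [mul_sub, mul_one, add_mul, one_mul, smul_mul_smul_comm, hnn]
    simp
  have hval : Y ((g * g) v) = Y v + t • (Y e₁ * Y v - Y v * Y e₁) -
      t ^ 2 • (Y e₁ * Y v * Y e₁) := by
    rw [← mul_one (Y ((g * g) v)), ← hinv, ← mul_assoc, ← hgg]
    simp only [mul_sub, add_mul, mul_smul_comm, smul_mul_assoc, mul_one, one_mul]
    module
  rw [← sub_eq_zero]
  refine H.eq_zero_of_slMap h2 ?_ ?_
  · have : (g * g) v - (v + polar φ e₁ v • t • w₁ - polar φ (t • w₁) v • e₁ -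
        (φ (t • w₁) * polar φ e₁ v) • e₁) = ((g * g) v - v) - (polar φ e₁ v • t • w₁ -
          polar φ (t • w₁) v • e₁ - (φ (t • w₁) * polar φ e₁ v) • e₁) := by abel
    rw [this]
    exact U.sub_mem hmem (U.sub_mem (U.sub_mem (U.smul_mem _ (U.smul_mem _ H₁.mem))
      (U.smul_mem _ H₁.left_mem)) (U.smul_mem _ H₁.left_mem))
  · rw [← hY, map_sub, hval, hcomm, hnyn]
    simp only [map_sub, map_add, map_smul, polar_smul_left, form_smul, hφw₁, smul_eq_mul]
    module

end QuaternionModel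

/-! ### Opposite Eichler transformations in the group of a three-dimensional space -/

section ThreeDim

open Matrix

variable {F V : Type*} [Field F] [AddCommGroup V] [Module F V] {φ : QuadraticForm F V}
  {U : Submodule F V} {e f w : V}

theorem HypBasis.det_slMap (h2 : (2 : F) ≠ 0) (H : HypBasis φ U e f w) {z : V} (hz : z ∈ U) :
    (slMap φ e f w z).det = -(φ z / φ w) := by
  have h := (traceless_mul_self (trace_slMap (φ := φ) (e := e) (f := f) (w := w) z)).symm.trans
    (H.slMap_mul_self h2 hz)
  have := congrFun (congrFun h 0) 0
  simp at this
  rw [← this, neg_neg]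

theorem HypBasis.exists_toMat_eq (h2 : (2 : F) ≠ 0) (H : HypBasis φ U e f w)
    {G : Subgroup (V ≃ₗ[F] V)} {z : V} (hz : z ∈ U) (hz0 : φ z ≠ 0) (hG : rho φ z ∈ G) :
    ∃ x : slGroup φ e f w G, toMat x = slMap φ e f w z :=
  ⟨⟨GeneralLinearGroup.mkOfDetNeZero (slMap φ e f w z) (by
    rw [H.det_slMap h2 hz]
    exact neg_ne_zero.2 (div_ne_zero hz0 H.ne_zero)), rho φ z, hG, H.slMap_rho h2 hz hz0⟩, rfl⟩

theorem scalar_mem_slGroup (G : Subgroup (V ≃ₗ[F] V)) (s : Fˣ) :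
    Units.map (algebraMap F (Matrix (Fin 2) (Fin 2) F)).toMonoidHom s ∈ slGroup φ e f w G :=
  ⟨1, G.one_mem, fun _ => Algebra.commutes _ _⟩

theorem toMat_pow {H : Subgroup (GL (Fin 2) F)} (x : H) (k : ℕ) : toMat (x ^ k) = toMat x ^ k := by
  simp [toMat]

theorem toMat_pow_mul {G : Subgroup (V ≃ₗ[F] V)} {x : slGroup φ e f w G}
    {g : V ≃ₗ[F] V} (h : ∀ v, toMat x * slMap φ e f w v = slMap φ e f w (g v) * toMat x) (k : ℕ)
    (v : V) : toMat (x ^ k) * slMap φ e f w v = slMap φ e f w ((g ^ k) v) * toMat (x ^ k) := by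
  induction k generalizing v with
  | zero => simp [toMat]
  | succ k ih =>
    rw [pow_succ, toMat_mul, mul_assoc, h, ← mul_assoc, ih, mul_assoc, pow_succ,
      LinearEquiv.mul_apply]

/-- The torus generated by the product of two symmetries and the scalars. -/
theorem HypBasis.card_torus_le [Finite F] (h2 : (2 : F) ≠ 0) (H : HypBasis φ U e f w)
    {G : Subgroup (V ≃ₗ[F] V)} {u v : V} (hu : u ∈ U) (hv : v ∈ U) (huv : polar φ u v = 1)
    (hdet : 4 * (φ u * φ v) ≠ 1) {x : slGroup φ e f w G}
    (hx : ∀ z, toMat x * slMap φ e f w z = slMap φ e f w ((rho φ u * rho φ v) z) * toMat x)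
    {n : Matrix (Fin 2) (Fin 2) F} (hn : toMat x * n = n * toMat x) :
    orderOf (rho φ u * rho φ v) * (Nat.card F - 1) ≤
      Nat.card {x : slGroup φ e f w G // toMat x * n = n * toMat x} := by
  have hF := Fintype.ofFinite F
  classical
  have hfin : Finite {x : slGroup φ e f w G // toMat x * n = n * toMat x} :=
    Finite.of_injective (fun x => toMat x.1) fun a b h => Subtype.ext (toMat_injective h)
  let sc : Fˣ → slGroup φ e f w G := fun s => ⟨_, scalar_mem_slGroup G s⟩
  have hsc : ∀ s, toMat (sc s) = algebraMap F _ (s : F) := fun s => rfl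
  have hcard : Nat.card (Fin (orderOf (rho φ u * rho φ v)) × Fˣ) =
      orderOf (rho φ u * rho φ v) * (Nat.card F - 1) := by
    rw [Nat.card_prod, Nat.card_fin, Nat.card_units]
  rw [← hcard]
  refine Nat.card_le_card_of_injective (fun p => ⟨sc p.2 * x ^ (p.1 : ℕ), ?_⟩) ?_
  · rw [toMat_mul, hsc, toMat_pow, mul_assoc, (show Commute (toMat x) n from hn).pow_left _ |>.eq,
      ← mul_assoc, Algebra.commutes, mul_assoc]
  · rintro ⟨k, s⟩ ⟨l, t⟩ h
    replace h := congrArg Subtype.val h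
    dsimp only at h
    have hact : ∀ (k : ℕ) (s : Fˣ) z, toMat (sc s * x ^ k) * slMap φ e f w z =
        slMap φ e f w (((rho φ u * rho φ v) ^ k) z) * toMat (sc s * x ^ k) := by
      intro k s z
      rw [toMat_mul, mul_assoc, toMat_pow_mul hx, ← mul_assoc, hsc, Algebra.commutes,
        mul_assoc]
    have hstab : ∀ (k : ℕ) (z : V), z ∈ U → ((rho φ u * rho φ v) ^ k) z ∈ U := by
      intro k
      induction k with
      | zero => exact fun z hz => hz
      | succ k ih =>
        intro z hz
        rw [pow_succ, LinearEquiv.mul_apply]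
        exact ih _ (rho_mem_of_mem hu (rho_mem_of_mem hv hz))
    have heq : ∀ z ∈ U, ((rho φ u * rho φ v) ^ (k : ℕ)) z = ((rho φ u * rho φ v) ^ (l : ℕ)) z := by
      intro z hz
      have h1 := hact k s z
      rw [h, hact l t z] at h1
      have h3 := congrArg (fun m => m * toMat (sc t * x ^ (l : ℕ))⁻¹) h1
      simp only [mul_assoc, toMat_mul_inv, mul_one] at h3
      rw [← sub_eq_zero]
      refine H.eq_zero_of_slMap h2 (U.sub_mem (hstab _ _ hz) (hstab _ _ hz)) ?_
      rw [map_sub, h3, sub_self]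
    have hpow : (rho φ u * rho φ v) ^ (k : ℕ) = (rho φ u * rho φ v) ^ (l : ℕ) := by
      ext z
      obtain ⟨a, b, h1, h3⟩ := exists_sub_orthogonal hdet huv z
      have h4 := heq (a • u + b • v) (U.add_mem (U.smul_mem _ hu) (U.smul_mem _ hv))
      have h5 := (pow_apply_orthogonal h1 h3 (k : ℕ)).trans (pow_apply_orthogonal h1 h3 (l : ℕ)).symm
      rw [map_sub, map_sub, h4] at h5
      exact sub_left_injective h5
    have hkl : k = l := Fin.ext (pow_injOn_Iio_orderOf k.2 l.2 hpow)
    subst hkl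
    have h1 := congrArg toMat (mul_right_cancel h)
    rw [hsc, hsc] at h1
    rw [Units.ext ((algebraMap F (Matrix (Fin 2) (Fin 2) F)).injective h1)]

variable [FiniteDimensional F V]

/-- The vector `p` is orthogonal to `u₁` and `u₂`, and its matrix is the axis of the torus of `rho φ
u₁ * rho φ u₂` and the scalars. The matrix of `u₁` anticommutes with it and so inverts the torus. By
`hD`, `u₃` is not orthogonal to `p`, and it is not proportional to `p` as it pairs nontrivially with
`u₂`; hence its matrix does not normalize the torus. Thus `exists_two_full_roots` applies, and its
two nilpotents become a hyperbolic pair whose root elements are Eichler transformations. -/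
theorem exists_hypBasis_hasEich [Finite F] (h2 : (2 : F) ≠ 0) (hq : 11 ≤ Nat.card F)
    (h3 : Module.finrank F U = 3) (hU : Nondeg φ U) {G : Subgroup (V ≃ₗ[F] V)}
    (hGU : ∀ g ∈ G, ∃ ε : F, (ε = 1 ∨ ε = -1) ∧ ∀ v, g v - ε • v ∈ U) {u₁ u₂ u₃ : V}
    (hu₁ : u₁ ∈ U) (hu₂ : u₂ ∈ U) (hu₃ : u₃ ∈ U) (hS₁ : u₁ ∈ reflSet φ G) (hS₂ : u₂ ∈ reflSet φ G)
    (hS₃ : u₃ ∈ reflSet φ G) (p12 : polar φ u₁ u₂ = 1) (p23 : polar φ u₂ u₃ = 1)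
    (p13 : polar φ u₁ u₃ = 0) (hdet : 4 * (φ u₁ * φ u₂) ≠ 1)
    (hD : (4 * (φ u₁ * φ u₂) - 1) * φ u₃ ≠ φ u₁) (h6 : 6 ≤ orderOf (rho φ u₁ * rho φ u₂))
    (hcq : Nat.card F - 1 ≤ 2 * orderOf (rho φ u₁ * rho φ u₂)) :
    ∃ e f w, HypBasis φ U e f w ∧ ∀ t : F, HasEich φ G e (t • w) ∧ HasEich φ G f (t • w) := by
  obtain ⟨e, f, w, H⟩ := exists_hypBasis h2 hU h3
  have hw := H.ne_zero
  obtain ⟨Y, hY⟩ : ∃ Y, Y = slMap φ e f w := ⟨_, rfl⟩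
  obtain ⟨x₁, hx₁⟩ := H.exists_toMat_eq h2 hu₁ hS₁.1 hS₁.2
  obtain ⟨x₂, hx₂⟩ := H.exists_toMat_eq h2 hu₂ hS₂.1 hS₂.2
  obtain ⟨x₃, hx₃⟩ := H.exists_toMat_eq h2 hu₃ hS₃.1 hS₃.2
  have hanti := fun {z : V} (hz : z ∈ U) (v : V) => H.slMap_anticomm h2 hz v
  rw [← hY] at hx₁ hx₂ hx₃ hanti
  set δ := 4 * (φ u₁ * φ u₂) - 1 with hδ
  have hδ0 : δ ≠ 0 := sub_ne_zero.2 hdet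
  have p21 : polar φ u₂ u₁ = 1 := by rw [polar_comm, p12]
  have p31 : polar φ u₃ u₁ = 0 := by rw [polar_comm, p13]
  obtain ⟨p, hp⟩ : ∃ p, p = u₁ - (2 * φ u₁) • u₂ + δ • u₃ := ⟨_, rfl⟩
  have hpU : p ∈ U := by
    rw [hp]
    exact U.add_mem (U.sub_mem hu₁ (U.smul_mem _ hu₂)) (U.smul_mem _ hu₃)
  have hp1 : polar φ p u₁ = 0 := by
    rw [hp, polar_add_left, polar_sub_left, polar_smul_left, polar_smul_left, polar_self_eq, p21,
      p31]
    simp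
  have hp2 : polar φ p u₂ = 0 := by
    rw [hp, polar_add_left, polar_sub_left, polar_smul_left, polar_smul_left, polar_self_eq, p12,
      polar_comm, p23, hδ]
    simp only [smul_eq_mul]
    ring
  have hp3 : polar φ p u₃ = 2 * (δ * φ u₃ - φ u₁) := by
    rw [hp, polar_add_left, polar_sub_left, polar_smul_left, polar_smul_left, polar_self_eq, p13,
      p23]
    simp only [smul_eq_mul]
    ring
  have hp3' : polar φ p u₃ ≠ 0 := by
    rw [hp3]
    exact mul_ne_zero h2 (sub_ne_zero.2 hD)
  have hφp : φ p ≠ 0 := by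
    intro h
    have h1 : polar φ p p = 2 * φ p := polar_self_eq φ p
    nth_rewrite 2 [hp] at h1
    rw [h, polar_add_right, polar_sub_right, polar_smul_right, polar_smul_right, hp1, hp2,
      smul_eq_mul, smul_eq_mul, mul_zero, mul_zero, sub_zero, zero_add] at h1
    exact mul_ne_zero hδ0 hp3' h1
  have hn1 : Y u₁ * Y p = -(Y p * Y u₁) := by
    rw [eq_neg_iff_add_eq_zero, add_comm, hanti hpU, hp1, zero_div, zero_smul]
  have hn2 : Y u₂ * Y p = -(Y p * Y u₂) := by
    rw [eq_neg_iff_add_eq_zero, add_comm, hanti hpU, hp2, zero_div, zero_smul]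
  have hx12 : ∀ z, toMat (x₁ * x₂) * slMap φ e f w z =
      slMap φ e f w ((rho φ u₁ * rho φ u₂) z) * toMat (x₁ * x₂) := by
    intro z
    rw [toMat_mul, hx₁, hx₂, hY, mul_assoc, H.slMap_rho h2 hu₂ hS₂.1, ← mul_assoc,
      H.slMap_rho h2 hu₁ hS₁.1, mul_assoc, LinearEquiv.mul_apply]
  have hcomm : toMat (x₁ * x₂) * Y p = Y p * toMat (x₁ * x₂) := by
    rw [toMat_mul, hx₁, hx₂, mul_assoc, hn2, mul_neg, ← mul_assoc, hn1, neg_mul, neg_neg, mul_assoc]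
  have hcard := H.card_torus_le h2 hu₁ hu₂ p12 hdet hx12 hcomm
  obtain ⟨n, m, hnt, hnd, hmt, hmd, hnm, hn, hm⟩ := exists_two_full_roots (n₀ := Y p) (j := x₁) h2 hq
    (scalar_mem_slGroup G) (by rw [hY]; exact trace_slMap p)
    (by rw [hY, H.det_slMap h2 hpU]; exact neg_ne_zero.2 (div_ne_zero hφp hw))
    (le_trans (Nat.mul_le_mul_right _ h6) hcard)
    (by
      refine le_trans (Nat.mul_le_mul_right _ hcq) ?_
      rw [mul_assoc]
      exact Nat.mul_le_mul_left _ hcard)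
    (by rw [hx₁, hn1])
    ⟨x₃, by
      rintro ⟨b, hb⟩
      rw [hx₃] at hb
      have h1 := hanti hpU u₃
      have h4 : (b + 1) • (Y p * Y u₃) = (polar φ p u₃ / φ w) • 1 := by
        rw [← h1, hb, add_smul, one_smul, add_comm]
      have h5 : Y (((b + 1) * (φ p / φ w)) • u₃ - (polar φ p u₃ / φ w) • p) = 0 := by
        have := congrArg (fun m => Y p * m) h4
        simp only [mul_smul_comm, ← mul_assoc, mul_one] at this
        rw [hY, H.slMap_mul_self h2 hpU, ← hY, smul_mul_assoc, one_mul, smul_smul] at this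
        rw [map_sub, map_smul, map_smul, this, sub_self]
      rw [hY] at h5
      have h7 := H.eq_zero_of_slMap h2 (U.sub_mem (U.smul_mem _ hu₃) (U.smul_mem _ hpU)) h5
      have h8 := congrArg (polar φ u₂) h7
      rw [polar_sub_right, polar_smul_right, polar_smul_right, p23, polar_comm φ u₂ p, hp2,
        polar_zero_right, smul_zero, sub_zero, smul_eq_mul, mul_one] at h8
      have h9 := (mul_eq_zero.1 h8).resolve_right (div_ne_zero hφp hw)
      rw [h9, zero_smul] at h4
      exact (smul_eq_zero.1 h4.symm).elim (div_ne_zero hp3' hw) one_ne_zero⟩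
  obtain ⟨e₁, he₁, rfl⟩ := H.exists_slMap_eq h2 hnt
  obtain ⟨f₁, hf₁, rfl⟩ := H.exists_slMap_eq h2 hmt
  rw [H.det_slMap h2 he₁] at hnd
  rw [H.det_slMap h2 hf₁] at hmd
  simp only [neg_eq_zero, div_eq_zero_iff, hw, or_false] at hnd hmd
  rw [← hY] at hnm hn hm
  have hpol : polar φ e₁ f₁ ≠ 0 := by
    intro h
    have h1 := congrArg trace (hanti he₁ f₁)
    rw [h, trace_add, trace_mul_comm (Y f₁), zero_div, zero_smul, trace_zero, ← two_mul] at h1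
    exact mul_ne_zero h2 hnm h1
  obtain ⟨f₂, hf₂⟩ : ∃ f₂, f₂ = (polar φ e₁ f₁)⁻¹ • f₁ := ⟨_, rfl⟩
  have hf₂U : f₂ ∈ U := by
    rw [hf₂]
    exact U.smul_mem _ hf₁
  have hef : IsHyp φ e₁ f₂ := ⟨hnd, by rw [hf₂, form_smul, hmd, mul_zero], by
    rw [hf₂, polar_smul_right, smul_eq_mul, inv_mul_cancel₀ hpol]⟩
  have hm' : ∀ t : F, ∃ x : slGroup φ e f w G, toMat x = 1 + t • Y f₂ := by
    intro t
    obtain ⟨x, hx⟩ := hm (t * (polar φ e₁ f₁)⁻¹)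
    exact ⟨x, by rw [hx, hf₂, map_smul, smul_smul]⟩
  have hnn : Y e₁ * Y e₁ = 0 := by
    rw [hY, H.slMap_mul_self h2 he₁, hnd, zero_div, zero_smul]
  have hmm : Y f₂ * Y f₂ = 0 := by
    rw [hY, H.slMap_mul_self h2 hf₂U, hef.right, zero_div, zero_smul]
  obtain ⟨w₁, hw₁U, hw₁⟩ := H.exists_slMap_eq h2 (n := Y e₁ * Y f₂ - Y f₂ * Y e₁)
    (by rw [trace_sub, trace_mul_comm, sub_self])
  rw [← hY] at hw₁
  have hzero : ∀ z ∈ U, Y z * Y w₁ + Y w₁ * Y z = 0 → polar φ z w₁ = 0 := by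
    intro z hz h
    rw [hanti hz] at h
    have := congrFun (congrFun h 0) 0
    simpa [hw] using this
  have hew : polar φ e₁ w₁ = 0 := hzero e₁ he₁ (by
    rw [hw₁, mul_sub, sub_mul, ← mul_assoc, ← mul_assoc, hnn, mul_assoc (Y f₂), hnn]
    simp)
  have hfw : polar φ f₂ w₁ = 0 := hzero f₂ hf₂U (by
    rw [hw₁, mul_sub, sub_mul, ← mul_assoc, ← mul_assoc, hmm, mul_assoc (Y e₁), hmm]
    simp)
  have hw₁0 : φ w₁ ≠ 0 := by
    intro h
    have h1 : (Y e₁ * Y f₂ - Y f₂ * Y e₁) * Y e₁ = (φ w)⁻¹ • Y e₁ := by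
      have := hanti he₁ f₂
      rw [hef.polar, one_div, ← eq_sub_iff_add_eq] at this
      rw [this, sub_sub, sub_mul, add_mul, mul_assoc, hnn, smul_mul_assoc, one_mul]
      simp
    have h4 : Y w₁ * Y w₁ = 0 := by
      rw [hY, H.slMap_mul_self h2 hw₁U, h, zero_div, zero_smul]
    rw [← hw₁] at h1
    have h5 : Y w₁ * (Y w₁ * Y e₁) = 0 := by rw [← mul_assoc, h4, zero_mul]
    rw [h1, mul_smul_comm, h1, smul_smul] at h5
    have h7 := (smul_eq_zero.1 h5).resolve_left (mul_ne_zero (inv_ne_zero hw) (inv_ne_zero hw))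
    rw [h7, zero_mul] at hnm
    simp at hnm
  have H₁ := hypBasis_of_finrank h2 h3 hef he₁ hf₂U hw₁U hew hfw hw₁0
  rw [hY] at hn hm' hw₁
  refine ⟨e₁, f₂, w₁, H₁, fun t => ⟨H.hasEich h2 H₁ hw₁ hGU hn t, ?_⟩⟩
  have := H.hasEich h2 H₁.symm (by rw [map_neg, hw₁, neg_sub]) hGU hm' (-t)
  rwa [neg_smul, smul_neg, neg_neg] at this

end ThreeDim

/-! ### Transitivity on vectors of given norm and its consequences -/

section Transitive

variable {F V : Type*} [Field F] [AddCommGroup V] [Module F V] {φ : QuadraticForm F V}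
  {U : Submodule F V} {e f w : V} {G : Subgroup (V ≃ₗ[F] V)}

/-- The maps fixing the orthogonal complement of `U` pointwise. -/
def perpFix (φ : QuadraticForm F V) (U : Submodule F V) : Subgroup (V ≃ₗ[F] V) where
  carrier := {g | ∀ n, (∀ z ∈ U, polar φ z n = 0) → g n = n}
  mul_mem' := by
    intro a b ha hb n hn
    rw [LinearEquiv.mul_apply, hb n hn, ha n hn]
  one_mem' := fun _ _ => rfl
  inv_mem' := by
    intro a ha n hn
    conv_lhs => rw [← ha n hn]
    rw [← LinearEquiv.mul_apply, inv_mul_cancel]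
    rfl

theorem HasEich.perpFix {x : V} (he : e ∈ U) (hx : x ∈ U) (h : HasEich φ G e x) :
    HasEich φ (G ⊓ perpFix φ U) e x := by
  obtain ⟨g, hg, hgv⟩ := h
  refine ⟨g, ⟨hg, fun n hn => ?_⟩, hgv⟩
  rw [hgv, hn e he, hn x hx]
  simp

theorem HypBasis.exists_map_eq [Finite F] (h2 : (2 : F) ≠ 0) (hq : 7 ≤ Nat.card F)
    (H : HypBasis φ U e f w) (hG : G ≤ orthGroup φ)
    (hE : ∀ t : F, HasEich φ G e (t • w) ∧ HasEich φ G f (t • w)) {z z' : V} (hz : z ∈ U)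
    (hz' : z' ∈ U) (hz0 : φ z ≠ 0) (heq : φ z = φ z') :
    ∃ g ∈ G, g z = z' ∧ ∀ n, (∀ z ∈ U, polar φ z n = 0) → g n = n := by
  have hW : ∀ x ∈ Submodule.span F {w}, ∃ t : F, x = t • w := fun x hx => by
    obtain ⟨t, ht⟩ := Submodule.mem_span_singleton.1 hx
    exact ⟨t, ht.symm⟩
  have hwW : w ∈ Submodule.span F {w} := Submodule.mem_span_singleton_self w
  rw [H.eq z hz] at hz0
  have heq' := heq
  rw [H.eq z hz, H.eq z' hz'] at heq'
  obtain ⟨g, hg, hgz⟩ := exists_map_eq_of_hasEich (G := G ⊓ StringOrth.perpFix φ U) h2 hq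
    (inf_le_left.trans hG) H.hyp (Submodule.span F {w})
    (fun x hx => by
      obtain ⟨t, rfl⟩ := hW x hx
      rw [polar_smul_right, H.left, smul_zero])
    (fun x hx => by
      obtain ⟨t, rfl⟩ := hW x hx
      rw [polar_smul_right, H.right, smul_zero])
    (fun x hx => by
      obtain ⟨t, rfl⟩ := hW x hx
      exact (hE t).1.perpFix H.left_mem (U.smul_mem _ H.mem))
    (fun x hx => by
      obtain ⟨t, rfl⟩ := hW x hx
      exact (hE t).2.perpFix H.right_mem (U.smul_mem _ H.mem))
    hwW H.ne_zero (Submodule.smul_mem _ _ hwW) (Submodule.smul_mem _ _ hwW) hz0 heq'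
  rw [← H.eq z hz, ← H.eq z' hz'] at hgz
  exact ⟨g, hg.1, hgz, hg.2⟩

theorem mem_reflSet_of_transitive (hG : G ≤ orthGroup φ)
    (htr : ∀ z ∈ U, ∀ z' ∈ U, φ z ≠ 0 → φ z = φ z' → ∃ g ∈ G, g z = z') {u x : V} (hu : u ∈ U)
    (hS : u ∈ reflSet φ G) (hus : IsSquare (φ u)) (hx : x ∈ U) (hx0 : φ x ≠ 0)
    (hxs : IsSquare (φ x)) : x ∈ reflSet φ G := by
  obtain ⟨s, hs⟩ := hxs.div hus
  have hs' : φ x = s ^ 2 * φ u := by rw [pow_two, ← hs, div_mul_cancel₀ _ hS.1]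
  have hs0 : s ≠ 0 := by
    rintro rfl
    exact hx0 (by rw [hs', zero_pow two_ne_zero, zero_mul])
  obtain ⟨g, hg, hgx⟩ := htr (s • u) (U.smul_mem _ hu) x hx (by rwa [form_smul, ← hs'])
    (by rw [form_smul, hs'])
  rw [← hgx]
  exact map_mem_reflSet (hG hg) hg (smul_mem_reflSet hs0 hS)

/-- Transitivity spreads the generators to all square norms. For `x`, `y` of nonsquare norm, some
`γ` in the group carries `x` to a multiple of `y`, so `rho φ x * rho φ y` equals `(rho φ x * γ * rho
φ x) * γ⁻¹`. This lies in the group because `rho φ x`, though perhaps outside it, normalizes it: it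
turns generators into negative symmetries of square norm. -/
theorem mem_genGroup_of_transitive [Finite F] [FiniteDimensional F V] (h2 : (2 : F) ≠ 0)
    {b : Module.Basis (Fin 5) F V} (hb : IsStd φ b 1) (hU : Nondeg φ U) {n : ℕ} {u : Fin n → V}
    {I : Set (Fin n)} (hI : ∀ i ∈ I, u i ∈ U ∧ φ (u i) ≠ 0 ∧ IsSquare (φ (u i))) (hne : I.Nonempty)
    (htr : ∀ z ∈ U, ∀ z' ∈ U, φ z ≠ 0 → φ z = φ z' → ∃ g ∈ genGroup φ u I, g z = z')
    {g : V ≃ₗ[F] V} (hg : g ∈ (spinHom b).range) {ε : F} (hε : ε = 1 ∨ ε = -1)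
    (hgU : ∀ v, g v - ε • v ∈ U) : g ∈ genGroup φ u I := by
  have hG := genGroup_le_orthGroup (φ := φ) u I
  obtain ⟨i₀, hi₀⟩ := hne
  have hfull : ∀ x ∈ U, φ x ≠ 0 → IsSquare (φ x) → rho φ x ∈ genGroup φ u I := fun x hx hx0 hxs =>
    (mem_reflSet_of_transitive hG htr (hI i₀ hi₀).1 ⟨(hI i₀ hi₀).2.1, rho_mem_genGroup u hi₀⟩
      (hI i₀ hi₀).2.2 hx hx0 hxs).2
  refine mem_of_mem_range_spinHom h2 hb hU hfull (fun x hx y hy hxs hys => ?_) hg hε hgU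
  obtain ⟨s, hs0, hs⟩ := exists_sq_mul_of_not_isSquare hxs hys
  have hx0 : φ x ≠ 0 := fun h => hxs (h ▸ IsSquare.zero)
  obtain ⟨γ, hγ, hγx⟩ := htr x hx (s • y) (U.smul_mem _ hy) hx0 (by rw [form_smul, hs])
  have hconj : ∀ k ∈ genGroup φ u I, rho φ x * k * (rho φ x)⁻¹ ∈ genGroup φ u I := by
    intro k hk
    induction hk using Subgroup.closure_induction with
    | mem k hk =>
      obtain ⟨i, hi, rfl⟩ := hk
      dsimp only
      rw [conj_rho (rho_mem_orthGroup φ x)]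
      exact hfull _ (rho_mem_of_mem hx (hI i hi).1) (by rw [form_rho]; exact (hI i hi).2.1)
        (by rw [form_rho]; exact (hI i hi).2.2)
    | one =>
      rw [mul_one, mul_inv_cancel]
      exact one_mem _
    | mul a b _ _ ha hb =>
      have := Subgroup.mul_mem _ ha hb
      rwa [← mul_assoc, ← mul_assoc, inv_mul_cancel_right, mul_assoc (rho φ x) a b] at this
    | inv a _ ha =>
      have := Subgroup.inv_mem _ ha
      rwa [mul_inv_rev, mul_inv_rev, inv_inv, ← mul_assoc] at this
  have h1 := conj_rho (hG hγ) x
  rw [hγx, rho_smul hs0] at h1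
  rw [← h1, ← mul_assoc, ← mul_assoc]
  have := Subgroup.mul_mem _ (hconj γ hγ) (Subgroup.inv_mem _ hγ)
  rwa [rho_inv] at this

end Transitive

/-! ### Extending Eichler transformations beyond the three-dimensional space -/

section Extension

variable {F V : Type*} [Field F] [AddCommGroup V] [Module F V] {φ : QuadraticForm F V}
  {U : Submodule F V} {e f w : V} {G : Subgroup (V ≃ₗ[F] V)}

theorem hasEich_zero (e : V) : HasEich φ G e 0 := ⟨1, G.one_mem, fun v => by simp⟩

/-- For singular `e` orthogonal to `r`, the symmetries in `r + s e` and `r` multiply to an Eichler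
transformation along `e` in a direction proportional to `r`; the choice `s = -t φ(r)` makes it `t
r`. -/
theorem hasEich_smul_of_reflSet (he : φ e = 0) {r : V} (her : polar φ e r = 0)
    (hr : ∀ t : F, r + t • e ∈ reflSet φ G) (t : F) : HasEich φ G e (t • r) := by
  have hr' := hr 0
  rw [zero_smul, add_zero] at hr'
  by_cases ht : t = 0
  · rw [ht, zero_smul]
    exact hasEich_zero e
  have hφr := hr'.1
  refine ⟨rho φ (r + (-(t * φ r)) • e) * rho φ r, G.mul_mem (hr _).2 hr'.2, fun v => ?_⟩
  have hform : φ (r + (-(t * φ r)) • e) = φ r := by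
    rw [form_add, form_smul, polar_smul_right, polar_comm, her, he]
    simp
  rw [LinearEquiv.mul_apply, rho_apply φ _ (rho φ r v), hform, rho_apply]
  simp only [polar_add_left, polar_smul_left, polar_sub_right, polar_smul_right, polar_self_eq, her,
    form_smul, smul_eq_mul]
  match_scalars <;> field_simp <;> ring

/-- The Eichler transformations along `e` in direction `w` shift `y w + t n` by all multiples of
`e`, so the preceding lemma gives the direction `y w + t n`. Its part along `w` is already available
and is subtracted. -/
theorem hasEich_smul_of_add (h2 : (2 : F) ≠ 0) (hG : G ≤ orthGroup φ) (he : φ e = 0)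
    (hew : polar φ e w = 0) (hw : φ w ≠ 0) (hE : ∀ t : F, HasEich φ G e (t • w)) {n : V}
    (hen : polar φ e n = 0) (hwn : polar φ w n = 0) {y t : F} (hy : y ≠ 0) (ht : t ≠ 0)
    (hr : y • w + t • n ∈ reflSet φ G) (τ : F) : HasEich φ G e (τ • n) := by
  have her : polar φ e (y • w + t • n) = 0 := by
    rw [polar_add_right, polar_smul_right, polar_smul_right, hew, hen, smul_zero, smul_zero,
      add_zero]
  have h1 : ∀ s : F, y • w + t • n + s • e ∈ reflSet φ G := by
    intro s
    obtain ⟨g, hg, hgv⟩ := hE (-(s / (2 * φ w * y)))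
    have : y • w + t • n + s • e = g (y • w + t • n) := by
      rw [hgv, her, polar_smul_left, polar_add_right, polar_smul_right, polar_smul_right, hwn,
        polar_self_eq]
      simp only [smul_eq_mul]
      match_scalars <;> field_simp <;> ring
    rw [this]
    exact map_mem_reflSet (hG hg) hg hr
  have h3 := hasEich_smul_of_reflSet he her h1 (τ / t)
  have h4 := h3.add he (by rw [polar_smul_right, her, smul_zero])
    (by rw [polar_smul_right, hew, smul_zero]) (hE (-(τ * y / t)))
  convert h4 using 1
  match_scalars
  · field_simp
  · field_simp
    ring

/-- If the group contains the Eichler transformations of `U`, they extend in the direction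
of the component orthogonal to `U` of any further symmetry vector. -/
theorem HypBasis.hasEich_extend [Finite F] (h2 : (2 : F) ≠ 0) (hq : 7 ≤ Nat.card F)
    (H : HypBasis φ U e f w) (hG : G ≤ orthGroup φ)
    (hE : ∀ t : F, HasEich φ G e (t • w) ∧ HasEich φ G f (t • w))
    (hfull : ∀ x ∈ U, φ x ≠ 0 → IsSquare (φ x) → x ∈ reflSet φ G) {z n : V} (hz : z ∈ U)
    (hn : ∀ z ∈ U, polar φ z n = 0) (hs : z + n ∈ reflSet φ G) (hz0 : φ z ≠ 0) (hn0 : φ n ≠ 0)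
    (τ : F) : HasEich φ G e (τ • n) ∧ HasEich φ G f (τ • n) := by
  have hfe := H.hyp.symm.polar
  obtain ⟨c, hc⟩ : ∃ c, c = φ z := ⟨_, rfl⟩
  obtain ⟨z', hz'⟩ : ∃ z', z' = e + c • f := ⟨_, rfl⟩
  have hz'U : z' ∈ U := by
    rw [hz']
    exact U.add_mem H.left_mem (U.smul_mem _ H.right_mem)
  have hφz' : φ z' = c := by
    rw [hz', form_add, form_smul, polar_smul_right, H.hyp.left, H.hyp.right, H.hyp.polar]
    simp
  obtain ⟨g, hg, hgz, hgn⟩ := H.exists_map_eq h2 hq hG hE hz hz'U hz0 (by rw [hφz', hc])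
  have hr₀ : z' + n ∈ reflSet φ G := by
    have := map_mem_reflSet (hG hg) hg hs
    rwa [map_add, hgz, hgn n hn] at this
  -- The aim is a symmetry vector `y w + t n`. If `x` in `U` has norm `m²` and `(z', x) = t N`, the
  -- symmetry in `z' + n` sends it to `(t z' - x) + t n`, and the part in `U` has the norm of `y w`
  -- exactly when `m² = t² φ(n) + y² φ(w)`. The two conditions on `x` amount to one quadratic
  -- equation in its coordinates `γ` and `a`; transitivity on `U` then replaces `t z' - x` by `y w`.
  obtain ⟨m, t, y, hm, ht, hy, hmty⟩ := exists_sq_eq_add_sq h2 hq hn0 H.ne_zero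
  obtain ⟨N, hN⟩ : ∃ N, N = φ (z' + n) := ⟨_, rfl⟩
  have hN0 : N ≠ 0 := hN ▸ hr₀.1
  obtain ⟨γ, a, ha⟩ := exists_quadratic_sum h2 H.ne_zero (neg_ne_zero.2 (hc ▸ hz0)) (t * N) (m ^ 2)
  obtain ⟨x, hx⟩ : ∃ x, x = a • e + (t * N - c * a) • f + γ • w := ⟨_, rfl⟩
  have hxU : x ∈ U := by
    rw [hx]
    exact U.add_mem (U.add_mem (U.smul_mem _ H.left_mem) (U.smul_mem _ H.right_mem))
      (U.smul_mem _ H.mem)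
  have hφx : φ x = m ^ 2 := by
    rw [hx]
    simp only [form_add, form_smul, polar_add_left, polar_smul_left, polar_smul_right, H.hyp.left,
      H.hyp.right, H.hyp.polar, H.left, H.right, smul_eq_mul]
    linear_combination ha
  have hzx : polar φ z' x = t * N := by
    rw [hx, hz']
    simp only [polar_add_left, polar_add_right, polar_smul_left, polar_smul_right, polar_self_eq,
      H.hyp.left, H.hyp.right, H.hyp.polar, hfe, H.left, H.right, smul_eq_mul]
    ring
  have hnx : polar φ n x = 0 := by rw [polar_comm, hn x hxU]
  have hxS := hfull x hxU (by rw [hφx]; exact pow_ne_zero 2 hm) ⟨m, by rw [hφx, pow_two]⟩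
  have hs' := rho_mem_reflSet hr₀ hxS
  have hval : rho φ (z' + n) x = (t • z' - x) + t • n := by
    rw [rho_apply, polar_add_left, hzx, hnx, ← hN, add_zero, mul_div_assoc, div_self hN0, mul_one]
    module
  rw [hval] at hs'
  have hNc : N = c + φ n := by rw [hN, form_add, hφz', hn z' hz'U, add_zero]
  have hφd : φ (t • z' - x) = φ (y • w) := by
    rw [form_sub, form_smul, form_smul, polar_smul_left, hφz', hφx, hzx, hNc, smul_eq_mul]
    linear_combination hmty
  obtain ⟨k, hk, hkz, hkn⟩ := H.exists_map_eq h2 hq hG hE (U.sub_mem (U.smul_mem t hz'U) hxU)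
    (U.smul_mem y H.mem) (by
      rw [hφd, form_smul]
      exact mul_ne_zero (pow_ne_zero 2 hy) H.ne_zero) hφd
  have hr := map_mem_reflSet (hG hk) hk hs'
  rw [map_add, hkz, map_smul, hkn n hn] at hr
  exact ⟨hasEich_smul_of_add h2 hG H.hyp.left H.left H.ne_zero (fun t => (hE t).1)
      (hn e H.left_mem) (hn w H.mem) hy ht hr τ,
    hasEich_smul_of_add h2 hG H.hyp.right H.right H.ne_zero (fun t => (hE t).2)
      (hn f H.right_mem) (hn w H.mem) hy ht hr τ⟩

/-- The projection of `s` to the span of a path `v₁`, `v₂`, `v₃`. -/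
theorem exists_path_projection {v₁ v₂ v₃ s : V} (p12 : polar φ v₁ v₂ = 1)
    (p23 : polar φ v₂ v₃ = 1) (p13 : polar φ v₁ v₃ = 0) (s1 : polar φ v₁ s = 1)
    (s2 : polar φ v₂ s = 0) (s3 : polar φ v₃ s = 0) (hdet : 4 * (φ v₂ * φ v₃) ≠ 1) {D : F}
    (hD : D = 2 * φ v₁ * (4 * (φ v₂ * φ v₃) - 1) - 2 * φ v₃) (hD0 : D ≠ 0)
    (hD' : 2 * D * φ s ≠ 4 * (φ v₂ * φ v₃) - 1) : ∃ (c₁ c₂ c₃ : F) (n : V),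
      s = (c₁ • v₁ + c₂ • v₂ + c₃ • v₃) + n ∧ polar φ v₁ n = 0 ∧ polar φ v₂ n = 0 ∧
      polar φ v₃ n = 0 ∧ φ (c₁ • v₁ + c₂ • v₂ + c₃ • v₃) ≠ 0 ∧ φ n ≠ 0 := by
  obtain ⟨δ, hδ⟩ : ∃ δ, δ = 4 * (φ v₂ * φ v₃) - 1 := ⟨_, rfl⟩
  have hδ0 : δ ≠ 0 := hδ ▸ sub_ne_zero.2 hdet
  have p21 : polar φ v₂ v₁ = 1 := by rw [polar_comm, p12]
  have p32 : polar φ v₃ v₂ = 1 := by rw [polar_comm, p23]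
  have p31 : polar φ v₃ v₁ = 0 := by rw [polar_comm, p13]
  rw [← hδ] at hD hD'
  -- This is the vector dual to `v₁`, with coefficients from the cofactors of the Gram matrix of the
  -- path, whose determinant is `D`. Its norm is `δ / (2 D)` and that of `s - z` is `φ s - δ / (2
  -- D)`.
  obtain ⟨z, hz⟩ : ∃ z, z = (δ / D) • v₁ + (-(2 * φ v₃) / D) • v₂ + (1 / D) • v₃ := ⟨_, rfl⟩
  have z1 : polar φ v₁ z = 1 := by
    rw [hz]
    simp only [polar_add_right, polar_smul_right, polar_self_eq, p12, p13, smul_eq_mul]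
    field_simp
    rw [hD]
    ring
  have z2 : polar φ v₂ z = 0 := by
    rw [hz]
    simp only [polar_add_right, polar_smul_right, polar_self_eq, p21, p23, smul_eq_mul]
    field_simp
    rw [hδ]
    ring
  have z3 : polar φ v₃ z = 0 := by
    rw [hz]
    simp only [polar_add_right, polar_smul_right, polar_self_eq, p31, p32, smul_eq_mul]
    field_simp
    ring
  have hzz : ∀ x : V, polar φ z x =
      δ / D * polar φ v₁ x + -(2 * φ v₃) / D * polar φ v₂ x + 1 / D * polar φ v₃ x := by
    intro x
    conv_lhs => rw [hz]
    simp only [polar_add_left, polar_smul_left, smul_eq_mul]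
  have hφz : 2 * φ z = δ / D := by
    rw [← polar_self_eq, hzz, z1, z2, z3]
    ring
  have hφn : 2 * φ (s - z) = 2 * φ s - δ / D := by
    rw [form_sub, polar_comm φ s z, hzz s, s1, s2, s3]
    linear_combination hφz
  refine ⟨_, _, _, s - z, by rw [← hz, add_sub_cancel], by rw [polar_sub_right, s1, z1, sub_self],
    by rw [polar_sub_right, s2, z2, sub_self], by rw [polar_sub_right, s3, z3, sub_self], ?_, ?_⟩
  · rw [← hz]
    intro h
    rw [h, mul_zero] at hφz
    exact div_ne_zero hδ0 hD0 hφz.symm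
  · intro h
    rw [h, mul_zero] at hφn
    apply hD'
    field_simp at hφn
    linear_combination -hφn

end Extension

/-! ### Odd q: generation and intersections -/

section OddGeneration

variable {F V : Type*} [Field F] [AddCommGroup V] [Module F V] {φ : QuadraticForm F V}

/-- Each generator acts as -1 both modulo its own line and on the orthogonal complement of that
line, so a word acts through a sign that depends on its length. -/
theorem exists_sign_of_mem_genGroup {n : ℕ} (u : Fin n → V) {I : Set (Fin n)} {g : V ≃ₗ[F] V}
    (hg : g ∈ genGroup φ u I) : ∃ ε : F, (ε = 1 ∨ ε = -1) ∧
      (∀ v, g v - ε • v ∈ Submodule.span F (u '' I)) ∧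
      ∀ v, (∀ i ∈ I, polar φ (u i) v = 0) → g v = ε • v := by
  induction hg using Subgroup.closure_induction with
  | mem x hx =>
    obtain ⟨i, hi, rfl⟩ := hx
    refine ⟨-1, Or.inr rfl, fun v => ?_, fun v hv => ?_⟩
    · rw [rho_apply, neg_one_smul, sub_neg_eq_add, sub_add_cancel]
      exact Submodule.smul_mem _ _ (Submodule.subset_span ⟨i, hi, rfl⟩)
    · rw [rho_apply, hv i hi]
      simp
  | one => exact ⟨1, Or.inl rfl, by simp, by simp⟩
  | mul x y _ _ hx hy =>
    obtain ⟨ε, hε, h1, h3⟩ := hx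
    obtain ⟨η, hη, h4, h5⟩ := hy
    refine ⟨ε * η, ?_, fun v => ?_, fun v hv => ?_⟩
    · rcases hε with rfl | rfl <;> rcases hη with rfl | rfl <;> simp
    · have := Submodule.add_mem _ (h1 (y v)) (Submodule.smul_mem _ ε (h4 v))
      rwa [smul_sub, sub_add_sub_cancel, smul_smul] at this
    · rw [LinearEquiv.mul_apply, h5 v hv, map_smul, h3 v hv, smul_smul, mul_comm]
  | inv x _ hx =>
    obtain ⟨ε, hε, h1, h3⟩ := hx
    have hεε : ε * ε = 1 := by rcases hε with rfl | rfl <;> simp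
    refine ⟨ε, hε, fun v => ?_, fun v hv => ?_⟩
    · have := Submodule.smul_mem _ (-ε) (h1 (x⁻¹ v))
      rw [← LinearEquiv.mul_apply, mul_inv_cancel, smul_sub, smul_smul, neg_mul, hεε] at this
      simpa [add_comm, sub_eq_add_neg] using this
    · have := congrArg (x⁻¹ : V ≃ₗ[F] V) (h3 v hv)
      rw [← LinearEquiv.mul_apply, inv_mul_cancel, map_smul, LinearEquiv.coe_one, id_eq] at this
      conv_rhs => rw [this, smul_smul, hεε, one_smul]

theorem IsStd.nondeg (h2 : (2 : F) ≠ 0) {b : Module.Basis (Fin 5) F V} (hb : IsStd φ b 1) :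
    Nondeg φ (⊤ : Submodule F V) := by
  intro y _ hy
  have hb' : ∀ v, φ v = b.repr v 0 * b.repr v 1 + b.repr v 2 * b.repr v 3 + 1 * b.repr v 4 ^ 2 := hb
  have h := fun i => hy (b i) trivial
  simp only [polar, hb'] at h
  have e0 := h 0
  have e1 := h 1
  have e2 := h 2
  have e3 := h 3
  have e4 := h 4
  simp at e0 e1 e2 e3 e4
  have e4' : 2 * b.repr y 4 = 0 := by linear_combination e4
  rw [← basis_sum_five b y, (mul_eq_zero.1 e4').resolve_left h2,
    show b.repr y 0 = 0 by linear_combination e1, show b.repr y 1 = 0 by linear_combination e0,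
    show b.repr y 2 = 0 by linear_combination e3, show b.repr y 3 = 0 by linear_combination e2]
  simp

/-- The order of `h(a, b)` is `(q ± 1) / 2`, in the form needed for planes. -/
theorem hasOrderOdd_dvd [Finite F] (hodd : Odd (Nat.card F)) (hq : 5 ≤ Nat.card F) {a b : F}
    (h : HasOrderOdd a b) : 0 < orderOf (hMatrix a b) ∧
      ((orderOf (hMatrix a b) ∣ Nat.card F - 1 ∧ Nat.card F - 1 ∣ 2 * orderOf (hMatrix a b)) ∨
      (orderOf (hMatrix a b) ∣ Nat.card F + 1 ∧ Nat.card F + 1 ∣ 2 * orderOf (hMatrix a b))) := by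
  obtain ⟨k, hk⟩ := hodd
  have e1 : (Nat.card F - 1) / 2 = k := by omega
  have e2 : (Nat.card F + 1) / 2 = k + 1 := by omega
  rw [HasOrderOdd, e1, e2] at h
  have e3 : Nat.card F - 1 = 2 * k := by omega
  have e4 : Nat.card F + 1 = 2 * (k + 1) := by omega
  rw [e3, e4]
  rcases h with h | h <;> rw [h]
  · exact ⟨by omega, Or.inl ⟨dvd_mul_left _ _, dvd_rfl⟩⟩
  · exact ⟨by omega, Or.inr ⟨dvd_mul_left _ _, dvd_rfl⟩⟩

variable [Finite F] [FiniteDimensional F V]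

/-- The torus of order `(q ± 1) / 2` contains the product of any two negative symmetries of the
plane whose norms agree up to squares. This covers both kinds of factors that
`mem_of_mem_range_spinHom` requires. -/
theorem mem_genGroup_of_plane (h2 : (2 : F) ≠ 0) (hodd : Odd (Nat.card F)) (hq : 5 ≤ Nat.card F)
    {b : Module.Basis (Fin 5) F V} (hb : IsStd φ b 1) {n : ℕ} (u : Fin n → V) {i j : Fin n}
    (hi : φ (u i) ≠ 0) (hj : φ (u j) ≠ 0) (his : IsSquare (φ (u i)))
    (hij : polar φ (u i) (u j) = 1) (hdet : 4 * (φ (u i) * φ (u j)) ≠ 1)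
    (hord : HasOrderOdd (φ (u i)) (φ (u j))) {g : V ≃ₗ[F] V} (hg : g ∈ (spinHom b).range) {ε : F}
    (hε : ε = 1 ∨ ε = -1) (hgU : ∀ v, g v - ε • v ∈ Submodule.span F (u '' {i, j})) :
    g ∈ genGroup φ u {i, j} := by
  have hspan : ∀ x, x ∈ Submodule.span F (u '' {i, j}) → ∃ a b : F, x = a • u i + b • u j := by
    intro x hx
    rw [Set.image_pair, Submodule.mem_span_pair] at hx
    obtain ⟨a, b, rfl⟩ := hx
    exact ⟨a, b, rfl⟩
  have hri : rho φ (u i) ∈ genGroup φ u {i, j} := rho_mem_genGroup u (Set.mem_insert _ _)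
  have hrj : rho φ (u j) ∈ genGroup φ u {i, j} :=
    rho_mem_genGroup u (Set.mem_insert_of_mem _ rfl)
  obtain ⟨hc0, hcq⟩ := hasOrderOdd_dvd hodd hq hord
  refine mem_of_mem_range_spinHom h2 hb ?_ ?_ ?_ hg hε hgU
  · intro x hx hxU
    have h1 := hxU (u i) (Submodule.subset_span ⟨i, Set.mem_insert _ _, rfl⟩)
    have h3 := hxU (u j) (Submodule.subset_span ⟨j, Set.mem_insert_of_mem _ rfl, rfl⟩)
    obtain ⟨a, c, rfl⟩ := hspan x hx
    simp only [polar_add_left, polar_smul_left, polar_self_eq, hij, polar_comm φ (u j) (u i),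
      smul_eq_mul] at h1 h3
    have ha : a * (4 * (φ (u i) * φ (u j)) - 1) = 0 := by
      linear_combination 2 * φ (u j) * h1 - h3
    have ha0 := (mul_eq_zero.1 ha).resolve_right (sub_ne_zero.2 hdet)
    have hc : c = 0 := by
      rw [ha0] at h1
      linear_combination h1
    rw [ha0, hc]
    simp
  · intro x hx hx0 hxs
    obtain ⟨a, c, rfl⟩ := hspan x hx
    obtain ⟨s, hs⟩ := hxs.div his
    have hs' : φ (a • u i + c • u j) = s ^ 2 * φ (u i) := by
      rw [pow_two, ← hs, div_mul_cancel₀ _ hi]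
    refine (mem_reflSet_of_plane (s := s) ⟨hi, hri⟩ ⟨hj, hrj⟩ hij hdet rfl hc0 hcq ?_ hs').2
    rintro rfl
    exact hx0 (by rw [hs', zero_pow two_ne_zero, zero_mul])
  · intro x hx y hy hxs hys
    obtain ⟨s, hs0, hs⟩ := exists_sq_mul_of_not_isSquare hxs hys
    obtain ⟨a, c, hx'⟩ := hspan x hx
    obtain ⟨d, l, hy'⟩ := hspan y hy
    obtain ⟨k, hk⟩ := exists_rho_eq_pow_mul hi hj hij hdet rfl hc0 hcq hs0 hx' hy'
      (fun h => hys (h ▸ IsSquare.zero)) hs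
    rw [hk, mul_assoc, rho_mul_self, mul_one]
    exact Subgroup.pow_mem _ (Subgroup.mul_mem _ hri hrj) k

theorem mem_genGroup_of_line (h2 : (2 : F) ≠ 0) {b : Module.Basis (Fin 5) F V} (hb : IsStd φ b 1)
    {n : ℕ} (u : Fin n → V) {i : Fin n} (hi : φ (u i) ≠ 0) (his : IsSquare (φ (u i)))
    {g : V ≃ₗ[F] V} (hg : g ∈ (spinHom b).range) {ε : F} (hε : ε = 1 ∨ ε = -1)
    (hgU : ∀ v, g v - ε • v ∈ Submodule.span F (u '' {i})) : g ∈ genGroup φ u {i} := by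
  have hspan : ∀ x, x ∈ Submodule.span F (u '' {i}) → ∃ c : F, x = c • u i := by
    intro x hx
    rw [Set.image_singleton, Submodule.mem_span_singleton] at hx
    obtain ⟨c, rfl⟩ := hx
    exact ⟨c, rfl⟩
  refine mem_of_mem_range_spinHom h2 hb ?_ ?_ ?_ hg hε hgU
  · intro x hx hxU
    have h1 := hxU (u i) (Submodule.subset_span ⟨i, rfl, rfl⟩)
    obtain ⟨c, rfl⟩ := hspan x hx
    rw [polar_smul_left, polar_self_eq, smul_eq_mul] at h1
    rw [(mul_eq_zero.1 h1).resolve_right (mul_ne_zero h2 hi), zero_smul]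
  · intro x hx hx0 _
    obtain ⟨c, rfl⟩ := hspan x hx
    rw [rho_smul (fun h => hx0 (by rw [h, zero_smul, QuadraticMap.map_zero]))]
    exact rho_mem_genGroup u rfl
  · intro x hx y _ hxs
    obtain ⟨c, rfl⟩ := hspan x hx
    refine absurd ?_ hxs
    rw [form_smul]
    exact (IsSquare.sq c).mul his

/-- Odd characteristic: the symmetries with respect to the given vectors generate the image
of the symplectic group, and satisfy the intersection property. -/
theorem genGroup_eq_range_and_intersection (h2 : (2 : F) ≠ 0) (hodd : Odd (Nat.card F))
    (hq : 11 ≤ Nat.card F) {b : Module.Basis (Fin 5) F V} (hb : IsStd φ b 1)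
    (u : Module.Basis (Fin 5) F V) {X a : F} (hX : X ≠ 0) (hXs : IsSquare X) (ha : a ≠ 0)
    (has : IsSquare a)
    (hd : φ (u 0) = 1 ∧ φ (u 1) = X ∧ φ (u 2) = 1 ∧ φ (u 3) = a ∧ φ (u 4) = 1)
    (h1 : ∀ i j : Fin 5, (i : ℕ) + 1 = j → polar φ (u i) (u j) = 1)
    (h0 : ∀ i j : Fin 5, (i : ℕ) + 1 < j → polar φ (u i) (u j) = 0)
    (ordX : HasOrderOdd X 1) (orda : HasOrderOdd 1 a) (hX4 : 4 * X ≠ 1) (ha4 : 4 * a ≠ 1)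
    (h6 : 6 ≤ orderOf (hMatrix X 1)) (hD : (4 * X - 1) * a ≠ X)
    (hN : 16 * (a * X) - 8 * a - 4 * X + 1 ≠ 0) (hN' : 16 * (a * X) - 8 * X - 4 * a + 1 ≠ 0) :
    genGroup φ u Set.univ = (spinHom b).range ∧
    ∀ a b : ℕ, a < b → b ≤ 4 → ∀ g,
      g ∈ genGroup φ u {i | a ≤ (i : ℕ) ∧ (i : ℕ) < b} →
      g ∈ genGroup φ u {i | a + 1 ≤ (i : ℕ) ∧ (i : ℕ) < b + 1} →
      g ∈ genGroup φ u {i | a + 1 ≤ (i : ℕ) ∧ (i : ℕ) < b} := by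
  obtain ⟨d0, d1, d2, d3, d4⟩ := hd
  have p01 := h1 0 1 rfl
  have p12 := h1 1 2 rfl
  have p23 := h1 2 3 rfl
  have p34 := h1 3 4 rfl
  have p02 := h0 0 2 (by decide)
  have p03 := h0 0 3 (by decide)
  have p13 := h0 1 3 (by decide)
  have p14 := h0 1 4 (by decide)
  have p24 := h0 2 4 (by decide)
  have p10 : polar φ (u 1) (u 0) = 1 := by rw [polar_comm, p01]
  have p21 : polar φ (u 2) (u 1) = 1 := by rw [polar_comm, p12]
  have p32 : polar φ (u 3) (u 2) = 1 := by rw [polar_comm, p23]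
  have p20 : polar φ (u 2) (u 0) = 0 := by rw [polar_comm, p02]
  have p30 : polar φ (u 3) (u 0) = 0 := by rw [polar_comm, p03]
  have p31 : polar φ (u 3) (u 1) = 0 := by rw [polar_comm, p13]
  have hne : ∀ i, φ (u i) ≠ 0 := by
    intro i
    fin_cases i
    exacts [d0 ▸ one_ne_zero, d1 ▸ hX, d2 ▸ one_ne_zero, d3 ▸ ha, d4 ▸ one_ne_zero]
  have hsq : ∀ i, IsSquare (φ (u i)) := by
    intro i
    fin_cases i
    exacts [d0 ▸ IsSquare.one, d1 ▸ hXs, d2 ▸ IsSquare.one, d3 ▸ has, d4 ▸ IsSquare.one]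
  have hrange : ∀ I, genGroup φ u I ≤ (spinHom b).range := by
    intro I
    rw [genGroup, Subgroup.closure_le]
    rintro _ ⟨i, -, rfl⟩
    exact mem_range_spinHom_of_isLift (isLift_rho hb (hne i)) (hsq i)
  -- the three-dimensional space
  obtain ⟨U, hUdef⟩ : ∃ U, U = Submodule.span F (u '' {1, 2, 3}) := ⟨_, rfl⟩
  have hmem : ∀ i ∈ ({1, 2, 3} : Set (Fin 5)), u i ∈ U := fun i hi =>
    hUdef ▸ Submodule.subset_span ⟨i, hi, rfl⟩
  have m1 := hmem 1 (by simp)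
  have m2 := hmem 2 (by simp)
  have m3 := hmem 3 (by simp)
  have hspan : ∀ x ∈ U, ∃ a b c : F, x = a • u 1 + b • u 2 + c • u 3 := by
    intro x hx
    rw [hUdef, Set.image_insert_eq, Set.image_pair, Submodule.mem_span_insert] at hx
    obtain ⟨a, y, hy, rfl⟩ := hx
    obtain ⟨b, c, rfl⟩ := Submodule.mem_span_pair.1 hy
    exact ⟨a, b, c, by rw [add_assoc]⟩
  have hperp : ∀ n, polar φ (u 1) n = 0 → polar φ (u 2) n = 0 → polar φ (u 3) n = 0 →
      ∀ z ∈ U, polar φ z n = 0 := by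
    intro n n1 n2 n3 z hz
    obtain ⟨a, b, c, rfl⟩ := hspan z hz
    simp [polar_add_left, polar_smul_left, n1, n2, n3]
  have hfin : Module.finrank F U = 3 := by
    rw [hUdef, show u '' {1, 2, 3} = Set.range (u ∘ ![1, 2, 3]) by
      rw [Set.range_comp]
      congr 1
      ext i
      fin_cases i <;> simp]
    rw [finrank_span_eq_card (u.linearIndependent.comp _ (by decide)), Fintype.card_fin]
  have hUnd : Nondeg φ U := by
    intro x hx hxU
    have e1 := hxU (u 1) m1
    have e2 := hxU (u 2) m2
    have e3 := hxU (u 3) m3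
    obtain ⟨r, s, t, rfl⟩ := hspan x hx
    simp only [polar_add_left, polar_smul_left, polar_self_eq, p12, p13, p21, p23, p31, p32, d1, d2,
      d3, smul_eq_mul] at e1 e2 e3
    have hr : r * (2 * ((4 * X - 1) * a - X)) = 0 := by
      linear_combination 4 * a * e1 - e1 - 2 * a * e2 + e3
    have hr0 := (mul_eq_zero.1 hr).resolve_right (mul_ne_zero h2 (sub_ne_zero.2 hD))
    rw [hr0] at e1 e2
    have hs0 : s = 0 := by linear_combination e1
    rw [hs0] at e2
    have ht0 : t = 0 := by linear_combination e2
    rw [hr0, hs0, ht0]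
    simp
  have ordeq := orderOf_rho_mul_rho (hne 1) (hne 2) p12 (by rw [d1, d2, mul_one]; exact hX4)
  rw [d1, d2] at ordeq
  obtain ⟨e, f, w, H, hE⟩ := exists_hypBasis_hasEich h2 hq hfin hUnd (G := genGroup φ u {1, 2, 3})
    (fun g hg => by
      obtain ⟨ε, hε, h, -⟩ := exists_sign_of_mem_genGroup u hg
      exact ⟨ε, hε, hUdef ▸ h⟩) m1 m2 m3
    ⟨hne 1, rho_mem_genGroup u (by simp)⟩ ⟨hne 2, rho_mem_genGroup u (by simp)⟩
    ⟨hne 3, rho_mem_genGroup u (by simp)⟩ p12 p23 p13 (by rw [d1, d2, mul_one]; exact hX4)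
    (by rw [d1, d2, d3, mul_one]; exact hD) (by rw [ordeq]; exact h6) (by
      rw [ordeq]
      rcases (hasOrderOdd_dvd hodd (by omega) ordX).2 with h | h
      · exact Nat.le_of_dvd (by omega) h.2
      · have := Nat.le_of_dvd (by omega) h.2
        omega)
  have htrU : ∀ z ∈ U, ∀ z' ∈ U, φ z ≠ 0 → φ z = φ z' →
      ∃ g ∈ genGroup φ u {1, 2, 3}, g z = z' := by
    intro z hz z' hz' hz0 hzz
    obtain ⟨g, hg, hgz, -⟩ := H.exists_map_eq h2 (by omega) (genGroup_le_orthGroup u _) hE hz hz' hz0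
      hzz
    exact ⟨g, hg, hgz⟩
  have hK123 : ∀ g ∈ (spinHom b).range, ∀ ε : F, (ε = 1 ∨ ε = -1) →
      (∀ v, g v - ε • v ∈ Submodule.span F (u '' {1, 2, 3})) → g ∈ genGroup φ u {1, 2, 3} := by
    intro g hg ε hε hgU
    exact mem_genGroup_of_transitive h2 hb hUnd (fun i hi => ⟨hmem i hi, hne i, hsq i⟩) ⟨1, by simp⟩
      htrU hg hε (hUdef ▸ hgU)
  -- generation
  obtain ⟨G, hGdef⟩ : ∃ G, G = genGroup φ u Set.univ := ⟨_, rfl⟩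
  have hG : G ≤ orthGroup φ := hGdef ▸ genGroup_le_orthGroup u _
  have hGle : genGroup φ u {1, 2, 3} ≤ G := hGdef ▸ genGroup_mono u (Set.subset_univ _)
  have hS : ∀ i, u i ∈ reflSet φ G := fun i =>
    ⟨hne i, hGdef ▸ rho_mem_genGroup u (Set.mem_univ i)⟩
  have hEG : ∀ t : F, HasEich φ G e (t • w) ∧ HasEich φ G f (t • w) := fun t =>
    ⟨(hE t).1.mono hGle, (hE t).2.mono hGle⟩
  have hfull : ∀ x ∈ U, φ x ≠ 0 → IsSquare (φ x) → x ∈ reflSet φ G := fun x hx hx0 hxs =>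
    reflSet_mono hGle (mem_reflSet_of_transitive (genGroup_le_orthGroup u _) htrU m1
      ⟨hne 1, rho_mem_genGroup u (by simp)⟩ (hsq 1) hx hx0 hxs)
  -- The outer vectors `u 0` and `u 4` are split into a component in `U` and orthogonal components
  -- `n` and `n'`. That these are nonsingular is what `hN` and `hN'` express; together with `U` they
  -- span the space, so the Eichler directions `w`, `n`, `n'` exhaust the complement `W` of the pair
  -- `e`, `f`.
  have hD' : 2 * ((4 * X - 1) * a - X) ≠ 0 := mul_ne_zero h2 (sub_ne_zero.2 hD)
  obtain ⟨r₁, r₂, r₃, n, hn, n1, n2, n3, hz0, hn0⟩ := exists_path_projection p12 p23 p13 p10 p20 p30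
    (by rw [d2, d3, one_mul]; exact ha4) (D := 2 * ((4 * X - 1) * a - X))
    (by rw [d1, d2, d3]; ring) hD' (by
      rw [d0, d2, d3]
      intro h
      exact hN (by linear_combination h))
  obtain ⟨s₁, s₂, s₃, n', hn', n1', n2', n3', hz0', hn0'⟩ := exists_path_projection p32 p21 p31 p34
    p24 p14 (by rw [d1, d2, one_mul]; exact hX4) (D := 2 * ((4 * X - 1) * a - X))
    (by rw [d1, d2, d3]; ring) hD' (by
      rw [d4, d2, d1]
      intro h
      exact hN' (by linear_combination h))
  have hnU := hperp n n1 n2 n3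
  have hnU' := hperp n' n3' n2' n1'
  have hcomb : ∀ c₁ c₂ c₃ : F, ∀ x ∈ U, ∀ y ∈ U, ∀ z ∈ U, c₁ • x + c₂ • y + c₃ • z ∈ U :=
    fun c₁ c₂ c₃ x hx y hy z hz =>
      U.add_mem (U.add_mem (U.smul_mem _ hx) (U.smul_mem _ hy)) (U.smul_mem _ hz)
  have hzU := hcomb r₁ r₂ r₃ _ m1 _ m2 _ m3
  have hzU' := hcomb s₁ s₂ s₃ _ m3 _ m2 _ m1
  have hEn := H.hasEich_extend h2 (by omega) hG hEG hfull hzU hnU (hn ▸ hS 0) hz0 hn0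
  have hEn' := H.hasEich_extend h2 (by omega) hG hEG hfull hzU' hnU' (hn' ▸ hS 4) hz0' hn0'
  have hdec : ∀ x, polar φ e x = 0 → polar φ f x = 0 →
      ∃ c d d' : F, x = c • w + d • n + d' • n' := by
    intro x hex hfx
    obtain ⟨y, hyU, hy⟩ : ∃ y ∈ U, x = y + u.repr x 0 • n + u.repr x 4 • n' := by
      refine ⟨u.repr x 0 • (r₁ • u 1 + r₂ • u 2 + r₃ • u 3) +
        (u.repr x 1 • u 1 + u.repr x 2 • u 2 + u.repr x 3 • u 3) +
        u.repr x 4 • (s₁ • u 3 + s₂ • u 2 + s₃ • u 1), U.add_mem (U.add_mem (U.smul_mem _ hzU)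
          (hcomb _ _ _ _ m1 _ m2 _ m3)) (U.smul_mem _ hzU'), ?_⟩
      have h5 := basis_sum_five u x
      rw [hn, hn'] at h5
      nth_rewrite 1 [← h5]
      module
    have hey : polar φ e y = 0 := by
      rw [hy, polar_add_right, polar_add_right, polar_smul_right, polar_smul_right,
        hnU e H.left_mem, hnU' e H.left_mem] at hex
      simpa using hex
    have hfy : polar φ f y = 0 := by
      rw [hy, polar_add_right, polar_add_right, polar_smul_right, polar_smul_right,
        hnU f H.right_mem, hnU' f H.right_mem] at hfx
      simpa using hfx
    refine ⟨polar φ w y / (2 * φ w), u.repr x 0, u.repr x 4, ?_⟩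
    conv_lhs => rw [hy, H.eq y hyU, hey, hfy]
    simp
  obtain ⟨W, hW⟩ : ∃ W : Submodule F V, ∀ x, x ∈ W ↔ polar φ e x = 0 ∧ polar φ f x = 0 :=
    ⟨LinearMap.ker ((polarBilin φ e).prod (polarBilin φ f)), fun x => by simp⟩
  have hEW : ∀ e', φ e' = 0 → e' ∈ U → polar φ e' w = 0 → (∀ t : F, HasEich φ G e' (t • w)) →
      (∀ t : F, HasEich φ G e' (t • n)) → (∀ t : F, HasEich φ G e' (t • n')) →
      ∀ x ∈ W, HasEich φ G e' x := by
    intro e' he' heU hew hw hn hn' x hx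
    obtain ⟨c, d, d', rfl⟩ := hdec x ((hW x).1 hx).1 ((hW x).1 hx).2
    have o1 : polar φ e' (c • w) = 0 := by rw [polar_smul_right, hew, smul_zero]
    have o2 : polar φ e' (d • n) = 0 := by rw [polar_smul_right, hnU e' heU, smul_zero]
    have o3 : polar φ e' (d' • n') = 0 := by rw [polar_smul_right, hnU' e' heU, smul_zero]
    exact ((hw c).add he' o1 o2 (hn d)).add he' (by rw [polar_add_right, o1, o2, add_zero]) o3 (hn' d')
  have htr : ∀ z ∈ (⊤ : Submodule F V), ∀ z' ∈ (⊤ : Submodule F V), φ z ≠ 0 → φ z = φ z' →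
      ∃ g ∈ genGroup φ u Set.univ, g z = z' := by
    intro z _ z' _ hz0 hzz
    have hfe := H.hyp.symm.polar
    have key : ∀ v, ∃ x ∈ W, v = polar φ f v • e + polar φ e v • f + x := fun v =>
      ⟨v - (polar φ f v • e + polar φ e v • f), (hW _).2 ⟨by
        simp [polar_sub_right, polar_add_right, polar_smul_right, H.hyp.left, H.hyp.polar], by
        simp [polar_sub_right, polar_add_right, polar_smul_right, H.hyp.right, hfe]⟩,
        by rw [add_sub_cancel]⟩
    obtain ⟨x, hx, hzx⟩ := key z
    obtain ⟨x', hx', hzx'⟩ := key z'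
    rw [← hGdef]
    have := exists_map_eq_of_hasEich h2 (by omega) hG H.hyp W (fun x hx => ((hW x).1 hx).1)
      (fun x hx => ((hW x).1 hx).2)
      (hEW e H.hyp.left H.left_mem H.left (fun t => (hEG t).1) (fun t => (hEn t).1)
        fun t => (hEn' t).1)
      (hEW f H.hyp.right H.right_mem H.right (fun t => (hEG t).2) (fun t => (hEn t).2)
        fun t => (hEn' t).2) ((hW w).2 ⟨H.left, H.right⟩) H.ne_zero hx hx'
      (by rw [← hzx]; exact hz0) (by rw [← hzx, ← hzx']; exact hzz)
    rwa [← hzx, ← hzx'] at this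
  have hVnd := hb.nondeg h2
  refine ⟨le_antisymm (hrange _) fun g hg => mem_genGroup_of_transitive h2 hb hVnd
    (fun i _ => ⟨trivial, hne i, hsq i⟩) Set.univ_nonempty htr hg (Or.inl rfl) fun _ => trivial, ?_⟩
  -- intersections
  have hK : ∀ a' b' : ℕ, a' < b' → b' ≤ 4 → ∀ g ∈ (spinHom b).range, ∀ ε : F, (ε = 1 ∨ ε = -1) →
      (∀ v, g v - ε • v ∈ Submodule.span F (u '' {i | a' + 1 ≤ (i : ℕ) ∧ (i : ℕ) < b'})) →
      g ∈ genGroup φ u {i | a' + 1 ≤ (i : ℕ) ∧ (i : ℕ) < b'} := by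
    refine forall_interval (P := fun K => ∀ g ∈ (spinHom b).range, ∀ ε : F, (ε = 1 ∨ ε = -1) →
      (∀ v, g v - ε • v ∈ Submodule.span F (u '' K)) → g ∈ genGroup φ u K) ?_
      (fun g hg ε hε h => mem_genGroup_of_line h2 hb u (hne 1) (hsq 1) hg hε h)
      (fun g hg ε hε h => mem_genGroup_of_line h2 hb u (hne 2) (hsq 2) hg hε h)
      (fun g hg ε hε h => mem_genGroup_of_line h2 hb u (hne 3) (hsq 3) hg hε h)
      (fun g hg ε hε h => mem_genGroup_of_plane h2 hodd (by omega) hb u (hne 1) (hne 2) (hsq 1) p12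
        (by rw [d1, d2, mul_one]; exact hX4) (by rw [d1, d2]; exact ordX) hg hε h)
      (fun g hg ε hε h => mem_genGroup_of_plane h2 hodd (by omega) hb u (hne 2) (hne 3) (hsq 2) p23
        (by rw [d2, d3, one_mul]; exact ha4) (by rw [d2, d3]; exact orda) hg hε h)
      hK123
    intro g hg ε hε h
    rw [Set.image_empty, Submodule.span_empty] at h
    refine mem_of_mem_range_spinHom (U := ⊥) h2 hb (fun x hx _ => hx) (fun x hx hx0 _ => ?_)
      (fun x hx y _ hxs => ?_) hg hε h
    · rw [(Submodule.mem_bot F).1 hx, QuadraticMap.map_zero] at hx0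
      exact absurd rfl hx0
    · rw [(Submodule.mem_bot F).1 hx, QuadraticMap.map_zero] at hxs
      exact absurd IsSquare.zero hxs
  intro a' b' hab hb' g hg hg'
  obtain ⟨ε, hε, hgε, -⟩ := exists_sign_of_mem_genGroup u hg
  obtain ⟨η, hη, hgη, hgη'⟩ := exists_sign_of_mem_genGroup u hg'
  -- Take a nonzero `v` orthogonal to `u 1, …, u 4`: as a word in these, `g` scales it by `η`. If
  -- the signs differed, the displacement `g v - ε v` would put `v` into the span of `u 0, …, u 3`;
  -- but there, orthogonality to `u 4, u 3, u 2, u 1` kills the coordinates one after another along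
  -- the path.
  have hεη : ε = η := by
    by_contra hne'
    have h22 : η - ε ≠ 0 := sub_ne_zero.2 (Ne.symm hne')
    obtain ⟨v, hv0, hv⟩ := exists_ne_zero_of_lt_finrank (n := 4)
      (fun i : Fin 4 => polarBilin φ (u i.succ))
      (by rw [Module.finrank_eq_card_basis u, Fintype.card_fin]; norm_num)
    have v1 : polar φ (u 1) v = 0 := hv 0
    have v2 : polar φ (u 2) v = 0 := hv 1
    have v3 : polar φ (u 3) v = 0 := hv 2
    have v4 : polar φ (u 4) v = 0 := hv 3
    have hgv : g v = η • v := hgη' v fun i hi => by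
      obtain ⟨j, rfl⟩ := Fin.exists_succ_eq.2 (show i ≠ 0 from by
        rintro rfl
        have := hi.1
        simp at this)
      exact hv j
    have hvI := hgε v
    rw [hgv, ← sub_smul, Submodule.smul_mem_iff _ h22, Module.Basis.mem_span_image] at hvI
    have hv4 : u.repr v 4 = 0 := by
      by_contra h
      have := hvI (Finsupp.mem_support_iff.2 h)
      have := this.2
      simp at this
      omega
    have h5 := basis_sum_five u v
    rw [hv4, zero_smul, add_zero] at h5
    generalize u.repr v 0 = c0 at h5
    generalize u.repr v 1 = c1 at h5
    generalize u.repr v 2 = c2 at h5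
    generalize u.repr v 3 = c3 at h5
    have p43 : polar φ (u 4) (u 3) = 1 := by rw [polar_comm, p34]
    have p42 : polar φ (u 4) (u 2) = 0 := by rw [polar_comm, p24]
    have p41 : polar φ (u 4) (u 1) = 0 := by rw [polar_comm, p14]
    have p40 : polar φ (u 4) (u 0) = 0 := by rw [polar_comm, h0 0 4 (by decide)]
    rw [← h5] at v1 v2 v3 v4 hv0
    simp only [polar_add_right, polar_smul_right, polar_self_eq, p10, p12, p13, p20, p21, p23, p30,
      p31, p32, p40, p41, p42, p43, smul_eq_mul, mul_one, mul_zero, add_zero, zero_add]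
      at v1 v2 v3 v4
    rw [v4] at v3 v2 hv0
    have hc2 : c2 = 0 := by linear_combination v3
    rw [hc2] at v2 v1 hv0
    have hc1 : c1 = 0 := by linear_combination v2
    rw [hc1] at v1 hv0
    have hc0 : c0 = 0 := by linear_combination v1
    rw [hc0] at hv0
    exact hv0 (by simp)
  refine hK a' b' hab hb' g (hrange _ hg) ε hε fun v => ?_
  refine Submodule.span_mono (Set.image_mono ?_) (mem_span_inter u (hgε v) (hεη ▸ hgη v))
  rintro i ⟨hi, hi'⟩
  exact ⟨hi'.1, hi.2⟩

end OddGeneration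

/-! ### Odd q: the discriminant and the normal form -/

section OddForm

variable {F V : Type*} [Field F] [AddCommGroup V] [Module F V] {φ : QuadraticForm F V}

/-- The left side of `hD` is the Gram determinant of the path. In a basis of the shape x₁y₁ + x₂y₂ +
cz² the Gram determinant is `2 c`, and a change of basis multiplies it by a square; so `c` is a
square and can be scaled to 1. -/
theorem exists_isStd_one_odd [Finite F] [FiniteDimensional F V] (h2 : (2 : F) ≠ 0)
    (u : Module.Basis (Fin 5) F V) {X a : F}
    (hd : φ (u 0) = 1 ∧ φ (u 1) = X ∧ φ (u 2) = 1 ∧ φ (u 3) = a ∧ φ (u 4) = 1)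
    (h1 : ∀ i j : Fin 5, (i : ℕ) + 1 = j → polar φ (u i) (u j) = 1)
    (h0 : ∀ i j : Fin 5, (i : ℕ) + 1 < j → polar φ (u i) (u j) = 0) {s : F} (hs : s ≠ 0)
    (hD : 32 * (a * X) - 16 * a - 16 * X + 6 = 2 * s ^ 2) :
    ∃ b : Module.Basis (Fin 5) F V, IsStd φ b 1 := by
  obtain ⟨d0, d1, d2, d3, d4⟩ := hd
  have p01 := h1 0 1 rfl
  have p12 := h1 1 2 rfl
  have p23 := h1 2 3 rfl
  have p34 := h1 3 4 rfl
  have p02 := h0 0 2 (by decide)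
  have p03 := h0 0 3 (by decide)
  have p04 := h0 0 4 (by decide)
  have p13 := h0 1 3 (by decide)
  have p14 := h0 1 4 (by decide)
  have p24 := h0 2 4 (by decide)
  have hD0 : 32 * (a * X) - 16 * a - 16 * X + 6 ≠ 0 := hD ▸ mul_ne_zero h2 (pow_ne_zero 2 hs)
  have hM : LinearMap.BilinForm.toMatrix u (polarBilin φ) =
      !![2, 1, 0, 0, 0; 1, 2 * X, 1, 0, 0; 0, 1, 2, 1, 0; 0, 0, 1, 2 * a, 1; 0, 0, 0, 1, 2] := by
    ext i j
    rw [LinearMap.BilinForm.toMatrix_apply, polarBilin_apply_apply]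
    fin_cases i <;> fin_cases j <;>
      simp [d0, d1, d2, d3, d4, p01, p12, p23, p34, p02, p03, p04, p13, p14, p24,
        polar_comm φ (u 1) (u 0), polar_comm φ (u 2) (u 0), polar_comm φ (u 3) (u 0),
        polar_comm φ (u 4) (u 0), polar_comm φ (u 2) (u 1), polar_comm φ (u 3) (u 1),
        polar_comm φ (u 4) (u 1), polar_comm φ (u 3) (u 2), polar_comm φ (u 4) (u 2),
        polar_comm φ (u 4) (u 3)]
  have hdet : (LinearMap.BilinForm.toMatrix u (polarBilin φ)).det =
      32 * (a * X) - 16 * a - 16 * X + 6 := by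
    rw [hM]
    simp [Matrix.det_succ_row_zero, Fin.sum_univ_succ, Fin.succAbove]
    ring
  have hreg : Regular φ := by
    intro y hy _
    have := (LinearMap.BilinForm.nondegenerate_toMatrix_iff (B := polarBilin φ) u).1
      (Matrix.nondegenerate_iff_det_ne_zero.2 (hdet ▸ hD0))
    exact this.1 y hy
  obtain ⟨b, c, hc, hb⟩ := exists_isStd hreg (by rw [Module.finrank_eq_card_basis u, Fintype.card_fin])
  have hMb : LinearMap.BilinForm.toMatrix b (polarBilin φ) =
      !![0, 1, 0, 0, 0; 1, 0, 0, 0, 0; 0, 0, 0, 1, 0; 0, 0, 1, 0, 0; 0, 0, 0, 0, 2 * c] := by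
    have hb' : ∀ v, φ v = b.repr v 0 * b.repr v 1 + b.repr v 2 * b.repr v 3 + c * b.repr v 4 ^ 2 := hb
    ext i j
    rw [LinearMap.BilinForm.toMatrix_apply, polarBilin_apply_apply]
    fin_cases i <;> fin_cases j <;> simp [polar, hb']
    ring
  have hdetb : (LinearMap.BilinForm.toMatrix b (polarBilin φ)).det = 2 * c := by
    rw [hMb]
    simp [Matrix.det_succ_row_zero, Fin.sum_univ_succ, Fin.succAbove]
  have hch := congrArg Matrix.det (LinearMap.BilinForm.toMatrix_mul_basis_toMatrix u b (polarBilin φ))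
  rw [Matrix.det_mul, Matrix.det_mul, Matrix.det_transpose, hdet, hdetb, hD] at hch
  generalize (u.toMatrix b).det = d at hch
  have hcd : c = (s * d) ^ 2 := by
    refine mul_left_cancel₀ h2 ?_
    linear_combination -hch
  refine exists_isStd_one hb (s := s * d) (fun h => hc ?_) hcd
  rw [hcd, h, zero_pow two_ne_zero]

end OddForm

/-! ### Fields with fewer than eleven elements -/

section SmallFields

variable {F : Type*} [Field F]

/-- The trace of an element `h(1, X)` of small order. -/
theorem eq_of_orderOf_hMatrix (h2 : (2 : F) ≠ 0) {X : F} (hX : X ≠ 0) {n : ℕ}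
    (h : orderOf (hMatrix 1 X) = n) : n ≠ 2 ∧ (n = 3 → X = 1) ∧ (n = 4 → X = 1 / 2) ∧
      (n = 5 → X ^ 2 - 3 * X + 1 = 0) ∧ (n = 6 → 3 * X = 1) := by
  obtain ⟨t, ht⟩ : ∃ t, t = 1 / X := ⟨_, rfl⟩
  have hXt : X * t = 1 := by rw [ht, mul_one_div_cancel hX]
  have hp : hMatrix 1 X ^ n = 1 := by rw [← h, pow_orderOf_eq_one]
  obtain ⟨M, hMdef⟩ : ∃ M, M = hMatrix 1 X := ⟨_, rfl⟩
  have hM : M = !![-1, t; -1, t - 1] := by simp [hMdef, hMatrix, ht]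
  have hMM : M * M = (t - 2) • M - 1 := by
    rw [hM]
    ext i j
    fin_cases i <;> fin_cases j <;> simp <;> ring
  -- The relation `M² = (t - 2) M - 1` gives a recursion for the coefficients of the powers of `M`.
  -- As `M` and 1 are independent, `M ^ n = 1` becomes two polynomial equations in `t`.
  have step : ∀ (n : ℕ) (p q : F), M ^ n = p • M - q • 1 →
      M ^ (n + 1) = (p * (t - 2) - q) • M - p • 1 := by
    intro n p q hn
    rw [pow_succ, hn, sub_mul, smul_mul_assoc, hMM, smul_mul_assoc, one_mul]
    module
  have fin : ∀ p q : F, p • M - q • 1 = 1 → p = 0 ∧ q = -1 := by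
    intro p q hpq
    have e1 := congrFun (congrFun hpq 1) 0
    have e0 := congrFun (congrFun hpq 0) 0
    simp [hM] at e1 e0
    exact ⟨e1, by linear_combination -e0 - e1⟩
  have m1 : M ^ 1 = (1 : F) • M - (0 : F) • 1 := by rw [pow_one, one_smul, zero_smul, sub_zero]
  have m2 := step _ _ _ m1
  have m3 := step _ _ _ m2
  have m4 := step _ _ _ m3
  have m5 := step _ _ _ m4
  have m6 := step _ _ _ m5
  rw [← hMdef] at hp
  refine ⟨?_, ?_, ?_, ?_, ?_⟩
  · rintro rfl
    obtain ⟨-, h3⟩ := fin _ _ (m2.symm.trans hp)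
    exact h2 (by linear_combination h3)
  · rintro rfl
    obtain ⟨-, h3⟩ := fin _ _ (m3.symm.trans hp)
    have : t = 1 := by linear_combination h3
    rw [this, mul_one] at hXt
    exact hXt
  · rintro rfl
    obtain ⟨-, h3⟩ := fin _ _ (m4.symm.trans hp)
    have h4 : (t - 2) ^ 2 = 0 := by linear_combination h3
    have h5 := sub_eq_zero.1 (pow_eq_zero_iff two_ne_zero |>.1 h4)
    rw [h5] at hXt
    rw [eq_div_iff h2, hXt]
  · rintro rfl
    obtain ⟨h3, h4⟩ := fin _ _ (m5.symm.trans hp)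
    have h5 : t ^ 2 - 3 * t + 1 = 0 := by linear_combination (t - 2) * h4 - h3
    linear_combination X ^ 2 * h5 - (X * t - 3 * X + 1) * hXt
  · rintro rfl
    obtain ⟨h3, h4⟩ := fin _ _ (m6.symm.trans hp)
    obtain ⟨τ, hτ⟩ : ∃ τ, τ = t - 2 := ⟨_, rfl⟩
    rw [← hτ] at h3 h4 m3
    have h5 : 2 * ((τ - 1) * (τ + 1)) = 0 := by
      linear_combination (τ ^ 2 - 1) * h4 - τ * h3
    rcases mul_eq_zero.1 ((mul_eq_zero.1 h5).resolve_left h2) with h7 | h7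
    · linear_combination hXt + X * hτ - X * h7
    · exfalso
      have h8 : τ = -1 := by linear_combination h7
      have h9 : M ^ 3 = 1 := by
        rw [m3, h8]
        module
      rw [hMdef] at h9
      have := orderOf_dvd_of_pow_eq_one h9
      rw [h] at this
      exact absurd (Nat.le_of_dvd (by norm_num) this) (by norm_num)

theorem pow_eq_one_of_isNonzeroSquare [Finite F] {y : F} (hy : IsNonzeroSquare y) {k : ℕ}
    (hk : Nat.card F = 2 * k + 1) : y ^ k = 1 := by
  have := Fintype.ofFinite F
  obtain ⟨hy0, s, rfl⟩ := hy
  have h := FiniteField.pow_card_sub_one_eq_one s (left_ne_zero_of_mul hy0)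
  rwa [← Nat.card_eq_fintype_card, hk, Nat.add_sub_cancel, pow_mul, pow_two] at h

theorem cast_card_eq_zero [Finite F] : ((Nat.card F : ℕ) : F) = 0 := by
  have := Fintype.ofFinite F
  rw [Nat.card_eq_fintype_card, FiniteField.cast_card_eq_zero]

/-- The conditions on the parameters exclude the fields with fewer than eleven elements. -/
theorem eleven_le_card [Finite F] (h2 : (2 : F) ≠ 0) (hodd : Odd (Nat.card F))
    (hq : 4 ≤ Nat.card F) {ξ a : F} (hξ : XiOdd ξ) (ha : a ∈ GammaOdd ξ) :
    11 ≤ Nat.card F ∧ 6 ≤ orderOf (hMatrix 1 (ξ ^ 2)) := by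
  obtain ⟨hξ0, -, hsq, ordX⟩ := hξ
  obtain ⟨⟨⟨⟨ha0, -⟩, orda⟩, hnot⟩, hval⟩ := ha
  have ha2 : a ≠ 1 / 2 := fun h => hnot (Set.mem_insert_iff.2 (Or.inl h))
  obtain ⟨X, hXdef⟩ : ∃ X, X = ξ ^ 2 := ⟨_, rfl⟩
  have hX0 : X ≠ 0 := hXdef ▸ pow_ne_zero 2 hξ0
  rw [show ξ ^ 4 = X ^ 2 by rw [hXdef]; ring] at hval
  rw [← hXdef] at hsq ordX hval ⊢
  have hX2 : X ≠ 1 / 2 := fun h => hsq.1 (sub_eq_zero.2 h)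
  obtain ⟨k, hk⟩ := hodd
  have hsqk := pow_eq_one_of_isNonzeroSquare hsq hk
  have hvalk := pow_eq_one_of_isNonzeroSquare hval hk
  have hcast := cast_card_eq_zero (F := F)
  have e1 : (Nat.card F - 1) / 2 = k := by omega
  have e2 : (Nat.card F + 1) / 2 = k + 1 := by omega
  rw [HasOrderOdd, e1, e2] at ordX orda
  rw [hk, Nat.cast_add, Nat.cast_mul, Nat.cast_ofNat, Nat.cast_one] at hcast
  obtain ⟨x2, x3, x4, x5, -⟩ := eq_of_orderOf_hMatrix h2 hX0 rfl
  obtain ⟨-, a3, a4, a5, a6⟩ := eq_of_orderOf_hMatrix h2 ha0 rfl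
  obtain ⟨i, hi⟩ : ∃ i : F, i = 1 / 2 := ⟨_, rfl⟩
  have hi2 : 2 * i = 1 := by rw [hi, mul_one_div_cancel h2]
  rw [← hi] at hsqk
  by_cases k6 : 6 ≤ k
  · exact ⟨by omega, by omega⟩
  -- The field has 5, 7, 9 or 11 elements, and the possible small orders determine `X` and `a`. A
  -- nonzero square has `k`-th power 1; evaluating the required squares violates this, or an
  -- excluded value or a zero occurs. What survives is only 11 elements with order 6.
  rcases (show k = 2 ∨ k = 3 ∨ k = 4 ∨ k = 5 by omega) with rfl | rfl | rfl | rfl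
  · exfalso
    push_cast at hcast
    have hX1 := x3 (by omega)
    rw [hX1] at hsqk
    grind
  · exfalso
    push_cast at hcast
    have hX1 : X = 1 := ordX.elim x3 fun h => absurd (x4 h) hX2
    have ha1 : a = 1 := orda.elim a3 fun h => absurd (a4 h) ha2
    rw [hX1, ha1] at hvalk
    norm_num at hvalk
    grind
  · exfalso
    push_cast at hcast
    have hX1 := x5 (ordX.resolve_left fun h => hX2 (x4 h))
    have h3 : (3 : F) = 0 := by
      have : (3 : F) * 3 = 0 := by linear_combination hcast
      simpa using this
    grind
  · refine ⟨by omega, ?_⟩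
    rcases ordX with h | h
    · exfalso
      push_cast at hcast
      have hX1 : (X - 5) * (X - 9) = 0 := by linear_combination x5 h - (X - 4) * hcast
      rcases mul_eq_zero.1 hX1 with h5 | h9
      · grind
      · rw [sub_eq_zero.1 h9] at hvalk hval
        rcases orda with h' | h'
        · have ha1 : (a - 5) * (a - 9) = 0 := by linear_combination a5 h' - (a - 4) * hcast
          rcases mul_eq_zero.1 ha1 with h5 | h9
          · rw [sub_eq_zero.1 h5, show (5 : F) * (16 * (2 * 9 - 1) ^ 2) +
              -(32 * 9 ^ 2 - 28 * 9 + 6) = 6 by linear_combination 1888 * hcast] at hvalk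
            grind
          · apply hval.1
            rw [sub_eq_zero.1 h9]
            linear_combination 3570 * hcast
        · have ha1 : a = 4 := by linear_combination 4 * a6 h' - a * hcast
          rw [ha1, show (4 : F) * (16 * (2 * 9 - 1) ^ 2) +
            -(32 * 9 ^ 2 - 28 * 9 + 6) = 2 by linear_combination 1468 * hcast] at hvalk
          grind
    · omega

end SmallFields

/-! ### The group Ω(V) and the assembly of the theorem -/

section Final

variable {F V : Type*} [Field F] [AddCommGroup V] [Module F V] {φ : QuadraticForm F V}
  {b : Module.Basis (Fin 5) F V}

/-- Even length and square spinor norm may be witnessed by different factorizations of `g`. A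
product of negative symmetries always has a lift and -1 has none, so an element with one even
factorization has only even ones, and its spinor norm is the multiplier of any lift modulo squares.
-/
theorem omega_eq_range_of_odd [Finite F] [FiniteDimensional F V] (h2 : (2 : F) ≠ 0)
    (hodd : Odd (Nat.card F)) (hb : IsStd φ b 1) : Omega φ = (spinHom b).range := by
  rw [Omega, if_pos hodd]
  ext g
  constructor
  · rintro ⟨⟨l, ⟨hl, hgl⟩, hle⟩, l', ⟨hl', hgl'⟩, hsq⟩
    obtain ⟨M, hM⟩ := exists_isLift_prod hb l hl
    obtain ⟨M', hM'⟩ := exists_isLift_prod hb l' hl'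
    rw [prod_symmetry_eq] at hgl hgl'
    rcases neg_pow_eq (F := F) (V := V) l.length with ⟨h, -⟩ | ⟨-, h⟩
    · rw [h, one_mul] at hgl
      rcases neg_pow_eq (F := F) (V := V) l'.length with ⟨h', -⟩ | ⟨h', -⟩
      · rw [hgl', h', one_mul]
        exact mem_range_spinHom_of_isLift hM' hsq
      · rw [h', hgl] at hgl'
        exact absurd hgl' (hM.ne_neg_mul h2 hM')
    · exact absurd hle h
  · intro hg
    obtain ⟨l, hl, hgl⟩ := exists_symmetry_list h2 (hb.nondeg h2) (range_spinHom_le hb hg)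
      fun _ => Submodule.mem_top
    have hl' : ∀ x ∈ l, φ x ≠ 0 := fun x hx => (hl x hx).2
    obtain ⟨M, hM⟩ := exists_isLift_prod hb l hl'
    have hP := hgl
    rw [prod_symmetry_eq] at hP
    rcases neg_pow_eq (F := F) (V := V) l.length with ⟨h, he⟩ | ⟨h, -⟩
    · rw [h, one_mul] at hP
      rw [← hP] at hM
      exact ⟨⟨l, ⟨hl', hgl⟩, he⟩, l, ⟨hl', hgl⟩, isSquare_of_mem_range hg hM⟩
    · rw [h] at hP
      obtain ⟨N, rfl⟩ := hg
      exact absurd hP ((isLift_spinHom b N).ne_neg_mul h2 hM)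

/-- The isomorphism is the first isomorphism theorem for `spinHom`, whose kernel is the centre; the
nondegeneracy of consecutive planes is needed only for the Schläfli type. -/
theorem string_group_of_range [FiniteDimensional F V] (hb : IsStd φ b 1)
    (hΩ : Omega φ = (spinHom b).range) (u : Module.Basis (Fin 5) F V)
    (hgen : genGroup φ u Set.univ = (spinHom b).range) (hne : ∀ i, φ (u i) ≠ 0)
    (h1 : ∀ i j : Fin 5, (i : ℕ) + 1 = j → polar φ (u i) (u j) = 1)
    (h0 : ∀ i j : Fin 5, (i : ℕ) + 1 < j → polar φ (u i) (u j) = 0)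
    (hdet : ∀ i : Fin 4, 4 * (φ (u i.castSucc) * φ (u i.succ)) ≠ 1)
    (hmeet : ∀ a b : ℕ, a < b → b ≤ 4 → ∀ g,
      g ∈ genGroup φ u {i | a ≤ (i : ℕ) ∧ (i : ℕ) < b} →
      g ∈ genGroup φ u {i | a + 1 ≤ (i : ℕ) ∧ (i : ℕ) < b + 1} →
      g ∈ genGroup φ u {i | a + 1 ≤ (i : ℕ) ∧ (i : ℕ) < b}) :
    Nonempty (Omega φ ≃* PSp4 F) ∧ ∃ ρ : Fin 5 → Omega φ,
      (∀ i v, (ρ i : V ≃ₗ[F] V) v = -symmetry φ (u i) v) ∧ IsStringCGroup ρ ∧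
      ∀ i, schlafliType ρ i = orderOf (hMatrix (φ (u i.castSucc)) (φ (u i.succ))) := by
  have hgΩ : genGroup φ u Set.univ = Omega φ := by rw [hgen, hΩ]
  refine ⟨⟨((MulEquiv.subgroupCongr hΩ).trans
    (QuotientGroup.quotientKerEquivRange (spinHom b)).symm).trans
    (QuotientGroup.quotientMulEquivOfEq (ker_spinHom hb))⟩,
    fun i => ⟨rho φ (u i), hgΩ ▸ rho_mem_genGroup u (Set.mem_univ i)⟩, fun i v => rfl,
    isStringCGroup_of_intervals u _ hgΩ hne h1 h0 hmeet _ fun i => rfl, fun i => ?_⟩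
  rw [schlafliType, ← Subgroup.orderOf_coe]
  exact orderOf_rho_mul_rho (hne _) (hne _) (h1 _ _ (by simp)) (hdet i)

theorem RepresentsForm.formMatrix {a : Fin 5 → F} {u : Module.Basis (Fin 5) F V}
    (h : RepresentsForm (formMatrix a) φ u) : (∀ i, φ (u i) = a i) ∧
      (∀ i j : Fin 5, (i : ℕ) + 1 = j → polar φ (u i) (u j) = 1) ∧
      ∀ i j : Fin 5, (i : ℕ) + 1 < j → polar φ (u i) (u j) = 0 := by
  obtain ⟨h1, h3, -⟩ := h
  refine ⟨fun i => ?_, fun i j hij => ?_, fun i j hij => ?_⟩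
  · rw [← h1]
    simp [_root_.formMatrix]
  · have hlt : i < j := Fin.lt_def.2 (by omega)
    rw [← h3 i j hlt]
    simp [_root_.formMatrix, hij, hlt.ne]
  · have hlt : i < j := Fin.lt_def.2 (by omega)
    rw [← h3 i j hlt]
    simp [_root_.formMatrix, hij.ne, hlt.ne]

theorem two_eq_zero_iff_even_card [Finite F] : (2 : F) = 0 ↔ Even (Nat.card F) := by
  have := Fintype.ofFinite F
  rw [Nat.card_eq_fintype_card]
  constructor
  · intro h
    rw [← Nat.not_odd_iff_even, Nat.odd_iff, ← Nat.mod_two_ne_zero, not_not]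
    exact FiniteField.even_card_of_char_two (CharP.ringChar_of_prime_eq_zero Nat.prime_two
      (by exact_mod_cast h))
  · intro h
    by_contra h2
    have : ringChar F ≠ 2 := fun h' => h2 (by
      have := CharP.cast_eq_zero F (ringChar F)
      rwa [h', Nat.cast_ofNat] at this)
    have := FiniteField.odd_card_of_char_ne_two this
    rw [Nat.even_iff] at h
    omega

end Final

end StringOrth

open StringOrth

theorem mainTheorem2 {F V : Type*} [Field F] [Finite F] [AddCommGroup V] [Module F V]
    (q : ℕ) (hq : Nat.card F = q) (hq4 : 4 ≤ q)
    (φ : QuadraticForm F V) (u : Module.Basis (Fin 5) F V) (ξ α : F)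
    (h : (Even q ∧ XiEven ξ ∧ α ∈ GammaEven ξ ∧ RepresentsForm (PhiEven ξ α) φ u) ∨
      (Odd q ∧ XiOdd ξ ∧ α ^ 2 ∈ GammaOdd ξ ∧ RepresentsForm (PhiOdd ξ α) φ u)) :
    Nonempty (Omega φ ≃* PSp4 F) ∧
    ∃ ρ : Fin 5 → Omega φ,
      (∀ i v, (ρ i : V ≃ₗ[F] V) v = -symmetry φ (u i) v) ∧
      IsStringCGroup ρ ∧
      (Even q → ∀ i, schlafliType ρ i ∈ ({q - 1, q + 1} : Set ℕ)) ∧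
      (Odd q → ∀ i, schlafliType ρ i ∈ ({(q - 1) / 2, (q + 1) / 2} : Set ℕ)) := by
  subst hq
  have hfd : FiniteDimensional F V := Module.Basis.finiteDimensional_of_finite u
  have h5 : Module.finrank F V = 5 := by rw [Module.finrank_eq_card_basis u, Fintype.card_fin]
  rcases h with ⟨heven, hξ, hα, hu⟩ | ⟨hodd, hξ, hα, hu⟩
  · have h2 : (2 : F) = 0 := two_eq_zero_iff_even_card.2 heven
    obtain ⟨hd, h1, h0⟩ := RepresentsForm.formMatrix hu
    obtain ⟨hreg, hgen, hmeet⟩ := genGroup_eq_orthGroup_and_intersection h2 hq4 hξ hα u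
      ⟨hd 0, hd 1, hd 2, hd 3, hd 4⟩ h1 h0
    obtain ⟨b₀, c, hc, hb₀⟩ := exists_isStd hreg h5
    obtain ⟨s, hs⟩ := exists_sq_two h2 c
    obtain ⟨b, hb⟩ := exists_isStd_one hb₀ (s := s) (by
      rintro rfl
      exact hc (by rw [← hs, zero_pow two_ne_zero])) hs.symm
    have hne : ∀ i, φ (u i) ≠ 0 := by
      intro i
      rw [hd]
      fin_cases i
      exacts [hξ.1, hξ.1, hα.1, hα.1, hξ.1]
    -- In characteristic 2 every norm is a square, so all generators lie in the image of `spinHom`,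
    -- and they generate the orthogonal group.
    have hrange : orthGroup φ = (spinHom b).range := by
      refine le_antisymm ?_ (range_spinHom_le hb)
      rw [← hgen, genGroup, Subgroup.closure_le]
      rintro _ ⟨i, -, rfl⟩
      refine mem_range_spinHom_of_isLift (isLift_rho hb (hne i)) ?_
      obtain ⟨t, ht⟩ := exists_sq_two h2 (φ (u i))
      exact ⟨t, by rw [← ht, pow_two]⟩
    obtain ⟨hiso, ρ, hρ, hC, htype⟩ := string_group_of_range hb (by
        rw [Omega, if_neg (Nat.not_odd_iff_even.2 heven), if_pos (by rw [h5]; decide), hrange]) u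
      (hgen.trans hrange) hne h1 h0 (fun i => by
        rw [show (4 : F) = 2 * 2 by norm_num, h2]
        simp) hmeet
    refine ⟨hiso, ρ, hρ, hC, fun _ i => ?_, fun hodd => absurd heven (Nat.not_even_iff_odd.2 hodd)⟩
    rw [htype, hd, hd]
    fin_cases i
    exacts [hξ.2, hα.2.2.2, hα.2.2.1, HasOrderEven.symm hξ.1 hα.1 hα.2.2.2]
  · have h2 : (2 : F) ≠ 0 := fun h =>
      Nat.not_even_iff_odd.2 hodd (two_eq_zero_iff_even_card.1 h)
    obtain ⟨hd, h1, h0⟩ := RepresentsForm.formMatrix hu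
    obtain ⟨hq11, h6⟩ := eleven_le_card h2 hodd hq4 hξ hα
    obtain ⟨hξ0, -, ⟨hX2, r, hr⟩, ordX⟩ := hξ
    obtain ⟨⟨⟨⟨ha0, has⟩, orda⟩, hnot⟩, hv0, v, hv⟩ := hα
    simp only [Set.mem_insert_iff, Set.mem_singleton_iff, not_or] at hnot
    obtain ⟨-, -, n3, n4, n5, -⟩ := hnot
    have hX0 : ξ ^ 2 ≠ 0 := pow_ne_zero 2 hξ0
    have hXs : IsSquare (ξ ^ 2) := IsSquare.sq ξ
    have hcast := cast_card_eq_zero (F := F)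
    -- Twice the order is `q - 1` or `q + 1`, hence -1 or 1 in `F`, so the order is nonzero there.
    have hdet : ∀ x : F, x ≠ 0 → HasOrderOdd 1 x → 4 * x ≠ 1 := by
      intro x hx hord
      rw [← one_mul x]
      refine mul_ne_one_of_orderOf one_ne_zero hx fun h => ?_
      obtain ⟨k, hk⟩ := hodd
      rw [HasOrderOdd, show (Nat.card F - 1) / 2 = k by omega,
        show (Nat.card F + 1) / 2 = k + 1 by omega] at hord
      rw [hk, Nat.cast_add, Nat.cast_mul, Nat.cast_ofNat, Nat.cast_one] at hcast
      rcases hord with h' | h' <;> rw [h'] at h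
      · exact one_ne_zero (α := F) (by linear_combination hcast - 2 * h)
      · rw [Nat.cast_add, Nat.cast_one] at h
        exact one_ne_zero (α := F) (by linear_combination 2 * h - hcast)
    have hX4 := hdet _ hX0 ordX
    have ha4 := hdet _ ha0 orda
    rw [show ξ ^ 4 = (ξ ^ 2) ^ 2 by ring] at hv hv0
    have hd' : φ (u 0) = 1 ∧ φ (u 1) = ξ ^ 2 ∧ φ (u 2) = 1 ∧ φ (u 3) = α ^ 2 ∧ φ (u 4) = 1 :=
      ⟨hd 0, hd 1, hd 2, hd 3, hd 4⟩
    generalize ξ ^ 2 = X at *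
    generalize α ^ 2 = a at *
    have hX4' : 4 * X - 1 ≠ 0 := sub_ne_zero.2 hX4
    obtain ⟨i, hi⟩ : ∃ i : F, i = 1 / 2 := ⟨_, rfl⟩
    have hi2 : 2 * i = 1 := by rw [hi, mul_one_div_cancel h2]
    have hi4 : (1 : F) / 4 = i ^ 2 := by
      rw [hi]
      norm_num
    rw [← hi] at hX2 hr
    rw [hi4] at n4 n5
    have hr0 : r ≠ 0 := by
      rintro rfl
      exact hX2 (by rw [hr, mul_zero])
    have hv0' : v ≠ 0 := by
      rintro rfl
      exact hv0 (by rw [hv, mul_zero])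
    have hX42 : 4 * X - 2 ≠ 0 := fun h => mul_ne_zero (mul_ne_zero h2 h2) hX2
      (by linear_combination h - 2 * hi2)
    -- The value required to be a square, here `v * v`, is `2 X - 1` times the Gram determinant. As
    -- `X - 1/2 = r * r`, the determinant is `v² / (2 r²)`, twice the square of `v / (2 r)`.
    obtain ⟨b, hb⟩ := exists_isStd_one_odd h2 u hd' h1 h0 (s := v / (2 * r))
      (div_ne_zero hv0' (mul_ne_zero h2 hr0)) (by
        have : (32 * (a * X) - 16 * a - 16 * X + 6) * (2 * (r * r)) = v * v := by
          rw [← hr, ← hv]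
          linear_combination -(32 * (a * X) - 16 * a - 16 * X + 6) * hi2
        field_simp
        linear_combination this)
    have ordX' : HasOrderOdd X 1 := by
      rwa [HasOrderOdd, orderOf_hMatrix_comm hX0 one_ne_zero]
    have orda' : HasOrderOdd a 1 := by
      rwa [HasOrderOdd, orderOf_hMatrix_comm ha0 one_ne_zero]
    -- The excluded values in `n3`, `n5`, `n4` are those at which, respectively, the middle
    -- three-dimensional space is degenerate, or the component orthogonal to it of `u 0` or of `u 4`
    -- is singular.
    obtain ⟨hgen, hmeet⟩ := genGroup_eq_range_and_intersection h2 hodd hq11 hb u hX0 hXs ha0 has hd'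
      h1 h0 ordX' orda hX4 ha4 (by rwa [orderOf_hMatrix_comm hX0 one_ne_zero])
      (fun h => n3 (by rw [eq_div_iff hX4']; linear_combination h))
      (fun h => n5 (by
        rw [eq_div_iff hX42]
        refine mul_left_cancel₀ (mul_ne_zero h2 h2) ?_
        linear_combination h + (2 * i + 1) * hi2))
      (fun h => n4 (by
        rw [eq_div_iff hX4']
        refine mul_left_cancel₀ (mul_ne_zero h2 h2) ?_
        linear_combination h + (2 * i + 1) * hi2))
    obtain ⟨d0, d1, d2, d3, d4⟩ := hd'
    have hne : ∀ i, φ (u i) ≠ 0 := by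
      intro i
      fin_cases i
      exacts [d0 ▸ one_ne_zero, d1 ▸ hX0, d2 ▸ one_ne_zero, d3 ▸ ha0, d4 ▸ one_ne_zero]
    have hpair : ∀ i : Fin 4, 4 * (φ (u i.castSucc) * φ (u i.succ)) ≠ 1 ∧
        HasOrderOdd (φ (u i.castSucc)) (φ (u i.succ)) := by
      intro i
      fin_cases i
      · change 4 * (φ (u 0) * φ (u 1)) ≠ 1 ∧ HasOrderOdd (φ (u 0)) (φ (u 1))
        rw [d0, d1, one_mul]
        exact ⟨hX4, ordX⟩
      · change 4 * (φ (u 1) * φ (u 2)) ≠ 1 ∧ HasOrderOdd (φ (u 1)) (φ (u 2))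
        rw [d1, d2, mul_one]
        exact ⟨hX4, ordX'⟩
      · change 4 * (φ (u 2) * φ (u 3)) ≠ 1 ∧ HasOrderOdd (φ (u 2)) (φ (u 3))
        rw [d2, d3, one_mul]
        exact ⟨ha4, orda⟩
      · change 4 * (φ (u 3) * φ (u 4)) ≠ 1 ∧ HasOrderOdd (φ (u 3)) (φ (u 4))
        rw [d3, d4, mul_one]
        exact ⟨ha4, orda'⟩
    obtain ⟨hiso, ρ, hρ, hC, htype⟩ := string_group_of_range hb (omega_eq_range_of_odd h2 hodd hb) u
      hgen hne h1 h0 (fun i => (hpair i).1) hmeet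
    refine ⟨hiso, ρ, hρ, hC, fun heven => absurd heven (Nat.not_even_iff_odd.2 hodd), fun _ i => ?_⟩
    rw [htype]
    exact (hpair i).2
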